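/- Let $\omega>0$, $\mu>0$, $2\mu+\lambda>0$, let $\Delta^{*}\mathbf u=\mu\Delta\mathbf u+(\lambda+\mu)\nabla\operatorname{div}\mathbf u$ on $\mathbb R^3$, and put $k_p=\omega/\sqrt{2\mu+\lambda}$, $k_s=\omega/\sqrt{\mu}$. A *fundamental solution of* $\Delta^*\mathbf u+\omega^2\mathbf u=\mathbf f$ *satisfying the Kupradze radiation conditions* is a $3\times3$ complex matrix function $\Phi(x,y)$ such that for every $y\in\mathbb R^3$ and $j\in\{1,2,3\}$ the column $\mathbf u=\Phi(\cdot,y)\mathbf e_j$ is locally integrable on $\mathbb R^3$, is $C^\infty$ on $\mathbb R^3\setminus\{y\}$, satisfies $\Delta^*\mathbf u+\omega^2\mathbf u=-\delta_y\mathbf e_j$ in the sense of distributions, and, with $\mathbf u_p=-k_p^{-2}\nabla\operatorname{div}\mathbf u$ and $\mathbf u_s=\mathbf u-\mathbf u_p$, satisfies $$\lim_{|x|\to\infty}|x|\,\bigl(\partial_{|x|}\mathbf u_p-ik_p\mathbf u_p\bigr)=0,\qquad \lim_{|x|\to\infty}|x|\,\bigl(\partial_{|x|}\mathbf u_s-ik_s\mathbf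 u_s\bigr)=0$$ uniformly in the direction $x/|x|$. **Notation.** For $n\ge0$, $|m|\le n$ let $$Y_n^m(\theta,\varphi)=\sqrt{\tfrac{(2n+1)(n-m)!}{4\pi(n+m)!}}\;e^{im\varphi}P_n^m(\cos\theta),$$ where, with $P_n$ the Legendre polynomial, $P_n^m(z)=(-1)^m(1-z^2)^{m/2}\frac{d^mP_n(z)}{dz^m}$ for $0\le m\le n$ and $P_n^{-m}=(-1)^m\frac{(n-m)!}{(n+m)!}P_n^m$ for $0<m\le n$. For all other pairs of integers $(n,m)$ put $Y_n^m=0$. Let $j_n$ and $h^{(1)}_n$ be the spherical Bessel functions of the first and third kind, and for $n_1,n_2\ge0$ let $$H^{k}_{n_1,n_2}(r,t)=k^3h^{(1)}_{n_1}(kr)\,j_{n_2}(kt),\qquad H^{\pm}_{n_1,n_2}=H^{k_p}_{n_1,n_2}\pm H^{k_s}_{n_1,n_2}.$$ Let $$a_n^m=\sqrt{\tfrac{(n-m+2)(n-m+1)}{(2n+3)(2n+1)}},\quad b_n^m=\sqrt{\tfrac{(n+m+2)(n+m+1)}{(2n+3)(2n+1)}},\quad c_n^m=\sqrt{\tfrac{(n+m)(n+m-1)}{(2n-1)(2n+1)}},$$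 $$d_n^m=\sqrt{\tfrac{(n-m)(n-m-1)}{(2n-1)(2n+1)}},\quad e_n^m=\sqrt{\tfrac{(n+m+1)(n-m+1)}{(2n+3)(2n+1)}},\quad f_n^m=\sqrt{\tfrac{(n+m)(n-m)}{(2n-1)(2n+1)}},$$ let $\mathrm S=\operatorname{diag}(0,0,1)$, $\mathrm P=\operatorname{diag}(1,1,0)$, and $$\mathrm A=\begin{pmatrix}-i&1&0\\1&i&0\\0&0&0\end{pmatrix},\ \mathrm B=\begin{pmatrix}0&0&i\\0&0&-1\\i&-1&0\end{pmatrix},\ \mathrm C=\begin{pmatrix}i&0&0\\0&i&0\\0&0&-2i\end{pmatrix},\ \mathrm D=\begin{pmatrix}0&0&-i\\0&0&-1\\-i&-1&0\end{pmatrix},\ \mathrm E=\begin{pmatrix}-i&-1&0\\-1&i&0\\0&0&0\end{pmatrix}.$$ Let (terms with $Y_{n_1}^{m_1}=0$, that is with $n_1<0$ or $|m_1|>n_1$, being omitted) $$S_{-,n}^m=\tfrac14b_{n-2}^{m-2}c_n^m\,Y_{n-2}^{m-2}\mathrm A+\tfrac12b_{n-2}^{m-1}f_n^m\,Y_{n-2}^{m-1}\mathrm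 B+\tfrac12a_{n-2}^{m}c_n^m\,Y_{n-2}^{m}\mathrm C+\tfrac12a_{n-2}^{m+1}f_n^m\,Y_{n-2}^{m+1}\mathrm D+\tfrac14a_{n-2}^{m+2}d_n^m\,Y_{n-2}^{m+2}\mathrm E,$$ $$\begin{aligned}S_{0,n}^m={}&\tfrac14(b_n^{m-2}a_n^m+d_n^{m-2}c_n^m)\,Y_n^{m-2}\mathrm A+\tfrac12(d_n^{m-1}f_n^m-b_n^{m-1}e_n^m)\,Y_n^{m-1}\mathrm B-\tfrac12\bigl((e_n^m)^2+(f_n^m)^2\bigr)Y_n^m\mathrm C\\&+\tfrac12(c_n^{m+1}f_n^m-a_n^{m+1}e_n^m)\,Y_n^{m+1}\mathrm D+\tfrac14(a_n^{m+2}b_n^m+c_n^{m+2}d_n^m)\,Y_n^{m+2}\mathrm E,\end{aligned}$$ $$S_{+,n}^m=\tfrac14d_{n+2}^{m-2}a_n^m\,Y_{n+2}^{m-2}\mathrm A-\tfrac12d_{n+2}^{m-1}e_n^m\,Y_{n+2}^{m-1}\mathrm B+\tfrac12c_{n+2}^{m}a_n^m\,Y_{n+2}^{m}\mathrm C-\tfrac12c_{n+2}^{m+1}e_n^m\,Y_{n+2}^{m+1}\mathrm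 D+\tfrac14c_{n+2}^{m+2}b_n^m\,Y_{n+2}^{m+2}\mathrm E.$$ **Theorem.** A fundamental solution satisfying the Kupradze radiation conditions exists, and for every such $\Phi$ and all $x,y$ with $|x|>|y|$, with spherical coordinates $(r,\theta_x,\varphi_x)$ and $(t,\theta_y,\varphi_y)$, $$\Phi(x,y)=\Psi(x,y)+\Phi_-(x,y)+\Phi_0(x,y)+\Phi_+(x,y),$$ where $$\Psi(x,y)=\frac i{\omega^2}\sum_{n=0}^\infty\Bigl(H^{k_s}_{n,n}(r,t)\,\mathrm S+\tfrac12H^{+}_{n,n}(r,t)\,\mathrm P\Bigr)\sum_{m=-n}^nY_n^m(\theta_x,\varphi_x)\overline{Y_n^m(\theta_y,\varphi_y)},$$ $$\Phi_-(x,y)=\frac1{\omega^2}\sum_{n=2}^\infty H^{-}_{n-2,n}(r,t)\sum_{m=-n}^nS_{-,n}^m(\theta_x,\varphi_x)\overline{Y_n^m(\theta_y,\varphi_y)},$$ $$\Phi_0(x,y)=\frac1{\omega^2}\sum_{n=0}^\infty H^{-}_{n,n}(r,t)\sum_{m=-n}^nS_{0,n}^m(\theta_x,\varphi_x)\overline{Y_n^m(\theta_y,\varphi_y)},$$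 $$\Phi_+(x,y)=\frac1{\omega^2}\sum_{n=0}^\infty H^{-}_{n+2,n}(r,t)\sum_{m=-n}^nS_{+,n}^m(\theta_x,\varphi_x)\overline{Y_n^m(\theta_y,\varphi_y)}.$$ The coefficients $a_n^m,b_n^m,c_n^m,d_n^m,e_n^m,f_n^m$ are uniformly bounded for $n\ge0$, $|m|\le n$. Each of the four series, as well as the series of its term-by-term first derivatives with respect to $|x|$ and with respect to $|y|$ (the angles being fixed), converges absolutely and uniformly on compact subsets of $\{(x,y)\in\mathbb R^3\times\mathbb R^3:|x|>|y|\}$. -/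

import Mathlib

open scoped ContDiff InnerProductSpace

namespace NavierLame

noncomputable section

/-! ### The Navier-Lamé operator and the Kupradze radiation conditions -/

/-- Euclidean three-space. -/
abbrev E3 : Type := EuclideanSpace ℝ (Fin 3)

/-- Partial derivative of a complex-valued function with respect to the `j`-th coordinate. -/
def pderiv (j : Fin 3) (f : E3 → ℂ) (x : E3) : ℂ :=
  fderiv ℝ f x (EuclideanSpace.single j 1)

/-- Divergence of a complex vector field. -/
def divergence (u : E3 → Fin 3 → ℂ) (x : E3) : ℂ :=
  ∑ j, pderiv j (fun z => u z j) x

/-- The operator `Δ* u = μ Δ u + (λ + μ) ∇ div u`, the Laplacian acting on each component. -/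
def lameOp (lam mu : ℝ) (u : E3 → Fin 3 → ℂ) (x : E3) (i : Fin 3) : ℂ :=
  (mu : ℂ) * Laplacian.laplacian (fun z => u z i) x
    + ((lam + mu : ℝ) : ℂ) * pderiv i (divergence u) x

/-- `k_p > 0` with `k_p ^ 2 = ω ^ 2 / (2 μ + λ)`. -/
def kP (lam mu omega : ℝ) : ℝ := omega / √(2 * mu + lam)

/-- `k_s > 0` with `k_s ^ 2 = ω ^ 2 / μ`. -/
def kS (mu omega : ℝ) : ℝ := omega / √mu

/-- The longitudinal part `u_p = - k_p⁻² ∇ div u` of a vector field. -/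
def longitudinalPart (lam mu omega : ℝ) (u : E3 → Fin 3 → ℂ) (x : E3) : Fin 3 → ℂ :=
  fun i => -(((kP lam mu omega) ^ 2 : ℝ) : ℂ)⁻¹ * pderiv i (divergence u) x

/-- The transversal part `u_s = u - u_p` of a vector field. -/
def transversalPart (lam mu omega : ℝ) (u : E3 → Fin 3 → ℂ) (x : E3) : Fin 3 → ℂ :=
  u x - longitudinalPart lam mu omega u x

/-- The outgoing Sommerfeld condition `r (∂_r v - i k v) → 0` as `r = |x| → ∞`, uniformly in the
direction `x / |x|`; here `∂_r` is the derivative in the direction `x / |x|`. -/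
def SommerfeldRadiating (k : ℝ) (v : E3 → Fin 3 → ℂ) : Prop :=
  Filter.Tendsto
    (fun x : E3 => (‖x‖ : ℂ) • (fderiv ℝ v x (‖x‖⁻¹ • x) - (Complex.I * (k : ℂ)) • v x))
    (Filter.cocompact E3) (nhds 0)

/-- The Kupradze radiation conditions: `u_p` and `u_s` satisfy the outgoing Sommerfeld condition
with wave numbers `k_p` and `k_s` respectively. -/
def KupradzeRadiating (lam mu omega : ℝ) (u : E3 → Fin 3 → ℂ) : Prop :=
  SommerfeldRadiating (kP lam mu omega) (longitudinalPart lam mu omega u) ∧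
    SommerfeldRadiating (kS mu omega) (transversalPart lam mu omega u)

/-- `Φ` is a fundamental solution of `Δ* u + ω² u = f` satisfying the Kupradze radiation
conditions: for every pole `y`, each column of `x ↦ Φ x y` is a locally integrable field which is
smooth off `y`, satisfies `Δ* u + ω² u = - δ_y e_j` in the sense of distributions, and satisfies
the Kupradze radiation conditions. (The operator `Δ* + ω²` is formally self-adjoint; test fields
are smooth, compactly supported and complex valued.) -/
structure IsKupradzeFundamentalSolution (lam mu omega : ℝ)
    (Φ : E3 → E3 → Matrix (Fin 3) (Fin 3) ℂ) : Prop where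
  locallyIntegrable : ∀ (y : E3) (i j : Fin 3),
    MeasureTheory.LocallyIntegrable (fun x => Φ x y i j)
  contDiffOn : ∀ (y : E3) (i j : Fin 3), ContDiffOn ℝ ∞ (fun x => Φ x y i j) {y}ᶜ
  equation : ∀ (y : E3) (j : Fin 3) (φ : E3 → Fin 3 → ℂ), ContDiff ℝ ∞ φ → HasCompactSupport φ →
    ∫ x, ∑ i, Φ x y i j * (lameOp lam mu φ x i + (omega : ℂ) ^ 2 * φ x i) = -φ y j
  radiating : ∀ (y : E3) (j : Fin 3), KupradzeRadiating lam mu omega (fun x i => Φ x y i j)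

/-! ### Spherical coordinates, spherical harmonics, spherical Bessel functions -/

/-- A triple of spherical coordinates: radius, polar angle, azimuthal angle. -/
structure SphCoord where
  r : ℝ
  θ : ℝ
  φ : ℝ

/-- The ranges `r ≥ 0` and `0 ≤ θ ≤ π`; the azimuth may be any real number. -/
def SphCoord.Admissible (p : SphCoord) : Prop := 0 ≤ p.r ∧ 0 ≤ p.θ ∧ p.θ ≤ Real.pi

/-- The point of three-space with the given spherical coordinates. -/
def SphCoord.toPoint (p : SphCoord) : E3 :=
  !₂[p.r * Real.cos p.φ * Real.sin p.θ, p.r * Real.sin p.φ * Real.sin p.θ, p.r * Real.cos p.θ]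

/-- The Legendre polynomial `P_n`, by Rodrigues' formula. -/
def legendreP (n : ℕ) : Polynomial ℝ :=
  Polynomial.C ((2 ^ n * (n.factorial : ℝ))⁻¹) *
    Polynomial.derivative^[n] ((Polynomial.X ^ 2 - 1) ^ n)

/-- The associated Legendre function of order `k ≥ 0`,
`P_n^k(z) = (-1)^k (1 - z²)^(k/2) d^k P_n / dz^k`, for `-1 ≤ z ≤ 1`. -/
def assocLegendreNat (n k : ℕ) (z : ℝ) : ℝ :=
  (-1) ^ k * √(1 - z ^ 2) ^ k * (Polynomial.derivative^[k] (legendreP n)).eval z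

/-- The associated Legendre function of integer order, with
`P_n^(-k) = (-1)^k (n-k)!/(n+k)! P_n^k` for `0 < k ≤ n`. -/
def assocLegendre (n : ℕ) (m : ℤ) (z : ℝ) : ℝ :=
  if 0 ≤ m then assocLegendreNat n m.natAbs z
  else (-1) ^ m.natAbs * (((n - m.natAbs).factorial : ℝ) / ((n + m.natAbs).factorial : ℝ)) *
    assocLegendreNat n m.natAbs z

/-- The orthonormal spherical harmonic
`Y_n^m = √((2n+1)(n-m)!/(4π(n+m)!)) e^{imφ} P_n^m(cos θ)` for `n ≥ 0`, `|m| ≤ n`; it is understood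
to be zero for all other pairs of integers `(n, m)`. -/
def sphY (n m : ℤ) (θ φ : ℝ) : ℂ :=
  if 0 ≤ n ∧ |m| ≤ n then
    ((√((2 * (n : ℝ) + 1) * ((n - m).toNat.factorial : ℝ) /
        (4 * Real.pi * ((n + m).toNat.factorial : ℝ))) : ℝ) : ℂ) *
      Complex.exp (Complex.I * (m : ℂ) * (φ : ℂ)) *
      ((assocLegendre n.toNat m (Real.cos θ) : ℝ) : ℂ)
  else 0

/-- The spherical Bessel function of the first kind,
`j_n(z) = z^n ∑_k (-z²/2)^k / (k! (2n+2k+1)!!)`. -/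
def sphBesselJ (n : ℕ) (z : ℝ) : ℝ :=
  z ^ n * ∑' k : ℕ, (-(z ^ 2) / 2) ^ k /
    ((k.factorial : ℝ) * ((2 * n + 2 * k + 1).doubleFactorial : ℝ))

/-- The spherical Bessel function of the third kind (spherical Hankel function of the first kind),
`h_n⁽¹⁾(z) = e^{iz} ∑_{k ≤ n} i^{k-n-1} (n+k)! / (2^k k! (n-k)! z^{k+1})`, for `z > 0`. -/
def sphHankel (n : ℕ) (z : ℝ) : ℂ :=
  Complex.exp (Complex.I * (z : ℂ)) * ∑ k ∈ Finset.range (n + 1),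
    Complex.I ^ ((k : ℤ) - (n : ℤ) - 1) * ((n + k).factorial : ℂ) /
      (2 ^ k * (k.factorial : ℂ) * ((n - k).factorial : ℂ) * (z : ℂ) ^ (k + 1))

/-! ### Coefficients -/

/-- `a_{n-1}^{m+1} = √((n-m)(n-m-1)/((2n+1)(2n-1)))`, re-indexed. -/
def coefA (n m : ℤ) : ℝ :=
  √((((n : ℝ) - m + 2) * ((n : ℝ) - m + 1)) / ((2 * n + 3) * (2 * n + 1)))

/-- `b_{n-1}^{m-1} = √((n+m)(n+m-1)/((2n+1)(2n-1)))`, re-indexed. -/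
def coefB (n m : ℤ) : ℝ :=
  √((((n : ℝ) + m + 2) * ((n : ℝ) + m + 1)) / ((2 * n + 3) * (2 * n + 1)))

/-- `c_{n+1}^{m+1} = √((n+m+2)(n+m+1)/((2n+1)(2n+3)))`, re-indexed. -/
def coefC (n m : ℤ) : ℝ :=
  √((((n : ℝ) + m) * ((n : ℝ) + m - 1)) / ((2 * n - 1) * (2 * n + 1)))

/-- `d_{n+1}^{m-1} = √((n-m+2)(n-m+1)/((2n+1)(2n+3)))`, re-indexed. -/
def coefD (n m : ℤ) : ℝ :=
  √((((n : ℝ) - m) * ((n : ℝ) - m - 1)) / ((2 * n - 1) * (2 * n + 1)))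

/-- `e_{n-1}^m = √((n+m)(n-m)/((2n+1)(2n-1)))`, re-indexed. -/
def coefE (n m : ℤ) : ℝ :=
  √((((n : ℝ) + m + 1) * ((n : ℝ) - m + 1)) / ((2 * n + 3) * (2 * n + 1)))

/-- `f_{n+1}^m = √((n+m+1)(n-m+1)/((2n+1)(2n+3)))`, re-indexed. -/
def coefF (n m : ℤ) : ℝ :=
  √((((n : ℝ) + m) * ((n : ℝ) - m)) / ((2 * n - 1) * (2 * n + 1)))

def matS : Matrix (Fin 3) (Fin 3) ℂ := !![0, 0, 0; 0, 0, 0; 0, 0, 1]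

def matP : Matrix (Fin 3) (Fin 3) ℂ := !![1, 0, 0; 0, 1, 0; 0, 0, 0]

def matA : Matrix (Fin 3) (Fin 3) ℂ := !![-Complex.I, 1, 0; 1, Complex.I, 0; 0, 0, 0]

def matB : Matrix (Fin 3) (Fin 3) ℂ := !![0, 0, Complex.I; 0, 0, -1; Complex.I, -1, 0]

def matC : Matrix (Fin 3) (Fin 3) ℂ :=
  !![Complex.I, 0, 0; 0, Complex.I, 0; 0, 0, -2 * Complex.I]

def matD : Matrix (Fin 3) (Fin 3) ℂ := !![0, 0, -Complex.I; 0, 0, -1; -Complex.I, -1, 0]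

def matE : Matrix (Fin 3) (Fin 3) ℂ := !![-Complex.I, -1, 0; -1, Complex.I, 0; 0, 0, 0]

/-- `S_{-,n}^m(θ, φ)`. -/
def Sminus (n m : ℤ) (θ φ : ℝ) : Matrix (Fin 3) (Fin 3) ℂ :=
  sphY (n - 2) (m - 2) θ φ • ((1 / 4 * (coefB (n - 2) (m - 2) * coefC n m) : ℝ) : ℂ) • matA
  + sphY (n - 2) (m - 1) θ φ • ((1 / 2 * (coefB (n - 2) (m - 1) * coefF n m) : ℝ) : ℂ) • matB
  + sphY (n - 2) m θ φ • ((1 / 2 * (coefA (n - 2) m * coefC n m) : ℝ) : ℂ) • matC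
  + sphY (n - 2) (m + 1) θ φ • ((1 / 2 * (coefA (n - 2) (m + 1) * coefF n m) : ℝ) : ℂ) • matD
  + sphY (n - 2) (m + 2) θ φ • ((1 / 4 * (coefA (n - 2) (m + 2) * coefD n m) : ℝ) : ℂ) • matE

/-- `S_{0,n}^m(θ, φ)`. -/
def Szero (n m : ℤ) (θ φ : ℝ) : Matrix (Fin 3) (Fin 3) ℂ :=
  sphY n (m - 2) θ φ •
      ((1 / 4 * (coefB n (m - 2) * coefA n m + coefD n (m - 2) * coefC n m) : ℝ) : ℂ) • matA
  + sphY n (m - 1) θ φ •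
      ((1 / 2 * (coefD n (m - 1) * coefF n m - coefB n (m - 1) * coefE n m) : ℝ) : ℂ) • matB
  + sphY n m θ φ • ((-(1 / 2) * (coefE n m ^ 2 + coefF n m ^ 2) : ℝ) : ℂ) • matC
  + sphY n (m + 1) θ φ •
      ((1 / 2 * (coefC n (m + 1) * coefF n m - coefA n (m + 1) * coefE n m) : ℝ) : ℂ) • matD
  + sphY n (m + 2) θ φ •
      ((1 / 4 * (coefA n (m + 2) * coefB n m + coefC n (m + 2) * coefD n m) : ℝ) : ℂ) • matE

/-- `S_{+,n}^m(θ, φ)`. -/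
def Splus (n m : ℤ) (θ φ : ℝ) : Matrix (Fin 3) (Fin 3) ℂ :=
  sphY (n + 2) (m - 2) θ φ • ((1 / 4 * (coefD (n + 2) (m - 2) * coefA n m) : ℝ) : ℂ) • matA
  + sphY (n + 2) (m - 1) θ φ • ((-(1 / 2) * (coefD (n + 2) (m - 1) * coefE n m) : ℝ) : ℂ) • matB
  + sphY (n + 2) m θ φ • ((1 / 2 * (coefC (n + 2) m * coefA n m) : ℝ) : ℂ) • matC
  + sphY (n + 2) (m + 1) θ φ • ((-(1 / 2) * (coefC (n + 2) (m + 1) * coefE n m) : ℝ) : ℂ) • matD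
  + sphY (n + 2) (m + 2) θ φ • ((1 / 4 * (coefC (n + 2) (m + 2) * coefB n m) : ℝ) : ℂ) • matE

/-! ### The four series -/

/-- `k³ h_{n₁}⁽¹⁾(k r) j_{n₂}(k t)`. -/
def Hfun (k : ℝ) (n₁ n₂ : ℕ) (r t : ℝ) : ℂ :=
  (k : ℂ) ^ 3 * sphHankel n₁ (k * r) * (sphBesselJ n₂ (k * t) : ℂ)

/-- The sum of `Hfun` for `k_p` and `k_s`. -/
def HfunPlus (kp ks : ℝ) (n₁ n₂ : ℕ) (r t : ℝ) : ℂ := Hfun kp n₁ n₂ r t + Hfun ks n₁ n₂ r t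

/-- The difference of `Hfun` for `k_p` and `k_s`. -/
def HfunMinus (kp ks : ℝ) (n₁ n₂ : ℕ) (r t : ℝ) : ℂ := Hfun kp n₁ n₂ r t - Hfun ks n₁ n₂ r t

/-- The term of index `(n, m)` of the series `Ψ`; `p` and `q` are the spherical coordinates of
`x` and `y`. -/
def psiTerm (lam mu omega : ℝ) (n : ℕ) (m : ℤ) (p q : SphCoord) : Matrix (Fin 3) (Fin 3) ℂ :=
  (Complex.I / (omega : ℂ) ^ 2) • (sphY n m p.θ p.φ * (starRingEnd ℂ) (sphY n m q.θ q.φ)) •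
    (Hfun (kS mu omega) n n p.r q.r • matS
      + ((1 / 2 : ℂ) * HfunPlus (kP lam mu omega) (kS mu omega) n n p.r q.r) • matP)

/-- The term of index `(n, m)` of the series `Φ₋`. For `n < 2` the factor `Sminus` vanishes,
so the truncated index `n - 2` is then irrelevant. -/
def minusTerm (lam mu omega : ℝ) (n : ℕ) (m : ℤ) (p q : SphCoord) : Matrix (Fin 3) (Fin 3) ℂ :=
  (1 / (omega : ℂ) ^ 2) • HfunMinus (kP lam mu omega) (kS mu omega) (n - 2) n p.r q.r •
    (starRingEnd ℂ) (sphY n m q.θ q.φ) • Sminus n m p.θ p.φ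

/-- The term of index `(n, m)` of the series `Φ₀`. -/
def zeroTerm (lam mu omega : ℝ) (n : ℕ) (m : ℤ) (p q : SphCoord) : Matrix (Fin 3) (Fin 3) ℂ :=
  (1 / (omega : ℂ) ^ 2) • HfunMinus (kP lam mu omega) (kS mu omega) n n p.r q.r •
    (starRingEnd ℂ) (sphY n m q.θ q.φ) • Szero n m p.θ p.φ

/-- The term of index `(n, m)` of the series `Φ₊`. -/
def plusTerm (lam mu omega : ℝ) (n : ℕ) (m : ℤ) (p q : SphCoord) : Matrix (Fin 3) (Fin 3) ℂ :=
  (1 / (omega : ℂ) ^ 2) • HfunMinus (kP lam mu omega) (kS mu omega) (n + 2) n p.r q.r •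
    (starRingEnd ℂ) (sphY n m q.θ q.φ) • Splus n m p.θ p.φ

/-- The sum `∑_{n ≥ 0} ∑_{m = -n}^{n} T n m` of a double series of matrices. -/
def doubleSum (T : ℕ → ℤ → SphCoord → SphCoord → Matrix (Fin 3) (Fin 3) ℂ) (p q : SphCoord) :
    Matrix (Fin 3) (Fin 3) ℂ :=
  ∑' n : ℕ, ∑ m ∈ Finset.Icc (-(n : ℤ)) n, T n m p q

/-- The series of entries of `∑_n ∑_{|m| ≤ n} T n m` converges absolutely and uniformly on the set
`K` of pairs of points `(x, y)`, for all choices of spherical coordinates of `x` and `y`: the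
double series of absolute values of each entry converges uniformly. -/
def AbsUnifConvergentOn (T : ℕ → ℤ → SphCoord → SphCoord → Matrix (Fin 3) (Fin 3) ℂ)
    (K : Set (E3 × E3)) : Prop :=
  ∀ i j : Fin 3, SummableUniformlyOn
    (fun (n : ℕ) (pq : SphCoord × SphCoord) =>
      ∑ m ∈ Finset.Icc (-(n : ℤ)) n, ‖T n m pq.1 pq.2 i j‖)
    {pq | pq.1.Admissible ∧ pq.2.Admissible ∧ (pq.1.toPoint, pq.2.toPoint) ∈ K}

/-- Termwise derivative with respect to `|x|`, the angles being fixed. -/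
def derivNormX (T : ℕ → ℤ → SphCoord → SphCoord → Matrix (Fin 3) (Fin 3) ℂ) :
    ℕ → ℤ → SphCoord → SphCoord → Matrix (Fin 3) (Fin 3) ℂ :=
  fun n m p q i j => deriv (fun s : ℝ => T n m { p with r := s } q i j) p.r

/-- Termwise derivative with respect to `|y|`, the angles being fixed. The terms that occur are
entire functions of `|y|`, so nothing special happens at `|y| = 0`. -/
def derivNormY (T : ℕ → ℤ → SphCoord → SphCoord → Matrix (Fin 3) (Fin 3) ℂ) :
    ℕ → ℤ → SphCoord → SphCoord → Matrix (Fin 3) (Fin 3) ℂ :=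
  fun n m p q i j => deriv (fun s : ℝ => T n m p { q with r := s } i j) q.r

/-- The series and its termwise first derivatives with respect to `|x|` and `|y|` are absolutely
and uniformly convergent on compact subsets of `|x| > |y|`. -/
def ConvergesWithRadialDerivatives
    (T : ℕ → ℤ → SphCoord → SphCoord → Matrix (Fin 3) (Fin 3) ℂ) : Prop :=
  ∀ K : Set (E3 × E3), IsCompact K → K ⊆ {xy | ‖xy.2‖ < ‖xy.1‖} →
    AbsUnifConvergentOn T K ∧ AbsUnifConvergentOn (derivNormX T) K ∧
      AbsUnifConvergentOn (derivNormY T) K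

end

end NavierLame

open scoped ContDiff InnerProductSpace ComplexConjugate

namespace NavierLame

noncomputable section

/-! ### Legendre polynomials -/

/-! The solution is explicit: Φ(x, y) is the Kupradze matrix `kupMat` at x − y, that is ω⁻²(k_s² G_s
δ_ij + ∂_i∂_j(G_s − G_p)) with G_k(x) = e^{ik|x|}/(4π|x|). It has to be shown that this is a
radiating fundamental solution, that off the diagonal there is no other, and that it expands into
the four series.

Expansion. For R = h or R = j, every first derivative of R_n(k|x|)Y_n^m is k times a fixed
combination of the six neighbours of degree n ± 1 and order m, m ± 1, with coefficients a, ..., f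
(`hasFDerivAt_wave`). Families obeying these relations (`IsLadder`) are stable under
differentiation. For such a family X put F_N(s) = ∑_{n ≤ N} ∑_m X_n^m(x − sy) conj(j_n Y_n^m)((1 −
s)y). At s = 0 this is a partial sum of the expansion; at s = 1 only the term (0, 0) survives and
gives a constant times X_0^0(x − y). Raising and lowering coefficients are adjoint to each other, so
the derivative of F_N telescopes to terms coupling the degrees N and N + 1 (`sum_ladderComb`), and
these are O(N^6 (|y|/|x|)^N). This proves an addition theorem (`IsLadder.tendsto_expansion`), which
is applied to the outgoing waves, hence to G_s, and to their second derivatives, hence to the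
Hessians of G_s and G_p. Applying the ladder relations twice produces the matrices S₋, S₀, S₊
(`ladderComb_ladderComb_eq`).

Convergence. One has |h_n(z)| ≤ (2n+1)!! e^z / z^{n+1}, |j_n(w)| ≤ w^n e^{w²/2} / (2n+1)!! and
|Y_n^m| ≤ √(2n+1), the last because ∑_m |Y_n^m|² is constant. In products the double factorials
cancel up to a power of n, and a geometric factor remains. Radial derivatives shift the orders by
one and change nothing essential.

Existence. With |x| replaced by √(|x|² + ε²), the Helmholtz operator sends the kernel to an
approximation of −δ (`integral_helmG_mul`). The Hessian of G_s − G_p is O(1/|x|) at the origin, so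
it contains no point mass (`integral_hessian_helmG_sub_mul`). Derivatives of outgoing waves are
combinations of outgoing waves, which gives the radiation conditions.

Uniqueness. Let w be the difference of two columns. Testing its equation with ∇∂_mψ and with
k_s²ψe_m + ∇∂_mψ shows that ∂_m div w and the components of w_s solve scalar Helmholtz equations
weakly, with no source at the pole. Such a function vanishes if it is radiating: its conserved flux
bounds it in mean square on large shells, and Green's representation then tends to zero
(`IsHelmholtzOff.eq_zero`). -/

open Polynomial in
theorem iterate_derivative_X_mul' (f : ℝ[X]) (m : ℕ) :
    derivative^[m + 1] (X * f) = X * derivative^[m + 1] f + C ((m : ℝ) + 1) * derivative^[m] f := by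
  induction m with
  | zero => simp [derivative_mul, add_comm]
  | succ m ih =>
    rw [Function.iterate_succ_apply', ih, derivative_add, derivative_mul, derivative_mul,
      derivative_X, derivative_C, ← Function.iterate_succ_apply' (f := derivative),
      ← Function.iterate_succ_apply' (f := derivative)]
    push_cast
    simp only [C_add, C_1]
    ring

open Polynomial in
theorem iterate_derivative_C_mul' (a : ℝ) (f : ℝ[X]) (m : ℕ) :
    derivative^[m] (C a * f) = C a * derivative^[m] f := by
  rw [← smul_eq_C_mul, iterate_derivative_smul, smul_eq_C_mul]

open Polynomial in
/-- `P'_{n+1} = z P'_n + (n+1) P_n`. -/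
theorem derivative_legendreP_succ (n : ℕ) :
    derivative (legendreP (n + 1)) =
      X * derivative (legendreP n) + C ((n : ℝ) + 1) * legendreP n := by
  have h1 : derivative ((X ^ 2 - 1 : ℝ[X]) ^ (n + 1)) =
      C (2 * ((n : ℝ) + 1)) * (X * (X ^ 2 - 1) ^ n) := by
    rw [derivative_pow_succ]
    simp only [derivative_sub, derivative_X_pow, derivative_one, C_mul, C_add, C_1]
    simp only [Nat.cast_ofNat, Nat.add_one_sub_one, pow_one, map_natCast, map_ofNat]
    ring
  have hc : ((2 ^ (n + 1) * ((n + 1).factorial : ℝ))⁻¹) * (2 * ((n : ℝ) + 1)) =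
      ((2 ^ n * (n.factorial : ℝ))⁻¹) := by
    rw [Nat.factorial_succ]; push_cast
    have : (n.factorial : ℝ) ≠ 0 := by positivity
    field_simp
    ring
  unfold legendreP
  rw [derivative_C_mul, ← Function.iterate_succ_apply' (f := derivative),
    Function.iterate_succ_apply, h1, iterate_derivative_C_mul', ← mul_assoc, ← C_mul, hc,
    iterate_derivative_X_mul', derivative_C_mul, ← Function.iterate_succ_apply' (f := derivative)]
  ring

open Polynomial in
/-- `P'_{n+2} = (2n+3) P_{n+1} + P'_n`. -/
theorem derivative_legendreP_add_two (n : ℕ) :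
    derivative (legendreP (n + 2)) =
      C (2 * (n : ℝ) + 3) * legendreP (n + 1) + derivative (legendreP n) := by
  have h2 : derivative (derivative ((X ^ 2 - 1 : ℝ[X]) ^ (n + 2))) =
      C (2 * ((n : ℝ) + 2)) * (C (2 * (n : ℝ) + 3) * (X ^ 2 - 1) ^ (n + 1)
        + C (2 * ((n : ℝ) + 1)) * (X ^ 2 - 1) ^ n) := by
    rw [derivative_pow_succ, derivative_mul, derivative_mul, derivative_pow_succ]
    simp only [derivative_sub, derivative_X_pow, derivative_one, C_mul, C_add, C_1]
    simp only [Nat.cast_ofNat, Nat.add_one_sub_one, pow_one, map_natCast, map_ofNat, map_add,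
      Nat.cast_add, Nat.cast_one, map_one, derivative_one,
      derivative_mul, derivative_X, derivative_natCast, derivative_ofNat, derivative_zero]
    ring
  have hc : ((2 ^ (n + 2) * ((n + 2).factorial : ℝ))⁻¹) * (2 * ((n : ℝ) + 2)) =
      ((2 ^ (n + 1) * ((n + 1).factorial : ℝ))⁻¹) := by
    rw [Nat.factorial_succ (n + 1)]; push_cast
    have : ((n + 1).factorial : ℝ) ≠ 0 := by positivity
    field_simp
    ring
  have hc' : ((2 ^ (n + 1) * ((n + 1).factorial : ℝ))⁻¹) * (2 * ((n : ℝ) + 1)) =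
      ((2 ^ n * (n.factorial : ℝ))⁻¹) := by
    rw [Nat.factorial_succ]; push_cast
    have : (n.factorial : ℝ) ≠ 0 := by positivity
    field_simp
    ring
  unfold legendreP
  rw [derivative_C_mul, ← Function.iterate_succ_apply' (f := derivative),
    Function.iterate_succ_apply, Function.iterate_succ_apply, h2, iterate_derivative_C_mul',
    ← mul_assoc, ← C_mul, hc, iterate_map_add, iterate_derivative_C_mul', iterate_derivative_C_mul',
    derivative_C_mul, ← Function.iterate_succ_apply' (f := derivative), ← hc',
    Nat.succ_eq_add_one]
  generalize derivative^[n + 1] ((X ^ 2 - 1 : ℝ[X]) ^ (n + 1)) = a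
  generalize derivative^[n + 1] ((X ^ 2 - 1 : ℝ[X]) ^ n) = b
  simp only [C_mul]
  generalize C ((2 ^ (n + 1) * ((n + 1).factorial : ℝ))⁻¹) = d
  generalize C (2 * (n : ℝ) + 3) = e
  ring

/-- The value at `c` of the `m`-th derivative of the Legendre polynomial `P_n`. -/
def legQ (n m : ℕ) (c : ℝ) : ℝ := (Polynomial.derivative^[m] (legendreP n)).eval c

/-- One of two basic contiguity relations, the other being `mul_legQ_succ_succ`. All later
identities for `legQ`, the Legendre equation included, are linear combinations of these two. -/
theorem legQ_succ_succ (n m : ℕ) (c : ℝ) :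
    legQ (n + 1) (m + 1) c = c * legQ n (m + 1) c + (n + m + 1) * legQ n m c := by
  unfold legQ
  rw [Function.iterate_succ_apply, derivative_legendreP_succ, iterate_map_add,
    iterate_derivative_C_mul']
  cases m with
  | zero => simp
  | succ m =>
    rw [iterate_derivative_X_mul', ← Function.iterate_succ_apply, ← Function.iterate_succ_apply]
    simp
    ring

/-- Equates the two expressions for the derivatives of P_{n+2} that follow from
`derivative_legendreP_succ` and `derivative_legendreP_add_two`. -/
theorem mul_legQ_succ_succ (n m : ℕ) (c : ℝ) :
    c * legQ (n + 1) (m + 1) c - legQ n (m + 1) c = (n + 1 - m) * legQ (n + 1) m c := by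
  have h1 := legQ_succ_succ (n + 1) m c
  have h2 : legQ (n + 2) (m + 1) c = (2 * n + 3) * legQ (n + 1) m c + legQ n (m + 1) c := by
    unfold legQ
    rw [Function.iterate_succ_apply, derivative_legendreP_add_two, iterate_map_add,
      iterate_derivative_C_mul', ← Function.iterate_succ_apply]
    simp
  push_cast at h1
  linear_combination h2 - h1

/-- In these names z, plus and minus stand for ∂_z (order kept) and ∂_x ± i∂_y (order shifted by
±1); lower and raise stand for the passage from degree n + 1 to n and from n to n + 1. -/
theorem legQ_z_lower (n m : ℕ) (c : ℝ) :
    (n + 1 - m) * c * legQ (n + 1) m c + (1 - c ^ 2) * legQ (n + 1) (m + 1) c =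
      (n + 1 + m) * legQ n m c := by
  linear_combination legQ_succ_succ n m c - c * mul_legQ_succ_succ n m c

theorem legQ_z_raise (n m : ℕ) (c : ℝ) :
    -(n + 1 + m) * c * legQ n m c + (1 - c ^ 2) * legQ n (m + 1) c =
      -(n - m + 1) * legQ (n + 1) m c := by
  linear_combination c * legQ_succ_succ n m c - mul_legQ_succ_succ n m c

theorem legQ_ode (n m : ℕ) (c : ℝ) :
    (1 - c ^ 2) * legQ n (m + 2) c - 2 * (m + 1) * c * legQ n (m + 1) c
      + (n - m) * (n + m + 1) * legQ n m c = 0 := by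
  have h := legQ_z_raise n (m + 1) c
  push_cast at h
  linear_combination h - (n - m) * legQ_succ_succ n m c

theorem legQ_minus_lower (n m : ℕ) (c : ℝ) :
    ((n + 1 : ℝ) - (m + 1)) * (1 - c ^ 2) * legQ (n + 1) (m + 1) c
      + 2 * (m + 1) * legQ (n + 1) (m + 1) c - (1 - c ^ 2) * c * legQ (n + 1) (m + 2) c =
      (n + m + 2) * (n + m + 1) * legQ n m c := by
  have h := legQ_ode (n + 1) m c
  have h1 := legQ_z_lower n m c
  push_cast at h
  linear_combination -c * h + (n + m + 2) * h1

theorem legQ_minus_raise (n m : ℕ) (c : ℝ) :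
    -((n + 1 : ℝ) + (m + 1)) * (1 - c ^ 2) * legQ n (m + 1) c
      + 2 * (m + 1) * legQ n (m + 1) c - (1 - c ^ 2) * c * legQ n (m + 2) c =
      (n - m) * (n - m + 1) * legQ (n + 1) m c := by
  have h := legQ_ode n m c
  have h1 := legQ_z_raise n m c
  linear_combination -c * h - (n - m) * h1

theorem legendreP_zero : legendreP 0 = 1 := by simp [legendreP]

theorem natDegree_legendreP_le (n : ℕ) : (legendreP n).natDegree ≤ n := by
  unfold legendreP
  refine (Polynomial.natDegree_C_mul_le _ _).trans ?_
  refine (Polynomial.natDegree_iterate_derivative _ _).trans ?_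
  have : ((Polynomial.X ^ 2 - 1 : Polynomial ℝ) ^ n).natDegree ≤ n * 2 := by
    refine Polynomial.natDegree_pow_le_of_le n ?_
    compute_degree
  omega

theorem legQ_eq_zero_of_lt {n m : ℕ} (h : n < m) (c : ℝ) : legQ n m c = 0 := by
  unfold legQ
  rw [Polynomial.iterate_derivative_eq_zero ((natDegree_legendreP_le n).trans_lt h)]
  simp

theorem legQ_zero_zero (c : ℝ) : legQ 0 0 c = 1 := by simp [legQ, legendreP_zero]

theorem legQ_at_one (n : ℕ) : legQ n 0 1 = 1 := by
  induction n with
  | zero => exact legQ_zero_zero 1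
  | succ n ih =>
    -- At c = 1 the derivative term drops out and P_{n+1}(1) = P_n(1) remains.
    have h := legQ_z_raise n 0 1
    rw [ih] at h
    have h0 : (n : ℝ) + 1 ≠ 0 := by positivity
    apply mul_left_cancel₀ h0
    push_cast at h
    linear_combination h

theorem hasDerivAt_legQ (n m : ℕ) (c : ℝ) : HasDerivAt (legQ n m) (legQ n (m + 1) c) c := by
  unfold legQ
  rw [Function.iterate_succ_apply']
  exact Polynomial.hasDerivAt _ _

/-! ### Spherical Bessel functions -/

/-- `(2n+1)!!` as a real number. -/
def oddFact (n : ℕ) : ℝ := ((2 * n + 1).doubleFactorial : ℝ)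

theorem oddFact_pos (n : ℕ) : 0 < oddFact n := by
  unfold oddFact; exact_mod_cast Nat.doubleFactorial_pos _

theorem oddFact_succ (n : ℕ) : oddFact (n + 1) = (2 * n + 3) * oddFact n := by
  unfold oddFact
  rw [show 2 * (n + 1) + 1 = (2 * n + 1) + 2 by ring, Nat.doubleFactorial_add_two]
  push_cast; ring

theorem oddFact_mono {m n : ℕ} (h : m ≤ n) : oddFact m ≤ oddFact n := by
  refine monotone_nat_of_le_succ (fun n => ?_) h
  rw [oddFact_succ]
  nlinarith [oddFact_pos n, (n.cast_nonneg : (0 : ℝ) ≤ n)]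

/-- The general term of the entire series `z⁻ⁿ j_n(z)` in the variable `u = z²`. -/
def besselTerm (n k : ℕ) (u : ℝ) : ℝ := (-u / 2) ^ k / ((k.factorial : ℝ) * oddFact (n + k))

/-- The entire function `J_n` with `j_n(z) = z^n J_n(z²)`. -/
def besselSer (n : ℕ) (u : ℝ) : ℝ := ∑' k : ℕ, besselTerm n k u

theorem sphBesselJ_eq (n : ℕ) (z : ℝ) : sphBesselJ n z = z ^ n * besselSer n (z ^ 2) := by
  unfold sphBesselJ besselSer besselTerm oddFact
  congr 1
  refine tsum_congr fun k => ?_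
  rw [show 2 * (n + k) + 1 = 2 * n + 2 * k + 1 by ring]

/-- Only the monotonicity of the double factorial is used, so that 1/(2n+1)!! factors out; it will
be played off against the growth of h_n. -/
theorem abs_besselTerm_le (n k : ℕ) (u : ℝ) :
    |besselTerm n k u| ≤ (|u| / 2) ^ k / (k.factorial : ℝ) * (oddFact n)⁻¹ := by
  unfold besselTerm
  rw [abs_div, abs_pow, abs_div, abs_neg, abs_two, abs_mul, abs_of_pos (oddFact_pos _),
    Nat.abs_cast, ← div_div, div_eq_mul_inv _ (oddFact _)]
  gcongr
  · exact oddFact_pos n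
  · exact oddFact_mono (by omega)

theorem hasSum_pow_div_factorial (x : ℝ) :
    HasSum (fun k : ℕ => x ^ k / (k.factorial : ℝ)) (Real.exp x) := by
  rw [Real.exp_eq_exp_ℝ]
  exact NormedSpace.expSeries_div_hasSum_exp x

theorem summable_besselTerm (n : ℕ) (u : ℝ) : Summable fun k => besselTerm n k u :=
  Summable.of_norm_bounded ((Real.summable_pow_div_factorial (|u| / 2)).mul_right _)
    fun k => abs_besselTerm_le n k u

theorem abs_besselSer_le (n : ℕ) (u : ℝ) :
    |besselSer n u| ≤ Real.exp (|u| / 2) * (oddFact n)⁻¹ := by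
  rw [← Real.norm_eq_abs, besselSer]
  exact tsum_of_norm_bounded ((hasSum_pow_div_factorial (|u| / 2)).mul_right _)
    fun k => abs_besselTerm_le n k u

/-- Term-by-term differentiation on the ball of radius |u| + 1, where an exponential series
dominates: the term of index j + 1 differentiates to −1/2 times the term of index j of J_{n+1}. -/
theorem hasDerivAt_besselSer (n : ℕ) (u : ℝ) :
    HasDerivAt (besselSer n) (-(1 / 2) * besselSer (n + 1) u) u := by
  set R : ℝ := |u| + 1
  -- The constant term has derivative 0, so majorant and derivatives are shifted by one index.
  let b : ℕ → ℝ := fun k => Nat.rec 0 (fun j _ => (R / 2) ^ j / (j.factorial : ℝ)) k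
  let g' : ℕ → ℝ → ℝ := fun k v => Nat.rec 0 (fun j _ => -(1 / 2) * besselTerm (n + 1) j v) k
  have hb : Summable b := (summable_nat_add_iff 1).1 (Real.summable_pow_div_factorial (R / 2))
  have hd : ∀ k, ∀ v ∈ Metric.ball (0 : ℝ) R, HasDerivAt (besselTerm n k) (g' k v) v := by
    intro k v _
    cases k with
    | zero =>
      have h1 : besselTerm n 0 = fun _ => (oddFact n)⁻¹ := by
        funext v; simp [besselTerm]
      rw [h1]
      exact hasDerivAt_const _ _
    | succ j =>
      have h1 : HasDerivAt (fun v : ℝ => -v / 2) (-1 / 2) v :=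
        ((hasDerivAt_id v).neg).div_const 2
      have h := (h1.pow (j + 1)).div_const (((j + 1).factorial : ℝ) * oddFact (n + (j + 1)))
      refine h.congr_deriv ?_
      change _ = -(1 / 2) * besselTerm (n + 1) j v
      simp only [besselTerm, Nat.factorial_succ]
      have h0 : (j.factorial : ℝ) ≠ 0 := by positivity
      have h2 := (oddFact_pos (n + 1 + j)).ne'
      rw [show n + (j + 1) = n + 1 + j by ring]
      push_cast
      field_simp
  have hg : ∀ k, ∀ v ∈ Metric.ball (0 : ℝ) R, ‖g' k v‖ ≤ b k := by
    intro k v hv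
    cases k with
    | zero => simp [g', b]
    | succ j =>
      have hv' : |v| ≤ R := by simpa using (mem_ball_zero_iff.1 hv).le
      change ‖-(1 / 2) * besselTerm (n + 1) j v‖ ≤ (R / 2) ^ j / (j.factorial : ℝ)
      rw [norm_mul, Real.norm_eq_abs, Real.norm_eq_abs]
      have h1 := abs_besselTerm_le (n + 1) j v
      have h2 : (oddFact (n + 1))⁻¹ ≤ 1 := by
        refine inv_le_one_of_one_le₀ ?_
        unfold oddFact; exact_mod_cast Nat.doubleFactorial_pos _
      have h3 : (|v| / 2) ^ j / (j.factorial : ℝ) ≤ (R / 2) ^ j / (j.factorial : ℝ) := by gcongr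
      have h4 : |-(1 / 2 : ℝ)| ≤ 1 := by rw [abs_neg, abs_of_pos] <;> norm_num
      calc |-(1 / 2 : ℝ)| * |besselTerm (n + 1) j v| ≤ 1 * ((R / 2) ^ j / (j.factorial : ℝ) * 1) := by
            gcongr
            exact h1.trans (mul_le_mul h3 h2 (inv_nonneg.2 (oddFact_pos _).le) (by positivity))
        _ = _ := by ring
  have hmem : u ∈ Metric.ball (0 : ℝ) R := by simp [R]
  have h := hasDerivAt_tsum_of_isPreconnected hb Metric.isOpen_ball
    (convex_ball (0 : ℝ) R).isPreconnected hd hg hmem (summable_besselTerm n u) hmem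
  refine h.congr_deriv ?_
  have hs : Summable fun k => g' k u := Summable.of_norm_bounded hb fun k => hg k u hmem
  rw [hs.tsum_eq_zero_add]
  have h0 : g' 0 u = 0 := rfl
  rw [h0, zero_add]
  exact tsum_mul_left

/-- Everything is measured against the terms of J_{n+1}: J_n carries the weights 2(n+k) + 3 and u
J_{n+2} the weights −2k, which add up to 2n + 3. In the variable u there is no division by z, so the
resulting formulas for j_n hold at the origin too. -/
theorem besselSer_recurrence (n : ℕ) (u : ℝ) :
    (2 * n + 3) * besselSer (n + 1) u = besselSer n u + u * besselSer (n + 2) u := by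
  have h1 : u * besselSer (n + 2) u = ∑' k : ℕ, (-(2 * k)) * besselTerm (n + 1) k u := by
    have hs : Summable fun k : ℕ => (-(2 * (k : ℝ))) * besselTerm (n + 1) k u := by
      have : (fun k : ℕ => (-(2 * (k : ℝ))) * besselTerm (n + 1) k u) =
          fun k : ℕ => Nat.rec 0 (fun j _ => u * besselTerm (n + 2) j u) k := by
        funext k
        cases k with
        | zero => simp
        | succ j =>
          simp only [besselTerm, Nat.factorial_succ]
          have h0 : (j.factorial : ℝ) ≠ 0 := by positivity
          have h2 := (oddFact_pos (n + 2 + j)).ne'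
          rw [show n + 1 + (j + 1) = n + 2 + j by ring]
          push_cast
          field_simp
          ring
      rw [this]
      exact (summable_nat_add_iff 1).1 ((summable_besselTerm (n + 2) u).mul_left u)
    rw [hs.tsum_eq_zero_add, besselSer, ← tsum_mul_left]
    simp only [Nat.cast_zero, mul_zero, neg_zero, zero_mul, zero_add]
    refine tsum_congr fun j => ?_
    simp only [besselTerm, Nat.factorial_succ]
    have h0 : (j.factorial : ℝ) ≠ 0 := by positivity
    have h2 := (oddFact_pos (n + 2 + j)).ne'
    rw [show n + 1 + (j + 1) = n + 2 + j by ring]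
    push_cast
    field_simp
    ring
  have h2 : besselSer n u = ∑' k : ℕ, (2 * (n + k) + 3) * besselTerm (n + 1) k u := by
    refine tsum_congr fun k => ?_
    simp only [besselTerm]
    rw [show n + 1 + k = n + k + 1 by ring, oddFact_succ]
    have h0 : (k.factorial : ℝ) ≠ 0 := by positivity
    have h2 := (oddFact_pos (n + k)).ne'
    have h3 : (2 * ((n : ℝ) + k) + 3) ≠ 0 := by positivity
    push_cast
    field_simp
  have hB := summable_besselTerm (n + 1) u
  have h3 : besselSer n u - (2 * n + 3) * besselSer (n + 1) u =
      ∑' k : ℕ, (2 * k) * besselTerm (n + 1) k u := by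
    have hs2 : Summable fun k : ℕ => (2 * ((n : ℝ) + k) + 3) * besselTerm (n + 1) k u := by
      have := summable_besselTerm n u
      refine this.congr fun k => ?_
      simp only [besselTerm]
      rw [show n + 1 + k = n + k + 1 by ring, oddFact_succ]
      have h0 : (k.factorial : ℝ) ≠ 0 := by positivity
      have h2 := (oddFact_pos (n + k)).ne'
      have h3 : (2 * ((n : ℝ) + k) + 3) ≠ 0 := by positivity
      push_cast
      field_simp
    rw [h2]
    conv_lhs => rw [besselSer, ← tsum_mul_left]
    rw [← hs2.tsum_sub (hB.mul_left _)]
    refine tsum_congr fun k => by ring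
  rw [h1]
  simp only [neg_mul, tsum_neg]
  linarith

theorem sphBesselJ_recurrence (n : ℕ) (z : ℝ) :
    (2 * n + 3) * sphBesselJ (n + 1) z = z * (sphBesselJ n z + sphBesselJ (n + 2) z) := by
  simp only [sphBesselJ_eq]
  have := besselSer_recurrence n (z ^ 2)
  linear_combination z ^ (n + 1) * this

/-- Valid at the origin as well. -/
theorem hasDerivAt_sphBesselJ_succ (n : ℕ) (z : ℝ) :
    HasDerivAt (sphBesselJ (n + 1))
      (((n + 1) * sphBesselJ n z - (n + 2) * sphBesselJ (n + 2) z) / (2 * n + 3)) z := by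
  have h1 : sphBesselJ (n + 1) = fun z => z ^ (n + 1) * besselSer (n + 1) (z ^ 2) :=
    funext (sphBesselJ_eq (n + 1))
  have h2 : HasDerivAt (fun z : ℝ => z ^ (n + 1) * besselSer (n + 1) (z ^ 2))
      ((n + 1) * z ^ n * besselSer (n + 1) (z ^ 2) +
        z ^ (n + 1) * (-(1 / 2) * besselSer (n + 2) (z ^ 2) * (2 * z))) z := by
    have hp := hasDerivAt_pow (n + 1) z
    simp only [Nat.cast_add, Nat.cast_one, add_tsub_cancel_right] at hp
    refine hp.mul ?_
    have := (hasDerivAt_besselSer (n + 1) (z ^ 2)).comp z (hasDerivAt_pow 2 z)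
    simpa [Function.comp_def] using this
  rw [h1]
  refine h2.congr_deriv ?_
  have h3 : (2 * (n : ℝ) + 3) ≠ 0 := by positivity
  rw [eq_div_iff h3, sphBesselJ_eq, sphBesselJ_eq]
  have := besselSer_recurrence n (z ^ 2)
  linear_combination (n + 1) * z ^ n * this

theorem hasDerivAt_sphBesselJ_zero (z : ℝ) :
    HasDerivAt (sphBesselJ 0) (-sphBesselJ 1 z) z := by
  have h1 : sphBesselJ 0 = fun z => besselSer 0 (z ^ 2) := by
    funext z; simp [sphBesselJ_eq]
  rw [h1]
  have := (hasDerivAt_besselSer 0 (z ^ 2)).comp z (hasDerivAt_pow 2 z)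
  refine this.congr_deriv ?_
  rw [sphBesselJ_eq]
  simp
  ring

theorem continuous_sphBesselJ (n : ℕ) : Continuous (sphBesselJ n) := by
  rw [continuous_iff_continuousAt]
  intro z
  cases n with
  | zero => exact (hasDerivAt_sphBesselJ_zero z).continuousAt
  | succ n => exact (hasDerivAt_sphBesselJ_succ n z).continuousAt

theorem sphBesselJ_zero_zero : sphBesselJ 0 0 = 1 := by
  rw [sphBesselJ_eq, besselSer, tsum_eq_single 0]
  · simp [besselTerm, oddFact]
  · intro k hk
    simp [besselTerm, hk]

theorem sphBesselJ_succ_zero (n : ℕ) : sphBesselJ (n + 1) 0 = 0 := by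
  rw [sphBesselJ_eq]; simp

theorem abs_sphBesselJ_le (n : ℕ) (z : ℝ) :
    |sphBesselJ n z| ≤ |z| ^ n * (Real.exp (z ^ 2 / 2) * (oddFact n)⁻¹) := by
  rw [sphBesselJ_eq, abs_mul, abs_pow]
  have := abs_besselSer_le n (z ^ 2)
  rw [abs_of_nonneg (sq_nonneg z)] at this
  gcongr

/-! ### Spherical Hankel functions -/

/-- The coefficients of the finite expansion of `e^{-iz} h_n(z)` in powers of `1/z`. -/
def hankelCoef (n k : ℕ) : ℂ :=
  if k ≤ n then Complex.I ^ ((k : ℤ) - (n : ℤ) - 1) * ((n + k).factorial : ℂ) /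
      (2 ^ k * (k.factorial : ℂ) * ((n - k).factorial : ℂ)) else 0

theorem hankelCoef_of_lt {n k : ℕ} (h : n < k) : hankelCoef n k = 0 := by
  simp [hankelCoef, not_le.2 h]

theorem sphHankel_eq {n M : ℕ} (hM : n < M) (z : ℝ) :
    sphHankel n z = Complex.exp (Complex.I * z) *
      ∑ k ∈ Finset.range M, hankelCoef n k / (z : ℂ) ^ (k + 1) := by
  unfold sphHankel
  congr 1
  rw [← Finset.sum_subset (Finset.range_mono (show n + 1 ≤ M by omega))]
  · refine Finset.sum_congr rfl fun k hk => ?_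
    have : k ≤ n := by simpa [Nat.lt_succ_iff] using hk
    rw [hankelCoef, if_pos this, div_div]
  · intro k _ hk
    rw [hankelCoef_of_lt (by simpa using hk), zero_div]

theorem I_zpow_sub_one (a : ℤ) : Complex.I ^ (a - 1) = -Complex.I * Complex.I ^ a := by
  rw [zpow_sub_one₀ Complex.I_ne_zero, Complex.inv_I]; ring

/-- The relations between neighbouring coefficient rows are the two formulas for the derivative of
h_n, read off at each power of 1/z. -/
theorem hankelCoef_succ_left (n k : ℕ) (hk : k ≤ n) :
    (n + 1 - k) * hankelCoef (n + 1) k = -Complex.I * (n + 1 + k) * hankelCoef n k := by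
  obtain ⟨d, rfl⟩ := Nat.exists_eq_add_of_le hk
  rw [hankelCoef, hankelCoef, if_pos (by omega), if_pos hk, show k + d - k = d by omega,
    show k + d + 1 - k = d + 1 by omega, show k + d + 1 + k = (k + d + k) + 1 by ring,
    Nat.factorial_succ, Nat.factorial_succ,
    show (k : ℤ) - ((k + d + 1 : ℕ) : ℤ) - 1 = ((k : ℤ) - ((k + d : ℕ) : ℤ) - 1) - 1 by
      push_cast; ring, I_zpow_sub_one]
  have h1 : (d.factorial : ℂ) ≠ 0 := by exact_mod_cast d.factorial_ne_zero
  have h2 : (k.factorial : ℂ) ≠ 0 := by exact_mod_cast k.factorial_ne_zero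
  have h3 : ((d : ℂ) + 1) ≠ 0 := by exact_mod_cast d.succ_ne_zero
  generalize Complex.I ^ ((k : ℤ) - ((k + d : ℕ) : ℤ) - 1) = e
  push_cast
  field_simp
  ring

/-- The convention that coefficients beyond k = n are zero makes this hold for every k, the top
coefficient included. -/
theorem hankelCoef_succ_succ (n k : ℕ) :
    hankelCoef (n + 1) (k + 1) =
      (n + 1 + k) * hankelCoef n k - Complex.I * hankelCoef n (k + 1) := by
  rcases lt_trichotomy k n with h | rfl | h
  · obtain ⟨d, rfl⟩ := Nat.exists_eq_add_of_lt h
    rw [hankelCoef, hankelCoef, hankelCoef, if_pos (by omega), if_pos (by omega),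
      if_pos (by omega), show k + d + 1 + 1 - (k + 1) = d + 1 by omega,
      show k + d + 1 - k = d + 1 by omega, show k + d + 1 - (k + 1) = d by omega,
      show k + d + 1 + 1 + (k + 1) = (2 * k + d + 1) + 1 + 1 by ring,
      show k + d + 1 + (k + 1) = (2 * k + d + 1) + 1 by ring,
      show k + d + 1 + k = 2 * k + d + 1 by ring,
      Nat.factorial_succ (2 * k + d + 1 + 1), Nat.factorial_succ (2 * k + d + 1),
      Nat.factorial_succ d, Nat.factorial_succ k,
      show ((k + 1 : ℕ) : ℤ) - ((k + d + 1 + 1 : ℕ) : ℤ) - 1 = (-(d : ℤ) - 1) - 1 by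
        push_cast; ring,
      show ((k : ℕ) : ℤ) - ((k + d + 1 : ℕ) : ℤ) - 1 = (-(d : ℤ) - 1) - 1 by
        push_cast; ring,
      show ((k + 1 : ℕ) : ℤ) - ((k + d + 1 : ℕ) : ℤ) - 1 = -(d : ℤ) - 1 by
        push_cast; ring, I_zpow_sub_one (-(d : ℤ) - 1)]
    have h1 : (d.factorial : ℂ) ≠ 0 := by exact_mod_cast d.factorial_ne_zero
    have h2 : (k.factorial : ℂ) ≠ 0 := by exact_mod_cast k.factorial_ne_zero
    have h3 : ((d : ℂ) + 1) ≠ 0 := by exact_mod_cast d.succ_ne_zero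
    have h4 : ((k : ℂ) + 1) ≠ 0 := by exact_mod_cast k.succ_ne_zero
    generalize Complex.I ^ (-(d : ℤ) - 1) = e
    push_cast
    field_simp
    ring
  · rw [hankelCoef_of_lt (Nat.lt_succ_self k), hankelCoef, hankelCoef, if_pos le_rfl,
      if_pos le_rfl, show k + 1 + (k + 1) = 2 * k + 1 + 1 by ring, show k + k = 2 * k by ring,
      Nat.factorial_succ, Nat.factorial_succ, Nat.factorial_succ]
    have h2 : (k.factorial : ℂ) ≠ 0 := by exact_mod_cast k.factorial_ne_zero
    have h4 : ((k : ℂ) + 1) ≠ 0 := by exact_mod_cast k.succ_ne_zero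
    simp only [sub_self, zero_sub]
    push_cast
    field_simp
    ring
  · rw [hankelCoef_of_lt (by omega : n + 1 < k + 1), hankelCoef_of_lt h,
      hankelCoef_of_lt (by omega : n < k + 1)]
    ring

theorem hankelCoef_succ_zero (n : ℕ) : hankelCoef (n + 1) 0 = -Complex.I * hankelCoef n 0 := by
  have h := hankelCoef_succ_left n 0 (Nat.zero_le n)
  have h1 : ((n : ℂ) + 1) ≠ 0 := by exact_mod_cast n.succ_ne_zero
  apply mul_left_cancel₀ h1
  push_cast at h
  linear_combination h

/-- The sum has one superfluous term, of index n + 1 and with coefficient zero; it makes room for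
the index shifts in the next two proofs. -/
theorem hasDerivAt_sphHankel_aux (n : ℕ) {z : ℝ} (hz : z ≠ 0) :
    HasDerivAt (sphHankel n) (Complex.exp (Complex.I * z) *
      ∑ k ∈ Finset.range (n + 2), (Complex.I * hankelCoef n k / (z : ℂ) ^ (k + 1) -
        (k + 1) * hankelCoef n k / (z : ℂ) ^ (k + 2))) z := by
  have hz' : (z : ℂ) ≠ 0 := by exact_mod_cast hz
  have h0 : sphHankel n = fun z : ℝ => Complex.exp (Complex.I * z) *
      ∑ k ∈ Finset.range (n + 2), hankelCoef n k / (z : ℂ) ^ (k + 1) :=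
    funext (sphHankel_eq (by omega))
  have h1 : HasDerivAt (fun w : ℂ => Complex.exp (Complex.I * w) *
      ∑ k ∈ Finset.range (n + 2), hankelCoef n k / w ^ (k + 1))
      (Complex.exp (Complex.I * z) * Complex.I *
        (∑ k ∈ Finset.range (n + 2), hankelCoef n k / (z : ℂ) ^ (k + 1)) +
      Complex.exp (Complex.I * z) *
        ∑ k ∈ Finset.range (n + 2), -((k + 1) * hankelCoef n k / (z : ℂ) ^ (k + 2))) (z : ℂ) := by
    refine HasDerivAt.mul ?_ (HasDerivAt.fun_sum fun k _ => ?_)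
    · have := (hasDerivAt_id (z : ℂ)).const_mul Complex.I
      simpa using this.cexp
    · have h2 := ((hasDerivAt_pow (k + 1) (z : ℂ)).inv (pow_ne_zero _ hz')).const_mul
        (hankelCoef n k)
      simp only [div_eq_mul_inv]
      refine h2.congr_deriv ?_
      simp only [add_tsub_cancel_right]
      push_cast
      field_simp
      ring
  rw [h0]
  refine h1.comp_ofReal.congr_deriv ?_
  rw [Finset.sum_sub_distrib, Finset.sum_neg_distrib, mul_assoc, ← mul_add, Finset.mul_sum,
    sub_eq_add_neg]
  congr 2
  refine Finset.sum_congr rfl fun k _ => by ring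

theorem hasDerivAt_sphHankel (n : ℕ) {z : ℝ} (hz : z ≠ 0) :
    HasDerivAt (sphHankel n) (n / z * sphHankel n z - sphHankel (n + 1) z) z := by
  refine (hasDerivAt_sphHankel_aux n hz).congr_deriv ?_
  have hz' : (z : ℂ) ≠ 0 := by exact_mod_cast hz
  have e1 : sphHankel (n + 1) z = Complex.exp (Complex.I * z) *
      (∑ k ∈ Finset.range (n + 2), ((n + 1 + k) * hankelCoef n k / (z : ℂ) ^ (k + 2) -
        Complex.I * hankelCoef n k / (z : ℂ) ^ (k + 1))) := by
    rw [sphHankel_eq (show n + 1 < n + 2 + 1 by omega), Finset.sum_range_succ',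
      hankelCoef_succ_zero, Finset.sum_sub_distrib]
    congr 1
    -- The shift k ↦ k + 1 loses nothing at the upper end, since `hankelCoef n (n + 2)` is zero.
    have h2 : ∑ k ∈ Finset.range (n + 2), Complex.I * hankelCoef n k / (z : ℂ) ^ (k + 1) =
        ∑ k ∈ Finset.range (n + 2), Complex.I * hankelCoef n (k + 1) / (z : ℂ) ^ (k + 2) +
          Complex.I * hankelCoef n 0 / (z : ℂ) ^ (0 + 1) := by
      have h3 := Finset.sum_range_succ (fun k => Complex.I * hankelCoef n k / (z : ℂ) ^ (k + 1))
        (n + 2)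
      rw [hankelCoef_of_lt (show n < n + 2 by omega), Finset.sum_range_succ'] at h3
      simp only [mul_zero, zero_div, add_zero] at h3
      rw [← h3]
    rw [h2, ← sub_sub, ← Finset.sum_sub_distrib, sub_eq_add_neg]
    congr 1
    · refine Finset.sum_congr rfl fun k _ => ?_
      rw [hankelCoef_succ_succ]
      ring
    · ring
  rw [e1, sphHankel_eq (show n < n + 2 by omega), mul_left_comm, ← mul_sub]
  congr 1
  rw [Finset.mul_sum, ← Finset.sum_sub_distrib]
  refine Finset.sum_congr rfl fun k _ => ?_
  field_simp
  ring

theorem hasDerivAt_sphHankel_succ (n : ℕ) {z : ℝ} (hz : z ≠ 0) :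
    HasDerivAt (sphHankel (n + 1))
      (sphHankel n z - (n + 2) / z * sphHankel (n + 1) z) z := by
  refine (hasDerivAt_sphHankel_aux (n + 1) hz).congr_deriv ?_
  have hz' : (z : ℂ) ≠ 0 := by exact_mod_cast hz
  have e1 : sphHankel n z = Complex.exp (Complex.I * z) *
      (∑ k ∈ Finset.range (n + 3), (Complex.I * hankelCoef (n + 1) k / (z : ℂ) ^ (k + 1) +
        (n + 1 - k) * hankelCoef (n + 1) k / (z : ℂ) ^ (k + 2))) := by
    rw [sphHankel_eq (show n < n + 3 + 1 by omega), Finset.sum_range_succ',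
      Finset.sum_add_distrib]
    congr 1
    have h2 : ∑ k ∈ Finset.range (n + 3), Complex.I * hankelCoef (n + 1) k / (z : ℂ) ^ (k + 1) =
        ∑ k ∈ Finset.range (n + 3), Complex.I * hankelCoef (n + 1) (k + 1) / (z : ℂ) ^ (k + 2) +
          Complex.I * hankelCoef (n + 1) 0 / (z : ℂ) ^ (0 + 1) := by
      have h3 := Finset.sum_range_succ
        (fun k => Complex.I * hankelCoef (n + 1) k / (z : ℂ) ^ (k + 1)) (n + 3)
      rw [hankelCoef_of_lt (show n + 1 < n + 3 by omega), Finset.sum_range_succ'] at h3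
      simp only [mul_zero, zero_div, add_zero] at h3
      rw [← h3]
    rw [h2, add_right_comm, ← Finset.sum_add_distrib]
    congr 1
    · refine Finset.sum_congr rfl fun k _ => ?_
      rw [hankelCoef_succ_succ]
      rcases le_or_gt k n with hk | hk
      · rw [hankelCoef_succ_left n k hk]
        linear_combination (hankelCoef n (k + 1) / (z : ℂ) ^ (k + 2)) * Complex.I_mul_I
      · rw [hankelCoef_of_lt hk, hankelCoef_of_lt (show n < k + 1 by omega)]
        rcases Nat.lt_or_ge (n + 1) k with h | h
        · rw [hankelCoef_of_lt h]; ring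
        · obtain rfl : k = n + 1 := by omega
          push_cast; ring
    · rw [hankelCoef_succ_zero]
      linear_combination (hankelCoef n 0 / (z : ℂ) ^ (0 + 1)) * Complex.I_mul_I
  rw [e1, sphHankel_eq (show n + 1 < n + 3 by omega), mul_left_comm, ← mul_sub]
  congr 1
  rw [Finset.mul_sum, ← Finset.sum_sub_distrib]
  refine Finset.sum_congr rfl fun k _ => ?_
  field_simp
  ring

theorem sphHankel_zero (z : ℝ) :
    sphHankel 0 z = -Complex.I * Complex.exp (Complex.I * z) / z := by
  simp [sphHankel]
  ring

/-- The function h_{n+1} has two derivative formulas, one through h_{n+2} and one through h_n; the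
derivative is unique. -/
theorem sphHankel_recurrence (n : ℕ) {z : ℝ} (hz : z ≠ 0) :
    (2 * n + 3) * sphHankel (n + 1) z = z * (sphHankel n z + sphHankel (n + 2) z) := by
  have h := (hasDerivAt_sphHankel (n + 1) hz).unique (hasDerivAt_sphHankel_succ n hz)
  have hz' : (z : ℂ) ≠ 0 := by exact_mod_cast hz
  push_cast at h
  field_simp at h
  linear_combination h

theorem norm_exp_I_mul_ofReal' (z : ℝ) : ‖Complex.exp (Complex.I * z)‖ = 1 := by
  rw [mul_comm]; exact Complex.norm_exp_ofReal_mul_I z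

/-- The quotient increases with k up to k = n, where it equals (2n−1)!!; hence an induction on d = n
− k. -/
theorem factorial_ratio_le {n k : ℕ} (hk : k ≤ n) :
    ((n + k).factorial : ℝ) / (2 ^ k * (k.factorial : ℝ)) ≤ oddFact n := by
  have h1 : ∀ d, ∀ k, k + d = n →
      ((n + k).factorial : ℝ) / (2 ^ k * (k.factorial : ℝ)) ≤ oddFact n := by
    intro d
    induction d with
    | zero =>
      rintro k rfl
      simp only [add_zero]
      have h := Nat.factorial_eq_mul_doubleFactorial (2 * k)
      rw [Nat.doubleFactorial_two_mul, Nat.factorial_succ] at h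
      have h' : ((2 * k + 1 : ℕ) : ℝ) * ((2 * k).factorial : ℝ) =
          oddFact k * (2 ^ k * (k.factorial : ℝ)) := by
        unfold oddFact; exact_mod_cast h
      rw [← two_mul, div_le_iff₀ (by positivity), ← h']
      push_cast
      nlinarith [(Nat.cast_nonneg k : (0 : ℝ) ≤ k),
        (Nat.cast_nonneg (2 * k).factorial : (0 : ℝ) ≤ _)]
    | succ d ih =>
      intro k hk
      refine le_trans ?_ (ih (k + 1) (by omega))
      rw [div_le_div_iff₀ (by positivity) (by positivity), show n + (k + 1) = n + k + 1 by ring,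
        Nat.factorial_succ k, Nat.factorial_succ (n + k)]
      have hn : (n : ℝ) = k + d + 1 := by rw [← hk]; push_cast; ring
      have h0 : (0 : ℝ) ≤ ((n + k).factorial : ℝ) * (2 ^ k * (k.factorial : ℝ)) := by positivity
      push_cast
      rw [pow_succ]
      have h1 : 0 ≤ ((n + k).factorial : ℝ) * (2 ^ k * (k.factorial : ℝ)) * (n - k - 1) := by
        refine mul_nonneg h0 ?_
        rw [hn]; ring_nf; positivity
      nlinarith
  obtain ⟨d, rfl⟩ := Nat.exists_eq_add_of_le hk
  exact h1 d k rfl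

/-- After `factorial_ratio_le`, what is left is z^{-(n+1)} times a partial sum of the exponential
series, read backwards. -/
theorem norm_sphHankel_le (n : ℕ) {z : ℝ} (hz : 0 < z) :
    ‖sphHankel n z‖ ≤ oddFact n * Real.exp z / z ^ (n + 1) := by
  rw [sphHankel_eq (Nat.lt_succ_self n), norm_mul, norm_exp_I_mul_ofReal', one_mul]
  have h1 : ∀ k ∈ Finset.range (n + 1), ‖hankelCoef n k / (z : ℂ) ^ (k + 1)‖ ≤
      oddFact n / z ^ (n + 1) * (z ^ (n - k) / ((n - k).factorial : ℝ)) := by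
    intro k hk
    have hk' : k ≤ n := by simpa [Nat.lt_succ_iff] using hk
    rw [hankelCoef, if_pos hk']
    simp only [norm_div, norm_mul, norm_zpow, Complex.norm_I, one_zpow, one_mul, norm_pow,
      Complex.norm_natCast, Complex.norm_ofNat, Complex.norm_real, Real.norm_eq_abs, abs_of_pos hz]
    have h2 := factorial_ratio_le hk'
    have h3 : z ^ (n + 1) = z ^ (k + 1) * z ^ (n - k) := by
      rw [← pow_add]; congr 1; omega
    rw [h3, ← div_div (_ : ℝ) (2 ^ k * (k.factorial : ℝ))]
    calc ((n + k).factorial : ℝ) / (2 ^ k * (k.factorial : ℝ)) / ((n - k).factorial : ℝ) /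
          z ^ (k + 1) ≤ oddFact n / ((n - k).factorial : ℝ) / z ^ (k + 1) := by gcongr
      _ = _ := by field_simp
  refine (norm_sum_le _ _).trans ((Finset.sum_le_sum h1).trans ?_)
  rw [← Finset.mul_sum, mul_comm (oddFact n), mul_div_assoc, mul_comm (Real.exp z)]
  have h4 : ∑ k ∈ Finset.range (n + 1), z ^ (n - k) / ((n - k).factorial : ℝ) ≤ Real.exp z := by
    have := Finset.sum_range_reflect (fun k => z ^ k / (k.factorial : ℝ)) (n + 1)
    simp only [add_tsub_cancel_right] at this
    rw [this]
    exact Real.sum_le_exp_of_nonneg hz.le _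
  have h5 : 0 ≤ oddFact n / z ^ (n + 1) := div_nonneg (oddFact_pos n).le (by positivity)
  exact mul_le_mul_of_nonneg_left h4 h5

/-- The spherical Hankel functions are `O(1/z)` and satisfy the radiation condition. -/
theorem sphHankel_asymptotics (n : ℕ) : ∃ C : ℝ, 0 ≤ C ∧ ∀ z : ℝ, 1 ≤ z →
    ‖sphHankel n z‖ ≤ C / z ∧
      ‖deriv (sphHankel n) z - Complex.I * sphHankel n z‖ ≤ C / z ^ 2 := by
  refine ⟨∑ k ∈ Finset.range (n + 2), (k + 1) * ‖hankelCoef n k‖, by positivity, fun z hz => ?_⟩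
  have hz0 : 0 < z := by linarith
  rw [(hasDerivAt_sphHankel_aux n hz0.ne').deriv, sphHankel_eq (show n < n + 2 by omega)]
  constructor
  · rw [norm_mul, norm_exp_I_mul_ofReal', one_mul, Finset.sum_div]
    refine (norm_sum_le _ _).trans (Finset.sum_le_sum fun k _ => ?_)
    rw [norm_div, norm_pow, Complex.norm_real, Real.norm_eq_abs, abs_of_pos hz0]
    have h1 : z ≤ z ^ (k + 1) := le_self_pow₀ hz (by omega)
    have h2 : ‖hankelCoef n k‖ ≤ (k + 1) * ‖hankelCoef n k‖ := by
      nlinarith [norm_nonneg (hankelCoef n k), (Nat.cast_nonneg k : (0 : ℝ) ≤ k)]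
    gcongr
  · have h1 : Complex.exp (Complex.I * z) * ∑ k ∈ Finset.range (n + 2),
        (Complex.I * hankelCoef n k / (z : ℂ) ^ (k + 1) -
          (k + 1) * hankelCoef n k / (z : ℂ) ^ (k + 2)) -
        Complex.I * (Complex.exp (Complex.I * z) *
          ∑ k ∈ Finset.range (n + 2), hankelCoef n k / (z : ℂ) ^ (k + 1)) =
        Complex.exp (Complex.I * z) * ∑ k ∈ Finset.range (n + 2),
          -((k + 1) * hankelCoef n k / (z : ℂ) ^ (k + 2)) := by
      rw [mul_left_comm, ← mul_sub]
      congr 1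
      rw [Finset.mul_sum, ← Finset.sum_sub_distrib]
      refine Finset.sum_congr rfl fun k _ => by ring
    rw [h1, norm_mul, norm_exp_I_mul_ofReal', one_mul, Finset.sum_div]
    refine (norm_sum_le _ _).trans (Finset.sum_le_sum fun k _ => ?_)
    rw [norm_neg, norm_div, norm_pow, Complex.norm_real, Real.norm_eq_abs, abs_of_pos hz0, norm_mul]
    have h1 : z ^ 2 ≤ z ^ (k + 2) := pow_le_pow_right₀ hz (by omega)
    have h2 : ‖(k : ℂ) + 1‖ = k + 1 := by
      have := Complex.norm_natCast (k + 1)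
      push_cast at this
      exact this
    rw [h2]
    gcongr

/-- A bounded shift of the order costs only a polynomial factor in n. -/
theorem oddFact_add_le (n d : ℕ) : oddFact (n + d) ≤ (2 * (n + d) + 1) ^ d * oddFact n := by
  induction d with
  | zero => simp
  | succ d ih =>
    rw [← add_assoc, oddFact_succ]
    have h0 := (oddFact_pos n).le
    push_cast
    calc (2 * ((n : ℝ) + d) + 3) * oddFact (n + d)
        ≤ (2 * (n + d) + 3) * ((2 * (n + d) + 1) ^ d * oddFact n) := by gcongr
      _ ≤ (2 * (n + d) + 3) * ((2 * (n + d) + 3) ^ d * oddFact n) := by gcongr; norm_num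
      _ = _ := by rw [pow_succ]; ring

/-- The basic estimate for the products of Hankel and Bessel functions of neighbouring orders. -/
theorem exists_norm_hankel_mul_bessel_le (B : ℝ) (hB : 1 ≤ B) :
    ∃ C : ℝ, 0 ≤ C ∧ ∀ (n₁ n₂ : ℕ), n₁ ≤ n₂ + 4 → n₂ ≤ n₁ + 4 → ∀ z w : ℝ, 1 / B ≤ z → z ≤ B →
      0 ≤ w → w ≤ z →
      ‖sphHankel n₁ z‖ * |sphBesselJ n₂ w| ≤ C * ((n₂ : ℝ) + 1) ^ 4 * (w / z) ^ n₂ := by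
  have hB0 : 0 < B := by linarith
  -- The factor 9^4 comes from (2n+9)^4 ≤ 9^4 (n+1)^4 for four extra orders, B^5 from at most five
  -- surplus powers of z or 1/z, and the exponential from z + w²/2.
  refine ⟨9 ^ 4 * B ^ 5 * Real.exp (B + B ^ 2), by positivity, ?_⟩
  intro n₁ n₂ h12 h21 z w hz1 hz2 hw0 hwz
  have hz0 : 0 < z := lt_of_lt_of_le (by positivity) hz1
  have h1 := norm_sphHankel_le n₁ hz0
  have h2 := abs_sphBesselJ_le n₂ w
  rw [abs_of_nonneg hw0] at h2
  have h3 : oddFact n₁ ≤ 9 ^ 4 * ((n₂ : ℝ) + 1) ^ 4 * oddFact n₂ := by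
    refine (oddFact_mono h12).trans ((oddFact_add_le n₂ 4).trans ?_)
    rw [← mul_pow]
    have := (oddFact_pos n₂).le
    gcongr
    push_cast
    linarith [(Nat.cast_nonneg n₂ : (0 : ℝ) ≤ n₂)]
  have h4 : Real.exp z * Real.exp (w ^ 2 / 2) ≤ Real.exp (B + B ^ 2) := by
    rw [← Real.exp_add]
    refine Real.exp_le_exp.2 ?_
    nlinarith
  have h5 : z ^ n₂ / z ^ (n₁ + 1) ≤ B ^ 5 := by
    rcases le_or_gt (n₁ + 1) n₂ with h | h
    · obtain ⟨d, rfl⟩ := Nat.exists_eq_add_of_le h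
      rw [pow_add, mul_div_cancel_left₀ _ (by positivity)]
      exact (pow_le_pow_left₀ hz0.le hz2 d).trans (pow_le_pow_right₀ hB (by omega))
    · obtain ⟨d, hd⟩ := Nat.exists_eq_add_of_lt h
      rw [hd, add_assoc, pow_add, div_mul_cancel_left₀ (by positivity)]
      have : z⁻¹ ≤ B := by
        rw [inv_le_comm₀ hz0 hB0, inv_eq_one_div]; exact hz1
      rw [← inv_pow]
      exact (pow_le_pow_left₀ (by positivity) this _).trans (pow_le_pow_right₀ hB (by omega))
  have hO := oddFact_pos n₂
  calc ‖sphHankel n₁ z‖ * |sphBesselJ n₂ w|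
      ≤ (oddFact n₁ * Real.exp z / z ^ (n₁ + 1)) *
          (w ^ n₂ * (Real.exp (w ^ 2 / 2) * (oddFact n₂)⁻¹)) := by
        gcongr
        exact (norm_nonneg _).trans h1
    _ = (oddFact n₁ * (oddFact n₂)⁻¹) * (Real.exp z * Real.exp (w ^ 2 / 2)) *
          (z ^ n₂ / z ^ (n₁ + 1)) * (w / z) ^ n₂ := by
        rw [div_pow]; field_simp
    _ ≤ (9 ^ 4 * ((n₂ : ℝ) + 1) ^ 4) * Real.exp (B + B ^ 2) * B ^ 5 * (w / z) ^ n₂ := by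
        have : oddFact n₁ * (oddFact n₂)⁻¹ ≤ 9 ^ 4 * ((n₂ : ℝ) + 1) ^ 4 := by
          rw [← div_eq_mul_inv, div_le_iff₀ hO]; exact h3
        gcongr
    _ = _ := by ring

/-! ### Normalised associated Legendre functions -/

/-- The normalisation constant of `Y_n^k`, `0 ≤ k ≤ n`. -/
def harmNorm (n k : ℕ) : ℝ :=
  √((2 * (n : ℝ) + 1) * ((n - k).factorial : ℝ) / (4 * Real.pi * ((n + k).factorial : ℝ)))

theorem harmNorm_nonneg (n k : ℕ) : 0 ≤ harmNorm n k := Real.sqrt_nonneg _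

theorem harmNorm_sq (n k : ℕ) : harmNorm n k ^ 2 =
    (2 * (n : ℝ) + 1) * ((n - k).factorial : ℝ) / (4 * Real.pi * ((n + k).factorial : ℝ)) :=
  Real.sq_sqrt (by positivity)

theorem eq_of_sq_eq_of_nonneg {a b : ℝ} (ha : 0 ≤ a) (hb : 0 ≤ b) (h : a ^ 2 = b ^ 2) : a = b :=
  (sq_eq_sq₀ ha hb).1 h

/-- This and the next five lemmas say that ratios of normalising constants are, up to rational
factors, the coefficients a, ..., f. Both sides are nonnegative, so it suffices to compare squares.
Writing the degree as the order plus d makes the subtractions inside the factorials exact. -/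
theorem coefE_mul_harmNorm (n d : ℕ) :
    (2 * ((n + d : ℕ) : ℝ) + 1) * coefE ((n + d : ℕ) : ℤ) n * harmNorm (n + d + 1) n =
      (d + 1) * harmNorm (n + d) n := by
  have h0 := harmNorm_nonneg (n + d + 1) n
  have h1 := harmNorm_nonneg (n + d) n
  have hr : 0 ≤ coefE ((n + d : ℕ) : ℤ) n := Real.sqrt_nonneg _
  refine eq_of_sq_eq_of_nonneg (by positivity) (by positivity) ?_
  rw [mul_pow, mul_pow, mul_pow, harmNorm_sq, harmNorm_sq, coefE, Real.sq_sqrt,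
    show n + d + 1 - n = d + 1 by omega, show n + d - n = d by omega,
    show n + d + 1 + n = n + d + n + 1 by ring, Nat.factorial_succ d,
    Nat.factorial_succ (n + d + n)]
  · push_cast
    field_simp
    ring
  · push_cast
    apply div_nonneg <;> [skip; positivity]
    ring_nf; positivity

theorem coefF_mul_harmNorm (n d : ℕ) :
    (2 * ((n + d : ℕ) : ℝ) + 3) * coefF ((n + d + 1 : ℕ) : ℤ) n * harmNorm (n + d) n =
      (n + d + 1 + n) * harmNorm (n + d + 1) n := by
  have h0 := harmNorm_nonneg (n + d + 1) n
  have h1 := harmNorm_nonneg (n + d) n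
  have hr : 0 ≤ coefF ((n + d + 1 : ℕ) : ℤ) n := Real.sqrt_nonneg _
  refine eq_of_sq_eq_of_nonneg (by positivity) (by positivity) ?_
  have e : (2 * ((n : ℝ) + d + 1) - 1) = 2 * (n + d) + 1 := by ring
  rw [mul_pow, mul_pow, mul_pow, harmNorm_sq, harmNorm_sq, coefF, Real.sq_sqrt,
    show n + d + 1 - n = d + 1 by omega, show n + d - n = d by omega,
    show n + d + 1 + n = n + d + n + 1 by ring, Nat.factorial_succ d,
    Nat.factorial_succ (n + d + n)]
  · push_cast
    rw [e]
    field_simp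
    ring
  · push_cast
    rw [e]
    apply div_nonneg <;> [skip; positivity]
    ring_nf; positivity

theorem coefD_mul_harmNorm (n d : ℕ) :
    (2 * ((n + 1 + d : ℕ) : ℝ) + 3) * coefD ((n + 1 + d + 1 : ℕ) : ℤ) n *
      harmNorm (n + 1 + d) (n + 1) = harmNorm (n + 1 + d + 1) n := by
  have h0 := harmNorm_nonneg (n + 1 + d) (n + 1)
  have hr : 0 ≤ coefD ((n + 1 + d + 1 : ℕ) : ℤ) n := Real.sqrt_nonneg _
  refine eq_of_sq_eq_of_nonneg (by positivity) (harmNorm_nonneg _ _) ?_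
  have e : (2 * ((n : ℝ) + 1 + d + 1) - 1) = 2 * (n + 1 + d) + 1 := by ring
  rw [mul_pow, mul_pow, harmNorm_sq, harmNorm_sq, coefD, Real.sq_sqrt,
    show n + 1 + d - (n + 1) = d by omega, show n + 1 + d + 1 - n = d + 1 + 1 by omega,
    show n + 1 + d + 1 + n = n + 1 + d + (n + 1) by ring, Nat.factorial_succ (d + 1),
    Nat.factorial_succ d]
  · push_cast
    rw [e]
    field_simp
    ring
  · push_cast
    rw [e]
    apply div_nonneg <;> [skip; positivity]
    ring_nf; positivity

theorem coefB_mul_harmNorm (n d : ℕ) :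
    (2 * ((n + d : ℕ) : ℝ) + 1) * coefB ((n + d : ℕ) : ℤ) n * harmNorm (n + d + 1) (n + 1) =
      harmNorm (n + d) n := by
  have h0 := harmNorm_nonneg (n + d + 1) (n + 1)
  have hr : 0 ≤ coefB ((n + d : ℕ) : ℤ) n := Real.sqrt_nonneg _
  refine eq_of_sq_eq_of_nonneg (by positivity) (harmNorm_nonneg _ _) ?_
  rw [mul_pow, mul_pow, harmNorm_sq, harmNorm_sq, coefB, Real.sq_sqrt,
    show n + d + 1 - (n + 1) = d by omega, show n + d - n = d by omega,
    show n + d + 1 + (n + 1) = n + d + n + 1 + 1 by ring, Nat.factorial_succ (n + d + n + 1),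
    Nat.factorial_succ (n + d + n)]
  · push_cast
    field_simp
    ring
  · push_cast
    positivity

theorem coefC_mul_harmNorm (n d : ℕ) :
    (2 * ((n + d : ℕ) : ℝ) + 3) * coefC ((n + d + 1 : ℕ) : ℤ) ((n + 1 : ℕ) : ℤ) *
      harmNorm (n + d) n =
      (n + d + n + 2) * (n + d + n + 1) * harmNorm (n + d + 1) (n + 1) := by
  have h0 := harmNorm_nonneg (n + d + 1) (n + 1)
  have h1 := harmNorm_nonneg (n + d) n
  have hr : 0 ≤ coefC ((n + d + 1 : ℕ) : ℤ) ((n + 1 : ℕ) : ℤ) := Real.sqrt_nonneg _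
  refine eq_of_sq_eq_of_nonneg (by positivity) (by positivity) ?_
  have e : (2 * ((n : ℝ) + d + 1) - 1) = 2 * (n + d) + 1 := by ring
  have e' : (n : ℝ) + d + 1 + (n + 1) - 1 = n + d + n + 1 := by ring
  rw [mul_pow, mul_pow, mul_pow, mul_pow, harmNorm_sq, harmNorm_sq, coefC, Real.sq_sqrt,
    show n + d + 1 - (n + 1) = d by omega, show n + d - n = d by omega,
    show n + d + 1 + (n + 1) = n + d + n + 1 + 1 by ring, Nat.factorial_succ (n + d + n + 1),
    Nat.factorial_succ (n + d + n)]
  · push_cast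
    rw [e, e']
    field_simp
    ring
  · push_cast
    rw [e, e']
    positivity

theorem coefA_mul_harmNorm (n d : ℕ) :
    (2 * ((n + 1 + d : ℕ) : ℝ) + 1) * coefA ((n + 1 + d : ℕ) : ℤ) ((n + 1 : ℕ) : ℤ) *
      harmNorm (n + 1 + d + 1) n = (d + 1) * (d + 2) * harmNorm (n + 1 + d) (n + 1) := by
  have h0 := harmNorm_nonneg (n + 1 + d + 1) n
  have h1 := harmNorm_nonneg (n + 1 + d) (n + 1)
  have hr : 0 ≤ coefA ((n + 1 + d : ℕ) : ℤ) ((n + 1 : ℕ) : ℤ) := Real.sqrt_nonneg _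
  refine eq_of_sq_eq_of_nonneg (by positivity) (by positivity) ?_
  have e : (n : ℝ) + 1 + d - (n + 1) = d := by ring
  rw [mul_pow, mul_pow, mul_pow, mul_pow, harmNorm_sq, harmNorm_sq, coefA, Real.sq_sqrt,
    show n + 1 + d - (n + 1) = d by omega, show n + 1 + d + 1 - n = d + 1 + 1 by omega,
    show n + 1 + d + 1 + n = n + 1 + d + (n + 1) by ring, Nat.factorial_succ (d + 1),
    Nat.factorial_succ d]
  · push_cast
    rw [e]
    field_simp
    ring
  · push_cast
    rw [e]
    positivity

/-- The normalised function `N_n^k P_n^{(k)}`. -/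
def legN (n k : ℕ) (c : ℝ) : ℝ := harmNorm n k * legQ n k c

/-- The derivative of `legN`. -/
def legN' (n k : ℕ) (c : ℝ) : ℝ := harmNorm n k * legQ n (k + 1) c

theorem legN_of_lt {n k : ℕ} (h : n < k) (c : ℝ) : legN n k c = 0 := by
  simp [legN, legQ_eq_zero_of_lt h]

theorem legN'_of_le {n k : ℕ} (h : n ≤ k) (c : ℝ) : legN' n k c = 0 := by
  simp [legN', legQ_eq_zero_of_lt (Nat.lt_succ_of_le h)]

/-- Normalisation turns the rational factor of `legQ_z_lower` into the coefficient f. For k > n the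
right side is zero, and on the left either the factor n + 1 − k or `legN (n + 1) k` vanishes. -/
theorem legN_z_lower (n k : ℕ) (c : ℝ) :
    (n + 1 - k) * c * legN (n + 1) k c + (1 - c ^ 2) * legN' (n + 1) k c =
      (2 * n + 3) * coefF ((n + 1 : ℕ) : ℤ) k * legN n k c := by
  rcases le_or_gt k n with h | h
  · obtain ⟨d, rfl⟩ := Nat.exists_eq_add_of_le h
    have h1 := coefF_mul_harmNorm k d
    have h2 := legQ_z_lower (k + d) k c
    simp only [legN, legN']
    push_cast at h1 h2 ⊢
    linear_combination harmNorm (k + d + 1) k * h2 - legQ (k + d) k c * h1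
  · rw [legN_of_lt h, legN'_of_le h]
    rcases eq_or_lt_of_le (Nat.succ_le_of_lt h) with rfl | h'
    · push_cast; ring
    · rw [legN_of_lt h']; ring

theorem legN_z_raise (n k : ℕ) (c : ℝ) :
    -(n + 1 + k) * c * legN n k c + (1 - c ^ 2) * legN' n k c =
      -((2 * n + 1) * coefE (n : ℤ) k * legN (n + 1) k c) := by
  rcases le_or_gt k n with h | h
  · obtain ⟨d, rfl⟩ := Nat.exists_eq_add_of_le h
    have h1 := coefE_mul_harmNorm k d
    have h2 := legQ_z_raise (k + d) k c
    simp only [legN, legN']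
    push_cast at h1 h2 ⊢
    linear_combination harmNorm (k + d) k * h2 + legQ (k + d + 1) k c * h1
  · rw [legN_of_lt h, legN'_of_le h.le]
    rcases eq_or_lt_of_le (Nat.succ_le_of_lt h) with rfl | h'
    · simp [coefE]
    · rw [legN_of_lt h']; ring

theorem legN_plus_lower (n k : ℕ) (c : ℝ) :
    (n + 1 - k) * legN (n + 1) k c - c * legN' (n + 1) k c =
      -((2 * n + 3) * coefD ((n + 1 : ℕ) : ℤ) k * legN n (k + 1) c) := by
  have h2 := mul_legQ_succ_succ n k c
  rcases le_or_gt (k + 1) n with h | h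
  · obtain ⟨d, rfl⟩ := Nat.exists_eq_add_of_le h
    have h1 := coefD_mul_harmNorm k d
    simp only [legN, legN']
    push_cast at h1 h2 ⊢
    linear_combination -harmNorm (k + 1 + d + 1) k * h2 + legQ (k + 1 + d) (k + 1) c * h1
  · rw [legN_of_lt h]
    rw [legQ_eq_zero_of_lt h] at h2
    simp only [legN, legN']
    linear_combination -harmNorm (n + 1) k * h2

theorem legN_plus_raise (n k : ℕ) (c : ℝ) :
    -(n + 1 + k) * legN n k c - c * legN' n k c =
      -((2 * n + 1) * coefB (n : ℤ) k * legN (n + 1) (k + 1) c) := by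
  rcases le_or_gt k n with h | h
  · obtain ⟨d, rfl⟩ := Nat.exists_eq_add_of_le h
    have h1 := coefB_mul_harmNorm k d
    have h2 := legQ_succ_succ (k + d) k c
    simp only [legN, legN']
    push_cast at h1 h2 ⊢
    linear_combination harmNorm (k + d) k * h2 + legQ (k + d + 1) (k + 1) c * h1
  · rw [legN_of_lt h, legN'_of_le h.le, legN_of_lt (Nat.succ_lt_succ h)]
    ring

theorem legN_minus_lower (n k : ℕ) (c : ℝ) :
    (n - k) * (1 - c ^ 2) * legN (n + 1) (k + 1) c + 2 * (k + 1) * legN (n + 1) (k + 1) c -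
        (1 - c ^ 2) * c * legN' (n + 1) (k + 1) c =
      (2 * n + 3) * coefC ((n + 1 : ℕ) : ℤ) ((k + 1 : ℕ) : ℤ) * legN n k c := by
  rcases le_or_gt k n with h | h
  · obtain ⟨d, rfl⟩ := Nat.exists_eq_add_of_le h
    have h1 := coefC_mul_harmNorm k d
    have h2 := legQ_minus_lower (k + d) k c
    simp only [legN, legN']
    push_cast at h1 h2 ⊢
    linear_combination harmNorm (k + d + 1) (k + 1) * h2 - legQ (k + d) k c * h1
  · rw [legN_of_lt h, legN_of_lt (Nat.succ_lt_succ h), legN'_of_le (by omega)]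
    ring

theorem legN_minus_raise (n k : ℕ) (c : ℝ) :
    -(n + k + 2) * (1 - c ^ 2) * legN n (k + 1) c + 2 * (k + 1) * legN n (k + 1) c -
        (1 - c ^ 2) * c * legN' n (k + 1) c =
      (2 * n + 1) * coefA (n : ℤ) ((k + 1 : ℕ) : ℤ) * legN (n + 1) k c := by
  rcases le_or_gt (k + 1) n with h | h
  · obtain ⟨d, rfl⟩ := Nat.exists_eq_add_of_le h
    have h1 := coefA_mul_harmNorm k d
    have h2 := legQ_minus_raise (k + 1 + d) k c
    simp only [legN, legN']
    push_cast at h1 h2 ⊢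
    linear_combination harmNorm (k + 1 + d) (k + 1) * h2 - legQ (k + 1 + d + 1) k c * h1
  · rw [legN_of_lt h, legN'_of_le h.le]
    -- In the first two cases the function of degree n + 1 on the right need not vanish, but its
    -- coefficient a does.
    obtain rfl | rfl | h' : n = k ∨ k = n + 1 ∨ n + 1 < k := by omega
    · simp [coefA]
    · have h0 : coefA (n : ℤ) ((n + 1 + 1 : ℕ) : ℤ) = 0 := by
        unfold coefA
        push_cast
        rw [show (n : ℝ) - (n + 1 + 1) + 2 = 0 by ring]
        simp
      rw [h0]; ring
    · rw [legN_of_lt h']; ring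

/-! ### The bound on spherical harmonics -/

theorem harmNorm_sq_succ {n k : ℕ} (h : k + 1 ≤ n) :
    harmNorm n (k + 1) ^ 2 * ((n - k) * (n + k + 1)) = harmNorm n k ^ 2 := by
  obtain ⟨d, rfl⟩ := Nat.exists_eq_add_of_le h
  rw [harmNorm_sq, harmNorm_sq, show k + 1 + d - (k + 1) = d by omega,
    show k + 1 + d - k = d + 1 by omega, show k + 1 + d + (k + 1) = k + 1 + d + k + 1 by ring,
    Nat.factorial_succ d, Nat.factorial_succ (k + 1 + d + k)]
  push_cast
  field_simp
  ring

/-- The sum `∑_{|m| ≤ n} |Y_n^m|²` as a function of `c = cos θ`. -/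
def legSum (n : ℕ) (c : ℝ) : ℝ :=
  legN n 0 c ^ 2 + 2 * ∑ k ∈ Finset.range n, (1 - c ^ 2) ^ (k + 1) * legN n (k + 1) c ^ 2

theorem hasDerivAt_legN (n k : ℕ) (c : ℝ) : HasDerivAt (legN n k) (legN' n k c) c :=
  (hasDerivAt_legQ n k c).const_mul _

/-- By the Legendre equation the derivative of each summand is a difference of consecutive terms of
one sequence. The sum telescopes: the last term contains P_n^{(n+1)} = 0, and the first cancels the
derivative of the zonal square. -/
theorem hasDerivAt_legSum (n : ℕ) (c : ℝ) : HasDerivAt (legSum n) 0 c := by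
  have h1 : HasDerivAt (fun c : ℝ => 1 - c ^ 2) (-(2 * c)) c := by
    simpa using (hasDerivAt_pow 2 c).const_sub 1
  have h2 : HasDerivAt (legSum n) (2 * legN n 0 c * legN' n 0 c +
      2 * ∑ k ∈ Finset.range n, (((k : ℝ) + 1) * (1 - c ^ 2) ^ k * (-(2 * c)) * legN n (k + 1) c ^ 2 +
        (1 - c ^ 2) ^ (k + 1) * (2 * legN n (k + 1) c * legN' n (k + 1) c))) c := by
    refine HasDerivAt.add ?_ (HasDerivAt.const_mul _ (HasDerivAt.fun_sum fun k _ => ?_))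
    · simpa using (hasDerivAt_legN n 0 c).fun_pow 2
    · refine HasDerivAt.mul ?_ ?_
      · simpa using h1.fun_pow (k + 1)
      · simpa using (hasDerivAt_legN n (k + 1) c).fun_pow 2
  refine h2.congr_deriv ?_
  have h3 : ∀ k ∈ Finset.range n,
      ((k : ℝ) + 1) * (1 - c ^ 2) ^ k * (-(2 * c)) * legN n (k + 1) c ^ 2 +
        (1 - c ^ 2) ^ (k + 1) * (2 * legN n (k + 1) c * legN' n (k + 1) c) =
      (1 - c ^ 2) ^ (k + 1) * harmNorm n (k + 1) ^ 2 * legQ n (k + 1) c * legQ n (k + 2) c -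
      (1 - c ^ 2) ^ k * harmNorm n k ^ 2 * legQ n k c * legQ n (k + 1) c := by
    intro k hk
    have hk' : k + 1 ≤ n := by simpa using hk
    have e := legQ_ode n k c
    rw [← harmNorm_sq_succ hk']
    simp only [legN, legN']
    linear_combination (1 - c ^ 2) ^ k * harmNorm n (k + 1) ^ 2 * legQ n (k + 1) c * e
  rw [Finset.sum_congr rfl h3, Finset.sum_range_sub
    (fun k => (1 - c ^ 2) ^ k * harmNorm n k ^ 2 * legQ n k c * legQ n (k + 1) c)]
  rw [legQ_eq_zero_of_lt (Nat.lt_succ_self n)]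
  simp only [legN, legN']
  ring

/-- A constant, evaluated at c = 1, where only the zonal term is left. -/
theorem legSum_eq (n : ℕ) (c : ℝ) : legSum n c = (2 * n + 1) / (4 * Real.pi) := by
  have h : legSum n c = legSum n 1 :=
    is_const_of_deriv_eq_zero (fun x => (hasDerivAt_legSum n x).differentiableAt)
      (fun x => (hasDerivAt_legSum n x).deriv) c 1
  rw [h, legSum]
  simp only [one_pow, sub_self, ne_eq, Nat.add_eq_zero_iff, one_ne_zero, and_false,
    not_false_eq_true, zero_pow, zero_mul, Finset.sum_const_zero, mul_zero, add_zero]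
  rw [legN, legQ_at_one, mul_one, harmNorm_sq]
  simp only [tsub_zero, add_zero]
  field_simp

/-- A single square is at most the whole sum (2n+1)/(4π). -/
theorem legN_bound (n k : ℕ) {c s : ℝ} (hs : s ^ 2 + c ^ 2 = 1) :
    s ^ k * |legN n k c| ≤ √(2 * n + 1) := by
  rcases lt_or_ge n k with h | h
  · rw [legN_of_lt h]; simp
  have hs2 : 1 - c ^ 2 = s ^ 2 := by linarith
  have hnn : ∀ j ∈ Finset.range n, 0 ≤ (1 - c ^ 2) ^ (j + 1) * legN n (j + 1) c ^ 2 := by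
    intro j _; rw [hs2]; positivity
  have h1 : (s ^ k * |legN n k c|) ^ 2 ≤ legSum n c := by
    rw [mul_pow, sq_abs, ← pow_mul, mul_comm k 2, pow_mul, ← hs2, legSum]
    cases k with
    | zero =>
      have := Finset.sum_nonneg hnn
      simp only [pow_zero, one_mul]
      linarith
    | succ k =>
      have := Finset.single_le_sum hnn (Finset.mem_range.2 h)
      have h0 := Finset.sum_nonneg hnn
      nlinarith [sq_nonneg (legN n 0 c)]
  refine Real.le_sqrt_of_sq_le (h1.trans ?_)
  rw [legSum_eq]
  refine div_le_self (by positivity) ?_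
  nlinarith [Real.pi_gt_three]

/-! ### Spherical harmonics as functions of the direction -/

/-- `Y_n^k` for `k ≥ 0`, as a function of `ζ = sin θ e^{iφ}` and `c = cos θ`. -/
def harmNat (n k : ℕ) (ζ : ℂ) (c : ℝ) : ℂ := (-1) ^ k * ζ ^ k * (legN n k c : ℂ)

/-- `Y_n^m` as a function of `ζ = sin θ e^{iφ}` and `c = cos θ`. -/
def harm (n m : ℤ) (ζ : ℂ) (c : ℝ) : ℂ :=
  if n < 0 then 0 else if 0 ≤ m then harmNat n.toNat m.toNat ζ c
    else (-1) ^ m.natAbs * conj (harmNat n.toNat m.natAbs ζ c)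

theorem harm_natCast (n k : ℕ) (ζ : ℂ) (c : ℝ) : harm n k ζ c = harmNat n k ζ c := by
  simp [harm]

theorem harm_natCast_neg (n k : ℕ) (ζ : ℂ) (c : ℝ) :
    harm n (-(k : ℤ)) ζ c = (-1) ^ k * conj (harmNat n k ζ c) := by
  rcases Nat.eq_zero_or_pos k with rfl | hk
  · have := harm_natCast n 0 ζ c
    simp only [Nat.cast_zero, neg_zero, pow_zero, one_mul] at this ⊢
    rw [this]
    simp [harmNat]
  · have h : ¬ (0 ≤ -(k : ℤ)) := by omega
    rw [harm, if_neg (by omega), if_neg h]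
    simp

theorem harm_of_neg {n : ℤ} (hn : n < 0) (m : ℤ) (ζ : ℂ) (c : ℝ) : harm n m ζ c = 0 := by
  simp [harm, hn]

theorem harm_neg (n m : ℤ) (ζ : ℂ) (c : ℝ) :
    harm n (-m) ζ c = (-1) ^ m.natAbs * conj (harm n m ζ c) := by
  rcases lt_or_ge n 0 with hn | hn
  · simp [harm_of_neg hn]
  obtain ⟨n, rfl⟩ := Int.eq_ofNat_of_zero_le hn
  have hsq : ∀ k : ℕ, ((-1 : ℂ) ^ k) * (-1) ^ k = 1 := fun k => by
    rw [← mul_pow]; simp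
  rcases le_total 0 m with hm | hm
  · obtain ⟨k, rfl⟩ := Int.eq_ofNat_of_zero_le hm
    rw [harm_natCast_neg, harm_natCast, Int.natAbs_natCast]
  · obtain ⟨k, hk⟩ := Int.eq_ofNat_of_zero_le (neg_nonneg.2 hm)
    obtain rfl : m = -(k : ℤ) := by omega
    rw [neg_neg, harm_natCast, harm_natCast_neg, Int.natAbs_neg, Int.natAbs_natCast, map_mul,
      Complex.conj_conj, map_pow, map_neg, map_one, ← mul_assoc, hsq, one_mul]

theorem harm_of_lt {n m : ℤ} (h : n < |m|) (ζ : ℂ) (c : ℝ) : harm n m ζ c = 0 := by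
  rcases lt_or_ge n 0 with hn | hn
  · exact harm_of_neg hn _ _ _
  obtain ⟨n, rfl⟩ := Int.eq_ofNat_of_zero_le hn
  have h' : ∀ k : ℕ, (n : ℤ) < k → harmNat n k ζ c = 0 := fun k hk => by
    rw [harmNat, legN_of_lt (by exact_mod_cast hk)]; simp
  rcases le_total 0 m with hm | hm
  · obtain ⟨k, rfl⟩ := Int.eq_ofNat_of_zero_le hm
    rw [harm_natCast, h' k (by simpa using h)]
  · obtain ⟨k, hk⟩ := Int.eq_ofNat_of_zero_le (neg_nonneg.2 hm)
    obtain rfl : m = -(k : ℤ) := by omega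
    rw [harm_natCast_neg, h' k (by simpa using h)]
    simp

theorem harm_bound (n : ℕ) (m : ℤ) {ζ : ℂ} {c : ℝ} (h : ‖ζ‖ ^ 2 + c ^ 2 = 1) :
    ‖harm n m ζ c‖ ≤ √(2 * n + 1) := by
  have h' : ∀ k : ℕ, ‖harmNat n k ζ c‖ ≤ √(2 * n + 1) := fun k => by
    simp only [harmNat, norm_mul, norm_pow, norm_neg, norm_one, one_pow, one_mul,
      Complex.norm_real, Real.norm_eq_abs]
    exact legN_bound n k h
  rcases le_total 0 m with hm | hm
  · obtain ⟨k, rfl⟩ := Int.eq_ofNat_of_zero_le hm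
    rw [harm_natCast]; exact h' k
  · obtain ⟨k, hk⟩ := Int.eq_ofNat_of_zero_le (neg_nonneg.2 hm)
    obtain rfl : m = -(k : ℤ) := by omega
    rw [harm_natCast_neg, norm_mul, norm_pow, norm_neg, norm_one, one_pow, one_mul,
      RCLike.norm_conj]
    exact h' k

theorem coefC_zero (n : ℤ) : coefC n 0 = coefD n 0 := by simp [coefC, coefD]
theorem coefA_zero (n : ℤ) : coefA n 0 = coefB n 0 := by simp [coefA, coefB]
theorem coefA_neg (n m : ℤ) : coefA n (-m) = coefB n m := by simp [coefA, coefB]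
theorem coefB_neg (n m : ℤ) : coefB n (-m) = coefA n m := by simp [coefA, coefB, sub_eq_add_neg]
theorem coefC_neg (n m : ℤ) : coefC n (-m) = coefD n m := by simp [coefC, coefD, sub_eq_add_neg]
theorem coefD_neg (n m : ℤ) : coefD n (-m) = coefC n m := by simp [coefC, coefD]
theorem coefE_neg (n m : ℤ) : coefE n (-m) = coefE n m := by
  simp only [coefE]; congr 2; push_cast; ring
theorem coefF_neg (n m : ℤ) : coefF n (-m) = coefF n m := by
  simp only [coefF]; congr 2; push_cast; ring

/-- The differential of `harmNat`, times `r`, along a curve with `r ζ' = ξ - ζ ρ`,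
`r c' = w - c ρ`. -/
def harmNatD (n k : ℕ) (ζ : ℂ) (c : ℝ) (ξ : ℂ) (w ρ : ℝ) : ℂ :=
  (-1) ^ k * (k * ζ ^ (k - 1) * (ξ - ζ * ρ) * (legN n k c : ℂ)
    + ζ ^ k * ((legN' n k c : ℂ) * (w - c * ρ)))

section angular

variable {ζ ξ : ℂ} {c w ρ : ℝ}

/-- Up to a power of r, the left side is the derivative of the solid harmonic r^{n+1} Y_{n+1}^k in
the direction with horizontal part ξ, vertical part w and radial component ρ. The part in w keeps
the order, the part in ξ̄ raises it and the part in ξ lowers it. -/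
theorem harmNat_lower (n k : ℕ) (h : ζ * conj ζ = 1 - c ^ 2)
    (hρ : (ρ : ℂ) = w * c + (ξ * conj ζ + conj ξ * ζ) / 2) :
    (n + 1) * ρ * harmNat (n + 1) k ζ c + harmNatD (n + 1) k ζ c ξ w ρ =
      (2 * n + 3) * (w * (coefF ((n + 1 : ℕ) : ℤ) k * harm n k ζ c)
        + conj ξ / 2 * (coefD ((n + 1 : ℕ) : ℤ) k * harm n (k + 1) ζ c)
        - ξ / 2 * (coefC ((n + 1 : ℕ) : ℤ) k * harm n (k - 1) ζ c)) := by
  have h1 := congrArg (fun x : ℝ => (x : ℂ)) (legN_z_lower n k c)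
  have h2 := congrArg (fun x : ℝ => (x : ℂ)) (legN_plus_lower n k c)
  have e1 : harm n ((k : ℤ) + 1) ζ c = harmNat n (k + 1) ζ c := by
    exact_mod_cast harm_natCast n (k + 1) ζ c
  rw [harm_natCast, e1, hρ]
  unfold harmNatD
  rw [hρ]
  push_cast at h1 h2
  cases k with
  | zero =>
    -- For k = 0 the lowered order is −1, which conjugation carries to order 1; the coefficients c
    -- and d agree at order zero.
    have e2 : harm n (((0 : ℕ) : ℤ) - 1) ζ c = (-1) ^ 1 * conj (harmNat n 1 ζ c) :=
      harm_natCast_neg n 1 ζ c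
    rw [e2]
    simp only [Nat.cast_zero, coefC_zero, harmNat, map_mul, map_neg, map_one,
      Complex.conj_ofReal, zero_add, pow_zero, pow_one] at h1 h2 ⊢
    push_cast
    linear_combination w * h1 + (ξ * conj ζ + conj ξ * ζ) / 2 * h2
  | succ k =>
    have h3 := congrArg (fun x : ℝ => (x : ℂ)) (legN_minus_lower n k c)
    have e2 : harm n (((k + 1 : ℕ) : ℤ) - 1) ζ c = harmNat n k ζ c := by
      rw [← harm_natCast]; congr 1; push_cast; ring
    rw [e2]
    simp only [harmNat, add_tsub_cancel_right]
    push_cast at h1 h2 h3 ⊢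
    linear_combination (-1) ^ (k + 1) * (w * ζ ^ (k + 1) * h1 + conj ξ / 2 * ζ ^ (k + 2) * h2
      + ξ / 2 * ζ ^ k * h3)
      + (-1) ^ (k + 1) * ξ / 2 * ζ ^ k * ((n - k) * (legN (n + 1) (k + 1) c : ℂ) -
        c * (legN' (n + 1) (k + 1) c : ℂ)) * h

/-- The counterpart of `harmNat_lower` for the decaying solid harmonic r^{-n-1} Y_n^k. -/
theorem harmNat_raise (n k : ℕ) (h : ζ * conj ζ = 1 - c ^ 2)
    (hρ : (ρ : ℂ) = w * c + (ξ * conj ζ + conj ξ * ζ) / 2) :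
    -(n + 1) * ρ * harmNat n k ζ c + harmNatD n k ζ c ξ w ρ =
      (2 * n + 1) * (-w * (coefE n k * harm (n + 1) k ζ c)
        + conj ξ / 2 * (coefB n k * harm (n + 1) (k + 1) ζ c)
        - ξ / 2 * (coefA n k * harm (n + 1) (k - 1) ζ c)) := by
  have h1 := congrArg (fun x : ℝ => (x : ℂ)) (legN_z_raise n k c)
  have h2 := congrArg (fun x : ℝ => (x : ℂ)) (legN_plus_raise n k c)
  have e0 : harm ((n : ℤ) + 1) k ζ c = harmNat (n + 1) k ζ c := by
    exact_mod_cast harm_natCast (n + 1) k ζ c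
  have e1 : harm ((n : ℤ) + 1) ((k : ℤ) + 1) ζ c = harmNat (n + 1) (k + 1) ζ c := by
    exact_mod_cast harm_natCast (n + 1) (k + 1) ζ c
  rw [e0, e1, hρ]
  unfold harmNatD
  rw [hρ]
  push_cast at h1 h2
  cases k with
  | zero =>
    have e2 : harm ((n : ℤ) + 1) (((0 : ℕ) : ℤ) - 1) ζ c =
        (-1) ^ 1 * conj (harmNat (n + 1) 1 ζ c) :=
      harm_natCast_neg (n + 1) 1 ζ c
    rw [e2]
    simp only [Nat.cast_zero, coefA_zero, harmNat, map_mul, map_neg, map_one,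
      Complex.conj_ofReal, zero_add, pow_zero, pow_one] at h1 h2 ⊢
    push_cast
    linear_combination w * h1 + (ξ * conj ζ + conj ξ * ζ) / 2 * h2
  | succ k =>
    have h3 := congrArg (fun x : ℝ => (x : ℂ)) (legN_minus_raise n k c)
    have e2 : harm ((n : ℤ) + 1) (((k + 1 : ℕ) : ℤ) - 1) ζ c = harmNat (n + 1) k ζ c := by
      rw [← harm_natCast]; congr 1; push_cast; ring
    rw [e2]
    simp only [harmNat, add_tsub_cancel_right]
    push_cast at h1 h2 h3 ⊢
    linear_combination (-1) ^ (k + 1) * (w * ζ ^ (k + 1) * h1 + conj ξ / 2 * ζ ^ (k + 2) * h2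
      + ξ / 2 * ζ ^ k * h3)
      + (-1) ^ (k + 1) * ξ / 2 * ζ ^ k * (-(n + k + 2) * (legN n (k + 1) c : ℂ) -
        c * (legN' n (k + 1) c : ℂ)) * h

end angular

/-! ### Spherical wave functions -/

/-- The relations common to `r ↦ h_n(k r)` and `r ↦ j_n(k r)`. -/
structure IsRadialFamily (k : ℝ) (R : ℕ → ℝ → ℂ) : Prop where
  deriv_zero : ∀ r : ℝ, 0 < r → HasDerivAt (R 0) (-k * R 1 r) r
  deriv_succ : ∀ (n : ℕ) (r : ℝ), 0 < r → HasDerivAt (R (n + 1))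
    (k * ((n + 1) * R n r - (n + 2) * R (n + 2) r) / (2 * n + 3)) r
  recurrence : ∀ (n : ℕ) (r : ℝ), 0 < r →
    (2 * n + 3) * R (n + 1) r = k * r * (R n r + R (n + 2) r)

/-- Since k is real, conjugation preserves the relations. This is what reduces waves of negative
order to those of nonnegative order. -/
theorem IsRadialFamily.conj {k : ℝ} {R : ℕ → ℝ → ℂ} (h : IsRadialFamily k R) :
    IsRadialFamily k (fun n r => conj (R n r)) where
  deriv_zero r hr := by
    have := (h.deriv_zero r hr).star
    simpa using this
  deriv_succ n r hr := by
    have := (h.deriv_succ n r hr).star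
    simpa using this
  recurrence n r hr := by
    have := congrArg (starRingEnd ℂ) (h.recurrence n r hr)
    simpa only [map_mul, map_add, map_ofNat, map_natCast, Complex.conj_ofReal] using this

/-- The projection `sin θ e^{iφ}` of the direction of `x`. -/
def dirZeta (x : E3) : ℂ := ((x 0 : ℂ) + Complex.I * (x 1 : ℂ)) / (‖x‖ : ℂ)

/-- The cosine of the polar angle of `x`. -/
def dirCos (x : E3) : ℝ := x 2 / ‖x‖

theorem norm_sq_E3 (x : E3) : ‖x‖ ^ 2 = x 0 ^ 2 + x 1 ^ 2 + x 2 ^ 2 := by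
  rw [EuclideanSpace.norm_sq_eq]
  simp [Fin.sum_univ_three]

theorem inner_E3 (x y : E3) : ⟪x, y⟫_ℝ = x 0 * y 0 + x 1 * y 1 + x 2 * y 2 := by
  rw [PiLp.inner_apply]
  simp [Fin.sum_univ_three, mul_comm]

theorem dirZeta_mul_conj {x : E3} (hx : x ≠ 0) :
    dirZeta x * conj (dirZeta x) = 1 - (dirCos x : ℂ) ^ 2 := by
  have h0 : (‖x‖ : ℂ) ≠ 0 := by exact_mod_cast norm_ne_zero_iff.2 hx
  have h1 : (‖x‖ : ℂ) ^ 2 = (x 0 : ℂ) ^ 2 + (x 1 : ℂ) ^ 2 + (x 2 : ℂ) ^ 2 := by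
    exact_mod_cast norm_sq_E3 x
  simp only [dirZeta, dirCos, map_div₀, map_add, map_mul, Complex.conj_ofReal, Complex.conj_I]
  push_cast
  field_simp
  linear_combination -h1 - (x 1 : ℂ) ^ 2 * Complex.I_sq

theorem norm_dirZeta_sq {x : E3} (hx : x ≠ 0) : ‖dirZeta x‖ ^ 2 + dirCos x ^ 2 = 1 := by
  have h := dirZeta_mul_conj hx
  rw [Complex.mul_conj, Complex.normSq_eq_norm_sq] at h
  have h' : ‖dirZeta x‖ ^ 2 = 1 - dirCos x ^ 2 := by exact_mod_cast h
  linarith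

/-- The spherical wave function `R_n(|x|) Y_n^m(x / |x|)`. -/
def wave (R : ℕ → ℝ → ℂ) (n m : ℤ) (x : E3) : ℂ :=
  R n.toNat ‖x‖ * harm n m (dirZeta x) (dirCos x)

theorem wave_of_neg (R : ℕ → ℝ → ℂ) {n : ℤ} (hn : n < 0) (m : ℤ) (x : E3) :
    wave R n m x = 0 := by rw [wave, harm_of_neg hn, mul_zero]

theorem wave_of_lt (R : ℕ → ℝ → ℂ) {n m : ℤ} (h : n < |m|) (x : E3) :
    wave R n m x = 0 := by rw [wave, harm_of_lt h, mul_zero]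

theorem wave_neg (R : ℕ → ℝ → ℂ) (n m : ℤ) (x : E3) :
    wave R n (-m) x = (-1) ^ m.natAbs * conj (wave (fun n r => conj (R n r)) n m x) := by
  rw [wave, wave, harm_neg]
  simp
  ring

/-- The value at `v` of the differential of `wave R n m` for a radial family `R`. -/
def waveGrad (k : ℝ) (R : ℕ → ℝ → ℂ) (n m : ℤ) (x v : E3) : ℂ :=
  k * ((v 2 : ℂ) * (coefF n m * wave R (n - 1) m x - coefE n m * wave R (n + 1) m x)
    + ((v 0 : ℂ) - Complex.I * (v 1 : ℂ)) / 2 *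
      (coefD n m * wave R (n - 1) (m + 1) x + coefB n m * wave R (n + 1) (m + 1) x)
    - ((v 0 : ℂ) + Complex.I * (v 1 : ℂ)) / 2 *
      (coefC n m * wave R (n - 1) (m - 1) x + coefA n m * wave R (n + 1) (m - 1) x))

section line

variable {x : E3} (hx : x ≠ 0) (v : E3)
include hx

theorem hasDerivAt_norm_line :
    HasDerivAt (fun t : ℝ => ‖x + t • v‖) (⟪x, v⟫_ℝ / ‖x‖) 0 := by
  have h1 : HasDerivAt (fun t : ℝ => x + t • v) v 0 := by
    simpa using ((hasDerivAt_id (0 : ℝ)).smul_const v).const_add x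
  have h2 := h1.norm_sq.sqrt (by simpa using hx)
  simp only [zero_smul, add_zero, Real.sqrt_sq (norm_nonneg _)] at h2
  refine h2.congr_deriv ?_
  rw [mul_div_mul_left _ _ two_ne_zero]

theorem hasDerivAt_dirZeta_line :
    HasDerivAt (fun t : ℝ => dirZeta (x + t • v))
      ((((v 0 : ℂ) + Complex.I * (v 1 : ℂ)) - dirZeta x * ((⟪x, v⟫_ℝ / ‖x‖ : ℝ) : ℂ)) / ‖x‖) 0 := by
  have h0 : (‖x‖ : ℂ) ≠ 0 := by exact_mod_cast norm_ne_zero_iff.2 hx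
  have hc : ∀ i : Fin 3, HasDerivAt (fun t : ℝ => (((x + t • v) i : ℝ) : ℂ)) (v i : ℂ) 0 := by
    intro i
    have : HasDerivAt (fun t : ℝ => (x + t • v) i) (v i) 0 := by
      simpa using ((hasDerivAt_id (0 : ℝ)).mul_const (v i)).const_add (x i)
    exact this.ofReal_comp
  have h1 := ((hc 0).add ((hc 1).const_mul Complex.I)).div (hasDerivAt_norm_line hx v).ofReal_comp
    (by simpa using h0)
  refine h1.congr_deriv ?_
  simp only [zero_smul, add_zero, dirZeta, Pi.add_apply]
  field_simp

theorem hasDerivAt_dirCos_line :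
    HasDerivAt (fun t : ℝ => dirCos (x + t • v))
      ((v 2 - dirCos x * (⟪x, v⟫_ℝ / ‖x‖)) / ‖x‖) 0 := by
  have h0 : ‖x‖ ≠ 0 := norm_ne_zero_iff.2 hx
  have hc : HasDerivAt (fun t : ℝ => (x + t • v) 2) (v 2) 0 := by
    simpa using ((hasDerivAt_id (0 : ℝ)).mul_const (v 2)).const_add (x 2)
  refine (hc.div (hasDerivAt_norm_line hx v) (by simpa using h0)).congr_deriv ?_
  simp only [zero_smul, add_zero, dirCos]
  field_simp

theorem inner_div_norm_eq : ((⟪x, v⟫_ℝ / ‖x‖ : ℝ) : ℂ) = (v 2 : ℂ) * (dirCos x : ℂ) +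
    (((v 0 : ℂ) + Complex.I * (v 1 : ℂ)) * conj (dirZeta x) +
      conj ((v 0 : ℂ) + Complex.I * (v 1 : ℂ)) * dirZeta x) / 2 := by
  have h0 : (‖x‖ : ℂ) ≠ 0 := by exact_mod_cast norm_ne_zero_iff.2 hx
  rw [inner_E3]
  simp only [dirZeta, dirCos, map_div₀, map_add, map_mul, Complex.conj_ofReal, Complex.conj_I]
  push_cast
  field_simp
  linear_combination 2 * (x 1 : ℂ) * v 1 * Complex.I_sq

theorem hasDerivAt_harmNat_line (n k : ℕ) :
    HasDerivAt (fun t : ℝ => harmNat n k (dirZeta (x + t • v)) (dirCos (x + t • v)))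
      (harmNatD n k (dirZeta x) (dirCos x) ((v 0 : ℂ) + Complex.I * (v 1 : ℂ)) (v 2)
        (⟪x, v⟫_ℝ / ‖x‖) / ‖x‖) 0 := by
  have h0 : (‖x‖ : ℂ) ≠ 0 := by exact_mod_cast norm_ne_zero_iff.2 hx
  have h1 := ((hasDerivAt_dirZeta_line hx v).fun_pow k).const_mul ((-1 : ℂ) ^ k)
  have h2 := ((hasDerivAt_legN n k (dirCos (x + (0 : ℝ) • v))).comp (0 : ℝ)
    (hasDerivAt_dirCos_line hx v)).ofReal_comp
  refine (h1.mul h2).congr_deriv ?_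
  simp only [zero_smul, add_zero, harmNatD, Function.comp_apply]
  push_cast
  field_simp

end line

/-- The product rule gives R'ρY + (R/r)D, where D is the angular differential. For degree n + 1 the
radial relations express R' and R/r through R_n and R_{n+2}; the factor of R_n is then the left side
of `harmNat_lower` and that of R_{n+2} the left side of `harmNat_raise`. -/
theorem hasDerivAt_wave_line_of_nonneg {κ : ℝ} {R : ℕ → ℝ → ℂ} (hR : IsRadialFamily κ R)
    {x : E3} (hx : x ≠ 0) (v : E3) (n k : ℕ) :
    HasDerivAt (fun t : ℝ => wave R n k (x + t • v)) (waveGrad κ R n k x v) 0 := by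
  have hr : 0 < ‖x‖ := norm_pos_iff.2 hx
  have h0 : (‖x‖ : ℂ) ≠ 0 := by exact_mod_cast hr.ne'
  have hζ := dirZeta_mul_conj hx
  have hρ := inner_div_norm_eq hx v
  have hA := hasDerivAt_harmNat_line hx v n k
  have hw : (fun t : ℝ => wave R n k (x + t • v)) = fun t : ℝ => R n ‖x + t • v‖ *
      harmNat n k (dirZeta (x + t • v)) (dirCos (x + t • v)) := by
    funext t; rw [wave, harm_natCast]; rfl
  have hBid := harmNat_raise n k hζ hρ
  have hcj : conj ((v 0 : ℂ) + Complex.I * (v 1 : ℂ)) = (v 0 : ℂ) - Complex.I * (v 1 : ℂ) := by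
    simp [sub_eq_add_neg]
  rw [hcj] at hBid
  rw [hw]
  have hx0 : ‖x + (0 : ℝ) • v‖ = ‖x‖ := by simp
  cases n with
  | zero =>
    have hR0 := hR.deriv_zero ‖x + (0 : ℝ) • v‖ (by rw [hx0]; exact hr)
    have hd := hR0.scomp (0 : ℝ) (hasDerivAt_norm_line hx v)
    refine (hd.mul hA).congr_deriv ?_
    -- In degree 0 the harmonic is constant for k = 0 and zero otherwise, so there is no angular
    -- contribution.
    have hz : harmNatD 0 k (dirZeta x) (dirCos x) ((v 0 : ℂ) + Complex.I * (v 1 : ℂ)) (v 2)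
        (⟪x, v⟫_ℝ / ‖x‖) = 0 := by
      rw [harmNatD, legN'_of_le (Nat.zero_le k)]
      cases k with
      | zero => simp
      | succ k => rw [legN_of_lt (Nat.succ_pos k)]; simp
    rw [hz] at hBid ⊢
    simp only [Function.comp_apply, Complex.real_smul, zero_div, mul_zero, add_zero, waveGrad,
      wave_of_neg R (show ((0 : ℕ) : ℤ) - 1 < 0 by simp), zero_smul]
    simp only [wave, show (((0 : ℕ) : ℤ) + 1).toNat = 1 from rfl]
    simp only [Nat.cast_zero, zero_add, mul_zero, add_zero] at hBid ⊢
    linear_combination (κ * R 1 ‖x‖) * hBid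
  | succ n =>
    have hR0 := hR.deriv_succ n ‖x + (0 : ℝ) • v‖ (by rw [hx0]; exact hr)
    have hd := hR0.scomp (0 : ℝ) (hasDerivAt_norm_line hx v)
    refine (hd.mul hA).congr_deriv ?_
    have hAid := harmNat_lower n k hζ hρ
    rw [hcj] at hAid
    have hrec := hR.recurrence n ‖x‖ hr
    have hn : (2 * (n : ℂ) + 3) ≠ 0 := by
      have : (2 * (n : ℝ) + 3) ≠ 0 := by positivity
      exact_mod_cast this
    have hR1 : R (n + 1) ‖x‖ / ‖x‖ = κ * (R n ‖x‖ + R (n + 2) ‖x‖) / (2 * n + 3) := by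
      field_simp
      linear_combination hrec
    simp only [Function.comp_apply, Complex.real_smul, zero_smul, add_zero]
    generalize harmNatD (n + 1) k (dirZeta x) (dirCos x) _ (v 2) _ = D at hAid hBid ⊢
    generalize (⟪x, v⟫_ℝ / ‖x‖ : ℝ) = ρ at hAid hBid ⊢
    rw [show R (n + 1) ‖x‖ * (D / ‖x‖) = R (n + 1) ‖x‖ / ‖x‖ * D by ring, hR1]
    simp only [waveGrad, wave, show (((n + 1 : ℕ) : ℤ) + 1).toNat = n + 2 by omega,
      show (((n + 1 : ℕ) : ℤ) - 1).toNat = n by omega]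
    have e1 : ((n + 1 : ℕ) : ℤ) - 1 = n := by push_cast; ring
    rw [e1]
    push_cast at hAid hBid ⊢
    simp only [div_eq_mul_inv _ (2 * (n : ℂ) + 3)]
    have hinv : (2 * (n : ℂ) + 3) * (2 * (n : ℂ) + 3)⁻¹ = 1 := mul_inv_cancel₀ hn
    generalize (2 * (n : ℂ) + 3)⁻¹ = q at hinv
    linear_combination κ * R n ‖x‖ * q * hAid + κ * R (n + 2) ‖x‖ * q * hBid
      + κ * (R n ‖x‖ * (v 2 * (coefF (n + 1) k * harm n k (dirZeta x) (dirCos x))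
        + (v 0 - Complex.I * v 1) / 2 * (coefD (n + 1) k * harm n (k + 1) (dirZeta x) (dirCos x))
        - (v 0 + Complex.I * v 1) / 2 * (coefC (n + 1) k * harm n (k - 1) (dirZeta x) (dirCos x)))
      + R (n + 2) ‖x‖ * (-v 2 * (coefE (n + 1) k * harm (n + 1 + 1) k (dirZeta x) (dirCos x))
        + (v 0 - Complex.I * v 1) / 2 *
          (coefB (n + 1) k * harm (n + 1 + 1) (k + 1) (dirZeta x) (dirCos x))
        - (v 0 + Complex.I * v 1) / 2 *
          (coefA (n + 1) k * harm (n + 1 + 1) (k - 1) (dirZeta x) (dirCos x)))) * hinv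

/-- A coordinate as a complex-valued real-linear functional. -/
def coordL (i : Fin 3) : E3 →L[ℝ] ℂ := Complex.ofRealCLM.comp (EuclideanSpace.proj i)

@[simp] theorem coordL_apply (i : Fin 3) (v : E3) : coordL i v = (v i : ℂ) := rfl

/-- `waveGrad` as a linear functional. -/
def waveGradL (k : ℝ) (R : ℕ → ℝ → ℂ) (n m : ℤ) (x : E3) : E3 →L[ℝ] ℂ :=
  (k : ℂ) • ((coefF n m * wave R (n - 1) m x - coefE n m * wave R (n + 1) m x) • coordL 2
    + ((coefD n m * wave R (n - 1) (m + 1) x + coefB n m * wave R (n + 1) (m + 1) x) / 2) •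
      (coordL 0 - Complex.I • coordL 1)
    - ((coefC n m * wave R (n - 1) (m - 1) x + coefA n m * wave R (n + 1) (m - 1) x) / 2) •
      (coordL 0 + Complex.I • coordL 1))

theorem waveGradL_apply (k : ℝ) (R : ℕ → ℝ → ℂ) (n m : ℤ) (x v : E3) :
    waveGradL k R n m x v = waveGrad k R n m x v := by
  simp only [waveGradL, waveGrad, smul_apply, add_apply,
    sub_apply, coordL_apply, smul_eq_mul]
  ring

theorem IsRadialFamily.differentiableAt {k : ℝ} {R : ℕ → ℝ → ℂ} (hR : IsRadialFamily k R) (n : ℕ)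
    {r : ℝ} (hr : 0 < r) : DifferentiableAt ℝ (R n) r := by
  cases n with
  | zero => exact (hR.deriv_zero r hr).differentiableAt
  | succ n => exact (hR.deriv_succ n r hr).differentiableAt

theorem differentiableAt_dirZeta {x : E3} (hx : x ≠ 0) : DifferentiableAt ℝ dirZeta x := by
  have h0 : (‖x‖ : ℂ) ≠ 0 := by exact_mod_cast norm_ne_zero_iff.2 hx
  have hn : DifferentiableAt ℝ (fun x : E3 => (‖x‖ : ℂ)) x :=
    Complex.ofRealCLM.differentiableAt.comp x (differentiableAt_id.norm ℝ hx)
  have h1 : DifferentiableAt ℝ (fun x : E3 => ((x 0 : ℂ) + Complex.I * (x 1 : ℂ))) x :=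
    (coordL 0 + Complex.I • coordL 1).differentiableAt
  unfold dirZeta
  simp only [div_eq_mul_inv]
  exact h1.mul (hn.inv h0)

theorem differentiableAt_dirCos {x : E3} (hx : x ≠ 0) : DifferentiableAt ℝ dirCos x := by
  have h0 : ‖x‖ ≠ 0 := norm_ne_zero_iff.2 hx
  have hn : DifferentiableAt ℝ (fun x : E3 => ‖x‖) x := differentiableAt_id.norm ℝ hx
  have h1 : DifferentiableAt ℝ (fun x : E3 => x 2) x :=
    (EuclideanSpace.proj (𝕜 := ℝ) (2 : Fin 3)).differentiableAt
  unfold dirCos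
  simp only [div_eq_mul_inv]
  exact h1.mul (hn.inv h0)

theorem differentiableAt_wave_of_nonneg {k : ℝ} {R : ℕ → ℝ → ℂ} (hR : IsRadialFamily k R)
    (n l : ℕ) {x : E3} (hx : x ≠ 0) : DifferentiableAt ℝ (wave R n l) x := by
  have hw : wave R n l = fun x => R n ‖x‖ *
      ((-1) ^ l * dirZeta x ^ l * Complex.ofRealCLM (legN n l (dirCos x))) := by
    funext y; rw [wave, harm_natCast]; rfl
  rw [hw]
  have h1 : DifferentiableAt ℝ (fun x : E3 => R n ‖x‖) x :=
    (hR.differentiableAt n (norm_pos_iff.2 hx)).comp x (differentiableAt_id.norm ℝ hx)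
  have h2 : DifferentiableAt ℝ (fun x : E3 => Complex.ofRealCLM (legN n l (dirCos x))) x :=
    Complex.ofRealCLM.differentiableAt.comp x
      ((hasDerivAt_legN n l (dirCos x)).differentiableAt.comp x (differentiableAt_dirCos hx))
  exact h1.mul ((((differentiableAt_dirZeta hx).pow l).const_mul _).mul h2)

/-- Differentiability is known beforehand, so the derivatives along lines determine the
differential. -/
theorem hasFDerivAt_wave_of_nonneg {k : ℝ} {R : ℕ → ℝ → ℂ} (hR : IsRadialFamily k R)
    (n l : ℕ) {x : E3} (hx : x ≠ 0) : HasFDerivAt (wave R n l) (waveGradL k R n l x) x := by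
  have h := (differentiableAt_wave_of_nonneg hR n l hx).hasFDerivAt
  have he : fderiv ℝ (wave R n l) x = waveGradL k R n l x := by
    ext v
    rw [waveGradL_apply]
    have h1 : HasDerivAt (fun t : ℝ => x + t • v) v 0 := by
      simpa using ((hasDerivAt_id (0 : ℝ)).smul_const v).const_add x
    have h' : HasFDerivAt (wave R n l) (fderiv ℝ (wave R n l) x) (x + (0 : ℝ) • v) := by
      simpa using h
    have h3 : HasDerivAt (fun t : ℝ => wave R n l (x + t • v)) (fderiv ℝ (wave R n l) x v) 0 :=
      HasFDerivAt.comp_hasDerivAt (f := fun t : ℝ => x + t • v) (0 : ℝ) h' h1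
    exact h3.unique (hasDerivAt_wave_line_of_nonneg hR hx v n l)
  rwa [he] at h

theorem coefB_neg_one_zero : coefB (-1) (-1) = 0 := by norm_num [coefB]
theorem coefA_neg_one_zero : coefA (-1) 1 = 0 := by norm_num [coefA]
theorem coefE_neg_one_zero : coefE (-1) 0 = 0 := by simp [coefE]

/-- The delicate degree is −1, whose upper neighbour has degree 0 and does not vanish at order 0;
there the coefficients a, b, e with which it enters are zero. -/
theorem waveGradL_of_neg (k : ℝ) (R : ℕ → ℝ → ℂ) {n : ℤ} (hn : n < 0) (m : ℤ) (x : E3) :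
    waveGradL k R n m x = 0 := by
  have h1 : ∀ m, wave R (n - 1) m x = 0 := fun m => wave_of_neg R (by omega) m x
  rcases lt_or_eq_of_le (show n + 1 ≤ 0 by omega) with h | h
  · have h2 : ∀ m, wave R (n + 1) m x = 0 := fun m => wave_of_neg R h m x
    ext v
    simp [waveGradL_apply, waveGrad, h1, h2]
  · obtain rfl : n = -1 := by omega
    have hE : (coefE (-1) m : ℂ) * wave R (-1 + 1) m x = 0 := by
      rcases eq_or_ne m 0 with rfl | hm
      · rw [coefE_neg_one_zero]; simp
      · rw [wave_of_lt R (by simpa using hm), mul_zero]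
    have hB : (coefB (-1) m : ℂ) * wave R (-1 + 1) (m + 1) x = 0 := by
      rcases eq_or_ne (m + 1) 0 with hm | hm
      · obtain rfl : m = -1 := by omega
        rw [coefB_neg_one_zero]; simp
      · rw [wave_of_lt R (by simpa using hm), mul_zero]
    have hA : (coefA (-1) m : ℂ) * wave R (-1 + 1) (m - 1) x = 0 := by
      rcases eq_or_ne (m - 1) 0 with hm | hm
      · obtain rfl : m = 1 := by omega
        rw [coefA_neg_one_zero]; simp
      · rw [wave_of_lt R (by simpa using hm), mul_zero]
    ext v
    rw [waveGradL_apply, waveGrad, hE, hA, hB, h1, h1, h1]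
    simp

/-- The ladder relations for spherical wave functions. -/
theorem hasFDerivAt_wave {k : ℝ} {R : ℕ → ℝ → ℂ} (hR : IsRadialFamily k R)
    (n m : ℤ) {x : E3} (hx : x ≠ 0) : HasFDerivAt (wave R n m) (waveGradL k R n m x) x := by
  rcases lt_or_ge n 0 with hn | hn
  · have : wave R n m = fun _ => 0 := funext fun y => wave_of_neg R hn m y
    rw [this, waveGradL_of_neg k R hn]
    exact hasFDerivAt_const _ _
  obtain ⟨n, rfl⟩ := Int.eq_ofNat_of_zero_le hn
  rcases le_total 0 m with hm | hm
  · obtain ⟨l, rfl⟩ := Int.eq_ofNat_of_zero_le hm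
    exact hasFDerivAt_wave_of_nonneg hR n l hx
  · obtain ⟨l, hl⟩ := Int.eq_ofNat_of_zero_le (neg_nonneg.2 hm)
    obtain rfl : m = -(l : ℤ) := by omega
    -- Up to sign, a wave of negative order is the conjugate of a wave of positive order for the
    -- conjugate radial family; m ↦ −m exchanges a with b and c with d.
    have hw : wave R n (-(l : ℤ)) = fun x =>
        (-1) ^ l * Complex.conjCLE (wave (fun n r => conj (R n r)) n l x) := by
      funext y
      rw [wave_neg]
      simp
    have h := ((Complex.conjCLE : ℂ →L[ℝ] ℂ).hasFDerivAt.comp x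
      (hasFDerivAt_wave_of_nonneg hR.conj n l hx)).const_mul ((-1 : ℂ) ^ l)
    rw [hw]
    refine h.congr_fderiv ?_
    ext v
    have e : ∀ j p : ℤ, conj (wave (fun n r => conj (R n r)) j p x) =
        (-1) ^ p.natAbs * wave R j (-p) x := by
      intro j p
      rw [wave_neg, ← mul_assoc, ← mul_pow]
      simp
    have s1 : ((-1 : ℂ)) ^ ((l : ℤ) + 1).natAbs = (-1) ^ l * (-1) := by
      rw [show ((l : ℤ) + 1).natAbs = l + 1 by omega, pow_succ]
    have s2 : ((-1 : ℂ)) ^ ((l : ℤ) - 1).natAbs = (-1) ^ l * (-1) := by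
      cases l with
      | zero => simp
      | succ l =>
        rw [show (((l + 1 : ℕ) : ℤ) - 1).natAbs = l by omega, pow_succ]
        ring
    have s3 : ((-1 : ℂ) ^ l) * (-1) ^ l = 1 := by rw [← mul_pow]; simp
    have h2 : conj (2 : ℂ) = 2 := map_ofNat _ 2
    change (-1) ^ l * conj (waveGradL k (fun n r => conj (R n r)) n l x v) =
      waveGradL k R n (-(l : ℤ)) x v
    simp only [waveGradL_apply, waveGrad, map_mul, map_add, map_sub, map_div₀, Complex.conj_ofReal,
      Complex.conj_I, e, s1, s2, h2, Int.natAbs_natCast, coefA_neg, coefB_neg, coefC_neg,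
      coefD_neg, coefE_neg, coefF_neg]
    rw [show -((l : ℤ) + 1) = -l - 1 by ring, show -((l : ℤ) - 1) = -l + 1 by ring]
    linear_combination (k * ((v 2 : ℂ) * (coefF n l * wave R (n - 1) (-l) x
        - coefE n l * wave R (n + 1) (-l) x)
      - ((v 0 : ℂ) + Complex.I * (v 1 : ℂ)) / 2 *
        (coefD n l * wave R (n - 1) (-l - 1) x + coefB n l * wave R (n + 1) (-l - 1) x)
      + ((v 0 : ℂ) - Complex.I * (v 1 : ℂ)) / 2 *
        (coefC n l * wave R (n - 1) (-l + 1) x + coefA n l * wave R (n + 1) (-l + 1) x))) * s3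

/-- The radial functions `h_n(k r)`. -/
def hankelRad (k : ℝ) (n : ℕ) (r : ℝ) : ℂ := sphHankel n (k * r)

/-- The radial functions `j_n(k r)`. -/
def besselRad (k : ℝ) (n : ℕ) (r : ℝ) : ℂ := (sphBesselJ n (k * r) : ℂ)

theorem isRadialFamily_hankel {k : ℝ} (hk : 0 < k) : IsRadialFamily k (hankelRad k) where
  deriv_zero r hr := by
    have h := (hasDerivAt_sphHankel 0 (mul_pos hk hr).ne').scomp r
      ((hasDerivAt_id r).const_mul k)
    have e : hankelRad k 0 = fun r => sphHankel 0 (k * r) := rfl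
    rw [e]
    simpa [Function.comp_def, hankelRad] using h
  deriv_succ n r hr := by
    have hz : k * r ≠ 0 := (mul_pos hk hr).ne'
    have h := (hasDerivAt_sphHankel_succ n hz).scomp r ((hasDerivAt_id r).const_mul k)
    refine h.congr_deriv ?_
    have h1 := sphHankel_recurrence n hz
    have hz' : ((k * r : ℝ) : ℂ) ≠ 0 := by exact_mod_cast hz
    have hn : (2 * (n : ℂ) + 3) ≠ 0 := by
      have : (2 * (n : ℝ) + 3) ≠ 0 := by positivity
      exact_mod_cast this
    simp only [hankelRad, Complex.real_smul, mul_one]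
    rw [eq_div_iff hn]
    generalize ((k * r : ℝ) : ℂ) = w at h1 hz'
    field_simp
    linear_combination -k * (n + 2) * h1
  recurrence n r hr := by
    have := sphHankel_recurrence n (mul_pos hk hr).ne'
    simpa [hankelRad] using this

theorem isRadialFamily_bessel (k : ℝ) : IsRadialFamily k (besselRad k) where
  deriv_zero r _ := by
    have h := ((hasDerivAt_sphBesselJ_zero (k * r)).ofReal_comp).scomp r
      ((hasDerivAt_id r).const_mul k)
    have e : besselRad k 0 = fun r => (sphBesselJ 0 (k * r) : ℂ) := rfl
    rw [e]
    simpa [Function.comp_def, besselRad] using h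
  deriv_succ n r _ := by
    have h := ((hasDerivAt_sphBesselJ_succ n (k * r)).ofReal_comp).scomp r
      ((hasDerivAt_id r).const_mul k)
    refine h.congr_deriv ?_
    simp only [besselRad, Complex.real_smul, mul_one]
    push_cast
    ring
  recurrence n r _ := by
    have := congrArg (fun x : ℝ => (x : ℂ)) (sphBesselJ_recurrence n (k * r))
    push_cast at this
    simpa [besselRad] using this

/-! ### Bounds on the coefficients -/

theorem sqrt_div_le_one {a b : ℝ} (hb : 0 < b) (h : a ≤ b) : √(a / b) ≤ 1 :=
  Real.sqrt_le_one.2 ((div_le_one hb).2 h)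

theorem coef_le_one {n m : ℤ} (h : |m| ≤ n) :
    coefA n m ≤ 1 ∧ coefB n m ≤ 1 ∧ coefC n m ≤ 1 ∧ coefD n m ≤ 1 ∧ coefE n m ≤ 1 ∧
      coefF n m ≤ 1 := by
  obtain ⟨h1, h2⟩ := abs_le.1 h
  have h1' : -(n : ℝ) ≤ m := by exact_mod_cast h1
  have h2' : (m : ℝ) ≤ n := by exact_mod_cast h2
  have hn : (0 : ℝ) ≤ n := by linarith
  have hden : (0 : ℝ) < (2 * n + 3) * (2 * n + 1) := by positivity
  have key : n = 0 ∨ 1 ≤ n := by omega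
  refine ⟨sqrt_div_le_one hden (by nlinarith), sqrt_div_le_one hden (by nlinarith), ?_, ?_,
    sqrt_div_le_one hden (by nlinarith), ?_⟩
  all_goals
    -- At n = 0 the denominators of c, d, f are negative, but then m = 0 and the numerators vanish.
    rcases key with rfl | hn1
    · obtain rfl : m = 0 := by omega
      simp [coefC, coefD, coefF]
    · have hn1' : (1 : ℝ) ≤ n := by exact_mod_cast hn1
      exact sqrt_div_le_one (by nlinarith) (by nlinarith)

theorem coefA_nonneg (n m : ℤ) : 0 ≤ coefA n m := Real.sqrt_nonneg _
theorem coefB_nonneg (n m : ℤ) : 0 ≤ coefB n m := Real.sqrt_nonneg _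
theorem coefC_nonneg (n m : ℤ) : 0 ≤ coefC n m := Real.sqrt_nonneg _
theorem coefD_nonneg (n m : ℤ) : 0 ≤ coefD n m := Real.sqrt_nonneg _
theorem coefE_nonneg (n m : ℤ) : 0 ≤ coefE n m := Real.sqrt_nonneg _
theorem coefF_nonneg (n m : ℤ) : 0 ≤ coefF n m := Real.sqrt_nonneg _

/-- The coefficient of a step up equals that of the reverse step down: the ladder operators are
adjoint to each other up to sign. This is the reason for the telescoping below. -/
theorem coefB_eq_coefC (n m : ℤ) : coefB n m = coefC (n + 1) (m + 1) := by
  unfold coefB coefC; congr 1; push_cast; ring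

theorem coefA_eq_coefD (n m : ℤ) : coefA n m = coefD (n + 1) (m - 1) := by
  unfold coefA coefD; congr 1; push_cast; ring

theorem coefE_eq_coefF (n m : ℤ) : coefE n m = coefF (n + 1) m := by
  unfold coefE coefF; congr 1; push_cast; ring

/-! ### Ladder combinations and their telescoping sums -/

/-- The combination of neighbouring terms occurring in the ladder relations. -/
def ladderComb (w α β : ℂ) (X : ℤ → ℤ → ℂ) (n m : ℤ) : ℂ :=
  w * (coefF n m * X (n - 1) m - coefE n m * X (n + 1) m)
    + α * (coefD n m * X (n - 1) (m + 1) + coefB n m * X (n + 1) (m + 1))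
    - β * (coefC n m * X (n - 1) (m - 1) + coefA n m * X (n + 1) (m - 1))

/-- The boundary term of index `(n, m)` in the telescoping sum. -/
def ladderBdry (w α β : ℂ) (X Z : ℤ → ℤ → ℂ) (n m : ℤ) : ℂ :=
  w * (coefF n m * (X (n - 1) m * Z n m + X n m * Z (n - 1) m))
    + α * (coefD n m * (X (n - 1) (m + 1) * Z n m) - coefC n m * (X n m * Z (n - 1) (m - 1)))
    + β * (coefD n m * (X n m * Z (n - 1) (m + 1)) - coefC n m * (X (n - 1) (m - 1) * Z n m))

/-- The support lies in |m| < M, so both sides are sums over all integers. -/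
theorem sum_Icc_shift {M : ℕ} {g : ℤ → ℂ} (hg : ∀ m : ℤ, (M : ℤ) ≤ |m| → g m = 0) :
    ∑ m ∈ Finset.Icc (-(M : ℤ)) M, g (m + 1) = ∑ m ∈ Finset.Icc (-(M : ℤ)) M, g m := by
  have h1 : ∑' m : ℤ, g (m + 1) = ∑ m ∈ Finset.Icc (-(M : ℤ)) M, g (m + 1) := by
    refine tsum_eq_sum fun m hm => hg _ ?_
    rw [Finset.mem_Icc, not_and_or] at hm
    rcases hm with h | h
    · rw [abs_of_nonpos (by omega)]; omega
    · rw [abs_of_nonneg (by omega)]; omega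
  have h2 : ∑' m : ℤ, g m = ∑ m ∈ Finset.Icc (-(M : ℤ)) M, g m := by
    refine tsum_eq_sum fun m hm => hg _ ?_
    rw [Finset.mem_Icc, not_and_or] at hm
    rcases hm with h | h
    · rw [abs_of_nonpos (by omega)]; omega
    · rw [abs_of_nonneg (by omega)]; omega
  rw [← h1, ← h2]
  exact (Equiv.addRight (1 : ℤ)).tsum_eq g

section telescope

variable {X Z : ℤ → ℤ → ℂ} (hX : ∀ n m : ℤ, n < |m| → X n m = 0)
  (hZ : ∀ n m : ℤ, n < |m| → Z n m = 0)
include hX hZ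

/-- The weights α and β are exchanged for Z because Z will be a family of conjugate waves. After
shifts of m and the identities `coefB_eq_coefC`, `coefA_eq_coefD`, `coefE_eq_coefF`, all that
remains is the coupling between the degrees n − 1, n and between n, n + 1. The bound on M leaves
room for the shifts. -/
theorem sum_ladderComb_step (w α β : ℂ) (n M : ℕ) (hM : n + 2 ≤ M) :
    ∑ m ∈ Finset.Icc (-(M : ℤ)) M, (ladderComb w α β X n m * Z n m
        + X n m * ladderComb w β α Z n m) =
      (∑ m ∈ Finset.Icc (-(M : ℤ)) M, ladderBdry w α β X Z n m)
        - ∑ m ∈ Finset.Icc (-(M : ℤ)) M, ladderBdry w α β X Z (n + 1) m := by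
  have s1 := sum_Icc_shift (M := M)
    (g := fun m => (α * coefC (n + 1) m) * (X (n + 1) m * Z n (m - 1))) fun m hm => by
      rw [hX _ _ (by omega)]; ring
  have s2 := sum_Icc_shift (M := M)
    (g := fun m => (β * coefC (n + 1) m) * (Z (n + 1) m * X n (m - 1))) fun m hm => by
      rw [hZ _ _ (by omega)]; ring
  have s3 := sum_Icc_shift (M := M)
    (g := fun m => (α * coefA n m) * (X n m * Z (n + 1) (m - 1))) fun m hm => by
      rw [hX _ _ (by omega)]; ring
  have s4 := sum_Icc_shift (M := M)
    (g := fun m => (β * coefA n m) * (Z n m * X (n + 1) (m - 1))) fun m hm => by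
      rw [hZ _ _ (by omega)]; ring
  simp only [add_sub_cancel_right, ← coefB_eq_coefC, coefA_eq_coefD] at s1 s2 s3 s4
  rw [← sub_eq_zero] at s1 s2 s3 s4 ⊢
  simp only [← Finset.sum_sub_distrib] at s1 s2 s3 s4 ⊢
  have key : ∀ m : ℤ, ladderComb w α β X n m * Z n m + X n m * ladderComb w β α Z n m
      - (ladderBdry w α β X Z n m - ladderBdry w α β X Z (n + 1) m) =
      (α * coefB n m * (X (n + 1) (m + 1) * Z n m) -
        α * coefC (n + 1) m * (X (n + 1) m * Z n (m - 1))) +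
      (β * coefB n m * (Z (n + 1) (m + 1) * X n m) -
        β * coefC (n + 1) m * (Z (n + 1) m * X n (m - 1))) +
      (α * coefD (n + 1) m * (X n (m + 1) * Z (n + 1) m) -
        α * coefD (n + 1) (m - 1) * (X n m * Z (n + 1) (m - 1))) +
      (β * coefD (n + 1) m * (Z n (m + 1) * X (n + 1) m) -
        β * coefD (n + 1) (m - 1) * (Z n m * X (n + 1) (m - 1))) := by
    intro m
    simp only [ladderComb, ladderBdry, coefE_eq_coefF, add_sub_cancel_right, coefA_eq_coefD n]
    ring
  rw [Finset.sum_congr rfl fun m _ => key m]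
  simp only [Finset.sum_add_distrib]
  rw [s1, s2, s3, s4]
  ring

theorem sum_ladderComb (w α β : ℂ) (N : ℕ) :
    ∑ n ∈ Finset.range (N + 1), ∑ m ∈ Finset.Icc (-(n : ℤ)) n,
        (ladderComb w α β X n m * Z n m + X n m * ladderComb w β α Z n m) =
      - ∑ m ∈ Finset.Icc (-((N + 2 : ℕ) : ℤ)) (N + 2 : ℕ), ladderBdry w α β X Z (N + 1) m := by
  have h1 : ∀ n ∈ Finset.range (N + 1), ∑ m ∈ Finset.Icc (-(n : ℤ)) n,
        (ladderComb w α β X n m * Z n m + X n m * ladderComb w β α Z n m) =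
      (∑ m ∈ Finset.Icc (-((N + 2 : ℕ) : ℤ)) (N + 2 : ℕ), ladderBdry w α β X Z (n : ℕ) m)
        - ∑ m ∈ Finset.Icc (-((N + 2 : ℕ) : ℤ)) (N + 2 : ℕ),
          ladderBdry w α β X Z ((n + 1 : ℕ) : ℤ) m := by
    intro n hn
    have hn' : n ≤ N := by simpa [Nat.lt_succ_iff] using hn
    have := sum_ladderComb_step hX hZ w α β n (N + 2) (by omega)
    push_cast at this ⊢
    rw [← this]
    refine Finset.sum_subset (Finset.Icc_subset_Icc (by omega) (by omega)) fun m _ hm => ?_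
    have hlt : (n : ℤ) < |m| := by
      rw [Finset.mem_Icc, ← abs_le] at hm; omega
    rw [hX _ _ hlt, hZ _ _ hlt]
    ring
  rw [Finset.sum_congr rfl h1, Finset.sum_range_sub' (fun n : ℕ =>
    ∑ m ∈ Finset.Icc (-((N + 2 : ℕ) : ℤ)) (N + 2 : ℕ), ladderBdry w α β X Z (n : ℕ) m)]
  -- The lower end contributes nothing: there are no functions of degree −1.
  have h0 : ∀ m : ℤ, ladderBdry w α β X Z ((0 : ℕ) : ℤ) m = 0 := by
    intro m
    have e1 : ∀ p, X (((0 : ℕ) : ℤ) - 1) p = 0 := fun p => hX _ _ (by have := abs_nonneg p; push_cast; omega)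
    have e2 : ∀ p, Z (((0 : ℕ) : ℤ) - 1) p = 0 := fun p => hZ _ _ (by have := abs_nonneg p; push_cast; omega)
    simp only [ladderBdry, e1, e2]
    ring
  rw [Finset.sum_congr rfl fun m _ => h0 m]
  push_cast
  simp

end telescope

/-! ### Ladder families -/

/-- The differential prescribed by the ladder relations. -/
def ladderL (k : ℝ) (X : ℤ → ℤ → E3 → ℂ) (n m : ℤ) (x : E3) : E3 →L[ℝ] ℂ :=
  (k : ℂ) • ((coefF n m * X (n - 1) m x - coefE n m * X (n + 1) m x) • coordL 2
    + ((coefD n m * X (n - 1) (m + 1) x + coefB n m * X (n + 1) (m + 1) x) / 2) •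
      (coordL 0 - Complex.I • coordL 1)
    - ((coefC n m * X (n - 1) (m - 1) x + coefA n m * X (n + 1) (m - 1) x) / 2) •
      (coordL 0 + Complex.I • coordL 1))

theorem ladderL_apply (k : ℝ) (X : ℤ → ℤ → E3 → ℂ) (n m : ℤ) (x v : E3) :
    ladderL k X n m x v = k * ladderComb (v 2) (((v 0 : ℂ) - Complex.I * v 1) / 2)
      (((v 0 : ℂ) + Complex.I * v 1) / 2) (fun n m => X n m x) n m := by
  simp only [ladderL, ladderComb, smul_apply, add_apply,
    sub_apply, coordL_apply, smul_eq_mul]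
  ring

/-- Families of functions that satisfy the ladder relations away from the origin. -/
structure IsLadder (k : ℝ) (X : ℤ → ℤ → E3 → ℂ) : Prop where
  eq_zero : ∀ (n m : ℤ) (x : E3), n < |m| → X n m x = 0
  hasFDerivAt : ∀ (n m : ℤ) (x : E3), x ≠ 0 → HasFDerivAt (X n m) (ladderL k X n m x) x

theorem isLadder_wave {k : ℝ} {R : ℕ → ℝ → ℂ} (hR : IsRadialFamily k R) :
    IsLadder k (wave R) where
  eq_zero _ _ x h := wave_of_lt R h x
  hasFDerivAt n m _ hx := hasFDerivAt_wave hR n m hx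

theorem contDiffOn_ladderL {k : ℝ} {X : ℤ → ℤ → E3 → ℂ} {N : WithTop ℕ∞} {s : Set E3}
    (h : ∀ n m, ContDiffOn ℝ N (X n m) s) (n m : ℤ) :
    ContDiffOn ℝ N (fun x => ladderL k X n m x) s := by
  unfold ladderL
  have hh : ∀ (a b : ℝ) (j p j' p' : ℤ), ContDiffOn ℝ N
      (fun x => (a : ℂ) * X j p x + (b : ℂ) * X j' p' x) s := fun a b j p j' p' =>
    (contDiffOn_const.mul (h j p)).add (contDiffOn_const.mul (h j' p'))
  have hh' : ∀ (a b : ℝ) (j p j' p' : ℤ), ContDiffOn ℝ N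
      (fun x => (a : ℂ) * X j p x - (b : ℂ) * X j' p' x) s := fun a b j p j' p' =>
    (contDiffOn_const.mul (h j p)).sub (contDiffOn_const.mul (h j' p'))
  exact (((hh' _ _ _ _ _ _).smul contDiffOn_const).add
    (((hh _ _ _ _ _ _).div_const 2).smul contDiffOn_const)).sub
    (((hh _ _ _ _ _ _).div_const 2).smul contDiffOn_const) |>.const_smul (k : ℂ)

/-- Bootstrap: the differential of each member is a combination of members, so regularity C^N of all
of them gives C^{N+1}. -/
theorem IsLadder.contDiffOn {k : ℝ} {X : ℤ → ℤ → E3 → ℂ} (hX : IsLadder k X) (n m : ℤ) :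
    ContDiffOn ℝ ∞ (X n m) {0}ᶜ := by
  have hopen : IsOpen ({0}ᶜ : Set E3) := isOpen_compl_singleton
  rw [contDiffOn_infty]
  intro N
  induction N generalizing n m with
  | zero =>
    refine contDiffOn_zero.2 fun x hx => ?_
    exact (hX.hasFDerivAt n m x hx).continuousAt.continuousWithinAt
  | succ N ih =>
    have : ((N + 1 : ℕ) : WithTop ℕ∞) = (N : WithTop ℕ∞) + 1 := by push_cast; rfl
    rw [this, contDiffOn_succ_iff_fderiv_of_isOpen hopen]
    refine ⟨fun x hx => (hX.hasFDerivAt n m x hx).differentiableAt.differentiableWithinAt,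
      by simp, ?_⟩
    exact (contDiffOn_ladderL ih n m).congr fun x hx => (hX.hasFDerivAt n m x hx).fderiv

theorem IsLadder.contDiffAt {k : ℝ} {X : ℤ → ℤ → E3 → ℂ} (hX : IsLadder k X) (n m : ℤ)
    {x : E3} (hx : x ≠ 0) : ContDiffAt ℝ ∞ (X n m) x :=
  (hX.contDiffOn n m).contDiffAt (isOpen_compl_singleton.mem_nhds hx)

theorem ladderL_clm_comm (k : ℝ) (X : ℤ → ℤ → E3 → ℂ) (hX : IsLadder k X) (n m : ℤ) {x : E3}
    (hx : x ≠ 0) (u v : E3) :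
    fderiv ℝ (fun x => ladderL k X n m x u) x v =
      ladderL k (fun n m x => fderiv ℝ (X n m) x v) n m x u := by
  have hd : ∀ j p, HasFDerivAt (X j p) (fderiv ℝ (X j p) x) x := fun j p =>
    (hX.hasFDerivAt j p x hx).differentiableAt.hasFDerivAt
  have hc : ∀ (a : ℂ) j p, HasFDerivAt (fun x => a * X j p x) (a • fderiv ℝ (X j p) x) x :=
    fun a j p => (hd j p).const_mul a
  simp only [ladderL_apply, ladderComb]
  have h := ((((hc (coefF n m) (n - 1) m).fun_sub (hc (coefE n m) (n + 1) m)).const_mul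
      (u 2 : ℂ)).fun_add (((hc (coefD n m) (n - 1) (m + 1)).fun_add
        (hc (coefB n m) (n + 1) (m + 1))).const_mul (((u 0 : ℂ) - Complex.I * u 1) / 2))).fun_sub
      (((hc (coefC n m) (n - 1) (m - 1)).fun_add (hc (coefA n m) (n + 1) (m - 1))).const_mul
        (((u 0 : ℂ) + Complex.I * u 1) / 2))
  rw [(h.const_mul (k : ℂ)).fderiv]
  simp only [smul_apply, add_apply, sub_apply, smul_eq_mul]

/-- Directional derivatives of a ladder family form a ladder family. -/
theorem IsLadder.fderiv {k : ℝ} {X : ℤ → ℤ → E3 → ℂ} (hX : IsLadder k X) (v : E3) :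
    IsLadder k (fun n m x => fderiv ℝ (X n m) x v) where
  eq_zero n m x h := by
    have : X n m = fun _ => 0 := funext fun y => hX.eq_zero n m y h
    simp [this]
  hasFDerivAt n m x hx := by
    -- The claim reduces to D²X(u, v) = D²X(v, u), because the ladder relation in the direction u
    -- can be differentiated in the direction v with its coefficients constant.
    have hs : IsSymmSndFDerivAt ℝ (X n m) x :=
      (hX.contDiffAt n m hx).isSymmSndFDerivAt (by simp; exact WithTop.coe_le_coe.2 le_top)
    have hdd : DifferentiableAt ℝ (_root_.fderiv ℝ (X n m)) x :=
      ((hX.contDiffAt n m hx).fderiv_right (m := 1) (by exact WithTop.coe_le_coe.2 le_top)).differentiableAt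
        (by simp)
    have h := hdd.hasFDerivAt.clm_apply (hasFDerivAt_const v x)
    refine h.congr_fderiv ?_
    ext u
    rw [← ladderL_clm_comm k X hX n m hx]
    have e : (fun x => ladderL k X n m x u) =ᶠ[nhds x] fun x => _root_.fderiv ℝ (X n m) x u := by
      filter_upwards [isOpen_compl_singleton.mem_nhds hx] with y hy
      rw [(hX.hasFDerivAt n m y hy).fderiv]
    rw [e.fderiv_eq, (hdd.hasFDerivAt.clm_apply (hasFDerivAt_const u x)).fderiv]
    simp
    exact hs u v

/-! ### The expansion of translates -/

/-- The conjugate regular wave functions `conj (j_n(k|y|) Y_n^m(ŷ))`. -/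
def regWave (k : ℝ) (n m : ℤ) (y : E3) : ℂ := conj (wave (besselRad k) n m y)

/-- Along a ray the direction is fixed, so only the radial factor varies. -/
theorem regWave_smul (k : ℝ) (n m : ℤ) (y : E3) {s : ℝ} (hs : 0 < s) :
    regWave k n m (s • y) =
      (sphBesselJ n.toNat (k * (s * ‖y‖)) : ℂ) * conj (harm n m (dirZeta y) (dirCos y)) := by
  have h1 : dirZeta (s • y) = dirZeta y := by
    have : (s : ℂ) ≠ 0 := by exact_mod_cast hs.ne'
    simp only [dirZeta, norm_smul, Real.norm_eq_abs, abs_of_pos hs, PiLp.smul_apply, smul_eq_mul]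
    push_cast
    rw [show (s : ℂ) * (y 0 : ℂ) + Complex.I * (s * (y 1 : ℂ)) =
      s * ((y 0 : ℂ) + Complex.I * (y 1 : ℂ)) by ring, mul_div_mul_left _ _ this]
  have h2 : dirCos (s • y) = dirCos y := by
    simp only [dirCos, norm_smul, Real.norm_eq_abs, abs_of_pos hs, PiLp.smul_apply, smul_eq_mul]
    rw [mul_div_mul_left _ _ hs.ne']
  rw [regWave, wave, h1, h2, norm_smul, Real.norm_eq_abs, abs_of_pos hs, map_mul, besselRad,
    Complex.conj_ofReal]

/-- Boundedness of the products `X_n^m(x - s y) Z_{n'}^{m'}((1 - s) y)` along the segment. -/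
def PathBound (k : ℝ) (x y : E3) (D : ℕ) (X : ℤ → ℤ → E3 → ℂ) : Prop :=
  ∃ C : ℝ, 0 ≤ C ∧ ∀ (n : ℤ) (n' : ℕ), n ≤ n' + D → (n' : ℤ) ≤ n + D → ∀ (m m' : ℤ) (s : ℝ),
    0 ≤ s → s < 1 → ‖X n m (x - s • y)‖ * ‖regWave k n' m' ((1 - s) • y)‖ ≤
      C * ((n' : ℝ) + 1) ^ 5 * (‖y‖ / ‖x‖) ^ n'

theorem PathBound.mono {k : ℝ} {x y : E3} {D D' : ℕ} {X : ℤ → ℤ → E3 → ℂ}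
    (h : PathBound k x y D X) (hD : D' ≤ D) : PathBound k x y D' X := by
  obtain ⟨C, hC, h⟩ := h
  exact ⟨C, hC, fun n n' h1 h2 => h n n' (by omega) (by omega)⟩

theorem norm_sub_smul_ge (x y : E3) {s : ℝ} (hs0 : 0 ≤ s) : ‖x‖ - s * ‖y‖ ≤ ‖x - s • y‖ := by
  have := norm_sub_norm_le x (s • y)
  rwa [norm_smul, Real.norm_eq_abs, abs_of_nonneg hs0] at this

section segment

variable {x y : E3} (hxy : ‖y‖ < ‖x‖)
include hxy

theorem sub_smul_ne_zero {s : ℝ} (hs0 : 0 ≤ s) (hs1 : s ≤ 1) : x - s • y ≠ 0 := by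
  rw [← norm_pos_iff]
  have := norm_sub_smul_ge x y hs0
  nlinarith [norm_nonneg y]

/-- The geometric point is (1 − s)|y| / |x − sy| ≤ |y|/|x| on the whole segment, because |x − sy| ≥
|x| − s|y| and |y| < |x|. The products of Hankel and Bessel functions thus keep the same geometric
rate for all s. -/
theorem pathBound_hankel {k : ℝ} (hk : 0 < k) (hy : y ≠ 0) : PathBound k x y 4 (wave (hankelRad k)) := by
  have hd : 0 < ‖x‖ - ‖y‖ := by linarith
  have hx0 : 0 < ‖x‖ := lt_of_le_of_lt (norm_nonneg y) hxy
  -- On the segment k|x − sy| stays between k(|x| − |y|) and k(|x| + |y|).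
  set B : ℝ := max 1 (max (1 / (k * (‖x‖ - ‖y‖))) (k * (‖x‖ + ‖y‖))) with hBdef
  have hB1 : 1 ≤ B := le_max_left _ _
  have hB2 : 1 / (k * (‖x‖ - ‖y‖)) ≤ B := (le_max_left _ _).trans (le_max_right _ _)
  have hB3 : k * (‖x‖ + ‖y‖) ≤ B := (le_max_right _ _).trans (le_max_right _ _)
  obtain ⟨C, hC, hbound⟩ := exists_norm_hankel_mul_bessel_le B hB1
  refine ⟨C * 9, by positivity, ?_⟩
  intro n n' h1 h2 m m' s hs0 hs1
  rcases lt_or_ge n 0 with hn | hn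
  · rw [wave_of_neg _ hn, norm_zero, zero_mul]
    positivity
  obtain ⟨n, rfl⟩ := Int.eq_ofNat_of_zero_le hn
  have hs1' : 0 < 1 - s := by linarith
  have hlow := norm_sub_smul_ge x y hs0
  have hup : ‖x - s • y‖ ≤ ‖x‖ + ‖y‖ := by
    refine (norm_sub_le _ _).trans ?_
    rw [norm_smul, Real.norm_eq_abs, abs_of_nonneg hs0]
    nlinarith [norm_nonneg y]
  have hxs := sub_smul_ne_zero hxy hs0 hs1.le
  have hxs0 : 0 < ‖x - s • y‖ := norm_pos_iff.2 hxs
  have hle : (1 - s) * ‖y‖ ≤ ‖x - s • y‖ := by nlinarith [norm_nonneg y]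
  have hz1 : 1 / B ≤ k * ‖x - s • y‖ := by
    have h3 : 0 < k * (‖x‖ - ‖y‖) := by positivity
    rw [div_le_iff₀ h3] at hB2
    rw [div_le_iff₀ (by linarith)]
    have : k * (‖x‖ - ‖y‖) ≤ k * ‖x - s • y‖ := by
      gcongr
      nlinarith [norm_nonneg y]
    nlinarith
  have hb := hbound n n' (by omega) (by omega) (k * ‖x - s • y‖) (k * ((1 - s) * ‖y‖)) hz1
    (le_trans (by gcongr) hB3) (by positivity) (by gcongr)
  have hq : k * ((1 - s) * ‖y‖) / (k * ‖x - s • y‖) ≤ ‖y‖ / ‖x‖ := by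
    rw [mul_div_mul_left _ _ hk.ne', div_le_div_iff₀ hxs0 hx0]
    calc (1 - s) * ‖y‖ * ‖x‖ ≤ ‖y‖ * (‖x‖ - s * ‖y‖) := by
          nlinarith [mul_nonneg hs0 (mul_nonneg (norm_nonneg y) hd.le)]
      _ ≤ ‖y‖ * ‖x - s • y‖ := by gcongr
  rw [regWave_smul k n' m' y hs1', wave, norm_mul, norm_mul, RCLike.norm_conj, Complex.norm_real,
    Real.norm_eq_abs, hankelRad, Int.toNat_natCast, Int.toNat_natCast]
  have e1 := harm_bound n m (norm_dirZeta_sq hxs)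
  have e2 := harm_bound n' m' (norm_dirZeta_sq hy)
  -- The two harmonics contribute the fifth power of n' + 1.
  have e3 : √(2 * n + 1) * √(2 * n' + 1) ≤ 9 * ((n' : ℝ) + 1) := by
    have hnn : (n : ℝ) ≤ n' + 4 := by exact_mod_cast h1
    have hn0 : (0 : ℝ) ≤ n' := n'.cast_nonneg
    rw [← Real.sqrt_mul (by positivity)]
    refine Real.sqrt_le_iff.2 ⟨by positivity, ?_⟩
    nlinarith
  calc ‖sphHankel n (k * ‖x - s • y‖)‖ * ‖harm n m (dirZeta (x - s • y)) (dirCos (x - s • y))‖ *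
        (|sphBesselJ n' (k * ((1 - s) * ‖y‖))| * ‖harm n' m' (dirZeta y) (dirCos y)‖)
      = (‖sphHankel n (k * ‖x - s • y‖)‖ * |sphBesselJ n' (k * ((1 - s) * ‖y‖))|) *
        (‖harm n m (dirZeta (x - s • y)) (dirCos (x - s • y))‖ *
          ‖harm n' m' (dirZeta y) (dirCos y)‖) := by ring
    _ ≤ (C * ((n' : ℝ) + 1) ^ 4 * (‖y‖ / ‖x‖) ^ n') * (√(2 * n + 1) * √(2 * n' + 1)) := by
        refine mul_le_mul (hb.trans ?_) (by gcongr) (by positivity) (by positivity)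
        gcongr
    _ ≤ (C * ((n' : ℝ) + 1) ^ 4 * (‖y‖ / ‖x‖) ^ n') * (9 * ((n' : ℝ) + 1)) := by gcongr
    _ = _ := by ring

/-- A derivative is a combination of six neighbours with coefficients at most one. Since these have
degrees n ± 1, the admissible gap between the two degrees shrinks by one. -/
theorem PathBound.fderiv {k : ℝ} {X : ℤ → ℤ → E3 → ℂ} (hX : IsLadder k X) {D : ℕ}
    (h : PathBound k x y (D + 1) X) (v : E3) :
    PathBound k x y D (fun n m x => fderiv ℝ (X n m) x v) := by
  obtain ⟨C, hC, h⟩ := h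
  set w : ℂ := (v 2 : ℂ)
  set α : ℂ := ((v 0 : ℂ) - Complex.I * v 1) / 2 with hα
  set β : ℂ := ((v 0 : ℂ) + Complex.I * v 1) / 2 with hβ
  refine ⟨|k| * (2 * (‖w‖ + ‖α‖ + ‖β‖)) * C, by positivity, ?_⟩
  intro n n' h1 h2 m m' s hs0 hs1
  have hne := sub_smul_ne_zero hxy hs0 hs1.le
  rcases lt_or_ge n |m| with hnm | hnm
  · have h0 : _root_.fderiv ℝ (X n m) (x - s • y) v = 0 := (hX.fderiv v).eq_zero n m _ hnm
    beta_reduce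
    rw [h0, norm_zero, zero_mul]
    positivity
  obtain ⟨cA, cB, cC, cD, cE, cF⟩ := coef_le_one hnm
  set b : ℝ := C * ((n' : ℝ) + 1) ^ 5 * (‖y‖ / ‖x‖) ^ n' with hb
  have key : ∀ (c : ℝ) (j p : ℤ), 0 ≤ c → c ≤ 1 → j ≤ n + 1 → n - 1 ≤ j →
      ‖(c : ℂ) * X j p (x - s • y)‖ * ‖regWave k n' m' ((1 - s) • y)‖ ≤ b := by
    intro c j p hc0 hc1 hj1 hj2
    have := h j n' (by push_cast; omega) (by push_cast; omega) p m' s hs0 hs1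
    refine le_trans ?_ this
    rw [norm_mul, Complex.norm_real, Real.norm_eq_abs, abs_of_nonneg hc0]
    gcongr
    exact mul_le_of_le_one_left (norm_nonneg _) hc1
  beta_reduce
  rw [(hX.hasFDerivAt n m _ hne).fderiv, ladderL_apply, ladderComb, norm_mul, Complex.norm_real,
    Real.norm_eq_abs]
  have k1 := key _ (n - 1) m (coefF_nonneg n m) cF (by omega) (by omega)
  have k2 := key _ (n + 1) m (coefE_nonneg n m) cE (by omega) (by omega)
  have k3 := key _ (n - 1) (m + 1) (coefD_nonneg n m) cD (by omega) (by omega)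
  have k4 := key _ (n + 1) (m + 1) (coefB_nonneg n m) cB (by omega) (by omega)
  have k5 := key _ (n - 1) (m - 1) (coefC_nonneg n m) cC (by omega) (by omega)
  have k6 := key _ (n + 1) (m - 1) (coefA_nonneg n m) cA (by omega) (by omega)
  generalize ‖regWave k n' m' ((1 - s) • y)‖ = z at k1 k2 k3 k4 k5 k6 ⊢
  rw [← hα, ← hβ]
  generalize (coefF n m : ℂ) * X (n - 1) m (x - s • y) = a1 at *
  generalize (coefE n m : ℂ) * X (n + 1) m (x - s • y) = a2 at *
  generalize (coefD n m : ℂ) * X (n - 1) (m + 1) (x - s • y) = a3 at *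
  generalize (coefB n m : ℂ) * X (n + 1) (m + 1) (x - s • y) = a4 at *
  generalize (coefC n m : ℂ) * X (n - 1) (m - 1) (x - s • y) = a5 at *
  generalize (coefA n m : ℂ) * X (n + 1) (m - 1) (x - s • y) = a6 at *
  have hz : 0 ≤ b := by positivity
  -- The generalisation has hidden that z is a norm; for negative z the estimate is trivial.
  by_cases hz0 : 0 ≤ z
  · calc |k| * ‖w * (a1 - a2) + α * (a3 + a4) - β * (a5 + a6)‖ * z
        ≤ |k| * (‖w‖ * (‖a1‖ + ‖a2‖) + ‖α‖ * (‖a3‖ + ‖a4‖) + ‖β‖ * (‖a5‖ + ‖a6‖)) * z := by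
          gcongr
          refine (norm_sub_le _ _).trans (add_le_add ((norm_add_le _ _).trans
            (add_le_add ?_ ?_)) ?_) <;> rw [norm_mul] <;> gcongr
          · exact norm_sub_le _ _
          · exact norm_add_le _ _
          · exact norm_add_le _ _
      _ = |k| * (‖w‖ * (‖a1‖ * z + ‖a2‖ * z) + ‖α‖ * (‖a3‖ * z + ‖a4‖ * z)
            + ‖β‖ * (‖a5‖ * z + ‖a6‖ * z)) := by ring
      _ ≤ |k| * (‖w‖ * (b + b) + ‖α‖ * (b + b) + ‖β‖ * (b + b)) := by gcongr
      _ = _ := by rw [hb]; ring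
  · have h3 : |k| * ‖w * (a1 - a2) + α * (a3 + a4) - β * (a5 + a6)‖ * z ≤ 0 :=
      mul_nonpos_of_nonneg_of_nonpos (by positivity) (not_le.1 hz0).le
    exact h3.trans (by positivity)

end segment

/-- The bound by one on the coefficients is only available for |m| ≤ n; outside this range the
function they multiply is zero. -/
theorem norm_coef_mul_le {c : ℝ} {P : ℂ} {n m : ℤ} {b : ℝ} (hb : 0 ≤ b) (hc0 : 0 ≤ c)
    (hc : |m| ≤ n → c ≤ 1) (hP : n < |m| → P = 0) (h : ‖P‖ ≤ b) : ‖(c : ℂ) * P‖ ≤ b := by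
  rcases lt_or_ge n |m| with hnm | hnm
  · rw [hP hnm]; simpa using hb
  · rw [norm_mul, Complex.norm_real, Real.norm_eq_abs, abs_of_nonneg hc0]
    exact (mul_le_of_le_one_left (norm_nonneg _) (hc hnm)).trans h

theorem norm_ladderBdry_le {X Z : ℤ → ℤ → ℂ} (hX : ∀ n m : ℤ, n < |m| → X n m = 0)
    (hZ : ∀ n m : ℤ, n < |m| → Z n m = 0) (w α β : ℂ) (n m : ℤ) {b : ℝ} (hb : 0 ≤ b)
    (h1 : ∀ p p', ‖X (n - 1) p * Z n p'‖ ≤ b) (h2 : ∀ p p', ‖X n p * Z (n - 1) p'‖ ≤ b) :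
    ‖ladderBdry w α β X Z n m‖ ≤ 2 * (‖w‖ + ‖α‖ + ‖β‖) * b := by
  have cF : |m| ≤ n → coefF n m ≤ 1 := fun h => (coef_le_one h).2.2.2.2.2
  have cD : |m| ≤ n → coefD n m ≤ 1 := fun h => (coef_le_one h).2.2.2.1
  have cC : |m| ≤ n → coefC n m ≤ 1 := fun h => (coef_le_one h).2.2.1
  have t1 := norm_coef_mul_le (by positivity) (coefF_nonneg n m) cF
    (fun h => by rw [hX n m h, hZ n m h]; ring)
    ((norm_add_le _ _).trans (add_le_add (h1 m m) (h2 m m)))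
  have t2 := norm_coef_mul_le hb (coefD_nonneg n m) cD
    (fun h => by rw [hZ n m h]; ring) (h1 (m + 1) m)
  have t3 := norm_coef_mul_le hb (coefC_nonneg n m) cC
    (fun h => by rw [hX n m h]; ring) (h2 m (m - 1))
  have t4 := norm_coef_mul_le hb (coefD_nonneg n m) cD
    (fun h => by rw [hX n m h]; ring) (h2 m (m + 1))
  have t5 := norm_coef_mul_le hb (coefC_nonneg n m) cC
    (fun h => by rw [hZ n m h]; ring) (h1 (m - 1) m)
  unfold ladderBdry
  calc _ ≤ ‖w‖ * (b + b) + ‖α‖ * (b + b) + ‖β‖ * (b + b) := by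
        refine (norm_add_le _ _).trans (add_le_add ((norm_add_le _ _).trans
          (add_le_add ?_ ?_)) ?_) <;> rw [norm_mul] <;> gcongr
        · exact (norm_sub_le _ _).trans (add_le_add t2 t3)
        · exact (norm_sub_le _ _).trans (add_le_add t4 t5)
    _ = _ := by ring

theorem regWave_eq_zero (k : ℝ) (n m : ℤ) (y : E3) (h : n < |m|) : regWave k n m y = 0 := by
  rw [regWave, wave_of_lt _ h, map_zero]

theorem hasFDerivAt_regWave (k : ℝ) (n m : ℤ) {y : E3} (hy : y ≠ 0) :
    HasFDerivAt (regWave k n m)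
      ((Complex.conjCLE : ℂ →L[ℝ] ℂ).comp (ladderL k (wave (besselRad k)) n m y)) y :=
  (Complex.conjCLE : ℂ →L[ℝ] ℂ).hasFDerivAt.comp y
    ((isLadder_wave (isRadialFamily_bessel k)).hasFDerivAt n m y hy)

theorem conj_ladderL (k : ℝ) (n m : ℤ) (y v : E3) :
    conj (ladderL k (wave (besselRad k)) n m y v) =
      k * ladderComb (v 2) (((v 0 : ℂ) + Complex.I * v 1) / 2)
        (((v 0 : ℂ) - Complex.I * v 1) / 2) (fun n m => regWave k n m y) n m := by
  have h2 : conj (2 : ℂ) = 2 := map_ofNat _ 2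
  rw [ladderL_apply]
  simp only [ladderComb, map_mul, map_add, map_sub, map_div₀, Complex.conj_ofReal, Complex.conj_I,
    h2, regWave]
  ring

theorem harm_zero_zero (ζ : ℂ) (c : ℝ) : harm 0 0 ζ c = harmNorm 0 0 := by
  have := harm_natCast 0 0 ζ c
  simp only [Nat.cast_zero] at this
  rw [this, harmNat, legN, legQ_zero_zero]
  simp

theorem tendsto_poly_mul_geometric {q : ℝ} (hq0 : 0 < q) (hq1 : q < 1) (C : ℝ) :
    Filter.Tendsto (fun N : ℕ => C * ((N : ℝ) + 3) ^ 6 * q ^ N) Filter.atTop (nhds 0) := by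
  have h := tendsto_pow_const_mul_const_pow_of_abs_lt_one 6 (r := q)
    (by rwa [abs_of_pos hq0])
  have h' := ((Filter.tendsto_add_atTop_iff_nat 3).2 h).const_mul (C / q ^ 3)
  rw [mul_zero] at h'
  refine h'.congr fun N => ?_
  push_cast
  rw [pow_add]
  field_simp

/-- Expansion of `X_0^0(x - y)` for a ladder family `X`. -/
theorem IsLadder.tendsto_expansion {k : ℝ} {X : ℤ → ℤ → E3 → ℂ} (hX : IsLadder k X) {x y : E3}
    (hxy : ‖y‖ < ‖x‖) (hy : y ≠ 0) (hB : PathBound k x y 1 X) :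
    Filter.Tendsto (fun N : ℕ => ∑ n ∈ Finset.range N, ∑ m ∈ Finset.Icc (-(n : ℤ)) n,
      X n m x * regWave k n m y) Filter.atTop (nhds (X 0 0 (x - y) * (harmNorm 0 0 : ℂ))) := by
  obtain ⟨C, hC, hB⟩ := hB
  set w : ℂ := (y 2 : ℂ) with hw
  set α : ℂ := ((y 0 : ℂ) - Complex.I * y 1) / 2 with hα
  set β : ℂ := ((y 0 : ℂ) + Complex.I * y 1) / 2 with hβ
  have hx0 : 0 < ‖x‖ := lt_of_le_of_lt (norm_nonneg y) hxy
  have hy0 : 0 < ‖y‖ := norm_pos_iff.2 hy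
  set q : ℝ := ‖y‖ / ‖x‖ with hq
  have hq0 : 0 < q := div_pos hy0 hx0
  have hq1 : q < 1 := (div_lt_one hx0).2 hxy
  -- The regular wave along the segment with the direction of y frozen: it agrees with `regWave` for
  -- s < 1 and is continuous up to s = 1, where (1 − s)y has no direction.
  let Zp : ℤ → ℤ → ℝ → ℂ := fun n m s =>
    (sphBesselJ n.toNat (k * ((1 - s) * ‖y‖)) : ℂ) * conj (harm n m (dirZeta y) (dirCos y))
  have hZp : ∀ n m s, s < 1 → regWave k n m ((1 - s) • y) = Zp n m s := fun n m s hs =>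
    regWave_smul k n m y (by linarith)
  have hZpc : ∀ n m, Continuous (Zp n m) := fun n m => by
    refine Continuous.mul ?_ continuous_const
    exact Complex.continuous_ofReal.comp ((continuous_sphBesselJ _).comp (by fun_prop))
  -- This interpolates between the partial sum at s = 0 and the limit at s = 1; its derivative `f'`
  -- is a pure boundary term, by telescoping.
  let f : ℕ → ℝ → ℂ := fun N s => ∑ n ∈ Finset.range (N + 1), ∑ m ∈ Finset.Icc (-(n : ℤ)) n,
    X n m (x - s • y) * Zp n m s
  let f' : ℕ → ℝ → ℂ := fun N s => k * ∑ m ∈ Finset.Icc (-((N + 2 : ℕ) : ℤ)) (N + 2 : ℕ),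
    ladderBdry w α β (fun n m => X n m (x - s • y)) (fun n m => regWave k n m ((1 - s) • y))
      (N + 1) m
  have hXd : ∀ n m s, 0 ≤ s → s ≤ 1 → HasDerivAt (fun s : ℝ => X n m (x - s • y))
      (-(ladderL k X n m (x - s • y) y)) s := by
    intro n m s hs0 hs1
    have h1 : HasDerivAt (fun t : ℝ => x - t • y) (-y) s := by
      simpa using ((hasDerivAt_id s).smul_const y).const_sub x
    have := HasFDerivAt.comp_hasDerivAt (f := fun t : ℝ => x - t • y) s
      (hX.hasFDerivAt n m _ (sub_smul_ne_zero hxy hs0 hs1)) h1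
    simpa [Function.comp_def] using this
  have hZd : ∀ n m s, s < 1 → HasDerivAt (Zp n m)
      (-conj (ladderL k (wave (besselRad k)) n m ((1 - s) • y) y)) s := by
    intro n m s hs
    have h1 : HasDerivAt (fun t : ℝ => (1 - t) • y) (-y) s := by
      simpa using ((hasDerivAt_id s).const_sub 1).smul_const y
    have hne : (1 - s) • y ≠ 0 := smul_ne_zero (by linarith) hy
    have := HasFDerivAt.comp_hasDerivAt (f := fun t : ℝ => (1 - t) • y) s
      (hasFDerivAt_regWave k n m hne) h1
    have h2 : HasDerivAt (fun t => regWave k n m ((1 - t) • y))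
        (-conj (ladderL k (wave (besselRad k)) n m ((1 - s) • y) y)) s := by
      simpa [Function.comp_def] using this
    refine h2.congr_of_eventuallyEq ?_
    filter_upwards [gt_mem_nhds hs] with t ht
    exact (hZp n m t ht).symm
  have hfd : ∀ N s, 0 ≤ s → s < 1 → HasDerivAt (f N) (f' N s) s := by
    intro N s hs0 hs1
    have h1 : HasDerivAt (f N) (∑ n ∈ Finset.range (N + 1), ∑ m ∈ Finset.Icc (-(n : ℤ)) n,
        (-(ladderL k X n m (x - s • y) y) * Zp n m s +
          X n m (x - s • y) * -conj (ladderL k (wave (besselRad k)) n m ((1 - s) • y) y))) s :=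
      HasDerivAt.fun_sum fun n _ => HasDerivAt.fun_sum fun m _ =>
        (hXd n m s hs0 hs1.le).mul (hZd n m s hs1)
    refine h1.congr_deriv ?_
    have h2 := sum_ladderComb (X := fun n m => X n m (x - s • y))
      (Z := fun n m => regWave k n m ((1 - s) • y)) (fun n m h => hX.eq_zero n m _ h)
      (fun n m h => regWave_eq_zero k n m _ h) w α β N
    have h3 : f' N s = -k * ∑ n ∈ Finset.range (N + 1), ∑ m ∈ Finset.Icc (-(n : ℤ)) n,
        (ladderComb w α β (fun n m => X n m (x - s • y)) n m * regWave k n m ((1 - s) • y) +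
          X n m (x - s • y) *
            ladderComb w β α (fun n m => regWave k n m ((1 - s) • y)) n m) := by
      rw [h2]; ring
    rw [h3, Finset.mul_sum]
    refine Finset.sum_congr rfl fun n _ => ?_
    rw [Finset.mul_sum]
    refine Finset.sum_congr rfl fun m _ => ?_
    rw [conj_ladderL, ladderL_apply, hZp n m s hs1]
    ring
  have hfc : ∀ N, ContinuousOn (f N) (Set.Icc 0 1) := by
    intro N
    refine continuousOn_finsetSum _ fun n _ => continuousOn_finsetSum _ fun m _ => ?_
    refine ContinuousOn.mul (fun s hs => ?_) (hZpc n m).continuousOn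
    exact (hXd n m s hs.1 hs.2).continuousAt.continuousWithinAt
  set A : ℝ := |k| * (2 * (2 * (‖w‖ + ‖α‖ + ‖β‖)) * C)
  -- There are 2N + 5 boundary terms, each of size O(N^5 q^N).
  have hbound : ∀ N s, 0 ≤ s → s < 1 → ‖f' N s‖ ≤ A * ((N : ℝ) + 3) ^ 6 * q ^ N := by
    intro N s hs0 hs1
    have hb : ∀ m, ‖ladderBdry w α β (fun n m => X n m (x - s • y))
        (fun n m => regWave k n m ((1 - s) • y)) (N + 1) m‖ ≤
        2 * (‖w‖ + ‖α‖ + ‖β‖) * (C * ((N : ℝ) + 2) ^ 5 * q ^ N) := by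
      intro m
      refine norm_ladderBdry_le (fun n m h => hX.eq_zero n m _ h)
        (fun n m h => regWave_eq_zero k n m _ h) w α β _ m (by positivity) ?_ ?_
      · intro p p'
        have := hB N (N + 1) (by push_cast; omega) (by push_cast; omega) p p' s hs0 hs1
        rw [norm_mul, add_sub_cancel_right]
        push_cast at this
        refine this.trans ?_
        rw [show (N : ℝ) + 1 + 1 = N + 2 by ring]
        exact mul_le_mul_of_nonneg_left (pow_le_pow_of_le_one hq0.le hq1.le (by omega))
          (by positivity)
      · intro p p'
        have := hB (N + 1) N (by push_cast; omega) (by push_cast; omega) p p' s hs0 hs1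
        rw [norm_mul, add_sub_cancel_right]
        refine this.trans ?_
        gcongr
        norm_num
    simp only [f', norm_mul, Complex.norm_real, Real.norm_eq_abs]
    calc |k| * ‖∑ m ∈ Finset.Icc (-((N + 2 : ℕ) : ℤ)) (N + 2 : ℕ), ladderBdry w α β
          (fun n m => X n m (x - s • y)) (fun n m => regWave k n m ((1 - s) • y)) (N + 1) m‖
        ≤ |k| * ((2 * N + 5) * (2 * (‖w‖ + ‖α‖ + ‖β‖) * (C * ((N : ℝ) + 2) ^ 5 * q ^ N))) := by
          gcongr
          refine (norm_sum_le_of_le _ fun m _ => hb m).trans_eq ?_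
          rw [Finset.sum_const, Int.card_Icc, nsmul_eq_mul]
          congr 1
          have : (((N + 2 : ℕ) : ℤ) + 1 - -((N + 2 : ℕ) : ℤ)).toNat = 2 * N + 5 := by omega
          rw [this]
          push_cast
          ring
      _ ≤ |k| * ((2 * (N + 3)) * (2 * (‖w‖ + ‖α‖ + ‖β‖) * (C * ((N : ℝ) + 3) ^ 5 * q ^ N))) := by
          gcongr
          · linarith
          · norm_num
      _ = _ := by simp only [A]; ring
  have hmv : ∀ N, ‖f N 1 - f N 0‖ ≤ A * ((N : ℝ) + 3) ^ 6 * q ^ N := by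
    intro N
    have := norm_image_sub_le_of_norm_deriv_right_le_segment (hfc N) (f' := f' N)
      (C := A * ((N : ℝ) + 3) ^ 6 * q ^ N)
      (fun s hs => (hfd N s hs.1 hs.2).hasDerivWithinAt) (fun s hs => hbound N s hs.1 hs.2) 1
      (by simp)
    simpa using this
  have hf1 : ∀ N, f N 1 = X 0 0 (x - y) * (harmNorm 0 0 : ℂ) := by
    intro N
    -- At s = 1 the Bessel functions of positive order are evaluated at 0.
    have hz : ∀ n ∈ Finset.range N, ∑ m ∈ Finset.Icc (-((n + 1 : ℕ) : ℤ)) (n + 1 : ℕ),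
        X (n + 1 : ℕ) m (x - (1 : ℝ) • y) * Zp (n + 1 : ℕ) m 1 = 0 := by
      intro n _
      refine Finset.sum_eq_zero fun m _ => ?_
      simp only [Zp, Int.toNat_natCast, sub_self, zero_mul, mul_zero, sphBesselJ_succ_zero,
        Complex.ofReal_zero]
    simp only [f]
    rw [Finset.sum_range_succ', Finset.sum_congr rfl hz]
    simp [Zp, sphBesselJ_zero_zero, harm_zero_zero]
  have hf0 : ∀ N, f N 0 = ∑ n ∈ Finset.range (N + 1), ∑ m ∈ Finset.Icc (-(n : ℤ)) n,
      X n m x * regWave k n m y := by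
    intro N
    refine Finset.sum_congr rfl fun n _ => Finset.sum_congr rfl fun m _ => ?_
    rw [← hZp n m 0 one_pos]
    simp
  rw [← Filter.tendsto_add_atTop_iff_nat 1]
  have h1 : Filter.Tendsto (fun N => f N 1 - f N 0) Filter.atTop (nhds 0) :=
    squeeze_zero_norm hmv (tendsto_poly_mul_geometric hq0 hq1 A)
  have h2 := h1.const_sub (X 0 0 (x - y) * (harmNorm 0 0 : ℂ))
  rw [sub_zero] at h2
  refine h2.congr fun N => ?_
  rw [hf1, ← hf0]
  ring

/-! ### Spherical harmonics in spherical coordinates -/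

/-- The absolute value appears because √(1 − cos²θ) = |sin θ|; no range of θ is assumed. For
negative m the factorial ratio is absorbed by the square root of the normalisation. -/
theorem sphY_eq_harm (n m : ℤ) (θ φ : ℝ) :
    sphY n m θ φ = harm n m ((|Real.sin θ| : ℝ) * Complex.exp (Complex.I * φ)) (Real.cos θ) := by
  by_cases h : 0 ≤ n ∧ |m| ≤ n
  swap
  · rw [sphY, if_neg h]
    rcases not_and_or.1 h with h | h
    · rw [harm_of_neg (not_le.1 h)]
    · rw [harm_of_lt (not_le.1 h)]
  obtain ⟨hn, hm⟩ := h
  have hsin : √(1 - Real.cos θ ^ 2) = |Real.sin θ| := by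
    rw [← Real.sin_sq, Real.sqrt_sq_eq_abs]
  rw [sphY, if_pos ⟨hn, hm⟩]
  obtain ⟨n, rfl⟩ := Int.eq_ofNat_of_zero_le hn
  rcases le_total 0 m with h0 | h0
  · obtain ⟨k, rfl⟩ := Int.eq_ofNat_of_zero_le h0
    have hk : k ≤ n := by rw [abs_of_nonneg h0] at hm; omega
    have e1 : ((n : ℤ) - k).toNat = n - k := by omega
    have e2 : ((n : ℤ) + k).toNat = n + k := by omega
    rw [harm_natCast, harmNat, legN, harmNorm, assocLegendre, if_pos h0, assocLegendreNat, hsin,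
      e1, e2, mul_pow, ← Complex.exp_nat_mul]
    simp only [Int.natAbs_natCast, Int.toNat_natCast, Int.cast_natCast, legQ]
    push_cast
    rw [show (k : ℂ) * (Complex.I * φ) = Complex.I * k * φ by ring]
    ring
  · obtain ⟨k, hk⟩ := Int.eq_ofNat_of_zero_le (neg_nonneg.2 h0)
    obtain rfl : m = -(k : ℤ) := by omega
    have hkn : k ≤ n := by rw [abs_of_nonpos h0] at hm; omega
    have e1 : ((n : ℤ) - -(k : ℤ)).toNat = n + k := by omega
    have e2 : ((n : ℤ) + -(k : ℤ)).toNat = n - k := by omega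
    rcases Nat.eq_zero_or_pos k with rfl | hk0
    · simp only [Nat.cast_zero, neg_zero]
      rw [show (0 : ℤ) = ((0 : ℕ) : ℤ) from rfl, harm_natCast, harmNat, legN, harmNorm,
        assocLegendre, if_pos (by simp), assocLegendreNat]
      simp [legQ]
    rw [harm_natCast_neg, harmNat, legN, harmNorm, assocLegendre, if_neg (by omega),
      assocLegendreNat, hsin, e1, e2, mul_pow, ← Complex.exp_nat_mul]
    have hexp : conj (Complex.exp (k * (Complex.I * φ))) =
        Complex.exp (Complex.I * (-(k : ℂ)) * φ) := by
      rw [← Complex.exp_conj]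
      simp only [map_mul, Complex.conj_I, Complex.conj_ofReal, map_natCast]
      congr 1; ring
    have hf1 : (0 : ℝ) < ((n - k).factorial : ℝ) := by exact_mod_cast Nat.factorial_pos _
    have hf2 : (0 : ℝ) < ((n + k).factorial : ℝ) := by exact_mod_cast Nat.factorial_pos _
    have hnorm : √((2 * (n : ℝ) + 1) * ((n + k).factorial : ℝ) /
          (4 * Real.pi * ((n - k).factorial : ℝ))) *
        (((n - k).factorial : ℝ) / ((n + k).factorial : ℝ)) =
        √((2 * (n : ℝ) + 1) * ((n - k).factorial : ℝ) /
          (4 * Real.pi * ((n + k).factorial : ℝ))) := by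
      have hp := Real.pi_pos
      rw [← Real.sqrt_sq (div_nonneg hf1.le hf2.le), ← Real.sqrt_mul (by positivity)]
      congr 1
      field_simp
    have hnormC := congrArg (fun t : ℝ => (t : ℂ)) hnorm
    simp only [map_mul, map_pow, map_neg, map_one, Complex.conj_ofReal, hexp, Int.natAbs_neg,
      Int.natAbs_natCast, Int.toNat_natCast, legQ]
    push_cast at hnormC ⊢
    rw [← hnormC]
    ring

theorem norm_sphY_le (n m : ℤ) (θ φ : ℝ) : ‖sphY n m θ φ‖ ≤ √(2 * n + 1) := by
  rw [sphY_eq_harm]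
  rcases lt_or_ge n 0 with hn | hn
  · rw [harm_of_neg hn, norm_zero]; positivity
  obtain ⟨n, rfl⟩ := Int.eq_ofNat_of_zero_le hn
  refine (harm_bound n m ?_).trans_eq (by simp)
  rw [norm_mul, Complex.norm_real, Real.norm_eq_abs, abs_abs,
    show Complex.exp (Complex.I * φ) = Complex.exp (φ * Complex.I) by rw [mul_comm],
    Complex.norm_exp_ofReal_mul_I, mul_one, sq_abs, Real.sin_sq_add_cos_sq]

theorem sphY_eq_zero {n m : ℤ} (h : n < |m|) (θ φ : ℝ) : sphY n m θ φ = 0 := by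
  rw [sphY, if_neg fun h' => absurd h'.2 (not_le.2 h)]

theorem norm_toPoint {p : SphCoord} (hp : 0 ≤ p.r) : ‖p.toPoint‖ = p.r := by
  rw [← abs_of_nonneg hp, ← abs_of_nonneg (norm_nonneg p.toPoint), ← sq_eq_sq_iff_abs_eq_abs,
    norm_sq_E3]
  simp only [SphCoord.toPoint, PiLp.toLp_apply, Matrix.cons_val_zero, Matrix.cons_val_one,
    Matrix.cons_val]
  linear_combination p.r ^ 2 * Real.sin_sq_add_cos_sq p.θ +
    p.r ^ 2 * Real.sin p.θ ^ 2 * Real.sin_sq_add_cos_sq p.φ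

theorem abs_coef_le_one {n m : ℤ} (h : |m| ≤ n) :
    |coefA n m| ≤ 1 ∧ |coefB n m| ≤ 1 ∧ |coefC n m| ≤ 1 ∧ |coefD n m| ≤ 1 ∧ |coefE n m| ≤ 1 ∧
      |coefF n m| ≤ 1 := by
  rw [abs_of_nonneg (coefA_nonneg n m), abs_of_nonneg (coefB_nonneg n m),
    abs_of_nonneg (coefC_nonneg n m), abs_of_nonneg (coefD_nonneg n m),
    abs_of_nonneg (coefE_nonneg n m), abs_of_nonneg (coefF_nonneg n m)]
  exact coef_le_one h

/-! ### Uniform convergence -/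

/-- Derivatives of h_ν and j_n involve only orders shifted by one, so the basic estimate with its
gap of four covers all three products. The exponent is n − 1 because j_n' contains j_{n−1}. -/
theorem exists_norm_radial_le (B : ℝ) (hB : 1 ≤ B) :
    ∃ C : ℝ, 0 ≤ C ∧ ∀ n ν : ℕ, ν ≤ n + 2 → n ≤ ν + 2 → ∀ z w ρ : ℝ, 1 / B ≤ z → z ≤ B →
      0 ≤ w → w ≤ ρ * z → 0 ≤ ρ → ρ ≤ 1 →
      ‖sphHankel ν z‖ * ‖sphBesselJ n w‖ ≤ C * ((n : ℝ) + 3) ^ 5 * ρ ^ (n - 1) ∧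
      ‖deriv (sphHankel ν) z‖ * ‖sphBesselJ n w‖ ≤ C * ((n : ℝ) + 3) ^ 5 * ρ ^ (n - 1) ∧
      ‖sphHankel ν z‖ * ‖deriv (sphBesselJ n) w‖ ≤ C * ((n : ℝ) + 3) ^ 5 * ρ ^ (n - 1) := by
  obtain ⟨C, hC, h⟩ := exists_norm_hankel_mul_bessel_le B hB
  refine ⟨C * (B + 2), by positivity, ?_⟩
  intro n ν h1 h2 z w ρ hz1 hz2 hw0 hwz hρ0 hρ1
  have hB0 : 0 < B := by linarith
  have hz0 : 0 < z := lt_of_lt_of_le (by positivity) hz1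
  have hwz' : w ≤ z := hwz.trans (mul_le_of_le_one_left hz0.le hρ1)
  have hq : w / z ≤ ρ := (div_le_iff₀ hz0).2 hwz
  have hq0 : 0 ≤ w / z := by positivity
  have key : ∀ ν' n' : ℕ, ν' ≤ n' + 4 → n' ≤ ν' + 4 → n' ≤ n + 2 → n - 1 ≤ n' →
      ‖sphHankel ν' z‖ * ‖sphBesselJ n' w‖ ≤ C * ((n : ℝ) + 3) ^ 4 * ρ ^ (n - 1) := by
    intro ν' n' a b c d
    refine (h ν' n' a b z w hz1 hz2 hw0 hwz').trans ?_
    have hn' : (n' : ℝ) ≤ n + 2 := by exact_mod_cast c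
    calc C * ((n' : ℝ) + 1) ^ 4 * (w / z) ^ n' ≤ C * ((n : ℝ) + 3) ^ 4 * ρ ^ n' := by
          have : (n' : ℝ) + 1 ≤ n + 3 := by linarith
          gcongr
      _ ≤ _ := mul_le_mul_of_nonneg_left (pow_le_pow_of_le_one hρ0 hρ1 d) (by positivity)
  set E : ℝ := C * ((n : ℝ) + 3) ^ 4 * ρ ^ (n - 1) with hE
  have hE0 : 0 ≤ E := by positivity
  have hn0 : (0 : ℝ) ≤ n := n.cast_nonneg
  have hgoal : C * (B + 2) * ((n : ℝ) + 3) ^ 5 * ρ ^ (n - 1) = (B + 2) * (n + 3) * E := by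
    rw [hE]; ring
  rw [hgoal]
  have k0 := key ν n (by omega) (by omega) (by omega) (by omega)
  have hle1 : 1 * E ≤ (B + 2) * (n + 3) * E := by gcongr; nlinarith
  refine ⟨?_, ?_, ?_⟩
  · linarith
  · rw [(hasDerivAt_sphHankel ν hz0.ne').deriv]
    have k1 := key (ν + 1) n (by omega) (by omega) (by omega) (by omega)
    have hz' : ‖((ν : ℂ) / (z : ℂ))‖ ≤ (n + 2) * B := by
      rw [norm_div, Complex.norm_natCast, Complex.norm_real, Real.norm_eq_abs, abs_of_pos hz0,
        div_le_iff₀ hz0]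
      have h3 : 1 ≤ B * z := by
        rw [div_le_iff₀ hB0] at hz1; linarith
      have h4 : (ν : ℝ) ≤ n + 2 := by exact_mod_cast h1
      nlinarith
    calc ‖(ν : ℂ) / z * sphHankel ν z - sphHankel (ν + 1) z‖ * ‖sphBesselJ n w‖
        ≤ ((n + 2) * B * ‖sphHankel ν z‖ + ‖sphHankel (ν + 1) z‖) * ‖sphBesselJ n w‖ := by
          gcongr
          refine (norm_sub_le _ _).trans ?_
          rw [norm_mul]
          gcongr
      _ = (n + 2) * B * (‖sphHankel ν z‖ * ‖sphBesselJ n w‖)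
          + ‖sphHankel (ν + 1) z‖ * ‖sphBesselJ n w‖ := by ring
      _ ≤ (n + 2) * B * E + E := by gcongr
      _ ≤ _ := by nlinarith
  · cases n with
    | zero =>
      rw [(hasDerivAt_sphBesselJ_zero w).deriv, norm_neg]
      have k1 := key ν 1 (by omega) (by omega) (by omega) (by omega)
      linarith
    | succ n =>
      rw [(hasDerivAt_sphBesselJ_succ n w).deriv]
      have k1 := key ν n (by omega) (by omega) (by omega) (by omega)
      have k2 := key ν (n + 2) (by omega) (by omega) (by omega) (by omega)
      have hn0' : (0 : ℝ) ≤ n := n.cast_nonneg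
      have hb : ‖(((n : ℝ) + 1) * sphBesselJ n w - (n + 2) * sphBesselJ (n + 2) w) / (2 * n + 3)‖ ≤
          ‖sphBesselJ n w‖ + ‖sphBesselJ (n + 2) w‖ := by
        rw [norm_div, Real.norm_of_nonneg (by positivity : (0 : ℝ) ≤ 2 * n + 3),
          div_le_iff₀ (by positivity)]
        refine (norm_sub_le _ _).trans ?_
        rw [norm_mul, norm_mul, Real.norm_of_nonneg (by positivity : (0 : ℝ) ≤ n + 1),
          Real.norm_of_nonneg (by positivity : (0 : ℝ) ≤ n + 2)]
        nlinarith [norm_nonneg (sphBesselJ n w), norm_nonneg (sphBesselJ (n + 2) w),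
          mul_nonneg hn0' (norm_nonneg (sphBesselJ n w)),
          mul_nonneg hn0' (norm_nonneg (sphBesselJ (n + 2) w))]
      calc _ ≤ ‖sphHankel ν z‖ * (‖sphBesselJ n w‖ + ‖sphBesselJ (n + 2) w‖) := by gcongr
        _ ≤ E + E := by rw [mul_add]; exact add_le_add k1 k2
        _ ≤ _ := by
          rw [← two_mul]
          gcongr
          push_cast
          nlinarith

theorem exists_range_of_isCompact {K : Set (E3 × E3)} (hK : IsCompact K)
    (hK' : K ⊆ {xy | ‖xy.2‖ < ‖xy.1‖}) :
    ∃ B ρ : ℝ, 1 ≤ B ∧ 0 ≤ ρ ∧ ρ < 1 ∧ ∀ xy ∈ K, 1 / B ≤ ‖xy.1‖ ∧ ‖xy.1‖ ≤ B ∧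
      ‖xy.2‖ ≤ ρ * ‖xy.1‖ := by
  rcases K.eq_empty_or_nonempty with rfl | hne
  · exact ⟨1, 0, le_rfl, le_rfl, one_pos, by simp⟩
  have hpos : ∀ xy ∈ K, 0 < ‖xy.1‖ := fun xy h => (norm_nonneg _).trans_lt (hK' h)
  have hc1 : ContinuousOn (fun xy : E3 × E3 => ‖xy.1‖) K := by fun_prop
  obtain ⟨a, haK, ha⟩ := hK.exists_isMaxOn hne hc1
  obtain ⟨b, hbK, hb⟩ := hK.exists_isMinOn hne hc1
  have hc2 : ContinuousOn (fun xy : E3 × E3 => ‖xy.2‖ / ‖xy.1‖) K :=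
    ContinuousOn.div (by fun_prop) (by fun_prop) fun xy h => (hpos xy h).ne'
  obtain ⟨c, hcK, hc⟩ := hK.exists_isMaxOn hne hc2
  have hb0 := hpos b hbK
  refine ⟨max 1 (max ‖a.1‖ (1 / ‖b.1‖)), ‖c.2‖ / ‖c.1‖, le_max_left _ _, by positivity,
    (div_lt_one (hpos c hcK)).2 (hK' hcK), fun xy h => ⟨?_, ?_, ?_⟩⟩
  · have h1 : ‖b.1‖ ≤ ‖xy.1‖ := hb h
    refine le_trans ?_ h1
    rw [one_div_le (by positivity) hb0]
    exact (le_max_right _ _).trans (le_max_right _ _)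
  · exact (ha h : ‖xy.1‖ ≤ ‖a.1‖).trans ((le_max_left _ _).trans (le_max_right _ _))
  · exact (div_le_iff₀ (hpos xy h)).1 (hc h)

theorem exists_norm_radial_le_of_isCompact {k : ℝ} (hk : 0 < k) {K : Set (E3 × E3)}
    (hK : IsCompact K) (hK' : K ⊆ {xy | ‖xy.2‖ < ‖xy.1‖}) :
    ∃ C ρ : ℝ, 0 ≤ C ∧ 0 ≤ ρ ∧ ρ < 1 ∧ ∀ n ν : ℕ, ν ≤ n + 2 → n ≤ ν + 2 → ∀ p q : SphCoord,
      p.Admissible → q.Admissible → (p.toPoint, q.toPoint) ∈ K → 0 < p.r ∧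
      ‖sphHankel ν (k * p.r)‖ * ‖sphBesselJ n (k * q.r)‖ ≤ C * ((n : ℝ) + 3) ^ 5 * ρ ^ (n - 1) ∧
      ‖deriv (sphHankel ν) (k * p.r)‖ * ‖sphBesselJ n (k * q.r)‖ ≤
        C * ((n : ℝ) + 3) ^ 5 * ρ ^ (n - 1) ∧
      ‖sphHankel ν (k * p.r)‖ * ‖deriv (sphBesselJ n) (k * q.r)‖ ≤
        C * ((n : ℝ) + 3) ^ 5 * ρ ^ (n - 1) := by
  obtain ⟨B, ρ, hB, hρ0, hρ1, hr⟩ := exists_range_of_isCompact hK hK'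
  have hB0 : 0 < B := by linarith
  set B' : ℝ := max 1 (max (k * B) (B / k)) with hB'
  have hB'1 : 1 ≤ B' := le_max_left _ _
  have hB'2 : k * B ≤ B' := (le_max_left _ _).trans (le_max_right _ _)
  have hB'3 : B / k ≤ B' := (le_max_right _ _).trans (le_max_right _ _)
  obtain ⟨C, hC, h⟩ := exists_norm_radial_le B' hB'1
  refine ⟨C, ρ, hC, hρ0, hρ1, fun n ν h1 h2 p q hp hq hpq => ?_⟩
  obtain ⟨h3, h4, h5⟩ := hr _ hpq
  simp only [norm_toPoint hp.1, norm_toPoint hq.1] at h3 h4 h5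
  have hp0 : 0 < p.r := lt_of_lt_of_le (by positivity) h3
  refine ⟨hp0, h n ν h1 h2 (k * p.r) (k * q.r) ρ ?_ ?_ (mul_nonneg hk.le hq.1) ?_ hρ0 hρ1.le⟩
  · rw [one_div_le (by positivity) (by positivity)]
    refine le_trans ?_ hB'3
    rw [one_div_le (by positivity) (by positivity), one_div_div]
    rw [div_le_iff₀ hB0] at h3 ⊢
    nlinarith
  · exact le_trans (by gcongr) hB'2
  · calc k * q.r ≤ k * (ρ * p.r) := by gcongr
      _ = _ := by ring

/-- Weierstrass' test; the 2n + 1 values of m raise the power of n + 3 from six to seven. -/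
theorem absUnifConvergentOn_of_bound {T : ℕ → ℤ → SphCoord → SphCoord → Matrix (Fin 3) (Fin 3) ℂ}
    {K : Set (E3 × E3)} {C ρ : ℝ} (hρ0 : 0 ≤ ρ) (hρ1 : ρ < 1)
    (h : ∀ (n : ℕ) m p q i j, |m| ≤ (n : ℤ) → p.Admissible → q.Admissible → (p.toPoint, q.toPoint) ∈ K →
      ‖T n m p q i j‖ ≤ C * ((n : ℝ) + 3) ^ 6 * ρ ^ (n - 1)) :
    AbsUnifConvergentOn T K := by
  intro i j
  have hs : Summable fun n : ℕ => 2 * C * ((n : ℝ) + 3) ^ 7 * ρ ^ (n - 1) := by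
    rw [← summable_nat_add_iff 1]
    have h1 := summable_pow_mul_geometric_of_norm_lt_one (R := ℝ) 7 (r := ρ)
      (by rwa [Real.norm_of_nonneg hρ0])
    refine Summable.of_norm_bounded (g := fun n : ℕ => ‖2 * C‖ * 5 ^ 7 *
      (((n : ℝ) ^ 7 * ρ ^ n) + ρ ^ n))
      ((h1.add (summable_geometric_of_lt_one hρ0 hρ1)).mul_left _) fun n => ?_
    rw [norm_mul, norm_mul, Real.norm_of_nonneg (by positivity : (0 : ℝ) ≤ ρ ^ (n + 1 - 1)),
      Real.norm_of_nonneg (by positivity : (0 : ℝ) ≤ (((n + 1 : ℕ) : ℝ) + 3) ^ 7),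
      Nat.add_sub_cancel, mul_assoc, mul_assoc]
    refine mul_le_mul_of_nonneg_left ?_ (norm_nonneg _)
    have h3 : (((n + 1 : ℕ) : ℝ) + 3) ^ 7 ≤ 5 ^ 7 * ((n : ℝ) ^ 7 + 1) := by
      rcases Nat.eq_zero_or_pos n with rfl | hn
      · norm_num
      · have hn1 : (1 : ℝ) ≤ n := by exact_mod_cast hn
        push_cast
        calc ((n : ℝ) + 1 + 3) ^ 7 ≤ (5 * n) ^ 7 := by gcongr; linarith
          _ ≤ _ := by rw [mul_pow]; gcongr; linarith
    calc _ ≤ 5 ^ 7 * ((n : ℝ) ^ 7 + 1) * ρ ^ n := by gcongr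
      _ = _ := by ring
  refine (HasSumUniformlyOn.of_norm_le_summable hs fun n pq hpq => ?_).summableUniformlyOn
  rw [Real.norm_of_nonneg (Finset.sum_nonneg fun _ _ => norm_nonneg _)]
  -- No sign of C is assumed; the bound at m = 0 shows that the majorant is nonnegative.
  have h0 := h n 0 pq.1 pq.2 i j (by simp) hpq.1 hpq.2.1 hpq.2.2
  have h0' := (norm_nonneg _).trans h0
  calc ∑ m ∈ Finset.Icc (-(n : ℤ)) n, ‖T n m pq.1 pq.2 i j‖
      ≤ ∑ m ∈ Finset.Icc (-(n : ℤ)) n, C * ((n : ℝ) + 3) ^ 6 * ρ ^ (n - 1) :=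
        Finset.sum_le_sum fun m hm => h n m _ _ i j (abs_le.2 (Finset.mem_Icc.1 hm))
          hpq.1 hpq.2.1 hpq.2.2
    _ = (2 * n + 1) * (C * ((n : ℝ) + 3) ^ 6 * ρ ^ (n - 1)) := by
        rw [Finset.sum_const, Int.card_Icc, nsmul_eq_mul,
          show ((n : ℤ) + 1 - -(n : ℤ)).toNat = 2 * n + 1 by omega]
        push_cast; ring
    _ ≤ (2 * (n + 3)) * (C * ((n : ℝ) + 3) ^ 6 * ρ ^ (n - 1)) := by gcongr; linarith
    _ = _ := by ring

/-- Series whose terms are products of radial functions with bounded angular functions. -/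
theorem convergesWithRadialDerivatives_of_form
    {T : ℕ → ℤ → SphCoord → SphCoord → Matrix (Fin 3) (Fin 3) ℂ} {k₁ k₂ : ℝ} (hk₁ : 0 < k₁)
    (hk₂ : 0 < k₂) (ν : ℕ → ℕ) (hν1 : ∀ n, ν n ≤ n + 2) (hν2 : ∀ n, n ≤ ν n + 2)
    (g₁ g₂ : Fin 3 → Fin 3 → ℕ → ℤ → ℝ → ℝ → ℝ → ℝ → ℂ) {M : ℝ} (hM : 0 ≤ M)
    (hg₁ : ∀ i j (n : ℕ) m a b c d, |m| ≤ (n : ℤ) → ‖g₁ i j n m a b c d‖ ≤ M * ((n : ℝ) + 3))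
    (hg₂ : ∀ i j (n : ℕ) m a b c d, |m| ≤ (n : ℤ) → ‖g₂ i j n m a b c d‖ ≤ M * ((n : ℝ) + 3))
    (hT : ∀ n m p q i j, T n m p q i j =
      sphHankel (ν n) (k₁ * p.r) * (sphBesselJ n (k₁ * q.r) : ℂ) * g₁ i j n m p.θ p.φ q.θ q.φ +
      sphHankel (ν n) (k₂ * p.r) * (sphBesselJ n (k₂ * q.r) : ℂ) * g₂ i j n m p.θ p.φ q.θ q.φ) :
    ConvergesWithRadialDerivatives T := by
  intro K hK hK'
  obtain ⟨C₁, ρ₁, hC₁, hρ₁, hρ₁', h₁⟩ := exists_norm_radial_le_of_isCompact hk₁ hK hK'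
  obtain ⟨C₂, ρ₂, hC₂, hρ₂, hρ₂', h₂⟩ := exists_norm_radial_le_of_isCompact hk₂ hK hK'
  set ρ := max ρ₁ ρ₂
  have hρ0 : 0 ≤ ρ := hρ₁.trans (le_max_left _ _)
  have hρ1 : ρ < 1 := max_lt hρ₁' hρ₂'
  set κ : ℝ := 1 + k₁ + k₂ with hκ
  have hmain : ∀ (n : ℕ) (a₁ b₁ a₂ b₂ c₁ c₂ : ℂ) (l₁ l₂ : ℝ),
      ‖a₁‖ * ‖b₁‖ ≤ C₁ * ((n : ℝ) + 3) ^ 5 * ρ₁ ^ (n - 1) →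
      ‖a₂‖ * ‖b₂‖ ≤ C₂ * ((n : ℝ) + 3) ^ 5 * ρ₂ ^ (n - 1) →
      ‖c₁‖ ≤ M * ((n : ℝ) + 3) → ‖c₂‖ ≤ M * ((n : ℝ) + 3) →
      0 ≤ l₁ → l₁ ≤ κ → 0 ≤ l₂ → l₂ ≤ κ →
      ‖(l₁ : ℂ) * (a₁ * b₁ * c₁) + (l₂ : ℂ) * (a₂ * b₂ * c₂)‖ ≤
        κ * ((C₁ + C₂) * M) * ((n : ℝ) + 3) ^ 6 * ρ ^ (n - 1) := by
    intro n a₁ b₁ a₂ b₂ c₁ c₂ l₁ l₂ e1 e2 e3 e4 e5 e6 e7 e8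
    have hr1 : ρ₁ ^ (n - 1) ≤ ρ ^ (n - 1) := pow_le_pow_left₀ hρ₁ (le_max_left _ _) _
    have hr2 : ρ₂ ^ (n - 1) ≤ ρ ^ (n - 1) := pow_le_pow_left₀ hρ₂ (le_max_right _ _) _
    calc _ ≤ l₁ * ((‖a₁‖ * ‖b₁‖) * ‖c₁‖) + l₂ * ((‖a₂‖ * ‖b₂‖) * ‖c₂‖) := by
          refine (norm_add_le _ _).trans_eq ?_
          simp only [norm_mul, Complex.norm_real, Real.norm_of_nonneg e5, Real.norm_of_nonneg e7]
      _ ≤ l₁ * ((C₁ * ((n : ℝ) + 3) ^ 5 * ρ ^ (n - 1)) * (M * ((n : ℝ) + 3))) +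
          l₂ * ((C₂ * ((n : ℝ) + 3) ^ 5 * ρ ^ (n - 1)) * (M * ((n : ℝ) + 3))) := by
          refine add_le_add (mul_le_mul_of_nonneg_left (mul_le_mul (e1.trans ?_) e3 (norm_nonneg _)
            (by positivity)) e5) (mul_le_mul_of_nonneg_left (mul_le_mul (e2.trans ?_) e4
            (norm_nonneg _) (by positivity)) e7) <;> gcongr
      _ ≤ κ * ((C₁ * ((n : ℝ) + 3) ^ 5 * ρ ^ (n - 1)) * (M * ((n : ℝ) + 3))) +
          κ * ((C₂ * ((n : ℝ) + 3) ^ 5 * ρ ^ (n - 1)) * (M * ((n : ℝ) + 3))) := by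
          gcongr
      _ = _ := by ring
  refine ⟨?_, ?_, ?_⟩
  · refine absUnifConvergentOn_of_bound hρ0 hρ1 (C := κ * ((C₁ + C₂) * M)) ?_
    intro n m p q i j hm hp hq hpq
    rw [hT]
    obtain ⟨-, d1, -, -⟩ := h₁ n (ν n) (hν1 n) (hν2 n) p q hp hq hpq
    obtain ⟨-, d2, -, -⟩ := h₂ n (ν n) (hν1 n) (hν2 n) p q hp hq hpq
    rw [← Complex.norm_real] at d1 d2
    simpa using hmain n _ _ _ _ _ _ 1 1 d1 d2 (hg₁ i j n m p.θ p.φ q.θ q.φ hm)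
      (hg₂ i j n m p.θ p.φ q.θ q.φ hm) zero_le_one (by linarith) zero_le_one (by linarith)
  · refine absUnifConvergentOn_of_bound hρ0 hρ1 (C := κ * ((C₁ + C₂) * M)) ?_
    intro n m p q i j hm hp hq hpq
    obtain ⟨hr, -, d1, -⟩ := h₁ n (ν n) (hν1 n) (hν2 n) p q hp hq hpq
    obtain ⟨-, -, d2, -⟩ := h₂ n (ν n) (hν1 n) (hν2 n) p q hp hq hpq
    rw [← Complex.norm_real (sphBesselJ n _)] at d1 d2
    have hd : ∀ k : ℝ, 0 < k → HasDerivAt (fun s : ℝ => sphHankel (ν n) (k * s))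
        (k * deriv (sphHankel (ν n)) (k * p.r)) p.r := fun k hk => by
      have := ((hasDerivAt_sphHankel (ν n) (mul_pos hk hr).ne').differentiableAt.hasDerivAt).scomp
        p.r ((hasDerivAt_id p.r).const_mul k)
      simpa [Function.comp_def] using this
    have hder : derivNormX T n m p q i j =
        (k₁ : ℂ) * (deriv (sphHankel (ν n)) (k₁ * p.r) * (sphBesselJ n (k₁ * q.r) : ℂ) *
          g₁ i j n m p.θ p.φ q.θ q.φ) +
        (k₂ : ℂ) * (deriv (sphHankel (ν n)) (k₂ * p.r) * (sphBesselJ n (k₂ * q.r) : ℂ) *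
          g₂ i j n m p.θ p.φ q.θ q.φ) := by
      simp only [derivNormX, hT]
      refine HasDerivAt.deriv ?_
      refine ((((hd k₁ hk₁).mul_const _).mul_const _).add
        (((hd k₂ hk₂).mul_const _).mul_const _)).congr_deriv ?_
      ring
    rw [hder]
    exact hmain n _ _ _ _ _ _ k₁ k₂ d1 d2 (hg₁ i j n m p.θ p.φ q.θ q.φ hm)
      (hg₂ i j n m p.θ p.φ q.θ q.φ hm) hk₁.le (by linarith) hk₂.le (by linarith)
  · refine absUnifConvergentOn_of_bound hρ0 hρ1 (C := κ * ((C₁ + C₂) * M)) ?_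
    intro n m p q i j hm hp hq hpq
    obtain ⟨hr, -, -, d1⟩ := h₁ n (ν n) (hν1 n) (hν2 n) p q hp hq hpq
    obtain ⟨-, -, -, d2⟩ := h₂ n (ν n) (hν1 n) (hν2 n) p q hp hq hpq
    rw [← Complex.norm_real (deriv (sphBesselJ n) _)] at d1 d2
    have hdiff : ∀ z, DifferentiableAt ℝ (sphBesselJ n) z := fun z => by
      cases n with
      | zero => exact (hasDerivAt_sphBesselJ_zero z).differentiableAt
      | succ n => exact (hasDerivAt_sphBesselJ_succ n z).differentiableAt
    have hd : ∀ k : ℝ, HasDerivAt (fun s : ℝ => (sphBesselJ n (k * s) : ℂ))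
        (k * (deriv (sphBesselJ n) (k * q.r) : ℝ)) q.r := fun k => by
      have := ((hdiff (k * q.r)).hasDerivAt.scomp q.r
        ((hasDerivAt_id q.r).const_mul k)).ofReal_comp
      simpa [Function.comp_def] using this
    have hder : derivNormY T n m p q i j =
        (k₁ : ℂ) * (sphHankel (ν n) (k₁ * p.r) * (deriv (sphBesselJ n) (k₁ * q.r) : ℝ) *
          g₁ i j n m p.θ p.φ q.θ q.φ) +
        (k₂ : ℂ) * (sphHankel (ν n) (k₂ * p.r) * (deriv (sphBesselJ n) (k₂ * q.r) : ℝ) *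
          g₂ i j n m p.θ p.φ q.θ q.φ) := by
      simp only [derivNormY, hT]
      refine HasDerivAt.deriv ?_
      refine ((((hd k₁).const_mul _).mul_const _).add
        (((hd k₂).const_mul _).mul_const _)).congr_deriv ?_
      ring
    rw [hder]
    exact hmain n _ _ _ _ _ _ k₁ k₂ d1 d2 (hg₁ i j n m p.θ p.φ q.θ q.φ hm)
      (hg₂ i j n m p.θ p.φ q.θ q.φ hm) hk₁.le (by linarith) hk₂.le (by linarith)

/-! ### Convergence of the four series -/

/-- The coefficient has to be controlled only where the harmonic is not zero by convention. -/
theorem norm_smul_smul_entry_le {n : ℕ} {n' m' : ℤ} {c : ℝ} {A : Matrix (Fin 3) (Fin 3) ℂ}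
    (hn : n' ≤ n + 2) (hc : |m'| ≤ n' → |c| ≤ 1) (hA : ∀ i j, ‖A i j‖ ≤ 2) (θ φ : ℝ)
    (i j : Fin 3) :
    ‖(sphY n' m' θ φ • (c : ℂ) • A) i j‖ ≤ 2 * √(2 * n + 5) := by
  rcases lt_or_ge n' |m'| with h | h
  · rw [sphY_eq_zero h]; simp
  rw [Matrix.smul_apply, Matrix.smul_apply, smul_eq_mul, smul_eq_mul, norm_mul, norm_mul,
    Complex.norm_real, Real.norm_eq_abs]
  have h1 : ‖sphY n' m' θ φ‖ ≤ √(2 * n + 5) := by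
    refine (norm_sphY_le _ _ _ _).trans (Real.sqrt_le_sqrt ?_)
    have : (n' : ℝ) ≤ n + 2 := by exact_mod_cast hn
    linarith
  calc ‖sphY n' m' θ φ‖ * (|c| * ‖A i j‖) ≤ √(2 * n + 5) * (1 * 2) := by
        gcongr
        · exact hc h
        · exact hA i j
    _ = _ := by ring

theorem norm_matA_le (i j : Fin 3) : ‖matA i j‖ ≤ 2 := by
  fin_cases i <;> fin_cases j <;> simp [matA]
theorem norm_matB_le (i j : Fin 3) : ‖matB i j‖ ≤ 2 := by
  fin_cases i <;> fin_cases j <;> simp [matB]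
theorem norm_matC_le (i j : Fin 3) : ‖matC i j‖ ≤ 2 := by
  fin_cases i <;> fin_cases j <;> simp [matC]
theorem norm_matD_le (i j : Fin 3) : ‖matD i j‖ ≤ 2 := by
  fin_cases i <;> fin_cases j <;> simp [matD]
theorem norm_matE_le (i j : Fin 3) : ‖matE i j‖ ≤ 2 := by
  fin_cases i <;> fin_cases j <;> simp [matE]

theorem norm_sum_five_le {A B C D E : Matrix (Fin 3) (Fin 3) ℂ} {i j : Fin 3} {b : ℝ}
    (hA : ‖A i j‖ ≤ b) (hB : ‖B i j‖ ≤ b) (hC : ‖C i j‖ ≤ b) (hD : ‖D i j‖ ≤ b)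
    (hE : ‖E i j‖ ≤ b) : ‖(A + B + C + D + E) i j‖ ≤ 5 * b := by
  simp only [Matrix.add_apply]
  have h1 := norm_add_le (A i j + B i j + C i j + D i j) (E i j)
  have h2 := norm_add_le (A i j + B i j + C i j) (D i j)
  have h3 := norm_add_le (A i j + B i j) (C i j)
  have h4 := norm_add_le (A i j) (B i j)
  linarith

theorem abs_mul_le_one_of {a b c : ℝ} (ha0 : 0 ≤ a) (ha : a ≤ 1) (hb0 : 0 ≤ b) (hb : b ≤ 1)
    (hc : |c| ≤ 1) : |c * (a * b)| ≤ 1 := by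
  rw [abs_mul, abs_of_nonneg (mul_nonneg ha0 hb0)]
  exact mul_le_one₀ hc (mul_nonneg ha0 hb0) (mul_le_one₀ ha hb0 hb)

theorem abs_add_mul_le_one_of {a b a' b' c : ℝ} (ha0 : 0 ≤ a) (ha : a ≤ 1) (hb0 : 0 ≤ b)
    (hb : b ≤ 1) (ha0' : 0 ≤ a') (ha' : a' ≤ 1) (hb0' : 0 ≤ b') (hb' : b' ≤ 1)
    (hc : |c| ≤ 1 / 2) : |c * (a * b + a' * b')| ≤ 1 ∧ |c * (a * b - a' * b')| ≤ 1 := by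
  have h1 := mul_nonneg ha0 hb0
  have h2 := mul_nonneg ha0' hb0'
  have h3 := mul_le_one₀ ha hb0 hb
  have h4 := mul_le_one₀ ha' hb0' hb'
  constructor
  · rw [abs_mul]
    have : |a * b + a' * b'| ≤ 2 := abs_le.2 ⟨by linarith, by linarith⟩
    nlinarith [abs_nonneg c, abs_nonneg (a * b + a' * b')]
  · rw [abs_mul]
    have : |a * b - a' * b'| ≤ 2 := abs_le.2 ⟨by linarith, by linarith⟩
    nlinarith [abs_nonneg c, abs_nonneg (a * b - a' * b')]

theorem norm_Sminus_le {n : ℕ} {m : ℤ} (hm : |m| ≤ (n : ℤ)) (θ φ : ℝ) (i j : Fin 3) :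
    ‖Sminus n m θ φ i j‖ ≤ 5 * (2 * √(2 * n + 5)) := by
  obtain ⟨-, -, hC, hD, -, hF⟩ := coef_le_one hm
  unfold Sminus
  refine norm_sum_five_le (norm_smul_smul_entry_le (by omega) (fun h => ?_) norm_matA_le _ _ _ _)
    (norm_smul_smul_entry_le (by omega) (fun h => ?_) norm_matB_le _ _ _ _)
    (norm_smul_smul_entry_le (by omega) (fun h => ?_) norm_matC_le _ _ _ _)
    (norm_smul_smul_entry_le (by omega) (fun h => ?_) norm_matD_le _ _ _ _)
    (norm_smul_smul_entry_le (by omega) (fun h => ?_) norm_matE_le _ _ _ _)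
  · exact abs_mul_le_one_of (coefB_nonneg _ _) (coef_le_one h).2.1 (coefC_nonneg _ _) hC
      (by norm_num)
  · exact abs_mul_le_one_of (coefB_nonneg _ _) (coef_le_one h).2.1 (coefF_nonneg _ _) hF
      (by norm_num)
  · exact abs_mul_le_one_of (coefA_nonneg _ _) (coef_le_one h).1 (coefC_nonneg _ _) hC
      (by norm_num)
  · exact abs_mul_le_one_of (coefA_nonneg _ _) (coef_le_one h).1 (coefF_nonneg _ _) hF
      (by norm_num)
  · exact abs_mul_le_one_of (coefA_nonneg _ _) (coef_le_one h).1 (coefD_nonneg _ _) hD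
      (by norm_num)

theorem norm_Szero_le {n : ℕ} {m : ℤ} (hm : |m| ≤ (n : ℤ)) (θ φ : ℝ) (i j : Fin 3) :
    ‖Szero n m θ φ i j‖ ≤ 5 * (2 * √(2 * n + 5)) := by
  obtain ⟨hA, hB, hC, hD, hE, hF⟩ := coef_le_one hm
  unfold Szero
  refine norm_sum_five_le (norm_smul_smul_entry_le (by omega) (fun h => ?_) norm_matA_le _ _ _ _)
    (norm_smul_smul_entry_le (by omega) (fun h => ?_) norm_matB_le _ _ _ _)
    (norm_smul_smul_entry_le (by omega) (fun h => ?_) norm_matC_le _ _ _ _)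
    (norm_smul_smul_entry_le (by omega) (fun h => ?_) norm_matD_le _ _ _ _)
    (norm_smul_smul_entry_le (by omega) (fun h => ?_) norm_matE_le _ _ _ _)
  · obtain ⟨hA', hB', hC', hD', -, -⟩ := coef_le_one h
    exact (abs_add_mul_le_one_of (coefB_nonneg _ _) hB' (coefA_nonneg _ _) hA
      (coefD_nonneg _ _) hD' (coefC_nonneg _ _) hC (by norm_num [abs_of_pos])).1
  · obtain ⟨hA', hB', hC', hD', -, -⟩ := coef_le_one h
    exact (abs_add_mul_le_one_of (coefD_nonneg _ _) hD' (coefF_nonneg _ _) hF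
      (coefB_nonneg _ _) hB' (coefE_nonneg _ _) hE (by norm_num [abs_of_pos])).2
  · rw [sq, sq]
    exact (abs_add_mul_le_one_of (coefE_nonneg _ _) hE (coefE_nonneg _ _) hE
      (coefF_nonneg _ _) hF (coefF_nonneg _ _) hF (by norm_num [abs_of_pos])).1
  · obtain ⟨hA', hB', hC', hD', -, -⟩ := coef_le_one h
    exact (abs_add_mul_le_one_of (coefC_nonneg _ _) hC' (coefF_nonneg _ _) hF
      (coefA_nonneg _ _) hA' (coefE_nonneg _ _) hE (by norm_num [abs_of_pos])).2
  · obtain ⟨hA', hB', hC', hD', -, -⟩ := coef_le_one h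
    exact (abs_add_mul_le_one_of (coefA_nonneg _ _) hA' (coefB_nonneg _ _) hB
      (coefC_nonneg _ _) hC' (coefD_nonneg _ _) hD (by norm_num [abs_of_pos])).1

theorem norm_Splus_le {n : ℕ} {m : ℤ} (hm : |m| ≤ (n : ℤ)) (θ φ : ℝ) (i j : Fin 3) :
    ‖Splus n m θ φ i j‖ ≤ 5 * (2 * √(2 * n + 5)) := by
  obtain ⟨hA, hB, -, -, hE, -⟩ := coef_le_one hm
  unfold Splus
  refine norm_sum_five_le (norm_smul_smul_entry_le (by omega) (fun h => ?_) norm_matA_le _ _ _ _)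
    (norm_smul_smul_entry_le (by omega) (fun h => ?_) norm_matB_le _ _ _ _)
    (norm_smul_smul_entry_le (by omega) (fun h => ?_) norm_matC_le _ _ _ _)
    (norm_smul_smul_entry_le (by omega) (fun h => ?_) norm_matD_le _ _ _ _)
    (norm_smul_smul_entry_le (by omega) (fun h => ?_) norm_matE_le _ _ _ _)
  · exact abs_mul_le_one_of (coefD_nonneg _ _) (coef_le_one h).2.2.2.1 (coefA_nonneg _ _) hA
      (by norm_num)
  · exact abs_mul_le_one_of (coefD_nonneg _ _) (coef_le_one h).2.2.2.1 (coefE_nonneg _ _) hE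
      (by norm_num [abs_of_pos])
  · exact abs_mul_le_one_of (coefC_nonneg _ _) (coef_le_one h).2.2.1 (coefA_nonneg _ _) hA
      (by norm_num)
  · exact abs_mul_le_one_of (coefC_nonneg _ _) (coef_le_one h).2.2.1 (coefE_nonneg _ _) hE
      (by norm_num [abs_of_pos])
  · exact abs_mul_le_one_of (coefC_nonneg _ _) (coef_le_one h).2.2.1 (coefB_nonneg _ _) hB
      (by norm_num)

theorem norm_const_mul_conj_sphY_mul_le {n : ℕ} {m : ℤ} {s : ℂ} (c : ℂ) (θ φ : ℝ)
    (hs : ‖s‖ ≤ 5 * (2 * √(2 * n + 5))) :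
    ‖c * (conj (sphY n m θ φ) * s)‖ ≤ (20 * ‖c‖) * ((n : ℝ) + 3) := by
  have h1 : ‖sphY n m θ φ‖ ≤ √(2 * n + 5) :=
    (norm_sphY_le n m θ φ).trans (Real.sqrt_le_sqrt (by push_cast; linarith))
  have h2 : √(2 * (n : ℝ) + 5) * √(2 * n + 5) = 2 * n + 5 := Real.mul_self_sqrt (by positivity)
  rw [norm_mul, norm_mul, RCLike.norm_conj]
  calc ‖c‖ * (‖sphY n m θ φ‖ * ‖s‖) ≤ ‖c‖ * (√(2 * n + 5) * (5 * (2 * √(2 * n + 5)))) := by gcongr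
    _ = ‖c‖ * (10 * (2 * n + 5)) := by linear_combination (10 * ‖c‖) * h2
    _ ≤ _ := by nlinarith [norm_nonneg c]

theorem kP_pos {lam mu omega : ℝ} (h_omega : 0 < omega) (h_lam : 0 < 2 * mu + lam) :
    0 < kP lam mu omega := div_pos h_omega (Real.sqrt_pos.2 h_lam)

theorem kS_pos {mu omega : ℝ} (h_omega : 0 < omega) (h_mu : 0 < mu) :
    0 < kS mu omega := div_pos h_omega (Real.sqrt_pos.2 h_mu)

section terms

variable {lam mu omega : ℝ} (h_omega : 0 < omega) (h_mu : 0 < mu) (h_lam : 0 < 2 * mu + lam)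

include h_omega h_mu h_lam

/-- The three series with H⁻ differ only in the angular matrix and in the order of the Hankel
function, which stays within 2 of n. -/
theorem convergesWithRadialDerivatives_of_S {S : ℤ → ℤ → ℝ → ℝ → Matrix (Fin 3) (Fin 3) ℂ}
    (hS : ∀ (n : ℕ) (m : ℤ) (θ φ : ℝ) (i j : Fin 3), |m| ≤ (n : ℤ) →
      ‖S n m θ φ i j‖ ≤ 5 * (2 * √(2 * n + 5)))
    (ν : ℕ → ℕ) (hν1 : ∀ n, ν n ≤ n + 2) (hν2 : ∀ n, n ≤ ν n + 2) :
    ConvergesWithRadialDerivatives (fun n m p q =>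
      (1 / (omega : ℂ) ^ 2) • HfunMinus (kP lam mu omega) (kS mu omega) (ν n) n p.r q.r •
        (starRingEnd ℂ) (sphY n m q.θ q.φ) • S n m p.θ p.φ) := by
  set kp := kP lam mu omega
  set ks := kS mu omega
  refine convergesWithRadialDerivatives_of_form (kP_pos h_omega h_lam) (kS_pos h_omega h_mu) ν hν1
    hν2 (fun i j n m θ φ θ' φ' => (1 / (omega : ℂ) ^ 2 * (kp : ℂ) ^ 3) *
      (conj (sphY n m θ' φ') * S n m θ φ i j))
    (fun i j n m θ φ θ' φ' => (-(1 / (omega : ℂ) ^ 2 * (ks : ℂ) ^ 3)) *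
      (conj (sphY n m θ' φ') * S n m θ φ i j))
    (M := 20 * ‖(1 / (omega : ℂ) ^ 2 * (kp : ℂ) ^ 3)‖ +
      20 * ‖(-(1 / (omega : ℂ) ^ 2 * (ks : ℂ) ^ 3))‖) (by positivity) ?_ ?_ ?_
  · intro i j n m a b c d hm
    refine (norm_const_mul_conj_sphY_mul_le _ _ _ (hS n m a b i j hm)).trans ?_
    gcongr
    exact le_add_of_nonneg_right (by positivity)
  · intro i j n m a b c d hm
    refine (norm_const_mul_conj_sphY_mul_le _ _ _ (hS n m a b i j hm)).trans ?_
    gcongr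
    exact le_add_of_nonneg_left (by positivity)
  · intro n m p q i j
    simp only [Matrix.smul_apply, smul_eq_mul, HfunMinus, Hfun]
    ring

theorem converges_minusTerm : ConvergesWithRadialDerivatives (minusTerm lam mu omega) :=
  convergesWithRadialDerivatives_of_S h_omega h_mu h_lam
    (fun _ _ θ φ i j hm => norm_Sminus_le hm θ φ i j) (fun n => n - 2) (fun n => by omega)
    fun n => by omega

theorem converges_zeroTerm : ConvergesWithRadialDerivatives (zeroTerm lam mu omega) :=
  convergesWithRadialDerivatives_of_S h_omega h_mu h_lam
    (fun _ _ θ φ i j hm => norm_Szero_le hm θ φ i j) (fun n => n) (fun n => by omega)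
    fun n => by omega

theorem converges_plusTerm : ConvergesWithRadialDerivatives (plusTerm lam mu omega) :=
  convergesWithRadialDerivatives_of_S h_omega h_mu h_lam
    (fun _ _ θ φ i j hm => norm_Splus_le hm θ φ i j) (fun n => n + 2) (fun n => by omega)
    fun n => by omega

theorem converges_psiTerm : ConvergesWithRadialDerivatives (psiTerm lam mu omega) := by
  set kp := kP lam mu omega
  set ks := kS mu omega
  set c₁ : ℂ := Complex.I / (omega : ℂ) ^ 2 * (kp : ℂ) ^ 3 * (1 / 2)
  set c₂ : ℂ := Complex.I / (omega : ℂ) ^ 2 * (ks : ℂ) ^ 3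
  have hb : ∀ (n : ℕ) (m : ℤ) (θ φ : ℝ) (s : ℂ), ‖s‖ ≤ 2 →
      ‖sphY n m θ φ * s‖ ≤ 5 * (2 * √(2 * n + 5)) := by
    intro n m θ φ s hs
    have h1 : ‖sphY n m θ φ‖ ≤ √(2 * n + 5) :=
      (norm_sphY_le n m θ φ).trans (Real.sqrt_le_sqrt (by push_cast; linarith))
    rw [norm_mul]
    nlinarith [norm_nonneg s, Real.sqrt_nonneg (2 * (n : ℝ) + 5)]
  -- In Ψ the wave number k_p meets only P/2, while k_s meets S + P/2.
  refine convergesWithRadialDerivatives_of_form (kP_pos h_omega h_lam) (kS_pos h_omega h_mu)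
    (fun n => n) (fun n => by omega) (fun n => by omega)
    (fun i j n m θ φ θ' φ' => c₁ * (conj (sphY n m θ' φ') * (sphY n m θ φ * matP i j)))
    (fun i j n m θ φ θ' φ' => c₂ *
      (conj (sphY n m θ' φ') * (sphY n m θ φ * (matS i j + 1 / 2 * matP i j))))
    (M := 20 * ‖c₁‖ + 20 * ‖c₂‖) (by positivity) ?_ ?_ ?_
  · intro i j n m a b c d hm
    refine (norm_const_mul_conj_sphY_mul_le _ _ _ (hb n m a b _ ?_)).trans ?_
    · fin_cases i <;> fin_cases j <;> simp [matP]
    · gcongr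
      exact le_add_of_nonneg_right (by positivity)
  · intro i j n m a b c d hm
    refine (norm_const_mul_conj_sphY_mul_le _ _ _ (hb n m a b _ ?_)).trans ?_
    · fin_cases i <;> fin_cases j <;> norm_num [matP, matS]
    · gcongr
      exact le_add_of_nonneg_left (by positivity)
  · intro n m p q i j
    simp only [psiTerm, Matrix.smul_apply, Matrix.add_apply, smul_eq_mul, HfunPlus, Hfun, c₁, c₂]
    ring

end terms

/-! ### Second derivatives of the wave functions -/

/-- This is the component of degree n − 2 of the Helmholtz equation for waves: the contributions of
∂_x² + ∂_y² and ∂_z² cancel there. The restriction on m makes the factors in the radicands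
nonnegative. -/
theorem coefC_mul_coefD {n m : ℤ} (h : |m| ≤ n - 2) :
    coefC n m * coefD (n - 1) (m - 1) = coefF n m * coefF (n - 1) m := by
  obtain ⟨h1, h2⟩ := abs_le.1 h
  have h1' : -((n : ℝ) - 2) ≤ m := by exact_mod_cast h1
  have h2' : (m : ℝ) ≤ n - 2 := by exact_mod_cast h2
  unfold coefC coefD coefF
  rw [← Real.sqrt_mul, ← Real.sqrt_mul]
  · congr 1
    push_cast
    ring
  · exact div_nonneg (mul_nonneg (by linarith) (by linarith))
      (mul_nonneg (by linarith) (by linarith))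
  · exact div_nonneg (mul_nonneg (by linarith) (by linarith))
      (mul_nonneg (by linarith) (by linarith))

theorem coefD_mul_coefC {n m : ℤ} (h : |m| ≤ n - 2) :
    coefD n m * coefC (n - 1) (m + 1) = coefF n m * coefF (n - 1) m := by
  have := coefC_mul_coefD (n := n) (m := -m) (by rwa [abs_neg])
  rwa [coefC_neg, coefF_neg, coefF_neg, show -m - 1 = -(m + 1) by ring, coefD_neg] at this

/-- The diagonal component of the same equation: the four squares that bring the Laplacian back to
(n, m) add up to one. -/
theorem coefC_sq_add {n m : ℤ} (h : |m| ≤ n) :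
    coefC n m ^ 2 + coefD (n + 1) (m - 1) ^ 2 = 1 - coefF n m ^ 2 - coefF (n + 1) m ^ 2 := by
  obtain ⟨h1, h2⟩ := abs_le.1 h
  have h1' : -(n : ℝ) ≤ m := by exact_mod_cast h1
  have h2' : (m : ℝ) ≤ n := by exact_mod_cast h2
  rcases (show n = 0 ∨ 1 ≤ n by omega) with rfl | hn
  · obtain rfl : m = 0 := by omega
    norm_num [coefC, coefD, coefF, div_pow]
  have hn' : (1 : ℝ) ≤ n := by exact_mod_cast hn
  have hCpos : 0 ≤ ((n : ℝ) + m) * (n + m - 1) := by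
    rcases (show n + m = 0 ∨ 1 ≤ n + m by omega) with h0 | h0
    · have : (n : ℝ) + m = 0 := by exact_mod_cast h0
      rw [this]; simp
    · have : (1 : ℝ) ≤ n + m := by exact_mod_cast h0
      exact mul_nonneg (by linarith) (by linarith)
  have d1 : (0 : ℝ) < 2 * n - 1 := by linarith
  have d2 : (0 : ℝ) < 2 * n + 1 := by linarith
  have d3 : (0 : ℝ) < 2 * n + 3 := by linarith
  unfold coefC coefD coefF
  push_cast
  rw [Real.sq_sqrt (div_nonneg hCpos (by positivity)), Real.sq_sqrt, Real.sq_sqrt, Real.sq_sqrt]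
  · rw [show (2 * ((n : ℝ) + 1) - 1) = 2 * n + 1 by ring,
      show (2 * ((n : ℝ) + 1) + 1) = 2 * n + 3 by ring]
    have e1 : ((n : ℝ) + m) * (n + m - 1) / ((2 * n - 1) * (2 * n + 1)) +
        (n + m) * (n - m) / ((2 * n - 1) * (2 * n + 1)) = (n + m) / (2 * n + 1) := by
      rw [← add_div, div_eq_div_iff (by positivity) d2.ne']; ring
    have e2 : ((n : ℝ) + 1 - (m - 1)) * (n + 1 - (m - 1) - 1) / ((2 * n + 1) * (2 * n + 3)) +
        (n + 1 + m) * (n + 1 - m) / ((2 * n + 1) * (2 * n + 3)) = (n - m + 1) / (2 * n + 1) := by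
      rw [← add_div, div_eq_div_iff (by positivity) d2.ne']; ring
    have e3 : ((n : ℝ) + m) / (2 * n + 1) + (n - m + 1) / (2 * n + 1) = 1 := by
      rw [← add_div, div_eq_one_iff_eq d2.ne']; ring
    linarith
  · exact div_nonneg (mul_nonneg (by linarith) (by linarith))
      (mul_nonneg (by linarith) (by linarith))
  · exact div_nonneg (mul_nonneg (by linarith) (by linarith))
      (mul_nonneg (by linarith) (by linarith))
  · exact div_nonneg (mul_nonneg (by linarith) (by linarith))
      (mul_nonneg (by linarith) (by linarith))

theorem coefD_sq_add {n m : ℤ} (h : |m| ≤ n) :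
    coefD n m ^ 2 + coefC (n + 1) (m + 1) ^ 2 = 1 - coefF n m ^ 2 - coefF (n + 1) m ^ 2 := by
  have := coefC_sq_add (n := n) (m := -m) (by rwa [abs_neg])
  rwa [coefC_neg, coefF_neg, coefF_neg, show -m - 1 = -(m + 1) by ring, coefD_neg] at this

/-- The weights `w, α, β` of the ladder combination for the coordinate direction `i`. -/
def dirW (i : Fin 3) : ℂ := ![0, 0, 1] i
def dirAl (i : Fin 3) : ℂ := ![1 / 2, -Complex.I / 2, 0] i
def dirBe (i : Fin 3) : ℂ := ![1 / 2, Complex.I / 2, 0] i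

/-- The double ladder step is expanded and compared harmonic by harmonic. Where the order m is
restored, the products of coefficients only match through the quadratic identities `t1` to `t3'`;
all other terms agree directly. The case i > j follows later from the symmetry of the Hessian. -/
theorem ladderComb_ladderComb_eq {n m : ℤ} (hm : |m| ≤ n) (h : ℤ → ℂ) (θ φ : ℝ) {i j : Fin 3}
    (hij : i ≤ j) :
    Complex.I * ladderComb (dirW j) (dirAl j) (dirBe j) (fun n m => ladderComb (dirW i) (dirAl i)
      (dirBe i) (fun n m => h n * sphY n m θ φ) n m) n m =
    -(h (n - 2) * Sminus n m θ φ i j + h n * Szero n m θ φ i j + h (n + 2) * Splus n m θ φ i j)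
      - Complex.I * (matP i j / 2) * (h n * sphY n m θ φ) := by
  have a1 : ∀ a : ℤ, a - 1 - 1 = a - 2 := fun a => by ring
  have a2 : ∀ a : ℤ, a + 1 + 1 = a + 2 := fun a => by ring
  have a3 : ∀ a : ℤ, a - 1 + 1 = a := fun a => by ring
  have a4 : ∀ a : ℤ, a + 1 - 1 = a := fun a => by ring
  have a5 : ∀ a : ℤ, a - 2 + 1 = a - 1 := fun a => by ring
  have a6 : ∀ a : ℤ, a + 2 - 1 = a + 1 := fun a => by ring
  -- For |m| > n − 2 the quadratic identity is not available, but the harmonic of degree n − 2 is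
  -- zero.
  have t1 : (coefC n m * coefD (n - 1) (m - 1) : ℂ) * sphY (n - 2) m θ φ =
      coefF n m * coefF (n - 1) m * sphY (n - 2) m θ φ := by
    rcases lt_or_ge (n - 2) |m| with hlt | hge
    · rw [sphY_eq_zero hlt]; ring
    · exact_mod_cast congrArg (fun t : ℝ => (t : ℂ) * sphY (n - 2) m θ φ) (coefC_mul_coefD hge)
  have t1' : (coefD n m * coefC (n - 1) (m + 1) : ℂ) * sphY (n - 2) m θ φ =
      coefF n m * coefF (n - 1) m * sphY (n - 2) m θ φ := by
    rcases lt_or_ge (n - 2) |m| with hlt | hge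
    · rw [sphY_eq_zero hlt]; ring
    · exact_mod_cast congrArg (fun t : ℝ => (t : ℂ) * sphY (n - 2) m θ φ) (coefD_mul_coefC hge)
  have t2 : (coefC (n + 2) m * coefD (n + 1) (m - 1) : ℂ) =
      coefF (n + 2) m * coefF (n + 1) m := by
    have := coefC_mul_coefD (n := n + 2) (m := m) (by omega)
    rw [a6] at this
    exact_mod_cast this
  have t2' : (coefD (n + 2) m * coefC (n + 1) (m + 1) : ℂ) =
      coefF (n + 2) m * coefF (n + 1) m := by
    have := coefD_mul_coefC (n := n + 2) (m := m) (by omega)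
    rw [a6] at this
    exact_mod_cast this
  have t3 : (coefC n m : ℂ) ^ 2 + (coefD (n + 1) (m - 1) : ℂ) ^ 2 =
      1 - (coefF n m : ℂ) ^ 2 - (coefF (n + 1) m : ℂ) ^ 2 := by
    exact_mod_cast congrArg (fun t : ℝ => (t : ℂ)) (coefC_sq_add hm)
  have t3' : (coefD n m : ℂ) ^ 2 + (coefC (n + 1) (m + 1) : ℂ) ^ 2 =
      1 - (coefF n m : ℂ) ^ 2 - (coefF (n + 1) m : ℂ) ^ 2 := by
    exact_mod_cast congrArg (fun t : ℝ => (t : ℂ)) (coefD_sq_add hm)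
  have hI : Complex.I ^ 2 = -1 := Complex.I_sq
  have hI3 : Complex.I ^ 3 = -Complex.I := by rw [pow_succ, hI]; ring
  simp only [ladderComb, Sminus, Szero, Splus, Matrix.add_apply, Matrix.smul_apply, smul_eq_mul,
    coefA_eq_coefD, coefB_eq_coefC, coefE_eq_coefF, a1, a2, a3, a4, a5, a6]
  clear a1 a2 a3 a4 a5 a6 hm
  generalize n - 2 = nm2 at *
  generalize n - 1 = nm1 at *
  generalize n + 2 = np2 at *
  generalize n + 1 = np1 at *
  generalize m - 2 = mm2 at *
  generalize m - 1 = mm1 at *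
  generalize m + 2 = mp2 at *
  generalize m + 1 = mp1 at *
  fin_cases i <;> fin_cases j <;> first
    | exact absurd hij (by decide)
    | skip
  all_goals
    simp only [dirW, dirAl, dirBe, matA, matB, matC, matD, matE, matP, Fin.zero_eta,
      Fin.mk_one, Fin.reduceFinMk, Matrix.cons_val_zero, Matrix.cons_val_one, Matrix.cons_val,
      Matrix.of_apply, Matrix.cons_val', Matrix.cons_val_fin_one, Complex.ofReal_mul,
      Complex.ofReal_add, Complex.ofReal_sub, Complex.ofReal_div, Complex.ofReal_one,
      Complex.ofReal_ofNat, Complex.ofReal_pow, Complex.ofReal_neg]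
  all_goals ring_nf
  all_goals try simp only [hI, hI3]
  · linear_combination (Complex.I / 4 * h nm2) * (t1 - t1') + (Complex.I / 4 * h np2 *
      sphY np2 m θ φ) * (t2 - t2') - (Complex.I / 4 * h n * sphY n m θ φ) * (t3 + t3')
  · linear_combination (1 / 4 * h nm2) * (t1 - t1') + (1 / 4 * h np2 *
      sphY np2 m θ φ) * (t2 - t2') + (1 / 4 * h n * sphY n m θ φ) * (t3 - t3')
  · linear_combination (Complex.I / 4 * h nm2) * (t1 - t1') + (Complex.I / 4 * h np2 *
      sphY np2 m θ φ) * (t2 - t2') - (Complex.I / 4 * h n * sphY n m θ φ) * (t3 + t3')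
  · ring
  · linear_combination (-Complex.I * h nm2) * t1  + (-Complex.I * h np2 *
      sphY np2 m θ φ) * t2

/-! ### The fundamental solution and its expansion -/

/-- The outgoing fundamental solution `e^{ik|x|} / (4π|x|)` of the Helmholtz equation. -/
def helmG (k : ℝ) (x : E3) : ℂ :=
  Complex.exp (Complex.I * (k * ‖x‖ : ℝ)) / (4 * Real.pi * ‖x‖ : ℝ)

/-- The fundamental matrix `ω⁻² (k_s² G_s δ_ij + ∂_i ∂_j (G_s - G_p))`. -/
def kupMat (lam mu omega : ℝ) (x : E3) : Matrix (Fin 3) (Fin 3) ℂ := fun i j =>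
  1 / (omega : ℂ) ^ 2 * ((if i = j then ((kS mu omega : ℂ)) ^ 2 else 0) * helmG (kS mu omega) x
    + pderiv j (pderiv i (helmG (kS mu omega))) x - pderiv j (pderiv i (helmG (kP lam mu omega))) x)

theorem pderiv_const_mul (j : Fin 3) (c : ℂ) (f : E3 → ℂ) :
    pderiv j (fun x => c * f x) = fun x => c * pderiv j f x := by
  funext x
  have := congrFun (fderiv_const_smul_field (𝕜 := ℝ) (f := f) c) x
  have h2 : (fun x => c * f x) = c • f := rfl
  simp only [pderiv, h2, this]
  simp

theorem harmNorm_zero_sq : harmNorm 0 0 ^ 2 = 1 / (4 * Real.pi) := by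
  rw [harmNorm_sq]; simp

/-- Since h_0(z) = −i e^{iz}/z and (Y_0^0)² = 1/(4π), the scalar fundamental solution is a multiple
of the wave of index (0, 0), to which the addition theorem applies. At x = 0 both sides are zero by
convention. -/
theorem helmG_eq {k : ℝ} (hk : k ≠ 0) :
    helmG k = fun x => (Complex.I * k * harmNorm 0 0) * wave (hankelRad k) 0 0 x := by
  funext x
  have hk' : (k : ℂ) ≠ 0 := by exact_mod_cast hk
  have h2 : (harmNorm 0 0 : ℂ) ^ 2 = 1 / (4 * Real.pi) := by
    have := congrArg (fun t : ℝ => (t : ℂ)) harmNorm_zero_sq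
    push_cast at this
    exact this
  rw [wave, harm_zero_zero, hankelRad, Int.toNat_zero, sphHankel_zero, helmG]
  rcases eq_or_ne x 0 with rfl | hx
  · simp
  have hx' : (‖x‖ : ℂ) ≠ 0 := by exact_mod_cast norm_ne_zero_iff.2 hx
  have hpi : (Real.pi : ℂ) ≠ 0 := by exact_mod_cast Real.pi_ne_zero
  have e : Complex.I * k * harmNorm 0 0 * (-Complex.I * Complex.exp (Complex.I * (k * ‖x‖ : ℝ)) /
      (k * ‖x‖ : ℝ) * harmNorm 0 0) = -(Complex.I ^ 2) * (harmNorm 0 0 : ℂ) ^ 2 *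
      (k * Complex.exp (Complex.I * (k * ‖x‖ : ℝ)) / (k * ‖x‖ : ℝ)) := by ring
  rw [e, h2, Complex.I_sq]
  push_cast
  field_simp

/-- Second derivatives of the outgoing waves. -/
def hessWave (k : ℝ) (i j : Fin 3) (n m : ℤ) (x : E3) : ℂ :=
  pderiv j (pderiv i (wave (hankelRad k) n m)) x

theorem isLadder_hessWave {k : ℝ} (hk : 0 < k) (i j : Fin 3) : IsLadder k (hessWave k i j) :=
  ((isLadder_wave (isRadialFamily_hankel hk)).fderiv (EuclideanSpace.single i 1)).fderiv
    (EuclideanSpace.single j 1)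

/-- The expansion needs a gap of one; two differentiations consume two more. -/
theorem pathBound_hessWave {k : ℝ} (hk : 0 < k) {x y : E3} (hxy : ‖y‖ < ‖x‖) (hy : y ≠ 0)
    (i j : Fin 3) : PathBound k x y 1 (hessWave k i j) := by
  have hL := isLadder_wave (isRadialFamily_hankel hk)
  exact (PathBound.fderiv hxy (hL.fderiv (EuclideanSpace.single i 1))
    (PathBound.fderiv hxy hL ((pathBound_hankel hxy hk hy).mono (by norm_num))
      (EuclideanSpace.single i 1)) (EuclideanSpace.single j 1))

theorem dir_single (i : Fin 3) :
    (((EuclideanSpace.single i (1 : ℝ) : E3) 2 : ℝ) : ℂ) = dirW i ∧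
    ((((EuclideanSpace.single i (1 : ℝ) : E3) 0 : ℝ) : ℂ) -
      Complex.I * ((EuclideanSpace.single i (1 : ℝ) : E3) 1 : ℝ)) / 2 = dirAl i ∧
    ((((EuclideanSpace.single i (1 : ℝ) : E3) 0 : ℝ) : ℂ) +
      Complex.I * ((EuclideanSpace.single i (1 : ℝ) : E3) 1 : ℝ)) / 2 = dirBe i := by
  fin_cases i <;> simp [dirW, dirAl, dirBe]

theorem IsLadder.pderiv_eq {k : ℝ} {X : ℤ → ℤ → E3 → ℂ} (hX : IsLadder k X) (i : Fin 3) (n m : ℤ)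
    {x : E3} (hx : x ≠ 0) : pderiv i (X n m) x =
      k * ladderComb (dirW i) (dirAl i) (dirBe i) (fun n m => X n m x) n m := by
  obtain ⟨h1, h2, h3⟩ := dir_single i
  rw [pderiv, (hX.hasFDerivAt n m x hx).fderiv, ladderL_apply, h1, h2, h3]

theorem ladderComb_const_mul (c w α β : ℂ) (X : ℤ → ℤ → ℂ) (n m : ℤ) :
    ladderComb w α β (fun n m => c * X n m) n m = c * ladderComb w α β X n m := by
  simp only [ladderComb]; ring

theorem hessWave_eq {k : ℝ} (hk : 0 < k) (i j : Fin 3) (n m : ℤ) {x : E3} (hx : x ≠ 0) :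
    hessWave k i j n m x = k ^ 2 * ladderComb (dirW j) (dirAl j) (dirBe j) (fun n m =>
      ladderComb (dirW i) (dirAl i) (dirBe i) (fun n m => wave (hankelRad k) n m x) n m) n m := by
  have hL := isLadder_wave (isRadialFamily_hankel hk)
  have h1 := (hL.fderiv (EuclideanSpace.single i 1)).pderiv_eq j n m hx
  have h2 : (fun n m => fderiv ℝ (wave (hankelRad k) n m) x (EuclideanSpace.single i 1)) =
      fun n m => (k : ℂ) * ladderComb (dirW i) (dirAl i) (dirBe i)
        (fun n m => wave (hankelRad k) n m x) n m := by
    funext n m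
    exact hL.pderiv_eq i n m hx
  rw [h2, ladderComb_const_mul] at h1
  rw [hessWave]
  exact h1.trans (by ring)

theorem pderiv_comm {f : E3 → ℂ} {x : E3} (hf : ContDiffAt ℝ 2 f x) (i j : Fin 3) :
    pderiv i (pderiv j f) x = pderiv j (pderiv i f) x := by
  have hs : IsSymmSndFDerivAt ℝ f x := hf.isSymmSndFDerivAt (by simp)
  have hd : DifferentiableAt ℝ (fderiv ℝ f) x :=
    (hf.fderiv_right (m := 1) (by norm_num)).differentiableAt (by norm_num)
  have key : ∀ a b : Fin 3, pderiv a (pderiv b f) x =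
      fderiv ℝ (fderiv ℝ f) x (EuclideanSpace.single a 1) (EuclideanSpace.single b 1) := by
    intro a b
    have h := (hd.hasFDerivAt.clm_apply (hasFDerivAt_const (EuclideanSpace.single b (1 : ℝ)) x))
    have h' : fderiv ℝ (pderiv b f) x = _ := h.fderiv
    rw [pderiv, h']
    simp
  rw [key, key, hs]

theorem hessWave_comm {k : ℝ} (hk : 0 < k) (i j : Fin 3) (n m : ℤ) {x : E3} (hx : x ≠ 0) :
    hessWave k i j n m x = hessWave k j i n m x :=
  pderiv_comm (((isLadder_wave (isRadialFamily_hankel hk)).contDiffAt n m hx).of_le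
    (WithTop.coe_le_coe.2 le_top)) j i

theorem toPoint_ne_zero {p : SphCoord} (hp : 0 < p.r) : p.toPoint ≠ 0 := by
  rw [← norm_pos_iff, norm_toPoint hp.le]; exact hp

theorem dir_toPoint {p : SphCoord} (hp : p.Admissible) (hr : 0 < p.r) :
    dirZeta p.toPoint = (|Real.sin p.θ| : ℝ) * Complex.exp (Complex.I * p.φ) ∧
      dirCos p.toPoint = Real.cos p.θ := by
  have hr' : (p.r : ℂ) ≠ 0 := by exact_mod_cast hr.ne'
  constructor
  · rw [dirZeta, norm_toPoint hr.le, abs_of_nonneg (Real.sin_nonneg_of_nonneg_of_le_pi hp.2.1 hp.2.2),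
      mul_comm Complex.I (p.φ : ℂ), Complex.exp_mul_I]
    simp only [SphCoord.toPoint, PiLp.toLp_apply, Matrix.cons_val_zero, Matrix.cons_val_one]
    push_cast
    field_simp
  · rw [dirCos, norm_toPoint hr.le]
    simp only [SphCoord.toPoint, PiLp.toLp_apply, Matrix.cons_val]
    field_simp

theorem wave_toPoint (R : ℕ → ℝ → ℂ) (n m : ℤ) {p : SphCoord} (hp : p.Admissible) (hr : 0 < p.r) :
    wave R n m p.toPoint = R n.toNat p.r * sphY n m p.θ p.φ := by
  rw [wave, (dir_toPoint hp hr).1, (dir_toPoint hp hr).2, ← sphY_eq_harm, norm_toPoint hr.le]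

theorem regWave_zero (k : ℝ) (n : ℕ) (m : ℤ) (hn : n ≠ 0) : regWave k n m 0 = 0 := by
  obtain ⟨n, rfl⟩ := Nat.exists_eq_succ_of_ne_zero hn
  rw [regWave, wave, besselRad, Int.toNat_natCast, norm_zero, mul_zero, sphBesselJ_succ_zero]
  simp

/-- At radius zero the angles of q carry no information, but the harmonic of degree 0 is constant
and the Bessel functions of positive order vanish. -/
theorem regWave_toPoint (k : ℝ) (n : ℕ) (m : ℤ) {q : SphCoord} (hq : q.Admissible) :
    regWave k n m q.toPoint = (sphBesselJ n (k * q.r) : ℂ) * conj (sphY n m q.θ q.φ) := by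
  rcases hq.1.eq_or_lt with h | h
  · have h0 : q.toPoint = 0 := by rw [← norm_eq_zero, norm_toPoint hq.1, h]
    rcases eq_or_ne n 0 with rfl | hn
    · rw [regWave, wave, sphY_eq_harm, ← h, besselRad, h0, norm_zero, map_mul, Complex.conj_ofReal,
        Int.toNat_natCast]
      rcases eq_or_ne m 0 with rfl | hm
      · rw [show ((0 : ℕ) : ℤ) = 0 from rfl, harm_zero_zero, harm_zero_zero]
      · rw [harm_of_lt (by simpa using hm), harm_of_lt (by simpa using hm)]
    · rw [h0, regWave_zero k n m hn, ← h, mul_zero]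
      obtain ⟨n, rfl⟩ := Nat.exists_eq_succ_of_ne_zero hn
      rw [sphBesselJ_succ_zero]; simp
  · rw [regWave, wave_toPoint _ n m hq h, map_mul, besselRad, Complex.conj_ofReal, Int.toNat_natCast]

/-- For y = 0 the regular waves of positive degree vanish, so the partial sums are constant from the
first one on. -/
theorem IsLadder.tendsto_expansion_of_norm_lt {k : ℝ} {X : ℤ → ℤ → E3 → ℂ} (hX : IsLadder k X)
    {x y : E3} (hxy : ‖y‖ < ‖x‖) (hB : y ≠ 0 → PathBound k x y 1 X) :
    Filter.Tendsto (fun N : ℕ => ∑ n ∈ Finset.range N, ∑ m ∈ Finset.Icc (-(n : ℤ)) n,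
      X n m x * regWave k n m y) Filter.atTop (nhds (X 0 0 (x - y) * (harmNorm 0 0 : ℂ))) := by
  rcases eq_or_ne y 0 with rfl | hy
  swap
  · exact hX.tendsto_expansion hxy hy (hB hy)
  rw [← Filter.tendsto_add_atTop_iff_nat 1]
  refine tendsto_const_nhds.congr fun N => ?_
  rw [Finset.sum_range_succ', Finset.sum_eq_zero]
  · simp [regWave, wave, besselRad, sphBesselJ_zero_zero, harm_zero_zero]
  · intro n _
    refine Finset.sum_eq_zero fun m _ => ?_
    rw [regWave_zero k (n + 1) m (by omega), mul_zero]

theorem Sminus_comm (n m : ℤ) (θ φ : ℝ) (i j : Fin 3) :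
    Sminus n m θ φ i j = Sminus n m θ φ j i := by
  simp only [Sminus, Matrix.add_apply, Matrix.smul_apply]
  fin_cases i <;> fin_cases j <;> simp [matA, matB, matC, matD, matE]

theorem Szero_comm (n m : ℤ) (θ φ : ℝ) (i j : Fin 3) :
    Szero n m θ φ i j = Szero n m θ φ j i := by
  simp only [Szero, Matrix.add_apply, Matrix.smul_apply]
  fin_cases i <;> fin_cases j <;> simp [matA, matB, matC, matD, matE]

theorem Splus_comm (n m : ℤ) (θ φ : ℝ) (i j : Fin 3) :
    Splus n m θ φ i j = Splus n m θ φ j i := by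
  simp only [Splus, Matrix.add_apply, Matrix.smul_apply]
  fin_cases i <;> fin_cases j <;> simp [matA, matB, matC, matD, matE]

theorem matP_comm (i j : Fin 3) : matP i j = matP j i := by
  fin_cases i <;> fin_cases j <;> simp [matP]

theorem hessWave_toPoint {k : ℝ} (hk : 0 < k) (i j : Fin 3) {n : ℕ} {m : ℤ} (hm : |m| ≤ (n : ℤ))
    {p : SphCoord} (hp : p.Admissible) (hr : 0 < p.r) :
    Complex.I * hessWave k i j n m p.toPoint = k ^ 2 *
      (-(sphHankel (n - 2) (k * p.r) * Sminus n m p.θ p.φ i j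
        + sphHankel n (k * p.r) * Szero n m p.θ p.φ i j
        + sphHankel (n + 2) (k * p.r) * Splus n m p.θ p.φ i j)
      - Complex.I * (matP i j / 2) * (sphHankel n (k * p.r) * sphY n m p.θ p.φ)) := by
  have key : ∀ i j : Fin 3, i ≤ j → Complex.I * hessWave k i j n m p.toPoint = k ^ 2 *
      (-(sphHankel (n - 2) (k * p.r) * Sminus n m p.θ p.φ i j
        + sphHankel n (k * p.r) * Szero n m p.θ p.φ i j
        + sphHankel (n + 2) (k * p.r) * Splus n m p.θ p.φ i j)
      - Complex.I * (matP i j / 2) * (sphHankel n (k * p.r) * sphY n m p.θ p.φ)) := by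
    intro i j hij
    rw [hessWave_eq hk i j n m (toPoint_ne_zero hr)]
    have hw : (fun n m => wave (hankelRad k) n m p.toPoint) =
        fun n m => sphHankel n.toNat (k * p.r) * sphY n m p.θ p.φ := by
      funext n m; exact wave_toPoint _ n m hp hr
    have h := ladderComb_ladderComb_eq hm (fun n => sphHankel n.toNat (k * p.r)) p.θ p.φ hij
    have e1 : ((n : ℤ) - 2).toNat = n - 2 := by omega
    have e2 : ((n : ℤ) + 2).toNat = n + 2 := by omega
    simp only [e1, e2, Int.toNat_natCast] at h
    rw [hw, mul_left_comm, h]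
  rcases le_total i j with hij | hij
  · exact key i j hij
  · rw [hessWave_comm hk i j n m (toPoint_ne_zero hr), key j i hij, Sminus_comm, Szero_comm,
      Splus_comm, matP_comm]

theorem pderiv_pderiv_helmG {k : ℝ} (hk : 0 < k) (i j : Fin 3) (x : E3) :
    pderiv j (pderiv i (helmG k)) x =
      (Complex.I * k * harmNorm 0 0) * hessWave k i j 0 0 x := by
  rw [helmG_eq hk.ne', pderiv_const_mul, pderiv_const_mul]
  rfl

theorem summable_of_converges {T : ℕ → ℤ → SphCoord → SphCoord → Matrix (Fin 3) (Fin 3) ℂ}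
    (hT : ConvergesWithRadialDerivatives T) {p q : SphCoord} (hp : p.Admissible)
    (hq : q.Admissible) (h : ‖q.toPoint‖ < ‖p.toPoint‖) :
    Summable fun n : ℕ => ∑ m ∈ Finset.Icc (-(n : ℤ)) n, T n m p q := by
  have hK := (hT {(p.toPoint, q.toPoint)} isCompact_singleton
    (Set.singleton_subset_iff.2 h)).1
  refine Pi.summable.2 fun i => Pi.summable.2 fun j => ?_
  have := SummableUniformlyOn.summable (hK i j) (x := (p, q)) ⟨hp, hq, rfl⟩
  refine Summable.of_norm_bounded this fun n => ?_
  have e : (∑ m ∈ Finset.Icc (-(n : ℤ)) n, T n m p q) i j =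
      ∑ m ∈ Finset.Icc (-(n : ℤ)) n, T n m p q i j := by
    rw [Matrix.sum_apply]
  rw [e]
  exact norm_sum_le _ _

section series

variable {lam mu omega : ℝ} (h_omega : 0 < omega) (h_mu : 0 < mu) (h_lam : 0 < 2 * mu + lam)

include h_omega h_mu h_lam

/-- The scalar term contributes k_s³ times S + P. The summand −iP/2 in the Hessian formula removes
half of the P part for k_s and supplies one half for k_p, which gives ½H⁺ in Ψ. The matrices S₋, S₀,
S₊ inherit the difference H⁻ from G_s − G_p. -/
theorem terms_add_eq {n : ℕ} {m : ℤ} (hm : |m| ≤ (n : ℤ)) {p q : SphCoord} (hp : p.Admissible)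
    (hq : q.Admissible) (hr : 0 < p.r) (i j : Fin 3) :
    psiTerm lam mu omega n m p q i j + minusTerm lam mu omega n m p q i j
      + zeroTerm lam mu omega n m p q i j + plusTerm lam mu omega n m p q i j =
    1 / (omega : ℂ) ^ 2 * ((if i = j then ((kS mu omega : ℂ)) ^ 2 else 0) * (Complex.I * kS mu omega)
        * (wave (hankelRad (kS mu omega)) n m p.toPoint * regWave (kS mu omega) n m q.toPoint)
      + kS mu omega * Complex.I * (hessWave (kS mu omega) i j n m p.toPoint *
          regWave (kS mu omega) n m q.toPoint)
      - kP lam mu omega * Complex.I * (hessWave (kP lam mu omega) i j n m p.toPoint *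
          regWave (kP lam mu omega) n m q.toPoint)) := by
  have h1 := hessWave_toPoint (kS_pos h_omega h_mu) i j hm hp hr
  have h2 := hessWave_toPoint (kP_pos h_omega h_lam) i j hm hp hr
  have hδ : (if i = j then ((kS mu omega : ℂ)) ^ 2 else 0) =
      (kS mu omega : ℂ) ^ 2 * (matS i j + matP i j) := by
    fin_cases i <;> fin_cases j <;> simp [matS, matP]
  rw [regWave_toPoint _ n m hq, regWave_toPoint _ n m hq, wave_toPoint _ n m hp hr, hδ, hankelRad,
    Int.toNat_natCast]
  simp only [psiTerm, minusTerm, zeroTerm, plusTerm, Matrix.smul_apply, Matrix.add_apply,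
    smul_eq_mul, HfunMinus, HfunPlus, Hfun]
  linear_combination (-(1 / (omega : ℂ) ^ 2) * kS mu omega *
    ((sphBesselJ n (kS mu omega * q.r) : ℂ) * conj (sphY n m q.θ q.φ))) * h1 +
    ((1 / (omega : ℂ) ^ 2) * kP lam mu omega *
    ((sphBesselJ n (kP lam mu omega * q.r) : ℂ) * conj (sphY n m q.θ q.φ))) * h2

theorem tendsto_kupMat {x y : E3} (hxy : ‖y‖ < ‖x‖) (i j : Fin 3) :
    Filter.Tendsto (fun N : ℕ => ∑ n ∈ Finset.range N, ∑ m ∈ Finset.Icc (-(n : ℤ)) n,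
      1 / (omega : ℂ) ^ 2 * ((if i = j then ((kS mu omega : ℂ)) ^ 2 else 0) *
          (Complex.I * kS mu omega)
        * (wave (hankelRad (kS mu omega)) n m x * regWave (kS mu omega) n m y)
      + kS mu omega * Complex.I * (hessWave (kS mu omega) i j n m x * regWave (kS mu omega) n m y)
      - kP lam mu omega * Complex.I * (hessWave (kP lam mu omega) i j n m x *
          regWave (kP lam mu omega) n m y))) Filter.atTop
      (nhds (kupMat lam mu omega (x - y) i j)) := by
  have hs := kS_pos h_omega h_mu
  have hp := kP_pos h_omega h_lam
  have t1 := (isLadder_wave (isRadialFamily_hankel hs)).tendsto_expansion_of_norm_lt hxy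
    fun hy => (pathBound_hankel hxy hs hy).mono (by norm_num)
  have t2 := (isLadder_hessWave hs i j).tendsto_expansion_of_norm_lt hxy
    fun hy => pathBound_hessWave hs hxy hy i j
  have t3 := (isLadder_hessWave hp i j).tendsto_expansion_of_norm_lt hxy
    fun hy => pathBound_hessWave hp hxy hy i j
  have t := (((t1.const_mul ((if i = j then ((kS mu omega : ℂ)) ^ 2 else 0) *
    (Complex.I * kS mu omega))).add (t2.const_mul (kS mu omega * Complex.I))).sub
    (t3.const_mul (kP lam mu omega * Complex.I))).const_mul (1 / (omega : ℂ) ^ 2)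
  have e : kupMat lam mu omega (x - y) i j = 1 / (omega : ℂ) ^ 2 *
      ((if i = j then ((kS mu omega : ℂ)) ^ 2 else 0) * (Complex.I * kS mu omega) *
        (wave (hankelRad (kS mu omega)) 0 0 (x - y) * harmNorm 0 0) +
      kS mu omega * Complex.I * (hessWave (kS mu omega) i j 0 0 (x - y) * harmNorm 0 0) -
      kP lam mu omega * Complex.I * (hessWave (kP lam mu omega) i j 0 0 (x - y) * harmNorm 0 0)) := by
    rw [kupMat, pderiv_pderiv_helmG hs, pderiv_pderiv_helmG hp,
      helmG_eq hs.ne']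
    ring
  rw [e]
  refine t.congr fun N => ?_
  simp only [Finset.mul_sum, ← Finset.sum_add_distrib, ← Finset.sum_sub_distrib]

/-- The addition theorem controls only the partial sums of the four series together; their separate
summability, proved above, allows the limit to be split. -/
theorem kupMat_eq_series {p q : SphCoord} (hp : p.Admissible) (hq : q.Admissible)
    (h : ‖q.toPoint‖ < ‖p.toPoint‖) :
    kupMat lam mu omega (p.toPoint - q.toPoint) =
      doubleSum (psiTerm lam mu omega) p q + doubleSum (minusTerm lam mu omega) p q
        + doubleSum (zeroTerm lam mu omega) p q + doubleSum (plusTerm lam mu omega) p q := by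
  have hr : 0 < p.r := by
    rw [← norm_toPoint hp.1]; exact (norm_nonneg _).trans_lt h
  have s1 := (summable_of_converges
    (converges_psiTerm h_omega h_mu h_lam) hp hq h).hasSum
  have s2 := (summable_of_converges
    (converges_minusTerm h_omega h_mu h_lam) hp hq h).hasSum
  have s3 := (summable_of_converges
    (converges_zeroTerm h_omega h_mu h_lam) hp hq h).hasSum
  have s4 := (summable_of_converges
    (converges_plusTerm h_omega h_mu h_lam) hp hq h).hasSum
  have s := ((s1.add s2).add s3).add s4
  ext i j
  have s' := (Pi.hasSum.1 (Pi.hasSum.1 s i) j).tendsto_sum_nat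
  refine tendsto_nhds_unique ?_ s'
  refine (tendsto_kupMat h_omega h_mu h_lam h i j).congr fun N => ?_
  refine Finset.sum_congr rfl fun n _ => ?_
  simp only [Matrix.add_apply, Matrix.sum_apply, ← Finset.sum_add_distrib]
  refine Finset.sum_congr rfl fun m hm => ?_
  exact (terms_add_eq h_omega h_mu h_lam (abs_le.2 (Finset.mem_Icc.1 hm)) hp hq hr i j).symm

end series

/-! ### Calculus of partial derivatives -/

theorem pderiv_add (i : Fin 3) {f g : E3 → ℂ} {x : E3} (hf : DifferentiableAt ℝ f x)
    (hg : DifferentiableAt ℝ g x) :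
    pderiv i (fun x => f x + g x) x = pderiv i f x + pderiv i g x := by
  rw [pderiv, fderiv_fun_add hf hg]; rfl

theorem pderiv_sub (i : Fin 3) {f g : E3 → ℂ} {x : E3} (hf : DifferentiableAt ℝ f x)
    (hg : DifferentiableAt ℝ g x) :
    pderiv i (fun x => f x - g x) x = pderiv i f x - pderiv i g x := by
  rw [pderiv, fderiv_fun_sub hf hg]; rfl

theorem pderiv_mul (i : Fin 3) {f g : E3 → ℂ} {x : E3} (hf : DifferentiableAt ℝ f x)
    (hg : DifferentiableAt ℝ g x) :
    pderiv i (fun x => f x * g x) x = f x * pderiv i g x + pderiv i f x * g x := by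
  rw [pderiv, fderiv_fun_mul hf hg]
  simp [pderiv, mul_comm]

theorem pderiv_sum (i : Fin 3) {ι : Type*} (s : Finset ι) {f : ι → E3 → ℂ} {x : E3}
    (hf : ∀ a ∈ s, DifferentiableAt ℝ (f a) x) :
    pderiv i (fun x => ∑ a ∈ s, f a x) x = ∑ a ∈ s, pderiv i (f a) x := by
  rw [pderiv, fderiv_fun_sum hf]; simp [pderiv]

theorem pderiv_congr (i : Fin 3) {f g : E3 → ℂ} {x : E3} (h : f =ᶠ[nhds x] g) :
    pderiv i f x = pderiv i g x := by
  rw [pderiv, h.fderiv_eq]; rfl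

theorem eventuallyEq_pderiv (i : Fin 3) {f g : E3 → ℂ} {x : E3} (h : f =ᶠ[nhds x] g) :
    pderiv i f =ᶠ[nhds x] pderiv i g :=
  h.eventuallyEq_nhds.mono fun _ hy => pderiv_congr i hy

theorem contDiffAt_pderiv (i : Fin 3) {f : E3 → ℂ} {x : E3} {m n : WithTop ℕ∞}
    (hf : ContDiffAt ℝ n f x) (hmn : m + 1 ≤ n) : ContDiffAt ℝ m (pderiv i f) x :=
  (hf.fderiv_right hmn).clm_apply contDiffAt_const

theorem contDiffAt_infty_pderiv (i : Fin 3) {f : E3 → ℂ} {x : E3} (hf : ContDiffAt ℝ ∞ f x) :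
    ContDiffAt ℝ ∞ (pderiv i f) x :=
  contDiffAt_pderiv i hf (by simp)

theorem contDiff_pderiv (i : Fin 3) {f : E3 → ℂ} (hf : ContDiff ℝ ∞ f) :
    ContDiff ℝ ∞ (pderiv i f) :=
  contDiff_iff_contDiffAt.2 fun _ => contDiffAt_infty_pderiv i hf.contDiffAt

theorem tsupport_pderiv_subset (i : Fin 3) (f : E3 → ℂ) : tsupport (pderiv i f) ⊆ tsupport f :=
  tsupport_fderiv_apply_subset ℝ _

theorem hasCompactSupport_pderiv (i : Fin 3) {f : E3 → ℂ} (hf : HasCompactSupport f) :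
    HasCompactSupport (pderiv i f) :=
  hf.fderiv_apply (𝕜 := ℝ) _

theorem differentiableAt_of_contDiffAt_infty {f : E3 → ℂ} {x : E3} (hf : ContDiffAt ℝ ∞ f x) :
    DifferentiableAt ℝ f x := hf.differentiableAt (by simp)

theorem contDiffAt_two_of_infty {f : E3 → ℂ} {x : E3} (hf : ContDiffAt ℝ ∞ f x) :
    ContDiffAt ℝ 2 f x := hf.of_le (WithTop.coe_le_coe.2 le_top)

/-- The Laplacian as a sum of second partial derivatives. -/
def lap (f : E3 → ℂ) (x : E3) : ℂ := ∑ i, pderiv i (pderiv i f) x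

theorem laplacian_eq_lap {f : E3 → ℂ} {x : E3} (hf : ContDiffAt ℝ 2 f x) :
    Laplacian.laplacian f x = lap f x := by
  have hd : DifferentiableAt ℝ (fderiv ℝ f) x :=
    (hf.fderiv_right (m := 1) (by norm_num)).differentiableAt (by norm_num)
  rw [InnerProductSpace.laplacian_eq_iteratedFDeriv_orthonormalBasis f
    (EuclideanSpace.basisFun (Fin 3) ℝ)]
  simp only [lap]
  refine Finset.sum_congr rfl fun i _ => ?_
  have h := hd.hasFDerivAt.clm_apply (hasFDerivAt_const (EuclideanSpace.single i (1 : ℝ)) x)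
  have h' : fderiv ℝ (pderiv i f) x = _ := h.fderiv
  rw [pderiv, h', iteratedFDeriv_two_apply]
  simp

theorem lap_congr {f g : E3 → ℂ} {x : E3} (h : f =ᶠ[nhds x] g) : lap f x = lap g x :=
  Finset.sum_congr rfl fun i _ => pderiv_congr i (eventuallyEq_pderiv i h)

theorem lap_const_mul (c : ℂ) (f : E3 → ℂ) (x : E3) : lap (fun x => c * f x) x = c * lap f x := by
  simp only [lap, pderiv_const_mul, Finset.mul_sum]

theorem contDiffAt_lap {f : E3 → ℂ} {x : E3} (hf : ContDiffAt ℝ ∞ f x) :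
    ContDiffAt ℝ ∞ (lap f) x :=
  ContDiffAt.sum fun i _ => contDiffAt_infty_pderiv i (contDiffAt_infty_pderiv i hf)

theorem contDiff_lap {f : E3 → ℂ} (hf : ContDiff ℝ ∞ f) : ContDiff ℝ ∞ (lap f) :=
  contDiff_iff_contDiffAt.2 fun _ => contDiffAt_lap hf.contDiffAt

theorem tsupport_lap_subset (f : E3 → ℂ) : tsupport (lap f) ⊆ tsupport f := by
  refine closure_minimal (fun x hx => ?_) (isClosed_tsupport f)
  by_contra h
  refine hx (Finset.sum_eq_zero fun i _ => ?_)
  have h2 : x ∉ tsupport (pderiv i (pderiv i f)) := fun h3 =>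
    h (tsupport_pderiv_subset i _ (tsupport_pderiv_subset i _ h3))
  exact image_eq_zero_of_notMem_tsupport h2

theorem hasCompactSupport_lap {f : E3 → ℂ} (hf : HasCompactSupport f) : HasCompactSupport (lap f) :=
  hf.of_isClosed_subset (isClosed_tsupport _) (tsupport_lap_subset f)

theorem pderiv_pderiv_comm {f : E3 → ℂ} {x : E3} (hf : ContDiffAt ℝ ∞ f x) (i j : Fin 3) :
    pderiv i (pderiv j f) x = pderiv j (pderiv i f) x :=
  pderiv_comm (contDiffAt_two_of_infty hf) i j

/-- Eventual form of `ContDiffAt`. -/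
theorem eventually_contDiffAt {f : E3 → ℂ} {U : Set E3} (hU : IsOpen U)
    (hf : ∀ x ∈ U, ContDiffAt ℝ ∞ f x) {x : E3} (hx : x ∈ U) :
    ∀ᶠ y in nhds x, ContDiffAt ℝ ∞ f y :=
  Filter.mem_of_superset (hU.mem_nhds hx) hf

theorem pderiv_lap {f : E3 → ℂ} {U : Set E3} (hU : IsOpen U)
    (hf : ∀ x ∈ U, ContDiffAt ℝ ∞ f x) {x : E3} (hx : x ∈ U) (j : Fin 3) :
    pderiv j (lap f) x = lap (pderiv j f) x := by
  have h1 : pderiv j (lap f) x = ∑ i, pderiv j (pderiv i (pderiv i f)) x :=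
    pderiv_sum j _ fun i _ => differentiableAt_of_contDiffAt_infty
      (contDiffAt_infty_pderiv i (contDiffAt_infty_pderiv i (hf x hx)))
  rw [h1, lap]
  refine Finset.sum_congr rfl fun i _ => ?_
  rw [pderiv_pderiv_comm (contDiffAt_infty_pderiv i (hf x hx))]
  refine pderiv_congr i ?_
  filter_upwards [eventually_contDiffAt hU hf hx] with y hy
  exact pderiv_pderiv_comm hy j i

theorem lap_add {f g : E3 → ℂ} {x : E3} (hf : ContDiffAt ℝ ∞ f x) (hg : ContDiffAt ℝ ∞ g x) :
    lap (fun x => f x + g x) x = lap f x + lap g x := by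
  simp only [lap, ← Finset.sum_add_distrib]
  refine Finset.sum_congr rfl fun i _ => ?_
  rw [← pderiv_add i (differentiableAt_of_contDiffAt_infty (contDiffAt_infty_pderiv i hf))
    (differentiableAt_of_contDiffAt_infty (contDiffAt_infty_pderiv i hg))]
  refine pderiv_congr i ?_
  filter_upwards [(hf.of_le (m := 1) (WithTop.coe_le_coe.2 le_top)).eventually (by simp),
    (hg.of_le (m := 1) (WithTop.coe_le_coe.2 le_top)).eventually (by simp)] with y h1 h2
  exact pderiv_add i (h1.differentiableAt (by simp)) (h2.differentiableAt (by simp))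

theorem lap_mul {f g : E3 → ℂ} {x : E3} (hf : ContDiffAt ℝ ∞ f x) (hg : ContDiffAt ℝ ∞ g x) :
    lap (fun x => f x * g x) x =
      lap f x * g x + 2 * (∑ i, pderiv i f x * pderiv i g x) + f x * lap g x := by
  simp only [lap, Finset.sum_mul, Finset.mul_sum, ← Finset.sum_add_distrib]
  refine Finset.sum_congr rfl fun i _ => ?_
  have hf1 := contDiffAt_infty_pderiv i hf
  have hg1 := contDiffAt_infty_pderiv i hg
  have h : pderiv i (fun x => f x * g x) =ᶠ[nhds x]
      fun x => f x * pderiv i g x + pderiv i f x * g x := by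
    filter_upwards [(hf.of_le (m := 1) (WithTop.coe_le_coe.2 le_top)).eventually (by simp),
      (hg.of_le (m := 1) (WithTop.coe_le_coe.2 le_top)).eventually (by simp)] with y h1 h2
    exact pderiv_mul i (h1.differentiableAt (by simp)) (h2.differentiableAt (by simp))
  have d := @differentiableAt_of_contDiffAt_infty
  rw [pderiv_congr i h, pderiv_add i ((d hf).fun_mul (d hg1)) ((d hf1).fun_mul (d hg)),
    pderiv_mul i (d hf) (d hg1), pderiv_mul i (d hf1) (d hg)]
  ring

theorem pderiv_comp_sub (i : Fin 3) (f : E3 → ℂ) (y x : E3) :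
    pderiv i (fun x => f (x - y)) x = pderiv i f (x - y) := by
  rw [pderiv, fderiv_comp_sub]; rfl

theorem pderiv_comp_add (i : Fin 3) (f : E3 → ℂ) (y x : E3) :
    pderiv i (fun x => f (x + y)) x = pderiv i f (x + y) := by
  rw [pderiv, fderiv_comp_add_right]; rfl

theorem pderiv_conj (i : Fin 3) {f : E3 → ℂ} {x : E3} (hf : DifferentiableAt ℝ f x) :
    pderiv i (fun x => conj (f x)) x = conj (pderiv i f x) := by
  have h := (Complex.conjCLE : ℂ →L[ℝ] ℂ).hasFDerivAt.comp x hf.hasFDerivAt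
  have h' : HasFDerivAt (fun x => conj (f x))
    ((Complex.conjCLE : ℂ →L[ℝ] ℂ).comp (fderiv ℝ f x)) x := h
  rw [pderiv, h'.fderiv]; rfl

/-! ### Integration by parts -/

/-- Nothing is required of f off the support of ψ. The lemmas on integration by parts share this
form, so that f may have poles there. -/
theorem integrable_mul_of_continuousAt_tsupport {f ψ : E3 → ℂ} (hψ : Continuous ψ)
    (hc : HasCompactSupport ψ) (hf : ∀ x ∈ tsupport ψ, ContinuousAt f x) :
    MeasureTheory.Integrable (fun x => f x * ψ x) := by
  refine Continuous.integrable_of_hasCompactSupport (continuous_of_tsupport fun x hx =>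
    (hf x (tsupport_mul_subset_right hx)).mul hψ.continuousAt) hc.mul_left

theorem integral_mul_pderiv {f ψ : E3 → ℂ} (i : Fin 3) (hψ : ContDiff ℝ ∞ ψ)
    (hc : HasCompactSupport ψ) (hf : ∀ x ∈ tsupport ψ, ContDiffAt ℝ 1 f x) :
    ∫ x, f x * pderiv i ψ x = -∫ x, pderiv i f x * ψ x := by
  refine integral_mul_fderiv_eq_neg_fderiv_mul_of_integrable ?_ ?_ ?_
    (fun x hx => (hf x hx).differentiableAt (by simp))
    (fun x _ => hψ.differentiable (by simp) x)
  · exact integrable_mul_of_continuousAt_tsupport hψ.continuous hc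
      fun x hx => (contDiffAt_pderiv (m := 0) i (hf x hx) (by simp)).continuousAt
  · exact integrable_mul_of_continuousAt_tsupport (contDiff_pderiv i hψ).continuous
      (hasCompactSupport_pderiv i hc) fun x hx =>
        (hf x (tsupport_pderiv_subset i ψ hx)).continuousAt
  · exact integrable_mul_of_continuousAt_tsupport hψ.continuous hc
      fun x hx => (hf x hx).continuousAt

theorem integral_mul_pderiv_pderiv {f ψ : E3 → ℂ} (i j : Fin 3) (hψ : ContDiff ℝ ∞ ψ)
    (hc : HasCompactSupport ψ) (hf : ∀ x ∈ tsupport ψ, ContDiffAt ℝ 2 f x) :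
    ∫ x, f x * pderiv i (pderiv j ψ) x = ∫ x, pderiv j (pderiv i f) x * ψ x := by
  rw [integral_mul_pderiv i (contDiff_pderiv j hψ) (hasCompactSupport_pderiv j hc)
    (fun x hx => (hf x (tsupport_pderiv_subset j ψ hx)).of_le (by norm_num)),
    integral_mul_pderiv j hψ hc fun x hx => contDiffAt_pderiv i (hf x hx) (by norm_num), neg_neg]

theorem integral_mul_lap {f ψ : E3 → ℂ} (hψ : ContDiff ℝ ∞ ψ)
    (hc : HasCompactSupport ψ) (hf : ∀ x ∈ tsupport ψ, ContDiffAt ℝ 2 f x) :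
    ∫ x, f x * lap ψ x = ∫ x, lap f x * ψ x := by
  simp only [lap, Finset.mul_sum, Finset.sum_mul]
  rw [MeasureTheory.integral_finsetSum, MeasureTheory.integral_finsetSum]
  · exact Finset.sum_congr rfl fun i _ => integral_mul_pderiv_pderiv i i hψ hc hf
  · intro i _
    exact integrable_mul_of_continuousAt_tsupport hψ.continuous hc fun x hx =>
      (contDiffAt_pderiv (m := 0) i (contDiffAt_pderiv (m := 1) i (hf x hx) (by norm_num))
        (by simp)).continuousAt
  · intro i _
    have hψ1 := contDiff_pderiv i hψ
    exact integrable_mul_of_continuousAt_tsupport (contDiff_pderiv i hψ1).continuous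
      (hasCompactSupport_pderiv i (hasCompactSupport_pderiv i hc)) fun x hx =>
      (hf x (tsupport_pderiv_subset i ψ (tsupport_pderiv_subset i _ hx))).continuousAt

/-! ### Functions of the regularised radius -/

/-- The regularised radius `√(|x|² + ε²)`. -/
def regNorm (ε : ℝ) (x : E3) : ℝ := √(‖x‖ ^ 2 + ε ^ 2)

theorem regNorm_pos {ε : ℝ} {x : E3} (h : ε ≠ 0 ∨ x ≠ 0) : 0 < regNorm ε x := by
  refine Real.sqrt_pos.2 ?_
  rcases h with h | h
  · have := sq_pos_of_ne_zero h; positivity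
  · have := norm_pos_iff.2 h; positivity

theorem regNorm_zero (x : E3) : regNorm 0 x = ‖x‖ := by simp [regNorm]

theorem norm_le_regNorm (ε : ℝ) (x : E3) : ‖x‖ ≤ regNorm ε x :=
  Real.le_sqrt_of_sq_le (by nlinarith [sq_nonneg ε])

theorem regNorm_sq (ε : ℝ) (x : E3) : regNorm ε x ^ 2 = ‖x‖ ^ 2 + ε ^ 2 :=
  Real.sq_sqrt (by positivity)

theorem continuous_regNorm (ε : ℝ) : Continuous (regNorm ε) := by unfold regNorm; fun_prop

theorem hasFDerivAt_regNorm {ε : ℝ} {x : E3} (h : 0 < regNorm ε x) :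
    HasFDerivAt (regNorm ε) ((regNorm ε x)⁻¹ • innerSL ℝ x) x := by
  have h1 : HasFDerivAt (fun x : E3 => ‖x‖ ^ 2 + ε ^ 2) (2 • innerSL ℝ x) x :=
    (hasStrictFDerivAt_norm_sq x).hasFDerivAt.add_const _
  have h2 := h1.sqrt (Real.sqrt_pos.1 h).ne'
  refine h2.congr_fderiv ?_
  ext v
  simp only [regNorm, smul_apply, innerSL_apply_apply, smul_eq_mul, nsmul_eq_mul]
  push_cast
  ring

theorem pderiv_regNorm_comp {ε : ℝ} {x : E3} (h : 0 < regNorm ε x) {f : ℝ → ℂ} {f' : ℂ}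
    (hf : HasDerivAt f f' (regNorm ε x)) (i : Fin 3) :
    DifferentiableAt ℝ (fun x => f (regNorm ε x)) x ∧
    pderiv i (fun x => f (regNorm ε x)) x = (x i : ℂ) * (f' / regNorm ε x) := by
  have h1 := hf.hasFDerivAt.comp x (hasFDerivAt_regNorm h)
  refine ⟨h1.differentiableAt, ?_⟩
  have h2 : HasFDerivAt (fun x => f (regNorm ε x)) _ x := h1
  have h3 : ⟪x, EuclideanSpace.single i (1 : ℝ)⟫_ℝ = x i := by
    rw [inner_E3]; fin_cases i <;> simp
  rw [pderiv, h2.fderiv]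
  simp [h3]
  ring

theorem pderiv_pderiv_regNorm_comp {ε : ℝ} {x : E3} (h : 0 < regNorm ε x) {f f1 f2 : ℝ → ℂ}
    (hf : ∀ s, 0 < s → HasDerivAt f (f1 s) s) (hf1 : ∀ s, 0 < s → HasDerivAt f1 (f2 s) s)
    (i j : Fin 3) :
    pderiv j (pderiv i (fun x => f (regNorm ε x))) x =
      (if i = j then 1 else 0) * (f1 (regNorm ε x) / regNorm ε x) +
      (x i : ℂ) * (x j : ℂ) * (f2 (regNorm ε x) / regNorm ε x ^ 2
        - f1 (regNorm ε x) / regNorm ε x ^ 3) := by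
  have he : pderiv i (fun x => f (regNorm ε x)) =ᶠ[nhds x]
      fun x => coordL i x * (fun s : ℝ => f1 s / s) (regNorm ε x) := by
    filter_upwards [(continuous_regNorm ε).continuousAt.eventually (lt_mem_nhds h)] with y hy
    exact (pderiv_regNorm_comp hy (hf _ hy) i).2
  have hs : (regNorm ε x : ℂ) ≠ 0 := by exact_mod_cast h.ne'
  have hg : HasDerivAt (fun s : ℝ => f1 s / (s : ℂ)) ((f2 (regNorm ε x) * regNorm ε x -
      f1 (regNorm ε x) * 1) / (regNorm ε x : ℂ) ^ 2) (regNorm ε x) :=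
    (hf1 _ h).div (Complex.ofRealCLM.hasDerivAt) hs
  obtain ⟨hd, hp⟩ := pderiv_regNorm_comp h hg j
  rw [pderiv_congr j he, pderiv_mul j (coordL i).differentiableAt hd, hp]
  have h3 : pderiv j (coordL i) x = if i = j then 1 else 0 := by
    rw [pderiv, ContinuousLinearMap.fderiv]
    by_cases hij : i = j <;> simp [hij]
  rw [h3, coordL_apply]
  field_simp
  ring

/-- The usual radial Laplacian, plus a term with factor ε² that arises because |x|² = s² − ε². -/
theorem lap_regNorm_comp {ε : ℝ} {x : E3} (h : 0 < regNorm ε x) {f f1 f2 : ℝ → ℂ}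
    (hf : ∀ s, 0 < s → HasDerivAt f (f1 s) s) (hf1 : ∀ s, 0 < s → HasDerivAt f1 (f2 s) s) :
    lap (fun x => f (regNorm ε x)) x = f2 (regNorm ε x) + 2 * f1 (regNorm ε x) / regNorm ε x +
      (ε : ℂ) ^ 2 / regNorm ε x ^ 2 * (f1 (regNorm ε x) / regNorm ε x - f2 (regNorm ε x)) := by
  have hs : (regNorm ε x : ℂ) ≠ 0 := by exact_mod_cast h.ne'
  have h2 : ((x 0 : ℂ)) ^ 2 + (x 1 : ℂ) ^ 2 + (x 2 : ℂ) ^ 2 = (regNorm ε x : ℂ) ^ 2 - ε ^ 2 := by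
    have := regNorm_sq ε x
    rw [norm_sq_E3] at this
    have := congrArg (fun t : ℝ => (t : ℂ)) this
    push_cast at this
    rw [this]; ring
  simp only [lap, pderiv_pderiv_regNorm_comp h hf hf1, if_true, Fin.sum_univ_three]
  generalize f1 (regNorm ε x) = a
  generalize f2 (regNorm ε x) = b
  generalize (regNorm ε x : ℂ) = s at *
  have e : ∀ t : ℂ, 1 * (a / s) + (x 0 : ℂ) * x 0 * t + (1 * (a / s) + (x 1 : ℂ) * x 1 * t) +
      (1 * (a / s) + (x 2 : ℂ) * x 2 * t) = 3 * (a / s) + (s ^ 2 - ε ^ 2) * t := by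
    intro t; rw [← h2]; ring
  rw [e]
  field_simp
  ring

theorem contDiffAt_regNorm {ε : ℝ} {x : E3} (h : 0 < regNorm ε x) :
    ContDiffAt ℝ ∞ (regNorm ε) x :=
  ContDiffAt.sqrt ((contDiff_norm_sq ℝ).add contDiff_const).contDiffAt (Real.sqrt_pos.1 h).ne'

open MeasureTheory Filter Topology

/-! ### Integrable singularities -/

theorem locallyIntegrable_one_add_inv_norm (M : ℝ) :
    LocallyIntegrable (fun x : E3 => M * (1 + ‖x‖⁻¹)) := by
  have h : LocallyIntegrable (fun x : E3 => ‖x‖⁻¹) := by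
    refine locallyIntegrable_of_norm_le_rpow (C := 1) (α := 1) (by simp) (by simp) ?_ ?_
    · refine Eventually.of_forall fun x => ?_
      rw [Real.rpow_neg_one, norm_inv, norm_norm, one_mul]
    · exact (by fun_prop : Measurable fun x : E3 => ‖x‖⁻¹).aestronglyMeasurable
  exact ((locallyIntegrable_const (1 : ℝ)).add h).smul M

theorem aestronglyMeasurable_of_continuousOn_compl {f : E3 → ℂ} {y : E3}
    (hf : ContinuousOn f {y}ᶜ) : AEStronglyMeasurable f := by
  have := hf.aestronglyMeasurable (μ := volume) (measurableSet_singleton y).compl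
  rwa [restrict_compl_singleton] at this

/-- A function with at most an inverse first power singularity is locally integrable. -/
theorem locallyIntegrable_of_bound {f : E3 → ℂ} (hf : ContinuousOn f {0}ᶜ)
    (hb : ∀ R : ℝ, ∃ M : ℝ, ∀ x : E3, x ≠ 0 → ‖x‖ ≤ R → ‖f x‖ ≤ M * (1 + ‖x‖⁻¹)) :
    LocallyIntegrable f := by
  intro z
  obtain ⟨M, hM⟩ := hb (‖z‖ + 1)
  obtain ⟨u, hu, hi⟩ := locallyIntegrable_one_add_inv_norm M z
  refine ⟨u ∩ Metric.ball z 1, inter_mem hu (Metric.ball_mem_nhds z one_pos), ?_⟩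
  have hi' := hi.mono_set (Set.inter_subset_left (t := Metric.ball z 1))
  refine Integrable.mono' hi' (
    aestronglyMeasurable_of_continuousOn_compl hf).restrict ?_
  have h1 : ∀ᵐ x ∂(volume.restrict (u ∩ Metric.ball z 1)), x ≠ (0 : E3) :=
    ae_restrict_of_ae (by simp [ae_iff])
  have h2 : ∀ᵐ x ∂(volume.restrict (u ∩ Metric.ball z 1)), x ∈ Metric.ball z 1 :=
    ae_restrict_of_ae_restrict_of_subset Set.inter_subset_right
      (ae_restrict_mem measurableSet_ball)
  filter_upwards [h1, h2] with x hx hxz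
  refine hM x hx ?_
  have : ‖x - z‖ < 1 := by rwa [← dist_eq_norm]
  linarith [norm_le_norm_add_norm_sub' x z]

theorem integrable_mul_of_locallyIntegrable {f ψ : E3 → ℂ} (hf : LocallyIntegrable f)
    (hψ : Continuous ψ) (hc : HasCompactSupport ψ) : Integrable (fun x => f x * ψ x) :=
  hf.integrable_smul_right_of_hasCompactSupport hψ hc

theorem integrable_one_add_inv_norm_mul (M : ℝ) {ψ : E3 → ℂ} (hψ : Continuous ψ)
    (hc : HasCompactSupport ψ) : Integrable (fun x => M * (1 + ‖x‖⁻¹) * ‖ψ x‖) :=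
  (locallyIntegrable_one_add_inv_norm M).integrable_smul_right_of_hasCompactSupport
    hψ.norm hc.norm

theorem exists_norm_bound_of_hasCompactSupport {ψ : E3 → ℂ} (hc : HasCompactSupport ψ) :
    ∃ R : ℝ, 0 ≤ R ∧ ∀ x, R < ‖x‖ → ψ x = 0 := by
  obtain ⟨R, hR⟩ := hc.isBounded.exists_norm_le
  refine ⟨max R 0, le_max_right _ _, fun x hx => ?_⟩
  by_contra h
  exact absurd (hR x (subset_tsupport _ h)) (not_le.2 (lt_of_le_of_lt (le_max_left _ _) hx))

/-- Passage to the limit `ε → 0` in integrals of regularised radial kernels. -/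
theorem tendsto_integral_mul_of_bound {F : ℝ → E3 → ℂ} {ψ : E3 → ℂ} (hψ : Continuous ψ)
    (hc : HasCompactSupport ψ) (hF : ∀ ε, 0 < ε → Continuous (F ε))
    (hb : ∀ R : ℝ, ∃ M : ℝ, ∀ ε, 0 < ε → ε ≤ 1 → ∀ x : E3, x ≠ 0 → ‖x‖ ≤ R →
      ‖F ε x‖ ≤ M * (1 + ‖x‖⁻¹))
    (hl : ∀ x : E3, x ≠ 0 → Tendsto (fun ε => F ε x) (𝓝[>] 0) (𝓝 (F 0 x))) :
    Tendsto (fun ε => ∫ x, F ε x * ψ x) (𝓝[>] 0) (𝓝 (∫ x, F 0 x * ψ x)) := by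
  obtain ⟨R, hR0, hR⟩ := exists_norm_bound_of_hasCompactSupport hc
  obtain ⟨M, hM⟩ := hb R
  have hne : ∀ᵐ x : E3, x ≠ 0 := by simp [ae_iff]
  refine tendsto_integral_filter_of_dominated_convergence _ ?_ ?_
    (integrable_one_add_inv_norm_mul M hψ hc) ?_
  · filter_upwards [self_mem_nhdsWithin] with ε hε
    exact ((hF ε hε).mul hψ).aestronglyMeasurable
  · filter_upwards [Ioc_mem_nhdsGT (zero_lt_one' ℝ)] with ε hε
    filter_upwards [hne] with x hx
    rw [norm_mul]
    rcases le_or_gt ‖x‖ R with h | h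
    · exact mul_le_mul_of_nonneg_right (hM ε hε.1 hε.2 x hx h) (norm_nonneg _)
    · simp [hR x h]
  · filter_upwards [hne] with x hx
    exact (hl x hx).mul_const _

theorem tendsto_regNorm (x : E3) : Tendsto (fun ε => regNorm ε x) (𝓝[>] 0) (𝓝 ‖x‖) := by
  have h : Continuous fun ε => regNorm ε x := by unfold regNorm; fun_prop
  have := h.tendsto 0
  rw [regNorm_zero] at this
  exact this.mono_left nhdsWithin_le_nhds

/-! ### The integral of `(1 + |u|²)^(-5/2)` -/

/-- An explicit primitive of the radial density of (1 + |u|²)^{-5/2} in polar coordinates. -/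
theorem hasDerivAt_cube_div (y : ℝ) :
    HasDerivAt (fun y : ℝ => (y / √(y ^ 2 + 1)) ^ 3 / 3) (y ^ 2 * (√(y ^ 2 + 1) ^ 5)⁻¹) y := by
  have hp : 0 < y ^ 2 + 1 := by positivity
  have h1 : HasDerivAt (fun y : ℝ => y ^ 2 + 1) (2 * y) y := by
    simpa using (hasDerivAt_pow 2 y).add_const 1
  have hs : 0 < √(y ^ 2 + 1) := Real.sqrt_pos.2 hp
  have h2 := (((hasDerivAt_id y).div (h1.sqrt hp.ne') hs.ne').pow 3).div_const 3
  refine h2.congr_deriv ?_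
  have hq : √(y ^ 2 + 1) ^ 2 = y ^ 2 + 1 := Real.sq_sqrt hp.le
  simp only [id, Pi.div_apply]
  generalize √(y ^ 2 + 1) = s at *
  have e : 1 * s - y * (2 * y / (2 * s)) = 1 / s := by
    field_simp; linarith
  rw [e]
  push_cast

  field_simp

theorem tendsto_cube_div :
    Tendsto (fun y : ℝ => (y / √(y ^ 2 + 1)) ^ 3 / 3) atTop (𝓝 (1 / 3)) := by
  have h1 : Tendsto (fun y : ℝ => √((y ^ 2)⁻¹ + 1)) atTop (𝓝 1) := by
    have : Tendsto (fun y : ℝ => (y ^ 2)⁻¹ + 1) atTop (𝓝 (0 + 1)) :=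
      (tendsto_inv_atTop_zero.comp (tendsto_pow_atTop two_ne_zero)).add_const 1
    simpa [Function.comp_def] using (Real.continuous_sqrt.tendsto _).comp this
  have h2 : Tendsto (fun y : ℝ => ((√((y ^ 2)⁻¹ + 1))⁻¹) ^ 3 / 3) atTop (𝓝 ((1⁻¹) ^ 3 / 3)) :=
    ((h1.inv₀ one_ne_zero).pow 3).div_const 3
  norm_num at h2 ⊢
  refine h2.congr' ?_
  filter_upwards [eventually_gt_atTop 0] with y hy
  have : √(y ^ 2 + 1) = y * √((y ^ 2)⁻¹ + 1) := by
    rw [show y ^ 2 + 1 = y ^ 2 * ((y ^ 2)⁻¹ + 1) by field_simp; ring, Real.sqrt_mul (by positivity),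
      Real.sqrt_sq hy.le]
  rw [this, div_mul_cancel_left₀ hy.ne']
  simp

theorem regNorm_one (x : E3) : regNorm 1 x = √(‖x‖ ^ 2 + 1) := by simp [regNorm]

theorem integrable_regNorm_one : Integrable (fun u : E3 => (regNorm 1 u ^ 5)⁻¹) := by
  simp only [regNorm_one]
  rw [integrable_fun_norm_addHaar volume (f := fun y => (√(y ^ 2 + 1) ^ 5)⁻¹)]
  have := integrableOn_Ioi_deriv_of_nonneg' (a := (0 : ℝ)) (fun x _ => hasDerivAt_cube_div x)
    (fun x _ => by positivity) tendsto_cube_div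
  simpa using this

theorem integral_regNorm_one : ∫ u : E3, (regNorm 1 u ^ 5)⁻¹ = 4 * Real.pi / 3 := by
  simp only [regNorm_one]
  rw [integral_fun_norm_addHaar volume (fun y => (√(y ^ 2 + 1) ^ 5)⁻¹)]
  have := integral_Ioi_of_hasDerivAt_of_nonneg' (a := (0 : ℝ)) (fun x _ => hasDerivAt_cube_div x)
    (fun x _ => by positivity) tendsto_cube_div
  have hv : volume.real (Metric.ball (0 : E3) 1) = Real.pi * 4 / 3 := by
    rw [Measure.real, EuclideanSpace.volume_ball_fin_three]
    simp [ENNReal.toReal_ofReal (by positivity : 0 ≤ Real.pi * 4 / 3)]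
  rw [hv]
  simp only [finrank_euclideanSpace, Fintype.card_fin, smul_eq_mul, nsmul_eq_mul]
  norm_num at this ⊢
  rw [this]
  ring

/-! ### The outgoing fundamental solution of the Helmholtz equation -/

/-- The radial profile of `helmG`. -/
def helmF (k s : ℝ) : ℂ := Complex.exp (Complex.I * (k * s : ℝ)) / (4 * Real.pi * s : ℝ)

theorem helmG_eq_helmF (k : ℝ) : helmG k = fun x => helmF k (regNorm 0 x) := by
  funext x; rw [regNorm_zero]; rfl

theorem norm_helmF {k s : ℝ} (hs : 0 < s) : ‖helmF k s‖ = (4 * Real.pi * s)⁻¹ := by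
  rw [helmF, norm_div, mul_comm Complex.I, Complex.norm_exp_ofReal_mul_I, Complex.norm_real,
    Real.norm_of_nonneg (by positivity), one_div]

theorem hasDerivAt_helmF (k : ℝ) {s : ℝ} (hs : 0 < s) :
    HasDerivAt (helmF k) ((Complex.I * k - 1 / s) * helmF k s) s := by
  have hs' : (s : ℂ) ≠ 0 := by exact_mod_cast hs.ne'
  have hpi : (Real.pi : ℂ) ≠ 0 := by exact_mod_cast Real.pi_ne_zero
  have h1 : HasDerivAt (fun s : ℝ => Complex.I * ((k * s : ℝ) : ℂ)) (Complex.I * k) s := by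
    simpa using (((hasDerivAt_id s).const_mul k).ofReal_comp).const_mul Complex.I
  have h2 : HasDerivAt (fun s : ℝ => ((4 * Real.pi * s : ℝ) : ℂ)) (4 * Real.pi) s := by
    simpa using ((hasDerivAt_id s).const_mul (4 * Real.pi)).ofReal_comp
  have h3 := h1.cexp.div h2 (by push_cast; simp [hpi, hs'])
  refine h3.congr_deriv ?_
  rw [helmF]
  push_cast
  field_simp

theorem hasDerivAt_helmF_deriv (k : ℝ) {s : ℝ} (hs : 0 < s) :
    HasDerivAt (fun s : ℝ => (Complex.I * k - 1 / s) * helmF k s)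
      ((-k ^ 2 - 2 * Complex.I * k / s + 2 / s ^ 2) * helmF k s) s := by
  have hs' : (s : ℂ) ≠ 0 := by exact_mod_cast hs.ne'
  have h1 : HasDerivAt (fun s : ℝ => Complex.I * k - 1 / (s : ℂ)) (1 / (s : ℂ) ^ 2) s := by
    have := ((hasDerivAt_id s).ofReal_comp.inv hs').const_sub (Complex.I * k)
    simp only [one_div]
    refine this.congr_deriv ?_
    simp [neg_div]
  refine (h1.mul (hasDerivAt_helmF k hs)).congr_deriv ?_
  linear_combination (helmF k s) * (k : ℂ) ^ 2 * Complex.I_sq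

/-- The defect of the regularised fundamental solution. -/
def helmDefect (k s : ℝ) : ℂ :=
  Complex.exp (Complex.I * (k * s : ℝ)) * (k ^ 2 * s ^ 2 + 3 * Complex.I * k * s - 3) /
    (4 * Real.pi)

/-- The defect is an approximation of −δ: under x = εu it becomes a multiple of (1 + |u|²)^{-5/2}
with mass tending to −3/(4π) · 4π/3 = −1. -/
theorem lap_helmF_regNorm (k : ℝ) {ε : ℝ} {x : E3} (h : 0 < regNorm ε x) :
    lap (fun x => helmF k (regNorm ε x)) x =
      -k ^ 2 * helmF k (regNorm ε x) + ε ^ 2 * helmDefect k (regNorm ε x) / regNorm ε x ^ 5 := by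
  rw [lap_regNorm_comp h (fun s hs => hasDerivAt_helmF k hs)
    (fun s hs => hasDerivAt_helmF_deriv k hs)]
  have hs' : (regNorm ε x : ℂ) ≠ 0 := by exact_mod_cast h.ne'
  have hpi : (Real.pi : ℂ) ≠ 0 := by exact_mod_cast Real.pi_ne_zero
  rw [helmF, helmDefect]
  push_cast
  generalize (regNorm ε x : ℂ) = s at *
  field_simp
  ring

theorem contDiffAt_helmF (k : ℝ) {s : ℝ} (hs : 0 < s) : ContDiffAt ℝ ∞ (helmF k) s := by
  have hpi := Real.pi_ne_zero
  have h1 : ContDiff ℝ ∞ (fun s : ℝ => ((k * s : ℝ) : ℂ)) :=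
    Complex.ofRealCLM.contDiff.comp (contDiff_const.mul contDiff_id)
  have h2 : ContDiff ℝ ∞ (fun s : ℝ => ((4 * Real.pi * s : ℝ) : ℂ)) :=
    Complex.ofRealCLM.contDiff.comp (contDiff_const.mul contDiff_id)
  have h3 : ((4 * Real.pi * s : ℝ) : ℂ) ≠ 0 := by have := hs.ne'; simp [hpi, this]
  have h4 := (contDiff_const (c := Complex.I)).mul h1
  have h5 := h4.cexp.contDiffAt.mul (h2.contDiffAt.inv h3)
  exact h5

theorem contDiffAt_helmF_regNorm (k : ℝ) {ε : ℝ} {x : E3} (h : 0 < regNorm ε x) :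
    ContDiffAt ℝ ∞ (fun x => helmF k (regNorm ε x)) x :=
  (contDiffAt_helmF k h).comp x (contDiffAt_regNorm h)

theorem contDiffAt_helmG (k : ℝ) {x : E3} (hx : x ≠ 0) : ContDiffAt ℝ ∞ (helmG k) x := by
  rw [helmG_eq_helmF]
  exact contDiffAt_helmF_regNorm k (regNorm_pos (Or.inr hx))

theorem lap_helmG (k : ℝ) {x : E3} (hx : x ≠ 0) : lap (helmG k) x = -k ^ 2 * helmG k x := by
  rw [helmG_eq_helmF, lap_helmF_regNorm k (regNorm_pos (Or.inr hx))]
  simp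

theorem norm_helmF_regNorm_le (k ε : ℝ) {x : E3} (hx : x ≠ 0) :
    ‖helmF k (regNorm ε x)‖ ≤ 1 * (1 + ‖x‖⁻¹) := by
  have h0 := norm_pos_iff.2 hx
  rw [norm_helmF (regNorm_pos (Or.inr hx)), mul_inv]
  have h1 : (regNorm ε x)⁻¹ ≤ ‖x‖⁻¹ := inv_anti₀ h0 (norm_le_regNorm ε x)
  have h2 : (4 * Real.pi)⁻¹ ≤ 1 := inv_le_one_of_one_le₀ (by linarith [Real.pi_gt_three])
  have h3 : 0 ≤ (regNorm ε x)⁻¹ := inv_nonneg.2 (Real.sqrt_nonneg _)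
  have h4 : (4 * Real.pi)⁻¹ * (regNorm ε x)⁻¹ ≤ 1 * (regNorm ε x)⁻¹ :=
    mul_le_mul_of_nonneg_right h2 h3
  linarith

theorem locallyIntegrable_helmG (k : ℝ) : LocallyIntegrable (helmG k) := by
  refine locallyIntegrable_of_bound
    (fun x hx => (contDiffAt_helmG k hx).continuousAt.continuousWithinAt) fun R => ⟨1, ?_⟩
  intro x hx _
  have := norm_helmF_regNorm_le k 0 hx
  rwa [regNorm_zero] at this

theorem tendsto_integral_helmF_mul (k : ℝ) {θ : E3 → ℂ} (hθ : Continuous θ)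
    (hc : HasCompactSupport θ) :
    Tendsto (fun ε => ∫ x, helmF k (regNorm ε x) * θ x) (𝓝[>] 0) (𝓝 (∫ x, helmG k x * θ x)) := by
  rw [helmG_eq_helmF]
  refine tendsto_integral_mul_of_bound (F := fun ε x => helmF k (regNorm ε x)) hθ hc ?_ ?_ ?_
  · intro ε hε
    exact continuous_iff_continuousAt.2 fun x =>
      (contDiffAt_helmF_regNorm k (regNorm_pos (Or.inl hε.ne'))).continuousAt
  · exact fun R => ⟨1, fun ε _ _ x hx _ => norm_helmF_regNorm_le k ε hx⟩
  · intro x hx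
    rw [regNorm_zero]
    exact (contDiffAt_helmF k (norm_pos_iff.2 hx)).continuousAt.tendsto.comp (tendsto_regNorm x)

/-- The Helmholtz operator is moved to the kernel, where only the defect survives; then x = εu is
substituted. The powers ε² of the defect, ε³ of the Jacobian and ε^{-5} of the denominator cancel.
-/
theorem integral_helmF_regNorm_mul (k : ℝ) {ε : ℝ} (hε : 0 < ε) {ψ : E3 → ℂ}
    (hψ : ContDiff ℝ ∞ ψ) (hc : HasCompactSupport ψ) :
    ∫ x, helmF k (regNorm ε x) * (lap ψ x + k ^ 2 * ψ x) =
      ∫ u, helmDefect k (ε * regNorm 1 u) * ψ (ε • u) * ((regNorm 1 u ^ 5)⁻¹ : ℝ) := by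
  have hN : ∀ x, 0 < regNorm ε x := fun x => regNorm_pos (Or.inl hε.ne')
  have hF : ∀ x, ContDiffAt ℝ ∞ (fun x => helmF k (regNorm ε x)) x := fun x =>
    contDiffAt_helmF_regNorm k (hN x)
  have hFc : ∀ x, ContinuousAt (fun x => helmF k (regNorm ε x)) x := fun x => (hF x).continuousAt
  have i1 : Integrable fun x => helmF k (regNorm ε x) * lap ψ x :=
    integrable_mul_of_continuousAt_tsupport (contDiff_lap hψ).continuous
      (hasCompactSupport_lap hc) fun x _ => hFc x
  have i2 : Integrable fun x => helmF k (regNorm ε x) * ψ x :=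
    integrable_mul_of_continuousAt_tsupport hψ.continuous hc fun x _ => hFc x
  have i3 : Integrable fun x => lap (fun x => helmF k (regNorm ε x)) x * ψ x :=
    integrable_mul_of_continuousAt_tsupport hψ.continuous hc
      fun x _ => (contDiffAt_lap (hF x)).continuousAt
  have e1 : ∀ x, helmF k (regNorm ε x) * (lap ψ x + k ^ 2 * ψ x) =
      helmF k (regNorm ε x) * lap ψ x + (k : ℂ) ^ 2 * (helmF k (regNorm ε x) * ψ x) :=
    fun x => by ring
  simp only [e1]
  rw [integral_add i1 (i2.const_mul _),
    integral_mul_lap hψ hc fun x _ => contDiffAt_two_of_infty (hF x),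
    ← integral_add i3 (i2.const_mul _)]
  have e2 := Measure.integral_comp_smul (volume : Measure E3)
    (fun x => lap (fun x => helmF k (regNorm ε x)) x * ψ x +
      (k : ℂ) ^ 2 * (helmF k (regNorm ε x) * ψ x)) ε
  have e3 : ∀ t : ℂ, t = (ε : ℂ) ^ 3 * (|(ε ^ Module.finrank ℝ E3)⁻¹| • t) := by
    intro t
    have : (ε : ℂ) ≠ 0 := by exact_mod_cast hε.ne'
    rw [abs_of_nonneg (by positivity), Complex.real_smul]
    simp
    field_simp
  rw [e3 (∫ x, _), ← e2, ← integral_const_mul]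
  refine integral_congr_ae (Eventually.of_forall fun u => ?_)
  have hr : regNorm ε (ε • u) = ε * regNorm 1 u := by
    rw [regNorm, regNorm, norm_smul, Real.norm_of_nonneg hε.le,
      show (ε * ‖u‖) ^ 2 + ε ^ 2 = ε ^ 2 * (‖u‖ ^ 2 + 1 ^ 2) by ring,
      Real.sqrt_mul (by positivity), Real.sqrt_sq hε.le]
  have h1 : (regNorm 1 u : ℂ) ≠ 0 := by exact_mod_cast (regNorm_pos (Or.inl one_ne_zero)).ne'
  have h2 : (ε : ℂ) ≠ 0 := by exact_mod_cast hε.ne'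
  simp only [lap_helmF_regNorm k (hN _), hr]
  push_cast
  field_simp
  ring

theorem continuous_helmDefect (k : ℝ) : Continuous (helmDefect k) := by
  unfold helmDefect; fun_prop

theorem exists_bound_of_continuous {f : ℝ → ℂ} (hf : Continuous f) (R : ℝ) :
    ∃ M, 0 ≤ M ∧ ∀ s, 0 ≤ s → s ≤ R → ‖f s‖ ≤ M := by
  obtain ⟨M, hM⟩ := (isCompact_Icc (a := (0 : ℝ)) (b := R)).exists_bound_of_continuousOn
    hf.continuousOn
  exact ⟨max M 0, le_max_right _ _, fun s h0 h1 => (hM s ⟨h0, h1⟩).trans (le_max_left _ _)⟩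

theorem regNorm_le (ε : ℝ) (x : E3) : regNorm ε x ≤ ‖x‖ + |ε| := by
  refine Real.sqrt_le_iff.2 ⟨by positivity, ?_⟩
  nlinarith [sq_abs ε, norm_nonneg x, abs_nonneg ε, mul_nonneg (norm_nonneg x) (abs_nonneg ε)]

theorem contDiff_helmholtz (k : ℝ) {ψ : E3 → ℂ} (hψ : ContDiff ℝ ∞ ψ) :
    ContDiff ℝ ∞ (fun x => lap ψ x + (k : ℂ) ^ 2 * ψ x) :=
  (contDiff_lap hψ).add (contDiff_const.mul hψ)

theorem hasCompactSupport_helmholtz (k : ℝ) {ψ : E3 → ℂ} (hc : HasCompactSupport ψ) :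
    HasCompactSupport (fun x => lap ψ x + (k : ℂ) ^ 2 * ψ x) := by
  have h : HasCompactSupport (fun x => (k : ℂ) ^ 2 * ψ x) := hc.mul_left
  exact HasCompactSupport.add (hasCompactSupport_lap hc) h

/-- `helmG k` is a fundamental solution of the Helmholtz equation. -/
theorem integral_helmG_mul (k : ℝ) {ψ : E3 → ℂ} (hψ : ContDiff ℝ ∞ ψ)
    (hc : HasCompactSupport ψ) : ∫ x, helmG k x * (lap ψ x + k ^ 2 * ψ x) = -ψ 0 := by
  have l1 := tendsto_integral_helmF_mul k (contDiff_helmholtz k hψ).continuous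
    (hasCompactSupport_helmholtz k hc)
  have l2 : Tendsto (fun ε => ∫ u, helmDefect k (ε * regNorm 1 u) *
    ψ (ε • u) * ((regNorm 1 u ^ 5)⁻¹ : ℝ)) (𝓝[>] 0) (𝓝 (∫ x, helmG k x *
      (lap ψ x + k ^ 2 * ψ x))) := by
    refine l1.congr' ?_
    filter_upwards [self_mem_nhdsWithin] with ε hε
    exact integral_helmF_regNorm_mul k hε hψ hc
  refine tendsto_nhds_unique l2 ?_
  obtain ⟨R, hR0, hR⟩ := exists_norm_bound_of_hasCompactSupport hc
  -- Where ψ(εu) ≠ 0 and ε ≤ 1 one has ε|u| ≤ R, so the argument of `helmDefect` is at most R + 1.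
  obtain ⟨M, hM0, hM⟩ := exists_bound_of_continuous (continuous_helmDefect k) (R + 1)
  obtain ⟨N, hN⟩ := hc.exists_bound_of_continuous hψ.continuous
  have hN0 : 0 ≤ N := (norm_nonneg _).trans (hN 0)
  have e : -ψ 0 = ∫ u : E3, helmDefect k 0 * ψ 0 * ((regNorm 1 u ^ 5)⁻¹ : ℝ) := by
    rw [integral_const_mul, integral_complex_ofReal, integral_regNorm_one, helmDefect]
    have hpi : (Real.pi : ℂ) ≠ 0 := by exact_mod_cast Real.pi_ne_zero
    push_cast
    simp
    field_simp
  rw [e]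
  refine tendsto_integral_filter_of_dominated_convergence
    (fun u => M * N * (regNorm 1 u ^ 5)⁻¹) ?_ ?_ (integrable_regNorm_one.const_mul _) ?_
  · refine Eventually.of_forall fun ε => Continuous.aestronglyMeasurable ?_
    have h1 : Continuous fun u : E3 => (regNorm 1 u ^ 5)⁻¹ :=
      ((continuous_regNorm 1).pow 5).inv₀ fun u =>
        pow_ne_zero 5 (regNorm_pos (Or.inl one_ne_zero)).ne'
    have h2 : Continuous fun u : E3 => helmDefect k (ε * regNorm 1 u) :=
      (continuous_helmDefect k).comp (continuous_const.mul (continuous_regNorm 1))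
    have h3 : Continuous fun u : E3 => ψ (ε • u) := hψ.continuous.comp (continuous_const_smul ε)
    have h4 : Continuous fun u : E3 => (((regNorm 1 u ^ 5)⁻¹ : ℝ) : ℂ) :=
      Complex.continuous_ofReal.comp h1
    exact (h2.mul h3).mul h4
  · filter_upwards [Ioc_mem_nhdsGT (zero_lt_one' ℝ)] with ε hε
    refine Eventually.of_forall fun u => ?_
    have h5 : 0 ≤ (regNorm 1 u ^ 5)⁻¹ := inv_nonneg.2 (pow_nonneg (Real.sqrt_nonneg _) 5)
    rw [norm_mul, norm_mul, Complex.norm_real, Real.norm_of_nonneg h5]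
    refine mul_le_mul_of_nonneg_right ?_ h5
    rcases le_or_gt ‖ε • u‖ R with h | h
    · refine mul_le_mul (hM _ (mul_nonneg hε.1.le (Real.sqrt_nonneg _)) ?_) (hN _)
        (norm_nonneg _) hM0
      rw [norm_smul, Real.norm_of_nonneg hε.1.le] at h
      have := mul_le_mul_of_nonneg_left (regNorm_le 1 u) hε.1.le
      rw [abs_one] at this
      linarith [hε.2]
    · rw [hR _ h]; simp; positivity
  · refine Eventually.of_forall fun u => Tendsto.mul_const _ (Tendsto.mul ?_ ?_)
    · have h : Continuous fun ε : ℝ => helmDefect k (ε * regNorm 1 u) :=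
        (continuous_helmDefect k).comp (continuous_mul_const _)
      have := h.tendsto 0
      rw [zero_mul] at this
      exact this.mono_left nhdsWithin_le_nhds
    · have h : Continuous fun ε : ℝ => ψ (ε • u) := hψ.continuous.comp (by fun_prop)
      have := h.tendsto 0
      rw [zero_smul] at this
      exact this.mono_left nhdsWithin_le_nhds

/-! ### The difference of two fundamental solutions -/

/-- The poles at s = 0 cancel: (e^{ikz} − e^{ilz})/z has a removable singularity, and `dslope` is
its entire extension. -/
theorem exists_smooth_profile (k l : ℝ) : ∃ f : ℝ → ℂ, ContDiff ℝ ∞ f ∧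
    ∀ s, s ≠ 0 → f s = helmF k s - helmF l s := by
  set e : ℂ → ℂ := fun z => Complex.exp (Complex.I * (k * z)) - Complex.exp (Complex.I * (l * z))
    with he
  have hd : Differentiable ℂ e := by rw [he]; fun_prop
  have hd2 : Differentiable ℂ (dslope e 0) := by
    rw [← differentiableOn_univ] at hd ⊢
    exact (Complex.differentiableOn_dslope univ_mem).2 hd
  refine ⟨fun s => dslope e 0 s / (4 * Real.pi), ?_, ?_⟩
  · exact (((hd2.contDiff (n := ∞)).restrict_scalars ℝ).comp Complex.ofRealCLM.contDiff).div_const _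
  · intro s hs
    have hs' : (s : ℂ) ≠ 0 := by exact_mod_cast hs
    have hpi : (Real.pi : ℂ) ≠ 0 := by exact_mod_cast Real.pi_ne_zero
    show dslope e 0 s / (4 * Real.pi) = _
    rw [dslope_of_ne _ hs', slope_def_field, he, helmF, helmF]
    push_cast
    simp
    field_simp

theorem hasDerivAt_of_contDiff {f : ℝ → ℂ} (hf : ContDiff ℝ ∞ f) (s : ℝ) :
    HasDerivAt f (deriv f s) s := (hf.differentiable (by simp) s).hasDerivAt

theorem contDiff_deriv {f : ℝ → ℂ} (hf : ContDiff ℝ ∞ f) : ContDiff ℝ ∞ (deriv f) :=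
  (contDiff_infty_iff_deriv.1 hf).2

theorem norm_coord_le (x : E3) (i : Fin 3) : ‖(x i : ℂ)‖ ≤ ‖x‖ := by
  rw [Complex.norm_real]; exact PiLp.norm_apply_le x i

/-- Since f' need not vanish at 0, the Hessian of f(|x|) contains terms of size f'/|x|. A
first-order pole is still integrable, and the bound is uniform in ε. -/
theorem hessian_regNorm_bound {f : ℝ → ℂ} (hf : ContDiff ℝ ∞ f) (i j : Fin 3) (R : ℝ) :
    ∃ M : ℝ, ∀ ε, |ε| ≤ 1 → ∀ x : E3, x ≠ 0 → ‖x‖ ≤ R →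
      ‖pderiv j (pderiv i (fun x => f (regNorm ε x))) x‖ ≤ M * (1 + ‖x‖⁻¹) := by
  have hf1 := contDiff_deriv hf
  have hf2 := contDiff_deriv hf1
  obtain ⟨M, hM0, hM⟩ := exists_bound_of_continuous hf1.continuous (R + 1)
  obtain ⟨N, hN0, hN⟩ := exists_bound_of_continuous hf2.continuous (R + 1)
  refine ⟨2 * M + N, fun ε hε x hx hR => ?_⟩
  have h := regNorm_pos (ε := ε) (Or.inr hx)
  have hx0 := norm_pos_iff.2 hx
  have hr : regNorm ε x ≤ R + 1 := (regNorm_le ε x).trans (add_le_add hR hε)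
  have hM := hM _ h.le hr
  have hN := hN _ h.le hr
  rw [pderiv_pderiv_regNorm_comp h (fun s _ => hasDerivAt_of_contDiff hf s)
    (fun s _ => hasDerivAt_of_contDiff hf1 s)]
  have hle := norm_le_regNorm ε x
  have hxi := (norm_coord_le x i).trans hle
  have hxj := (norm_coord_le x j).trans hle
  have hinv : (regNorm ε x)⁻¹ ≤ ‖x‖⁻¹ := inv_anti₀ hx0 hle
  set s := regNorm ε x
  have b1 : ‖((if i = j then 1 else 0) * (deriv f s / s) : ℂ)‖ ≤ M * s⁻¹ := by
    rw [norm_mul, norm_div, Complex.norm_real, Real.norm_of_nonneg h.le]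
    have : ‖(if i = j then 1 else 0 : ℂ)‖ ≤ 1 := by split_ifs <;> simp
    rw [← div_eq_mul_inv]
    refine (mul_le_of_le_one_left (by positivity) this).trans ?_
    gcongr
  have b2 : ‖((x i : ℂ) * (x j : ℂ) * (deriv (deriv f) s / s ^ 2 - deriv f s / s ^ 3) : ℂ)‖ ≤
      s * s * (N / s ^ 2 + M / s ^ 3) := by
    rw [norm_mul, norm_mul]
    refine mul_le_mul (mul_le_mul hxi hxj (norm_nonneg _) h.le) ?_ (norm_nonneg _) (by positivity)
    refine (norm_sub_le _ _).trans ?_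
    rw [norm_div, norm_div, norm_pow, norm_pow, Complex.norm_real, Real.norm_of_nonneg h.le]
    gcongr
  refine (norm_add_le _ _).trans ((add_le_add b1 b2).trans ?_)
  have e : M * s⁻¹ + s * s * (N / s ^ 2 + M / s ^ 3) = N + 2 * M * s⁻¹ := by
    field_simp; ring
  rw [e]
  have : M * s⁻¹ ≤ M * ‖x‖⁻¹ := mul_le_mul_of_nonneg_left hinv hM0
  have : 0 ≤ N * ‖x‖⁻¹ := by positivity
  nlinarith

theorem helmG_sub_eventuallyEq {f : ℝ → ℂ} {k l : ℝ}
    (hf : ∀ s, s ≠ 0 → f s = helmF k s - helmF l s) {x : E3} (hx : x ≠ 0) :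
    (fun x => helmG k x - helmG l x) =ᶠ[𝓝 x] fun x => f (regNorm 0 x) := by
  filter_upwards [isOpen_ne.mem_nhds hx] with y hy
  rw [hf _ (regNorm_pos (Or.inr hy)).ne', helmG_eq_helmF, helmG_eq_helmF]

theorem hessian_helmG_sub {f : ℝ → ℂ} {k l : ℝ}
    (hf : ∀ s, s ≠ 0 → f s = helmF k s - helmF l s) (i j : Fin 3) {x : E3} (hx : x ≠ 0) :
    pderiv j (pderiv i (helmG k)) x - pderiv j (pderiv i (helmG l)) x =
      pderiv j (pderiv i (fun x => f (regNorm 0 x))) x := by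
  have d := @differentiableAt_of_contDiffAt_infty
  have hk := contDiffAt_helmG k hx
  have hl := contDiffAt_helmG l hx
  rw [← pderiv_sub j (d (contDiffAt_infty_pderiv i hk)) (d (contDiffAt_infty_pderiv i hl))]
  refine pderiv_congr j ?_
  filter_upwards [isOpen_ne.mem_nhds hx] with y hy
  rw [← pderiv_congr i (helmG_sub_eventuallyEq hf hy),
    pderiv_sub i (d (contDiffAt_helmG k hy)) (d (contDiffAt_helmG l hy))]

theorem locallyIntegrable_hessian_helmG_sub (k l : ℝ) (i j : Fin 3) :
    LocallyIntegrable
      (fun x => pderiv j (pderiv i (helmG k)) x - pderiv j (pderiv i (helmG l)) x) := by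
  obtain ⟨f, hf, hfe⟩ := exists_smooth_profile k l
  refine locallyIntegrable_of_bound (fun x hx => ?_) fun R => ?_
  · exact ((contDiffAt_infty_pderiv j (contDiffAt_infty_pderiv i (contDiffAt_helmG k hx))).sub
      (contDiffAt_infty_pderiv j (contDiffAt_infty_pderiv i
        (contDiffAt_helmG l hx)))).continuousAt.continuousWithinAt
  · obtain ⟨M, hM⟩ := hessian_regNorm_bound hf i j R
    refine ⟨M, fun x hx hR => ?_⟩
    rw [hessian_helmG_sub hfe i j hx]
    exact hM 0 (by simp) x hx hR

theorem contDiffAt_comp_regNorm {f : ℝ → ℂ} (hf : ContDiff ℝ ∞ f) {ε : ℝ} {x : E3}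
    (h : 0 < regNorm ε x) : ContDiffAt ℝ ∞ (fun x => f (regNorm ε x)) x :=
  hf.contDiffAt.comp x (contDiffAt_regNorm h)

/-- The Hessian of the difference of two fundamental solutions, in the sense of distributions. -/
theorem integral_hessian_helmG_sub_mul (k l : ℝ) (i j : Fin 3) {ψ : E3 → ℂ} (hψ : ContDiff ℝ ∞ ψ)
    (hc : HasCompactSupport ψ) :
    ∫ x, (pderiv j (pderiv i (helmG k)) x - pderiv j (pderiv i (helmG l)) x) * ψ x =
      ∫ x, (helmG k x - helmG l x) * pderiv i (pderiv j ψ) x := by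
  obtain ⟨f, hf, hfe⟩ := exists_smooth_profile k l
  have hne : ∀ᵐ x : E3, x ≠ 0 := by simp [ae_iff]
  have hpos : ∀ ε : ℝ, 0 < ε → ∀ x, 0 < regNorm ε x := fun ε h x => regNorm_pos (Or.inl h.ne')
  have hs : ∀ ε : ℝ, 0 < ε → ∀ x, ContDiffAt ℝ ∞ (fun x => f (regNorm ε x)) x := fun ε h x =>
    contDiffAt_comp_regNorm hf (hpos ε h x)
  have l1 : Tendsto (fun ε => ∫ x, pderiv j (pderiv i (fun x => f (regNorm ε x))) x * ψ x)
      (𝓝[>] 0) (𝓝 (∫ x, pderiv j (pderiv i (fun x => f (regNorm 0 x))) x * ψ x)) := by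
    refine tendsto_integral_mul_of_bound
      (F := fun ε => pderiv j (pderiv i (fun x => f (regNorm ε x)))) hψ.continuous hc ?_ ?_ ?_
    · intro ε hε
      exact continuous_iff_continuousAt.2 fun x =>
        (contDiffAt_infty_pderiv j (contDiffAt_infty_pderiv i (hs ε hε x))).continuousAt
    · intro R
      obtain ⟨M, hM⟩ := hessian_regNorm_bound hf i j R
      exact ⟨M, fun ε h0 h1 x hx hR => hM ε (by rwa [abs_of_pos h0]) x hx hR⟩
    · intro x hx
      have h1 : ∀ ε : ℝ, pderiv j (pderiv i (fun x => f (regNorm ε x))) x = _ := fun ε =>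
        pderiv_pderiv_regNorm_comp (regNorm_pos (Or.inr hx))
          (fun s _ => hasDerivAt_of_contDiff hf s)
          (fun s _ => hasDerivAt_of_contDiff (contDiff_deriv hf) s) i j
      simp only [h1]
      rw [regNorm_zero]
      have hx' : (‖x‖ : ℂ) ≠ 0 := by exact_mod_cast norm_ne_zero_iff.2 hx
      have t1 := tendsto_regNorm x
      have t2 : Tendsto (fun ε => (regNorm ε x : ℂ)) (𝓝[>] 0) (𝓝 ‖x‖) :=
        (Complex.continuous_ofReal.tendsto _).comp t1
      have t3 := ((contDiff_deriv hf).continuous.tendsto _).comp t1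
      have t4 := ((contDiff_deriv (contDiff_deriv hf)).continuous.tendsto _).comp t1
      exact ((t3.div t2 hx').const_mul _).add (((t4.div (t2.pow 2) (pow_ne_zero 2 hx')).sub
        (t3.div (t2.pow 3) (pow_ne_zero 3 hx'))).const_mul _)
  have l2 : Tendsto (fun ε => ∫ x, f (regNorm ε x) * pderiv i (pderiv j ψ) x)
      (𝓝[>] 0) (𝓝 (∫ x, f (regNorm 0 x) * pderiv i (pderiv j ψ) x)) := by
    refine tendsto_integral_mul_of_bound (F := fun ε x => f (regNorm ε x))
      (contDiff_pderiv i (contDiff_pderiv j hψ)).continuous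
      (hasCompactSupport_pderiv i (hasCompactSupport_pderiv j hc)) ?_ ?_ ?_
    · exact fun ε _ => hf.continuous.comp (continuous_regNorm ε)
    · intro R
      obtain ⟨M, hM0, hM⟩ := exists_bound_of_continuous hf.continuous (R + 1)
      refine ⟨M, fun ε h0 h1 x hx hR => (hM _ (Real.sqrt_nonneg _) ((regNorm_le ε x).trans
        (add_le_add hR (by rwa [abs_of_pos h0])))).trans ?_⟩
      have : 0 ≤ M * ‖x‖⁻¹ := by positivity
      linarith
    · intro x hx
      rw [regNorm_zero]
      exact (hf.continuous.tendsto _).comp (tendsto_regNorm x)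
  have e1 : ∫ x, (pderiv j (pderiv i (helmG k)) x - pderiv j (pderiv i (helmG l)) x) * ψ x =
      ∫ x, pderiv j (pderiv i (fun x => f (regNorm 0 x))) x * ψ x := by
    refine integral_congr_ae ?_
    filter_upwards [hne] with x hx
    rw [hessian_helmG_sub hfe i j hx]
  have e2 : ∫ x, (helmG k x - helmG l x) * pderiv i (pderiv j ψ) x =
      ∫ x, f (regNorm 0 x) * pderiv i (pderiv j ψ) x := by
    refine integral_congr_ae ?_
    filter_upwards [hne] with x hx
    have := (helmG_sub_eventuallyEq hfe hx).self_of_nhds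
    simp only at this
    rw [this]
  rw [e1, e2]
  -- For ε > 0 the kernel is smooth everywhere and the two integrals agree by parts.
  refine tendsto_nhds_unique (l1.congr' ?_) l2
  filter_upwards [self_mem_nhdsWithin] with ε hε
  exact (integral_mul_pderiv_pderiv i j hψ hc
    fun x _ => contDiffAt_two_of_infty (hs ε hε x)).symm

/-! ### The Sommerfeld radiation condition for scalar functions -/

/-- The outgoing Sommerfeld condition for scalar functions. -/
def SommerfeldScalar (k : ℝ) (v : E3 → ℂ) : Prop :=
  Tendsto (fun x : E3 => (‖x‖ : ℂ) * (fderiv ℝ v x (‖x‖⁻¹ • x) - Complex.I * k * v x))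
    (cocompact E3) (𝓝 0)

theorem eventually_norm_ge (R : ℝ) : ∀ᶠ x in cocompact E3, R ≤ ‖x‖ :=
  (tendsto_norm_cocompact_atTop (E := E3)).eventually_ge_atTop R

theorem eventually_ne_cocompact (y : E3) : ∀ᶠ x in cocompact E3, x ≠ y :=
  isCompact_singleton.compl_mem_cocompact

theorem sommerfeldRadiating_iff {k : ℝ} {v : E3 → Fin 3 → ℂ} {y : E3}
    (hv : ∀ x, x ≠ y → ∀ i, DifferentiableAt ℝ (fun x => v x i) x) :
    SommerfeldRadiating k v ↔ ∀ i, SommerfeldScalar k (fun x => v x i) := by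
  rw [SommerfeldRadiating, tendsto_pi_nhds]
  refine forall_congr' fun i => ?_
  rw [SommerfeldScalar]
  refine tendsto_congr' ?_
  filter_upwards [eventually_ne_cocompact y] with x hx
  have h : HasFDerivAt v _ x := hasFDerivAt_pi.2 fun i => (hv x hx i).hasFDerivAt
  rw [h.fderiv]
  simp

theorem SommerfeldScalar.congr {k : ℝ} {v w : E3 → ℂ} {y : E3} (hv : SommerfeldScalar k v)
    (h : ∀ x, x ≠ y → v x = w x) : SommerfeldScalar k w := by
  refine Tendsto.congr' ?_ hv
  filter_upwards [eventually_ne_cocompact y] with x hx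
  have : v =ᶠ[𝓝 x] w := by
    filter_upwards [isOpen_ne.mem_nhds hx] with z hz using h z hz
  rw [this.fderiv_eq, h x hx]

theorem SommerfeldScalar.add {k : ℝ} {v w : E3 → ℂ} {y : E3} (hv : SommerfeldScalar k v)
    (hw : SommerfeldScalar k w) (hdv : ∀ x, x ≠ y → DifferentiableAt ℝ v x)
    (hdw : ∀ x, x ≠ y → DifferentiableAt ℝ w x) : SommerfeldScalar k (fun x => v x + w x) := by
  have := Tendsto.add hv hw
  rw [add_zero] at this
  refine this.congr' ?_
  filter_upwards [eventually_ne_cocompact y] with x hx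
  rw [fderiv_fun_add (hdv x hx) (hdw x hx), add_apply]
  ring

theorem SommerfeldScalar.const_mul {k : ℝ} {v : E3 → ℂ} (c : ℂ) (hv : SommerfeldScalar k v) :
    SommerfeldScalar k (fun x => c * v x) := by
  have := Tendsto.const_mul c hv
  rw [mul_zero] at this
  refine this.congr fun x => ?_
  have h2 : fderiv ℝ (fun x => c * v x) x = c • fderiv ℝ v x :=
    congrFun (fderiv_const_smul_field (𝕜 := ℝ) (f := v) c) x
  rw [h2, smul_apply, smul_eq_mul]
  ring

theorem SommerfeldScalar.sub {k : ℝ} {v w : E3 → ℂ} {y : E3} (hv : SommerfeldScalar k v)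
    (hw : SommerfeldScalar k w) (hdv : ∀ x, x ≠ y → DifferentiableAt ℝ v x)
    (hdw : ∀ x, x ≠ y → DifferentiableAt ℝ w x) : SommerfeldScalar k (fun x => v x - w x) := by
  have := hv.add (hw.const_mul (-1)) hdv fun x hx => (hdw x hx).const_mul _
  simpa [sub_eq_add_neg] using this

/-! ### Outgoing waves are radiating -/

/-- The harmonic is constant on the ray through x, so the radial derivative acts on h_n(kr) alone
and `sphHankel_asymptotics` applies. -/
theorem wave_bound {k : ℝ} (hk : 0 < k) (n m : ℤ) : ∃ C : ℝ, 0 ≤ C ∧ ∀ x : E3, 1 ≤ k * ‖x‖ →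
    ‖wave (hankelRad k) n m x‖ ≤ C / ‖x‖ ∧
    ‖fderiv ℝ (wave (hankelRad k) n m) x (‖x‖⁻¹ • x) - Complex.I * k * wave (hankelRad k) n m x‖
      ≤ C / ‖x‖ ^ 2 := by
  rcases lt_or_ge n 0 with hn | hn
  · have h : wave (hankelRad k) n m = fun _ => 0 := funext fun x => wave_of_neg _ hn m x
    exact ⟨0, le_rfl, fun x _ => by simp [h]⟩
  lift n to ℕ using hn
  obtain ⟨C, hC0, hC⟩ := sphHankel_asymptotics n
  refine ⟨(C / k) * √(2 * n + 1), by positivity, fun x hx => ?_⟩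
  have hx0 : x ≠ 0 := by rintro rfl; simp at hx; linarith
  have hr : 0 < ‖x‖ := norm_pos_iff.2 hx0
  obtain ⟨h1, h2⟩ := hC _ hx
  have hY := harm_bound n m (norm_dirZeta_sq hx0)
  set Y := harm n m (dirZeta x) (dirCos x) with hYdef
  constructor
  · rw [wave, norm_mul, Int.toNat_natCast, hankelRad]
    calc _ ≤ C / (k * ‖x‖) * √(2 * n + 1) := by gcongr
      _ = _ := by field_simp
  · have hray : ∀ s : ℝ, 0 < s → wave (hankelRad k) n m (s • (‖x‖⁻¹ • x)) =
        sphHankel n (k * s) * Y := by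
      intro s hs
      have hns : ‖s • (‖x‖⁻¹ • x)‖ = s := by
        rw [norm_smul, norm_smul, norm_inv, norm_norm, inv_mul_cancel₀ hr.ne', mul_one,
          Real.norm_of_nonneg hs.le]
      have e1 : dirZeta (s • (‖x‖⁻¹ • x)) = dirZeta x := by
        have hs' : (s : ℂ) ≠ 0 := by exact_mod_cast hs.ne'
        have hr' : (‖x‖ : ℂ) ≠ 0 := by exact_mod_cast hr.ne'
        rw [dirZeta, dirZeta, hns]
        simp
        field_simp
      have e2 : dirCos (s • (‖x‖⁻¹ • x)) = dirCos x := by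
        rw [dirCos, dirCos, hns]
        simp
        field_simp
      rw [wave, hns, e1, e2, Int.toNat_natCast, hankelRad]
    have hxx : ‖x‖ • (‖x‖⁻¹ • x) = x := by rw [smul_smul, mul_inv_cancel₀ hr.ne', one_smul]
    have hW : DifferentiableAt ℝ (wave (hankelRad k) n m) x :=
      ((isLadder_wave (isRadialFamily_hankel hk)).hasFDerivAt n m x hx0).differentiableAt
    have d1 : HasDerivAt (fun s : ℝ => wave (hankelRad k) n m (s • (‖x‖⁻¹ • x)))
        (fderiv ℝ (wave (hankelRad k) n m) x (‖x‖⁻¹ • x)) ‖x‖ := by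
      have hs : HasDerivAt (fun s : ℝ => s • (‖x‖⁻¹ • x)) (‖x‖⁻¹ • x) ‖x‖ := by
        simpa using (hasDerivAt_id ‖x‖).smul_const (‖x‖⁻¹ • x)
      have hW' : HasFDerivAt (wave (hankelRad k) n m) (fderiv ℝ (wave (hankelRad k) n m) x)
        (‖x‖ • (‖x‖⁻¹ • x)) := by rw [hxx]; exact hW.hasFDerivAt
      exact hW'.comp_hasDerivAt _ hs
    have d2 : HasDerivAt (fun s : ℝ => sphHankel n (k * s) * Y)
        (k * deriv (sphHankel n) (k * ‖x‖) * Y) ‖x‖ := by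
      have h := (hasDerivAt_sphHankel n (mul_pos hk hr).ne').differentiableAt.hasDerivAt
      have h' := h.scomp ‖x‖ ((hasDerivAt_id ‖x‖).const_mul k)
      simp only [mul_one] at h'
      refine (h'.mul_const Y).congr_deriv ?_
      simp
    have d3 := d1.congr_of_eventuallyEq (f₁ := fun s : ℝ => sphHankel n (k * s) * Y) (by
      filter_upwards [lt_mem_nhds hr] with s hs
      exact (hray s hs).symm)
    rw [d3.unique d2]
    have e : wave (hankelRad k) n m x = sphHankel n (k * ‖x‖) * Y := by
      have := hray _ hr
      rwa [hxx] at this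
    rw [e, show (k : ℂ) * deriv (sphHankel n) (k * ‖x‖) * Y -
      Complex.I * k * (sphHankel n (k * ‖x‖) * Y) =
      k * (deriv (sphHankel n) (k * ‖x‖) - Complex.I * sphHankel n (k * ‖x‖)) * Y by ring,
      norm_mul, norm_mul, Complex.norm_real, Real.norm_of_nonneg hk.le]
    calc _ ≤ k * (C / (k * ‖x‖) ^ 2) * √(2 * n + 1) := by gcongr
      _ = _ := by field_simp

/-- By the ladder relations the full gradient is a combination of waves, each of size O(1/|x|). -/
theorem norm_fderiv_wave_le {k : ℝ} (hk : 0 < k) (n m : ℤ) : ∃ C : ℝ, 0 ≤ C ∧ ∀ x : E3,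
    1 ≤ k * ‖x‖ → ∀ e : E3, ‖fderiv ℝ (wave (hankelRad k) n m) x e‖ ≤ C / ‖x‖ * ‖e‖ := by
  obtain ⟨C1, h10, h1⟩ := wave_bound hk (n - 1) m
  obtain ⟨C2, h20, h2⟩ := wave_bound hk (n + 1) m
  obtain ⟨C3, h30, h3⟩ := wave_bound hk (n - 1) (m + 1)
  obtain ⟨C4, h40, h4⟩ := wave_bound hk (n + 1) (m + 1)
  obtain ⟨C5, h50, h5⟩ := wave_bound hk (n - 1) (m - 1)
  obtain ⟨C6, h60, h6⟩ := wave_bound hk (n + 1) (m - 1)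
  refine ⟨k * ((|coefF n m| * C1 + |coefE n m| * C2) + (|coefD n m| * C3 + |coefB n m| * C4)
    + (|coefC n m| * C5 + |coefA n m| * C6)), by positivity, fun x hx e => ?_⟩
  have hx0 : x ≠ 0 := by rintro rfl; simp at hx; linarith
  have hr : 0 < ‖x‖ := norm_pos_iff.2 hx0
  have hc := norm_coord_le e
  have hA : ‖((e 0 : ℂ) - Complex.I * e 1) / 2‖ ≤ ‖e‖ := by
    rw [norm_div, Complex.norm_two]
    have := norm_sub_le (e 0 : ℂ) (Complex.I * e 1)
    rw [norm_mul, Complex.norm_I, one_mul] at this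
    linarith [hc 0, hc 1]
  have hB : ‖((e 0 : ℂ) + Complex.I * e 1) / 2‖ ≤ ‖e‖ := by
    rw [norm_div, Complex.norm_two]
    have := norm_add_le (e 0 : ℂ) (Complex.I * e 1)
    rw [norm_mul, Complex.norm_I, one_mul] at this
    linarith [hc 0, hc 1]
  have key : ∀ (a b : ℝ) (A B : ℂ) (u : ℂ) (D F : ℝ), ‖A‖ ≤ D / ‖x‖ → ‖B‖ ≤ F / ‖x‖ → ‖u‖ ≤ ‖e‖ →
      ‖u * (a * A + b * B)‖ ≤ (|a| * D + |b| * F) / ‖x‖ * ‖e‖ := by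
    intro a b A B u D F hA hB hu
    rw [norm_mul, mul_comm]
    refine mul_le_mul ?_ hu (norm_nonneg _) ((norm_nonneg _).trans (?_ : ‖(a : ℂ) * A + b * B‖ ≤ _))
    all_goals
      refine (norm_add_le _ _).trans ?_
      rw [norm_mul, norm_mul, Complex.norm_real, Complex.norm_real, Real.norm_eq_abs,
        Real.norm_eq_abs, add_div, mul_div_assoc, mul_div_assoc]
      gcongr
  rw [((isLadder_wave (isRadialFamily_hankel hk)).hasFDerivAt n m x hx0).fderiv, ladderL_apply,
    norm_mul, Complex.norm_real, Real.norm_of_nonneg hk.le, mul_div_assoc, mul_assoc]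
  refine mul_le_mul_of_nonneg_left ?_ hk.le
  rw [ladderComb]
  have k1 := key (coefF n m) (-coefE n m) _ _ _ _ _ (h1 x hx).1 (h2 x hx).1 (hc 2)
  have k2 := key (coefD n m) (coefB n m) _ _ _ _ _ (h3 x hx).1 (h4 x hx).1 hA
  have k3 := key (coefC n m) (coefA n m) _ _ _ _ _ (h5 x hx).1 (h6 x hx).1 hB
  rw [abs_neg] at k1
  push_cast at k1
  rw [neg_mul, ← sub_eq_add_neg] at k1
  refine (norm_sub_le _ _).trans ((add_le_add_left (norm_add_le _ _) _).trans ?_)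
  refine (add_le_add (add_le_add k1 k2) k3).trans (le_of_eq ?_)
  ring

theorem norm_div_norm_sub_le (x y : E3) (hx : x ≠ 0) (hxy : x - y ≠ 0) :
    ‖‖x‖⁻¹ • x - ‖x - y‖⁻¹ • (x - y)‖ ≤ 2 * ‖y‖ / ‖x‖ := by
  have h1 := norm_pos_iff.2 hx
  have h2 := norm_pos_iff.2 hxy
  have e : ‖x‖⁻¹ • x - ‖x - y‖⁻¹ • (x - y) =
      ‖x‖⁻¹ • y + (‖x‖⁻¹ - ‖x - y‖⁻¹) • (x - y) := by
    rw [sub_smul, smul_sub ‖x‖⁻¹ x y]; abel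
  have e2 : (‖x‖⁻¹ - ‖x - y‖⁻¹) * ‖x - y‖ = (‖x - y‖ - ‖x‖) / ‖x‖ := by field_simp
  rw [e]
  refine (norm_add_le _ _).trans ?_
  rw [norm_smul, norm_smul, norm_inv, norm_norm, Real.norm_eq_abs]
  nth_rewrite 2 [← abs_of_pos h2]
  rw [← abs_mul, e2, abs_div, abs_of_pos h1]
  have h3 : |‖x - y‖ - ‖x‖| ≤ ‖y‖ := by
    have := abs_norm_sub_norm_le (x - y) x
    simpa using this
  rw [two_mul, add_div, inv_mul_eq_div]
  gcongr

/-- Moving the centre to y turns the radial direction by O(1/|x|); multiplied by a gradient of size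
O(1/|x|), this is an error of the admissible order |x|^{-2}. -/
theorem wave_sub_bound {k : ℝ} (hk : 0 < k) (n m : ℤ) (y : E3) : ∃ C : ℝ, 0 ≤ C ∧
    ∀ᶠ x in cocompact E3, ‖wave (hankelRad k) n m (x - y)‖ ≤ C / ‖x‖ ∧
    ‖fderiv ℝ (fun x => wave (hankelRad k) n m (x - y)) x (‖x‖⁻¹ • x) -
      Complex.I * k * wave (hankelRad k) n m (x - y)‖ ≤ C / ‖x‖ ^ 2 := by
  obtain ⟨C1, h10, h1⟩ := wave_bound hk n m
  obtain ⟨C2, h20, h2⟩ := norm_fderiv_wave_le hk n m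
  refine ⟨4 * C1 + 4 * C2 * ‖y‖, by positivity, ?_⟩
  -- The threshold ensures both |x − y| ≥ |x|/2 and k|x − y| ≥ 1.
  filter_upwards [eventually_norm_ge (2 * ‖y‖ + 2 / k), eventually_ne_cocompact 0]
    with x hx hx0
  have hr : 0 < ‖x‖ := norm_pos_iff.2 hx0
  have hk2 : 0 < 2 / k := by positivity
  have ha : ‖x‖ / 2 ≤ ‖x - y‖ := by
    have := norm_sub_norm_le x y
    linarith
  have hak : 1 ≤ k * ‖x - y‖ := by
    have : 1 / k ≤ ‖x - y‖ := by
      have e : 1 / k = (2 / k) / 2 := by ring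
      rw [e]; linarith [norm_nonneg y]
    rwa [div_le_iff₀' hk] at this
  have ha0 : 0 < ‖x - y‖ := by linarith
  have hy0 := norm_nonneg y
  have hinv : 1 / ‖x - y‖ ≤ 2 / ‖x‖ := by
    rw [div_le_div_iff₀ ha0 hr]; linarith
  have hinv2 : 1 / ‖x - y‖ ^ 2 ≤ 4 / ‖x‖ ^ 2 := by
    have := mul_le_mul hinv hinv (by positivity) (by positivity)
    calc _ = 1 / ‖x - y‖ * (1 / ‖x - y‖) := by field_simp
      _ ≤ _ := this
      _ = _ := by field_simp; norm_num
  obtain ⟨b1, b2⟩ := h1 _ hak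
  constructor
  · refine b1.trans ?_
    calc C1 / ‖x - y‖ = C1 * (1 / ‖x - y‖) := by ring
      _ ≤ C1 * (2 / ‖x‖) := by gcongr
      _ = (2 * C1) / ‖x‖ := by ring
      _ ≤ _ := by gcongr; nlinarith [mul_nonneg h20 hy0]
  · rw [fderiv_comp_sub]
    set a := x - y
    have e : fderiv ℝ (wave (hankelRad k) n m) a (‖x‖⁻¹ • x) -
        Complex.I * k * wave (hankelRad k) n m a =
        (fderiv ℝ (wave (hankelRad k) n m) a (‖a‖⁻¹ • a) -
        Complex.I * k * wave (hankelRad k) n m a) +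
        fderiv ℝ (wave (hankelRad k) n m) a (‖x‖⁻¹ • x - ‖a‖⁻¹ • a) := by
      rw [map_sub]; ring
    rw [e]
    refine (norm_add_le _ _).trans ?_
    have b3 := h2 a hak (‖x‖⁻¹ • x - ‖a‖⁻¹ • a)
    have b4 := norm_div_norm_sub_le x y hx0 (norm_pos_iff.1 ha0)
    have b5 : C1 / ‖a‖ ^ 2 ≤ C1 * (4 / ‖x‖ ^ 2) := by
      rw [div_eq_mul_one_div]; gcongr
    have b6 : C2 / ‖a‖ * ‖‖x‖⁻¹ • x - ‖a‖⁻¹ • a‖ ≤ C2 * (2 / ‖x‖) * (2 * ‖y‖ / ‖x‖) := by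
      rw [div_eq_mul_one_div]; gcongr
    refine (add_le_add (b2.trans b5) (b3.trans b6)).trans (le_of_eq ?_)
    field_simp
    ring

theorem sommerfeldScalar_of_bound {k C : ℝ} {v : E3 → ℂ}
    (h : ∀ᶠ x in cocompact E3, ‖fderiv ℝ v x (‖x‖⁻¹ • x) - Complex.I * k * v x‖ ≤ C / ‖x‖ ^ 2) :
    SommerfeldScalar k v := by
  refine squeeze_zero_norm' (a := fun x => C / ‖x‖) ?_ ?_
  · filter_upwards [h, eventually_ne_cocompact 0] with x hx hx0
    have hr : 0 < ‖x‖ := norm_pos_iff.2 hx0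
    rw [norm_mul, Complex.norm_real, norm_norm]
    calc _ ≤ ‖x‖ * (C / ‖x‖ ^ 2) := by gcongr
      _ = _ := by field_simp
  · exact tendsto_const_nhds.div_atTop (tendsto_norm_cocompact_atTop (E := E3))

theorem sommerfeldScalar_wave {k : ℝ} (hk : 0 < k) (n m : ℤ) (y : E3) :
    SommerfeldScalar k (fun x => wave (hankelRad k) n m (x - y)) := by
  obtain ⟨C, _, h⟩ := wave_sub_bound hk n m y
  exact sommerfeldScalar_of_bound (h.mono fun x hx => hx.2)

theorem differentiableAt_wave_sub {k : ℝ} (hk : 0 < k) (n m : ℤ) {x y : E3} (hx : x ≠ y) :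
    DifferentiableAt ℝ (fun x => wave (hankelRad k) n m (x - y)) x := by
  have h := ((isLadder_wave (isRadialFamily_hankel hk)).hasFDerivAt n m (x - y)
    (sub_ne_zero.2 hx)).differentiableAt
  exact h.comp x (differentiableAt_id.sub_const y)

/-- Radiating functions which are differentiable off `y`. -/
def IsRadiatingOff (k : ℝ) (y : E3) (v : E3 → ℂ) : Prop :=
  SommerfeldScalar k v ∧ ∀ x, x ≠ y → DifferentiableAt ℝ v x

theorem IsRadiatingOff.add {k : ℝ} {y : E3} {v w : E3 → ℂ} (hv : IsRadiatingOff k y v)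
    (hw : IsRadiatingOff k y w) : IsRadiatingOff k y (fun x => v x + w x) :=
  ⟨hv.1.add hw.1 hv.2 hw.2, fun x hx => (hv.2 x hx).add (hw.2 x hx)⟩

theorem IsRadiatingOff.sub {k : ℝ} {y : E3} {v w : E3 → ℂ} (hv : IsRadiatingOff k y v)
    (hw : IsRadiatingOff k y w) : IsRadiatingOff k y (fun x => v x - w x) :=
  ⟨hv.1.sub hw.1 hv.2 hw.2, fun x hx => (hv.2 x hx).sub (hw.2 x hx)⟩

theorem IsRadiatingOff.const_mul {k : ℝ} {y : E3} {v : E3 → ℂ} (c : ℂ)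
    (hv : IsRadiatingOff k y v) : IsRadiatingOff k y (fun x => c * v x) :=
  ⟨hv.1.const_mul c, fun x hx => (hv.2 x hx).const_mul c⟩

theorem IsRadiatingOff.ladderComb {k : ℝ} {y : E3} {X : ℤ → ℤ → E3 → ℂ}
    (hX : ∀ n m, IsRadiatingOff k y (X n m)) (w α β : ℂ) (n m : ℤ) :
    IsRadiatingOff k y (fun x => ladderComb w α β (fun n m => X n m x) n m) := by
  unfold NavierLame.ladderComb
  exact ((((hX _ _).const_mul _).sub ((hX _ _).const_mul _)).const_mul w |>.add
    ((((hX _ _).const_mul _).add ((hX _ _).const_mul _)).const_mul α)).sub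
    ((((hX _ _).const_mul _).add ((hX _ _).const_mul _)).const_mul β)

/-- Two ladder steps write the Hessian as a finite combination of outgoing waves, so no separate
asymptotics of derivatives is needed. -/
theorem sommerfeldScalar_hessian_helmG {k : ℝ} (hk : 0 < k) (i j : Fin 3) (y : E3) :
    SommerfeldScalar k (fun x => pderiv j (pderiv i (helmG k)) (x - y)) := by
  have hW : ∀ n m, IsRadiatingOff k y (fun x => wave (hankelRad k) n m (x - y)) := fun n m =>
    ⟨sommerfeldScalar_wave hk n m y, fun x hx => differentiableAt_wave_sub hk n m hx⟩
  have h := ((IsRadiatingOff.ladderComb (fun n m => IsRadiatingOff.ladderComb hW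
    (dirW i) (dirAl i) (dirBe i) n m) (dirW j) (dirAl j) (dirBe j) 0 0).const_mul
      ((Complex.I * k * harmNorm 0 0) * k ^ 2)).1
  refine h.congr (y := y) fun x hx => ?_
  rw [pderiv_pderiv_helmG hk, hessWave_eq hk i j 0 0 (sub_ne_zero.2 hx)]
  ring

theorem sommerfeldScalar_helmG {k : ℝ} (hk : 0 < k) (y : E3) :
    SommerfeldScalar k (fun x => helmG k (x - y)) := by
  rw [helmG_eq hk.ne']
  exact (sommerfeldScalar_wave hk 0 0 y).const_mul _

theorem helmG_sub_bound {k : ℝ} (hk : 0 < k) (y : E3) : ∃ C : ℝ, 0 ≤ C ∧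
    ∀ᶠ x in cocompact E3, ‖helmG k (x - y)‖ ≤ C / ‖x‖ := by
  obtain ⟨C, hC, h⟩ := wave_sub_bound hk 0 0 y
  refine ⟨‖Complex.I * k * harmNorm 0 0‖ * C, by positivity, h.mono fun x hx => ?_⟩
  rw [helmG_eq hk.ne', norm_mul, mul_div_assoc]
  exact mul_le_mul_of_nonneg_left hx.1 (norm_nonneg _)

/-! ### The Navier-Lamé operator on smooth fields -/

theorem pderiv_smooth_comm {f : E3 → ℂ} (hf : ContDiff ℝ ∞ f) (i j : Fin 3) :
    pderiv i (pderiv j f) = pderiv j (pderiv i f) :=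
  funext fun _ => pderiv_pderiv_comm hf.contDiffAt i j

theorem pderiv_smooth_lap {f : E3 → ℂ} (hf : ContDiff ℝ ∞ f) (j : Fin 3) :
    pderiv j (lap f) = lap (pderiv j f) :=
  funext fun x => pderiv_lap isOpen_univ (fun _ _ => hf.contDiffAt) (Set.mem_univ x) j

theorem pderiv_smooth_add {f g : E3 → ℂ} (hf : ContDiff ℝ ∞ f) (hg : ContDiff ℝ ∞ g)
    (j : Fin 3) : pderiv j (fun x => f x + g x) = fun x => pderiv j f x + pderiv j g x :=
  funext fun x => pderiv_add j (hf.differentiable (by simp) x) (hg.differentiable (by simp) x)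

theorem pderiv_smooth_sum {ι : Type*} (s : Finset ι) {f : ι → E3 → ℂ}
    (hf : ∀ a, ContDiff ℝ ∞ (f a)) (j : Fin 3) :
    pderiv j (fun x => ∑ a ∈ s, f a x) = fun x => ∑ a ∈ s, pderiv j (f a) x :=
  funext fun x => pderiv_sum j s fun a _ => (hf a).differentiable (by simp) x

theorem lap_smooth_add {f g : E3 → ℂ} (hf : ContDiff ℝ ∞ f) (hg : ContDiff ℝ ∞ g) :
    lap (fun x => f x + g x) = fun x => lap f x + lap g x :=
  funext fun _ => lap_add hf.contDiffAt hg.contDiffAt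

theorem lap_smooth_sum {ι : Type*} (s : Finset ι) {f : ι → E3 → ℂ}
    (hf : ∀ a, ContDiff ℝ ∞ (f a)) :
    lap (fun x => ∑ a ∈ s, f a x) = fun x => ∑ a ∈ s, lap (f a) x := by
  funext x
  simp only [lap]
  rw [Finset.sum_comm]
  refine Finset.sum_congr rfl fun i _ => ?_
  rw [pderiv_smooth_sum s hf, pderiv_smooth_sum s fun a => contDiff_pderiv i (hf a)]

theorem contDiff_comp {u : E3 → Fin 3 → ℂ} (hu : ContDiff ℝ ∞ u) (i : Fin 3) :
    ContDiff ℝ ∞ (fun x => u x i) := contDiff_pi.1 hu i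

theorem contDiff_divergence {u : E3 → Fin 3 → ℂ} (hu : ∀ i, ContDiff ℝ ∞ fun x => u x i) :
    ContDiff ℝ ∞ (divergence u) :=
  ContDiff.sum fun i _ => contDiff_pderiv i (hu i)

theorem hasCompactSupport_comp {u : E3 → Fin 3 → ℂ} (hu : HasCompactSupport u) (i : Fin 3) :
    HasCompactSupport (fun x => u x i) :=
  hu.comp_left (g := fun v : Fin 3 → ℂ => v i) rfl

theorem hasCompactSupport_finset_sum {ι : Type*} (s : Finset ι) {f : ι → E3 → ℂ}
    (hf : ∀ a ∈ s, HasCompactSupport (f a)) : HasCompactSupport (fun x => ∑ a ∈ s, f a x) := by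
  classical
  induction s using Finset.induction_on with
  | empty => exact HasCompactSupport.zero
  | insert a s ha ih =>
    simp only [Finset.sum_insert ha]
    exact HasCompactSupport.add (hf a (Finset.mem_insert_self a s))
      (ih fun b hb => hf b (Finset.mem_insert_of_mem hb))

theorem hasCompactSupport_divergence {u : E3 → Fin 3 → ℂ} (hu : HasCompactSupport u) :
    HasCompactSupport (divergence u) :=
  hasCompactSupport_finset_sum _ fun i _ => hasCompactSupport_pderiv i (hasCompactSupport_comp hu i)

theorem lameOp_eq (lam mu : ℝ) {u : E3 → Fin 3 → ℂ} {x : E3} {i : Fin 3}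
    (hu : ContDiffAt ℝ 2 (fun x => u x i) x) :
    lameOp lam mu u x i = mu * lap (fun x => u x i) x +
      ((lam + mu : ℝ) : ℂ) * pderiv i (divergence u) x := by
  rw [lameOp, laplacian_eq_lap hu]

/-- The field `Δ* u + ω² u`. -/
def lameField (lam mu omega : ℝ) (u : E3 → Fin 3 → ℂ) (x : E3) (i : Fin 3) : ℂ :=
  mu * lap (fun x => u x i) x + ((lam + mu : ℝ) : ℂ) * pderiv i (divergence u) x +
    (omega : ℂ) ^ 2 * u x i

theorem contDiff_lameField (lam mu omega : ℝ) {u : E3 → Fin 3 → ℂ}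
    (hu : ∀ i, ContDiff ℝ ∞ fun x => u x i) (i : Fin 3) :
    ContDiff ℝ ∞ (fun x => lameField lam mu omega u x i) :=
  ((contDiff_const.mul (contDiff_lap (hu i))).add
    (contDiff_const.mul (contDiff_pderiv i (contDiff_divergence hu)))).add
      (contDiff_const.mul (hu i))

theorem hasCompactSupport_const_mul (c : ℂ) {f : E3 → ℂ} (hf : HasCompactSupport f) :
    HasCompactSupport (fun x => c * f x) := hf.mul_left

theorem hasCompactSupport_lameField (lam mu omega : ℝ) {u : E3 → Fin 3 → ℂ}
    (hu : HasCompactSupport u) (i : Fin 3) :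
    HasCompactSupport (fun x => lameField lam mu omega u x i) := by
  have h1 := hasCompactSupport_comp hu i
  exact HasCompactSupport.add (HasCompactSupport.add
    (hasCompactSupport_const_mul _ (hasCompactSupport_lap h1))
    (hasCompactSupport_const_mul _ (hasCompactSupport_pderiv i (hasCompactSupport_divergence hu))))
    (hasCompactSupport_const_mul _ h1)

theorem divergence_lap {u : E3 → Fin 3 → ℂ} (hu : ∀ i, ContDiff ℝ ∞ fun x => u x i) :
    (fun x => ∑ i, pderiv i (lap fun x => u x i) x) = lap (divergence u) := by
  have : divergence u = fun x => ∑ i, pderiv i (fun x => u x i) x := rfl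
  rw [this, lap_smooth_sum _ fun i => contDiff_pderiv i (hu i)]
  funext x
  exact Finset.sum_congr rfl fun i _ => by rw [pderiv_smooth_lap (hu i)]

theorem kP_sq {lam mu omega : ℝ} (h_lam : 0 < 2 * mu + lam) :
    (2 * mu + lam) * kP lam mu omega ^ 2 = omega ^ 2 := by
  rw [kP, div_pow, Real.sq_sqrt h_lam.le]
  field_simp

theorem kS_sq {mu omega : ℝ} (h_mu : 0 < mu) : mu * kS mu omega ^ 2 = omega ^ 2 := by
  rw [kS, div_pow, Real.sq_sqrt h_mu.le]
  field_simp

/-- Since div ∇ = Δ, the divergence of Δ*u is (2μ + λ)Δ div u: the divergence decouples and sees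
only the wave number k_p. -/
theorem divergence_lameField {lam mu omega : ℝ} (h_lam : 0 < 2 * mu + lam) {u : E3 → Fin 3 → ℂ}
    (hu : ∀ i, ContDiff ℝ ∞ fun x => u x i) :
    divergence (lameField lam mu omega u) = fun x => ((2 * mu + lam : ℝ) : ℂ) *
      (lap (divergence u) x + (kP lam mu omega : ℂ) ^ 2 * divergence u x) := by
  have hd := contDiff_divergence hu
  have h1 : ∀ i, pderiv i (fun x => lameField lam mu omega u x i) = fun x =>
      mu * pderiv i (lap fun x => u x i) x + ((lam + mu : ℝ) : ℂ) *
        pderiv i (pderiv i (divergence u)) x + (omega : ℂ) ^ 2 * pderiv i (fun x => u x i) x := by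
    intro i
    have c1 := contDiff_lap (hu i)
    have c2 := contDiff_pderiv i hd
    unfold lameField
    rw [pderiv_smooth_add ((contDiff_const.mul c1).add (contDiff_const.mul c2))
      (contDiff_const.mul (hu i)), pderiv_smooth_add (contDiff_const.mul c1)
      (contDiff_const.mul c2), pderiv_const_mul, pderiv_const_mul, pderiv_const_mul]
  funext x
  have h2 := congrFun (divergence_lap hu) x
  have h3 : ((2 * mu + lam : ℝ) : ℂ) * (kP lam mu omega : ℂ) ^ 2 = (omega : ℂ) ^ 2 := by
    exact_mod_cast kP_sq h_lam
  rw [divergence]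
  simp only [h1, Finset.sum_add_distrib, ← Finset.mul_sum, h2]
  rw [mul_add, ← mul_assoc _ ((kP lam mu omega : ℂ) ^ 2), h3]
  have h4 : ∑ i, pderiv i (pderiv i (divergence u)) x = lap (divergence u) x := rfl
  have h5 : ∑ i, pderiv i (fun x => u x i) x = divergence u x := rfl
  rw [h4, h5]
  push_cast
  ring

/-! ### The fundamental matrix -/

theorem locallyIntegrable_kupMat (lam mu omega : ℝ) (i j : Fin 3) :
    LocallyIntegrable (fun x => kupMat lam mu omega x i j) := by
  have h1 := (locallyIntegrable_helmG (kS mu omega)).smul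
    (if i = j then (kS mu omega : ℂ) ^ 2 else 0)
  have h2 := (h1.add (locallyIntegrable_hessian_helmG_sub (kS mu omega) (kP lam mu omega)
    i j)).smul (1 / (omega : ℂ) ^ 2)
  refine h2.congr (Eventually.of_forall fun x => ?_)
  simp only [kupMat, Pi.smul_apply, Pi.add_apply, smul_eq_mul]
  ring

theorem contDiffAt_kupMat (lam mu omega : ℝ) (i j : Fin 3) {x : E3} (hx : x ≠ 0) :
    ContDiffAt ℝ ∞ (fun x => kupMat lam mu omega x i j) x := by
  have h := fun k => contDiffAt_infty_pderiv j (contDiffAt_infty_pderiv i (contDiffAt_helmG k hx))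
  exact contDiffAt_const.mul (((contDiffAt_const.mul (contDiffAt_helmG _ hx)).add (h _)).sub (h _))

/-- Put θ = Δ*u + ω²u and e = ∂_j div u. The Hessian is moved onto θ, where ∑_i ∂_i∂_jθ_i = (2μ +
λ)(Δ + k_p²)e. The point values −e(0) from G_s and G_p cancel, and the integral with G_p has factor
k_p² − k_p² = 0. The factor of ∫ G_s e is (2μ + λ)(k_p² − k_s²) + (λ + μ)k_s² = ω² − μk_s² = 0,
which leaves −μk_s² u_j(0) = −ω² u_j(0). -/
theorem integral_kupMat_mul {lam mu omega : ℝ} (h_omega : 0 < omega) (h_mu : 0 < mu)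
    (h_lam : 0 < 2 * mu + lam) (j : Fin 3) {u : E3 → Fin 3 → ℂ} (hu : ContDiff ℝ ∞ u)
    (hc : HasCompactSupport u) :
    ∫ x, ∑ i, kupMat lam mu omega x i j * lameField lam mu omega u x i = -u 0 j := by
  have hu' := contDiff_comp hu
  set ks := kS mu omega with hks
  set kp := kP lam mu omega with hkp
  set θ : Fin 3 → E3 → ℂ := fun i x => lameField lam mu omega u x i with hθ
  have hθs : ∀ i, ContDiff ℝ ∞ (θ i) := contDiff_lameField lam mu omega hu'
  have hθc : ∀ i, HasCompactSupport (θ i) := hasCompactSupport_lameField lam mu omega hc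
  set e := pderiv j (divergence u) with he
  have hd := contDiff_divergence hu'
  have hes : ContDiff ℝ ∞ e := contDiff_pderiv j hd
  have hec : HasCompactSupport e := hasCompactSupport_pderiv j (hasCompactSupport_divergence hc)
  have hL : ∀ k, LocallyIntegrable (helmG k) := locallyIntegrable_helmG
  have hI : ∀ k {ψ : E3 → ℂ}, ContDiff ℝ ∞ ψ → HasCompactSupport ψ →
      Integrable (fun x => helmG k x * ψ x) := fun k ψ h1 h2 =>
    integrable_mul_of_locallyIntegrable (hL k) h1.continuous h2
  have hD : ∀ i, Integrable (fun x => (pderiv j (pderiv i (helmG ks)) x -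
      pderiv j (pderiv i (helmG kp)) x) * θ i x) := fun i =>
    integrable_mul_of_locallyIntegrable (locallyIntegrable_hessian_helmG_sub ks kp i j)
      (hθs i).continuous (hθc i)
  -- the sum of second derivatives of the components
  have hq : ∀ x, ∑ i, pderiv i (pderiv j (θ i)) x =
      ((2 * mu + lam : ℝ) : ℂ) * (lap e x + (kp : ℂ) ^ 2 * e x) := by
    intro x
    have h1 : ∑ i, pderiv i (pderiv j (θ i)) x =
        pderiv j (divergence (lameField lam mu omega u)) x := by
      have : divergence (lameField lam mu omega u) = fun x => ∑ i, pderiv i (θ i) x := rfl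
      rw [this, pderiv_smooth_sum _ fun i => contDiff_pderiv i (hθs i)]
      exact Finset.sum_congr rfl fun i _ => by rw [pderiv_smooth_comm (hθs i)]
    rw [h1, divergence_lameField h_lam hu', pderiv_const_mul,
      pderiv_smooth_add (contDiff_lap hd) (contDiff_const.mul hd), pderiv_const_mul,
      pderiv_smooth_lap hd]
  have hF := fun k {ψ : E3 → ℂ} => @integral_helmG_mul k ψ
  have hlap : ∀ k, ∫ x, helmG k x * lap e x = -e 0 - (k : ℂ) ^ 2 * ∫ x, helmG k x * e x := by
    intro k
    rw [← integral_const_mul, eq_sub_iff_add_eq, ← integral_add (hI k (contDiff_lap hes)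
      (hasCompactSupport_lap hec)) ((hI k hes hec).const_mul _), ← hF k hes hec]
    refine integral_congr_ae (Eventually.of_forall fun x => ?_)
    simp only
    ring
  have hlapu : ∫ x, helmG ks x * lap (fun x => u x j) x =
      -u 0 j - (ks : ℂ) ^ 2 * ∫ x, helmG ks x * u x j := by
    have c := hasCompactSupport_comp hc j
    rw [← integral_const_mul, eq_sub_iff_add_eq, ← integral_add (hI ks (contDiff_lap (hu' j))
      (hasCompactSupport_lap c)) ((hI ks (hu' j) c).const_mul _), ← hF ks (hu' j) c]
    refine integral_congr_ae (Eventually.of_forall fun x => ?_)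
    simp only
    ring
  have hq2 : ∀ k, ∫ x, helmG k x * ∑ i, pderiv i (pderiv j (θ i)) x =
      ((2 * mu + lam : ℝ) : ℂ) * (-e 0 + ((kp : ℂ) ^ 2 - (k : ℂ) ^ 2) * ∫ x, helmG k x * e x) := by
    intro k
    have h1 : ∀ x, helmG k x * ∑ i, pderiv i (pderiv j (θ i)) x = ((2 * mu + lam : ℝ) : ℂ) *
        (helmG k x * lap e x + (kp : ℂ) ^ 2 * (helmG k x * e x)) := fun x => by rw [hq]; ring
    simp only [h1]
    rw [integral_const_mul, integral_add (hI k (contDiff_lap hes)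
      (hasCompactSupport_lap hec)) ((hI k hes hec).const_mul _), hlap, integral_const_mul]
    ring
  have hG : ∫ x, helmG ks x * θ j x = mu * (-u 0 j) + ((lam + mu : ℝ) : ℂ) *
      ∫ x, helmG ks x * e x := by
    have c := hasCompactSupport_comp hc j
    have h1 : ∀ x, helmG ks x * θ j x = (mu * (helmG ks x * lap (fun x => u x j) x) +
        ((lam + mu : ℝ) : ℂ) * (helmG ks x * e x)) + (omega : ℂ) ^ 2 * (helmG ks x * u x j) :=
      fun x => by rw [hθ, he]; simp only [lameField]; ring
    have i1 := (hI ks (contDiff_lap (hu' j)) (hasCompactSupport_lap c)).const_mul (mu : ℂ)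
    have i2 := (hI ks hes hec).const_mul ((lam + mu : ℝ) : ℂ)
    have i3 := (hI ks (hu' j) c).const_mul ((omega : ℂ) ^ 2)
    have i12 : Integrable fun x => (mu : ℂ) * (helmG ks x * lap (fun x => u x j) x) +
      ((lam + mu : ℝ) : ℂ) * (helmG ks x * e x) := i1.add i2
    simp only [h1]
    rw [integral_add i12 i3, integral_add i1 i2, integral_const_mul, integral_const_mul,
      integral_const_mul, hlapu]
    have h3 : (mu : ℂ) * (ks : ℂ) ^ 2 = (omega : ℂ) ^ 2 := by exact_mod_cast kS_sq h_mu
    rw [← h3]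
    ring
  have hsum : ∑ i, ∫ x, (pderiv j (pderiv i (helmG ks)) x -
      pderiv j (pderiv i (helmG kp)) x) * θ i x =
      (∫ x, helmG ks x * ∑ i, pderiv i (pderiv j (θ i)) x) -
      ∫ x, helmG kp x * ∑ i, pderiv i (pderiv j (θ i)) x := by
    have hs := fun i => contDiff_pderiv i (contDiff_pderiv j (hθs i))
    have hcs := fun i => hasCompactSupport_pderiv i (hasCompactSupport_pderiv j (hθc i))
    simp only [Finset.mul_sum]
    rw [integral_finsetSum _ fun i _ => hI ks (hs i) (hcs i),
      integral_finsetSum _ fun i _ => hI kp (hs i) (hcs i), ← Finset.sum_sub_distrib]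
    refine Finset.sum_congr rfl fun i _ => ?_
    rw [integral_hessian_helmG_sub_mul ks kp i j (hθs i) (hθc i),
      ← integral_sub (hI ks (hs i) (hcs i)) (hI kp (hs i) (hcs i))]
    refine integral_congr_ae (Eventually.of_forall fun x => ?_)
    simp only
    ring
  have hint : ∀ x, ∑ i, kupMat lam mu omega x i j * lameField lam mu omega u x i =
      1 / (omega : ℂ) ^ 2 * ((ks : ℂ) ^ 2 * (helmG ks x * θ j x) +
        ∑ i, (pderiv j (pderiv i (helmG ks)) x - pderiv j (pderiv i (helmG kp)) x) * θ i x) := by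
    intro x
    have h1 : (ks : ℂ) ^ 2 * (helmG ks x * θ j x) =
        ∑ i, (if i = j then (ks : ℂ) ^ 2 else 0) * helmG ks x * θ i x := by
      simp only [ite_mul, zero_mul, Finset.sum_ite_eq', Finset.mem_univ, if_true]
      ring
    rw [h1, ← Finset.sum_add_distrib, Finset.mul_sum]
    refine Finset.sum_congr rfl fun i _ => ?_
    rw [kupMat]
    ring
  have homega : (omega : ℂ) ≠ 0 := by exact_mod_cast h_omega.ne'
  simp only [hint]
  rw [integral_const_mul, integral_add ((hI ks (hθs j) (hθc j)).const_mul _)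
    (integrable_finsetSum _ fun i _ => hD i), integral_const_mul, integral_finsetSum _
    fun i _ => hD i, hsum, hq2, hq2, hG]
  have h3 : (mu : ℂ) * (ks : ℂ) ^ 2 = (omega : ℂ) ^ 2 := by exact_mod_cast kS_sq h_mu
  have h4 : ((2 * mu + lam : ℝ) : ℂ) * (kp : ℂ) ^ 2 = (omega : ℂ) ^ 2 := by
    exact_mod_cast kP_sq h_lam
  rw [one_div, inv_mul_eq_div, div_eq_iff (pow_ne_zero 2 homega)]
  push_cast at h4 ⊢
  linear_combination (-u 0 j - ∫ x, helmG ks x * e x) * h3 + (∫ x, helmG ks x * e x) * h4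

theorem pderiv_sub_arg (i : Fin 3) (f : E3 → ℂ) (y : E3) :
    pderiv i (fun x => f (x - y)) = fun x => pderiv i f (x - y) :=
  funext fun x => pderiv_comp_sub i f y x

theorem pderiv_add_arg (i : Fin 3) (f : E3 → ℂ) (y : E3) :
    pderiv i (fun x => f (x + y)) = fun x => pderiv i f (x + y) :=
  funext fun x => pderiv_comp_add i f y x

theorem lap_add_arg (f : E3 → ℂ) (y : E3) : lap (fun x => f (x + y)) = fun x => lap f (x + y) := by
  funext x
  simp only [lap, pderiv_add_arg]

theorem lameField_add_arg (lam mu omega : ℝ) (u : E3 → Fin 3 → ℂ) (y x : E3) :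
    lameField lam mu omega (fun x => u (x + y)) x = lameField lam mu omega u (x + y) := by
  funext i
  have : divergence (fun x => u (x + y)) = fun x => divergence u (x + y) := by
    funext x
    simp only [divergence]
    exact Finset.sum_congr rfl fun j _ => congrFun (pderiv_add_arg j (fun x => u x j) y) x
  simp only [lameField, this, pderiv_add_arg]
  rw [lap_add_arg (fun x => u x i)]

/-- By ΔG = −k²G the two contributions of G_s cancel. -/
theorem divergence_kupMat {lam mu omega : ℝ} (j : Fin 3) {x : E3} (hx : x ≠ 0) :
    divergence (fun x i => kupMat lam mu omega x i j) x =
      1 / (omega : ℂ) ^ 2 * ((kP lam mu omega : ℂ) ^ 2 * pderiv j (helmG (kP lam mu omega)) x) := by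
  set ks := kS mu omega with hks
  set kp := kP lam mu omega with hkp
  have d := @differentiableAt_of_contDiffAt_infty
  have hG := fun k => contDiffAt_helmG k hx
  have hG1 := fun k i => contDiffAt_infty_pderiv i (hG k)
  have hG2 := fun k i l => contDiffAt_infty_pderiv l (hG1 k i)
  have h3 : ∀ k, ∑ i, pderiv i (pderiv j (pderiv i (helmG k))) x =
      -(k : ℂ) ^ 2 * pderiv j (helmG k) x := by
    intro k
    have h4 : pderiv j (lap (helmG k)) x = -(k : ℂ) ^ 2 * pderiv j (helmG k) x := by
      have : lap (helmG k) =ᶠ[𝓝 x] fun x => -(k : ℂ) ^ 2 * helmG k x := by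
        filter_upwards [isOpen_ne.mem_nhds hx] with z hz using lap_helmG k hz
      rw [pderiv_congr j this, pderiv_const_mul]
    rw [← h4]
    have h5 : pderiv j (lap (helmG k)) x = ∑ i, pderiv j (pderiv i (pderiv i (helmG k))) x :=
      pderiv_sum j _ fun i _ => d (hG2 k i i)
    rw [h5]
    exact Finset.sum_congr rfl fun i _ => pderiv_pderiv_comm (hG1 k i) i j
  have h1 : ∀ i, pderiv i (fun x => kupMat lam mu omega x i j) x = 1 / (omega : ℂ) ^ 2 *
      ((if i = j then (ks : ℂ) ^ 2 else 0) * pderiv i (helmG ks) x +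
        pderiv i (pderiv j (pderiv i (helmG ks))) x -
        pderiv i (pderiv j (pderiv i (helmG kp))) x) := by
    intro i
    unfold kupMat
    simp only [← hks, ← hkp]
    have d1 : DifferentiableAt ℝ (fun x => (if i = j then (ks : ℂ) ^ 2 else 0) * helmG ks x) x :=
      (d (hG ks)).const_mul _
    have d2 : DifferentiableAt ℝ (fun x => (if i = j then (ks : ℂ) ^ 2 else 0) * helmG ks x +
      pderiv j (pderiv i (helmG ks)) x) x := d1.add (d (hG2 ks i j))
    rw [pderiv_const_mul]
    simp only
    rw [pderiv_sub i d2 (d (hG2 kp i j)), pderiv_add i d1 (d (hG2 ks i j)), pderiv_const_mul]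
  rw [divergence]
  simp only [h1, ← Finset.mul_sum, Finset.sum_sub_distrib, Finset.sum_add_distrib, h3, ite_mul,
    zero_mul, Finset.sum_ite_eq', Finset.mem_univ, if_true]
  ring

theorem divergence_sub_arg (u : E3 → Fin 3 → ℂ) (y : E3) :
    divergence (fun x => u (x - y)) = fun x => divergence u (x - y) := by
  funext x
  simp only [divergence]
  exact Finset.sum_congr rfl fun j _ => congrFun (pderiv_sub_arg j (fun x => u x j) y) x

/-- The longitudinal part involves only G_p and hence the transversal part only G_s, so each
radiates with its own wave number. -/
theorem longitudinalPart_kupMat {lam mu omega : ℝ} (h_omega : 0 < omega)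
    (h_lam : 0 < 2 * mu + lam) (y : E3) (i j : Fin 3) {x : E3} (hx : x ≠ y) :
    longitudinalPart lam mu omega (fun x i => kupMat lam mu omega (x - y) i j) x i =
      -(1 / (omega : ℂ) ^ 2) * pderiv j (pderiv i (helmG (kP lam mu omega))) (x - y) := by
  have hxy := sub_ne_zero.2 hx
  have hkp := kP_pos h_omega h_lam
  rw [longitudinalPart, divergence_sub_arg (fun x i => kupMat lam mu omega x i j) y, pderiv_sub_arg]
  have h1 : divergence (fun x i => kupMat lam mu omega x i j) =ᶠ[𝓝 (x - y)] fun x =>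
      1 / (omega : ℂ) ^ 2 * ((kP lam mu omega : ℂ) ^ 2 * pderiv j (helmG (kP lam mu omega)) x) := by
    filter_upwards [isOpen_ne.mem_nhds hxy] with z hz using divergence_kupMat j hz
  simp only
  rw [pderiv_congr i h1, pderiv_const_mul, pderiv_const_mul]
  simp only
  rw [pderiv_pderiv_comm (contDiffAt_helmG _ hxy) i j]
  have : (kP lam mu omega : ℂ) ≠ 0 := by exact_mod_cast hkp.ne'
  push_cast
  field_simp

theorem isKupradzeFundamentalSolution_kupMat {lam mu omega : ℝ} (h_omega : 0 < omega)
    (h_mu : 0 < mu) (h_lam : 0 < 2 * mu + lam) :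
    IsKupradzeFundamentalSolution lam mu omega (fun x y => kupMat lam mu omega (x - y)) where
  locallyIntegrable y i j := by
    intro x
    obtain ⟨s, hs, hi⟩ := locallyIntegrable_kupMat lam mu omega i j (x - y)
    refine ⟨(fun x => x - y) ⁻¹' s, (continuous_id.sub continuous_const).continuousAt hs, ?_⟩
    exact ((measurePreserving_sub_right volume y).integrableOn_comp_preimage
      (Homeomorph.subRight y).measurableEmbedding).2 hi
  contDiffOn y i j := fun x hx => by
    have h := contDiffAt_kupMat lam mu omega i j (sub_ne_zero.2 hx)
    exact (h.comp x (contDiffAt_id.sub contDiffAt_const)).contDiffWithinAt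
  equation y j φ hφ hc := by
    have hs : ContDiff ℝ ∞ (fun x => φ (x + y)) := hφ.comp (contDiff_id.add contDiff_const)
    have hcs : HasCompactSupport (fun x => φ (x + y)) :=
      hc.comp_homeomorph (Homeomorph.addRight y)
    have h := integral_kupMat_mul h_omega h_mu h_lam j hs hcs
    rw [zero_add] at h
    rw [← h, ← integral_add_right_eq_self _ y]
    refine integral_congr_ae (Eventually.of_forall fun x => ?_)
    refine Finset.sum_congr rfl fun i _ => ?_
    rw [lameField_add_arg, add_sub_cancel_right, lameOp_eq lam mu
      (contDiffAt_two_of_infty (contDiff_comp hφ i).contDiffAt), lameField]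
  radiating y j := by
    have hkp := kP_pos h_omega h_lam
    have hks := kS_pos h_omega h_mu
    have hl := fun i {x} => @longitudinalPart_kupMat lam mu omega h_omega h_lam y i j x
    have d := @differentiableAt_of_contDiffAt_infty
    have hsub : ∀ (f : E3 → ℂ) x, DifferentiableAt ℝ f (x - y) →
        DifferentiableAt ℝ (fun x => f (x - y)) x := fun f x hf =>
      hf.comp x (differentiableAt_id.sub_const y)
    have hdG : ∀ k x, x ≠ y → DifferentiableAt ℝ (fun x => helmG k (x - y)) x := fun k x hx =>
      hsub _ x (d (contDiffAt_helmG k (sub_ne_zero.2 hx)))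
    have hdH : ∀ k i x, x ≠ y →
        DifferentiableAt ℝ (fun x => pderiv j (pderiv i (helmG k)) (x - y)) x := fun k i x hx =>
      hsub _ x (d (contDiffAt_infty_pderiv j (contDiffAt_infty_pderiv i
        (contDiffAt_helmG k (sub_ne_zero.2 hx)))))
    have hlong : ∀ i, IsRadiatingOff (kP lam mu omega) y (fun x => -(1 / (omega : ℂ) ^ 2) *
        pderiv j (pderiv i (helmG (kP lam mu omega))) (x - y)) := fun i =>
      IsRadiatingOff.const_mul _ ⟨sommerfeldScalar_hessian_helmG hkp i j y, hdH _ i⟩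
    have htrans : ∀ i, IsRadiatingOff (kS mu omega) y (fun x => 1 / (omega : ℂ) ^ 2 *
        ((if i = j then (kS mu omega : ℂ) ^ 2 else 0) * helmG (kS mu omega) (x - y) +
        pderiv j (pderiv i (helmG (kS mu omega))) (x - y))) := fun i =>
      IsRadiatingOff.const_mul _ (IsRadiatingOff.add
        (IsRadiatingOff.const_mul _ ⟨sommerfeldScalar_helmG hks y, hdG _⟩)
        ⟨sommerfeldScalar_hessian_helmG hks i j y, hdH _ i⟩)
    have ht : ∀ i x, x ≠ y → 1 / (omega : ℂ) ^ 2 *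
        ((if i = j then (kS mu omega : ℂ) ^ 2 else 0) * helmG (kS mu omega) (x - y) +
        pderiv j (pderiv i (helmG (kS mu omega))) (x - y)) =
        transversalPart lam mu omega (fun x i => kupMat lam mu omega (x - y) i j) x i := by
      intro i x hx
      rw [transversalPart, Pi.sub_apply, hl i hx, kupMat]
      ring
    have hev : ∀ {f g : E3 → ℂ}, (∀ x, x ≠ y → f x = g x) → ∀ x, x ≠ y →
        DifferentiableAt ℝ f x → DifferentiableAt ℝ g x := by
      intro f g hfg x hx hf
      refine hf.congr_of_eventuallyEq ?_
      filter_upwards [isOpen_ne.mem_nhds hx] with z hz using (hfg z hz).symm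
    constructor
    · refine (sommerfeldRadiating_iff (y := y) fun x hx i => ?_).2 fun i => ?_
      · exact hev (fun z hz => (hl i hz).symm) x hx ((hlong i).2 x hx)
      · exact (hlong i).1.congr (y := y) fun x hx => (hl i hx).symm
    · refine (sommerfeldRadiating_iff (y := y) fun x hx i => ?_).2 fun i => ?_
      · exact hev (ht i) x hx ((htrans i).2 x hx)
      · exact (htrans i).1.congr (y := y) (ht i)

/-! ### Green's second identity with cutoff functions -/

/-- Radial derivative. -/
def radDeriv (f : E3 → ℂ) (x : E3) : ℂ := fderiv ℝ f x (‖x‖⁻¹ • x)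

theorem fderiv_apply_eq_sum (f : E3 → ℂ) (x v : E3) :
    fderiv ℝ f x v = ∑ i, (v i : ℂ) * pderiv i f x := by
  have h : v = ∑ i, v i • EuclideanSpace.single i (1 : ℝ) := by
    ext j
    fin_cases j <;> simp [Fin.sum_univ_three]
  conv_lhs => rw [h, map_sum]
  simp [pderiv]

/-- The flux `∫ ∇χ · (f ∇g - g ∇f)`. -/
def flux (χ f g : E3 → ℂ) : ℂ :=
  ∫ x, ∑ i, (f x * pderiv i g x - g x * pderiv i f x) * pderiv i χ x

theorem flux_swap (χ f g : E3 → ℂ) : flux χ g f = -flux χ f g := by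
  rw [flux, flux, ← integral_neg]
  congr 1
  funext x
  rw [← Finset.sum_neg_distrib]
  exact Finset.sum_congr rfl fun i _ => by ring

theorem notMem_tsupport_pderiv {χ : E3 → ℂ} {c : ℂ} {s : E3} (h : ∀ᶠ x in 𝓝 s, χ x = c)
    (i : Fin 3) : s ∉ tsupport (pderiv i χ) := by
  rw [notMem_tsupport_iff_eventuallyEq]
  have h' : χ =ᶠ[𝓝 s] fun _ => c := h
  filter_upwards [eventuallyEq_pderiv i h'] with x hx
  rw [hx]
  simp [pderiv]

theorem contDiffAt_on_tsupport_pderiv {χ f : E3 → ℂ} {c : ℂ} {s : E3}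
    (h : ∀ᶠ x in 𝓝 s, χ x = c) (hf : ∀ x, x ≠ s → ContDiffAt ℝ ∞ f x) (i : Fin 3) :
    ∀ x ∈ tsupport (pderiv i χ), ContDiffAt ℝ ∞ f x := fun x hx =>
  hf x fun hxs => notMem_tsupport_pderiv h i (hxs ▸ hx)

theorem integrable_flux {χ f g : E3 → ℂ} (hχ : ContDiff ℝ ∞ χ) (hc : HasCompactSupport χ)
    (hf : ∀ i, ∀ x ∈ tsupport (pderiv i χ), ContDiffAt ℝ ∞ f x)
    (hg : ∀ i, ∀ x ∈ tsupport (pderiv i χ), ContDiffAt ℝ ∞ g x) :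
    Integrable fun x => ∑ i, (f x * pderiv i g x - g x * pderiv i f x) * pderiv i χ x := by
  refine integrable_finsetSum _ fun i _ => ?_
  refine integrable_mul_of_continuousAt_tsupport (contDiff_pderiv i hχ).continuous
    (hasCompactSupport_pderiv i hc) fun x hx => ?_
  exact ((hf i x hx).continuousAt.mul (contDiffAt_infty_pderiv i (hg i x hx)).continuousAt).sub
    ((hg i x hx).continuousAt.mul (contDiffAt_infty_pderiv i (hf i x hx)).continuousAt)

theorem flux_sub {χ ζ f g : E3 → ℂ} (hχ : ContDiff ℝ ∞ χ) (hc : HasCompactSupport χ)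
    (hζ : ContDiff ℝ ∞ ζ) (hcζ : HasCompactSupport ζ)
    (hf : ∀ i, ∀ x ∈ tsupport (pderiv i χ), ContDiffAt ℝ ∞ f x)
    (hg : ∀ i, ∀ x ∈ tsupport (pderiv i χ), ContDiffAt ℝ ∞ g x)
    (hf' : ∀ i, ∀ x ∈ tsupport (pderiv i ζ), ContDiffAt ℝ ∞ f x)
    (hg' : ∀ i, ∀ x ∈ tsupport (pderiv i ζ), ContDiffAt ℝ ∞ g x) :
    flux (fun x => χ x - ζ x) f g = flux χ f g - flux ζ f g := by
  rw [flux, flux, flux, ← integral_sub (integrable_flux hχ hc hf hg)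
    (integrable_flux hζ hcζ hf' hg')]
  congr 1
  funext x
  rw [← Finset.sum_sub_distrib]
  refine Finset.sum_congr rfl fun i _ => ?_
  rw [pderiv_sub i (hχ.differentiable (by simp) x) (hζ.differentiable (by simp) x)]
  ring

/-- The two integrands differ by the divergence of fg∇χ. Only the support of ∇χ matters, so f and g
may be singular where χ is locally constant. -/
theorem integral_mul_lap_cutoff {χ f g : E3 → ℂ} (hχ : ContDiff ℝ ∞ χ) (hc : HasCompactSupport χ)
    (hf : ∀ i, ∀ x ∈ tsupport (pderiv i χ), ContDiffAt ℝ ∞ f x)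
    (hg : ∀ i, ∀ x ∈ tsupport (pderiv i χ), ContDiffAt ℝ ∞ g x) :
    ∫ x, f x * (lap χ x * g x + 2 * ∑ i, pderiv i χ x * pderiv i g x) = flux χ f g := by
  have hχ1 := fun i => contDiff_pderiv i hχ
  have hc1 := fun i => hasCompactSupport_pderiv i hc
  have hfg : ∀ i, ∀ x ∈ tsupport (pderiv i χ), ContDiffAt ℝ ∞ (fun x => f x * g x) x :=
    fun i x hx => (hf i x hx).mul (hg i x hx)
  have hibp : ∀ i, ∫ x, (f x * g x) * pderiv i (pderiv i χ) x =
      -∫ x, pderiv i (fun x => f x * g x) x * pderiv i χ x := fun i =>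
    integral_mul_pderiv i (hχ1 i) (hc1 i) fun x hx =>
      (hfg i x hx).of_le (WithTop.coe_le_coe.2 le_top)
  have i1 : ∀ i, Integrable fun x => (f x * g x) * pderiv i (pderiv i χ) x := fun i =>
    integrable_mul_of_continuousAt_tsupport (contDiff_pderiv i (hχ1 i)).continuous
      (hasCompactSupport_pderiv i (hc1 i)) fun x hx =>
        (hfg i x (tsupport_pderiv_subset i _ hx)).continuousAt
  have i2 : ∀ i, Integrable fun x => pderiv i (fun x => f x * g x) x * pderiv i χ x := fun i =>
    integrable_mul_of_continuousAt_tsupport (hχ1 i).continuous (hc1 i) fun x hx =>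
      (contDiffAt_infty_pderiv i (hfg i x hx)).continuousAt
  have hz : ∫ x, ((∑ i, (f x * g x) * pderiv i (pderiv i χ) x) +
      ∑ i, pderiv i (fun x => f x * g x) x * pderiv i χ x) = 0 := by
    rw [integral_add (integrable_finsetSum _ fun i _ => i1 i)
      (integrable_finsetSum _ fun i _ => i2 i), integral_finsetSum _ fun i _ => i1 i,
      integral_finsetSum _ fun i _ => i2 i]
    simp only [hibp, Finset.sum_neg_distrib, neg_add_cancel]
  have i3 : Integrable fun x => (∑ i, (f x * g x) * pderiv i (pderiv i χ) x) +
      ∑ i, pderiv i (fun x => f x * g x) x * pderiv i χ x :=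
    (integrable_finsetSum _ fun i _ => i1 i).add (integrable_finsetSum _ fun i _ => i2 i)
  rw [← add_zero (flux χ f g), ← hz, flux, ← integral_add (integrable_flux hχ hc hf hg) i3]
  congr 1
  funext x
  simp only [lap, Finset.sum_mul, Finset.mul_sum, mul_add, ← Finset.sum_add_distrib]
  refine Finset.sum_congr rfl fun i _ => ?_
  by_cases hx : x ∈ tsupport (pderiv i χ)
  · rw [pderiv_mul i (differentiableAt_of_contDiffAt_infty (hf i x hx))
      (differentiableAt_of_contDiffAt_infty (hg i x hx))]
    ring
  · rw [image_eq_zero_of_notMem_tsupport hx, image_eq_zero_of_notMem_tsupport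
      (fun h => hx (tsupport_pderiv_subset i _ h))]
    ring

/-- A solution of the Helmholtz equation off `s`, multiplied by a cutoff vanishing near `s`. -/
theorem helmholtz_cutoff {k : ℝ} {s : E3} {η g : E3 → ℂ} (hη : ContDiff ℝ ∞ η)
    (h0 : ∀ᶠ x in 𝓝 s, η x = 0) (hg : ∀ x, x ≠ s → ContDiffAt ℝ ∞ g x)
    (hH : ∀ x, x ≠ s → lap g x = -(k : ℂ) ^ 2 * g x) :
    ContDiff ℝ ∞ (fun x => η x * g x) ∧ ∀ x, lap (fun x => η x * g x) x +
      (k : ℂ) ^ 2 * (η x * g x) = lap η x * g x + 2 * ∑ i, pderiv i η x * pderiv i g x := by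
  have hs : (fun x => η x * g x) =ᶠ[𝓝 s] fun _ => 0 := by
    filter_upwards [h0] with x hx
    rw [hx, zero_mul]
  constructor
  · refine contDiff_iff_contDiffAt.2 fun x => ?_
    by_cases hx : x = s
    · rw [hx]; exact contDiffAt_const.congr_of_eventuallyEq hs
    · exact hη.contDiffAt.mul (hg x hx)
  · intro x
    by_cases hx : x = s
    · subst hx
      have h1 : η =ᶠ[𝓝 x] fun _ => 0 := h0
      have z : ∀ i, pderiv i (fun _ : E3 => (0 : ℂ)) = fun _ => 0 := fun i => by
        funext x; simp [pderiv]
      have z2 : lap (fun _ : E3 => (0 : ℂ)) x = 0 := by simp [lap, z]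
      rw [lap_congr hs, lap_congr h1, h1.self_of_nhds, z2]
      have : ∀ i, pderiv i η x = 0 := fun i => by rw [pderiv_congr i h1, z]
      simp [this]
    · rw [lap_mul hη.contDiffAt (hg x hx), hH x hx]
      ring

/-! ### Radial cutoff functions -/

/-- A smooth function equal to one on the ball of radius `R` and to zero off the ball of
radius `2R`. -/
def ballCutoff (R : ℝ) (x : E3) : ℂ := (Real.smoothTransition (2 - ‖x‖ / R) : ℂ)

/-- The negative of the radial derivative of `ballCutoff`. -/
def shellWeight (R : ℝ) (x : E3) : ℝ := deriv Real.smoothTransition (2 - ‖x‖ / R) / R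

theorem ballCutoff_eq_one {R : ℝ} (hR : 0 < R) {x : E3} (hx : ‖x‖ ≤ R) : ballCutoff R x = 1 := by
  rw [ballCutoff, Real.smoothTransition.one_of_one_le, Complex.ofReal_one]
  have : ‖x‖ / R ≤ 1 := by rwa [div_le_one hR]
  linarith

theorem ballCutoff_eventually_eq_one {R : ℝ} (hR : 0 < R) {s : E3} (hs : ‖s‖ < R) :
    ∀ᶠ x in 𝓝 s, ballCutoff R x = 1 := by
  filter_upwards [continuous_norm.continuousAt.eventually (gt_mem_nhds hs)] with x hx
  exact ballCutoff_eq_one hR hx.le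

theorem hasCompactSupport_ballCutoff {R : ℝ} (hR : 0 < R) : HasCompactSupport (ballCutoff R) := by
  refine HasCompactSupport.of_support_subset_isCompact (isCompact_closedBall (0 : E3) (2 * R))
    fun x hx => ?_
  rw [mem_closedBall_zero_iff]
  by_contra h
  refine hx ?_
  rw [ballCutoff, Real.smoothTransition.zero_of_nonpos, Complex.ofReal_zero]
  have : 2 ≤ ‖x‖ / R := by rw [le_div_iff₀ hR]; linarith
  linarith

theorem contDiff_ballCutoff {R : ℝ} (hR : 0 < R) : ContDiff ℝ ∞ (ballCutoff R) := by
  refine contDiff_iff_contDiffAt.2 fun x => ?_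
  by_cases hx : x = 0
  · have h := ballCutoff_eventually_eq_one hR (s := x) (by rw [hx, norm_zero]; exact hR)
    exact contDiffAt_const.congr_of_eventuallyEq h
  · have h1 : ContDiffAt ℝ ∞ (fun x : E3 => 2 - ‖x‖ / R) x :=
      contDiffAt_const.sub ((contDiffAt_norm ℝ hx).div_const R)
    have h2 : ContDiffAt ℝ ∞ (fun x : E3 => Real.smoothTransition (2 - ‖x‖ / R)) x :=
      Real.smoothTransition.contDiff.contDiffAt.comp x h1
    exact Complex.ofRealCLM.contDiff.contDiffAt.comp x h2

theorem shellWeight_nonneg {R : ℝ} (hR : 0 < R) (x : E3) : 0 ≤ shellWeight R x :=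
  div_nonneg Real.smoothTransition.monotone.deriv_nonneg hR.le

theorem shellWeight_eq_zero_of_lt {R : ℝ} (hR : 0 < R) {x : E3} (hx : ‖x‖ < R) :
    shellWeight R x = 0 := by
  have h1 : 1 < 2 - ‖x‖ / R := by
    have : ‖x‖ / R < 1 := by rwa [div_lt_one hR]
    linarith
  have h2 : Real.smoothTransition =ᶠ[𝓝 (2 - ‖x‖ / R)] fun _ => 1 := by
    filter_upwards [lt_mem_nhds h1] with t ht using Real.smoothTransition.one_of_one_le ht.le
  rw [shellWeight, h2.deriv_eq]
  simp

theorem shellWeight_eq_zero_of_gt {R : ℝ} (hR : 0 < R) {x : E3} (hx : 2 * R < ‖x‖) :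
    shellWeight R x = 0 := by
  have h1 : 2 - ‖x‖ / R < 0 := by
    have : 2 < ‖x‖ / R := by rwa [lt_div_iff₀ hR]
    linarith
  have h2 : Real.smoothTransition =ᶠ[𝓝 (2 - ‖x‖ / R)] fun _ => 0 := by
    filter_upwards [gt_mem_nhds h1] with t ht using Real.smoothTransition.zero_of_nonpos ht.le
  rw [shellWeight, h2.deriv_eq]
  simp

theorem continuous_shellWeight (R : ℝ) : Continuous (shellWeight R) := by
  have h : Continuous (deriv Real.smoothTransition) :=
    (Real.smoothTransition.contDiff (n := 1)).continuous_deriv (by norm_num)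
  exact (h.comp (continuous_const.sub (continuous_norm.div_const R))).div_const R

theorem tsupport_shellWeight {R : ℝ} (hR : 0 < R) {x : E3} (hx : x ∈ tsupport (shellWeight R)) :
    R ≤ ‖x‖ ∧ ‖x‖ ≤ 2 * R := by
  have hcl : IsClosed {x : E3 | R ≤ ‖x‖ ∧ ‖x‖ ≤ 2 * R} :=
    (isClosed_le continuous_const continuous_norm).inter
      (isClosed_le continuous_norm continuous_const)
  refine closure_minimal (fun z hz => ?_) hcl hx
  constructor
  · by_contra h
    exact hz (shellWeight_eq_zero_of_lt hR (not_le.1 h))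
  · by_contra h
    exact hz (shellWeight_eq_zero_of_gt hR (not_le.1 h))

theorem hasCompactSupport_shellWeight {R : ℝ} (hR : 0 < R) : HasCompactSupport (shellWeight R) :=
  (isCompact_closedBall (0 : E3) (2 * R)).of_isClosed_subset (isClosed_tsupport _) fun x hx => by
    rw [mem_closedBall_zero_iff]; exact (tsupport_shellWeight hR hx).2

theorem integrable_shellWeight_smul {F : Type*} [NormedAddCommGroup F] [NormedSpace ℝ F] {R : ℝ}
    (hR : 0 < R) {h : E3 → F} (hh : ∀ x, R ≤ ‖x‖ → ContinuousAt h x) :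
    Integrable (fun x => shellWeight R x • h x) := by
  have hs : tsupport (fun x => shellWeight R x • h x) ⊆ tsupport (shellWeight R) :=
    tsupport_smul_subset_left _ _
  refine Continuous.integrable_of_hasCompactSupport (continuous_of_tsupport fun x hx => ?_)
    ((hasCompactSupport_shellWeight hR).smul_right)
  exact (continuous_shellWeight R).continuousAt.smul (hh x (tsupport_shellWeight hR (hs hx)).1)

/-- Scale invariance in three dimensions. It makes squares of errors of size O(1/|x|) bounded in
shell mean, uniformly in R. -/
theorem integral_shellWeight_mul_inv_sq {R : ℝ} (hR : 0 < R) :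
    ∫ x, shellWeight R x • (‖x‖ ^ 2)⁻¹ = ∫ x : E3, shellWeight 1 x • (‖x‖ ^ 2)⁻¹ := by
  have h := Measure.integral_comp_inv_smul (volume : Measure E3)
    (fun x => shellWeight 1 x • (‖x‖ ^ 2)⁻¹) R
  have h1 : ∀ x : E3, shellWeight 1 (R⁻¹ • x) • (‖R⁻¹ • x‖ ^ 2)⁻¹ =
      R ^ 3 * (shellWeight R x • (‖x‖ ^ 2)⁻¹) := by
    intro x
    have e : ‖R⁻¹ • x‖ = ‖x‖ / R := by
      rw [norm_smul, norm_inv, Real.norm_of_nonneg hR.le, inv_mul_eq_div]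
    rw [shellWeight, shellWeight, e, div_one, div_one, smul_eq_mul, smul_eq_mul, div_pow, inv_div]
    field_simp
  simp only [h1] at h
  rw [integral_const_mul, abs_of_nonneg (by positivity)] at h
  simp only [finrank_euclideanSpace, Fintype.card_fin, smul_eq_mul] at h ⊢
  exact mul_left_cancel₀ (pow_ne_zero 3 hR.ne') h

theorem pderiv_ballCutoff {R : ℝ} (hR : 0 < R) (i : Fin 3) (x : E3) :
    pderiv i (ballCutoff R) x = -(shellWeight R x : ℂ) * ((‖x‖⁻¹ • x : E3) i : ℂ) := by
  by_cases hx : x = 0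
  · have h := ballCutoff_eventually_eq_one hR (s := x) (by rw [hx, norm_zero]; exact hR)
    have h' : ballCutoff R =ᶠ[𝓝 x] fun _ => 1 := h
    rw [pderiv_congr i h', hx]
    simp [pderiv]
  have hp := regNorm_pos (ε := 0) (Or.inr hx)
  have h1 : HasDerivAt (fun s : ℝ => (Real.smoothTransition (2 - s / R) : ℂ))
      (-(deriv Real.smoothTransition (2 - ‖x‖ / R) / R : ℝ)) (regNorm 0 x) := by
    rw [regNorm_zero]
    have h2 : HasDerivAt (fun s : ℝ => 2 - s / R) (-(1 / R)) ‖x‖ :=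
      ((hasDerivAt_id _).div_const R).const_sub 2
    have h3 : HasDerivAt Real.smoothTransition (deriv Real.smoothTransition (2 - ‖x‖ / R))
      (2 - ‖x‖ / R) := ((Real.smoothTransition.contDiff (n := 1)).differentiable
        (by norm_num) _).hasDerivAt
    refine (h3.comp ‖x‖ h2).ofReal_comp.congr_deriv ?_
    push_cast
    ring
  have h4 := (pderiv_regNorm_comp hp h1 i).2
  have h5 : ballCutoff R = fun x => (Real.smoothTransition (2 - regNorm 0 x / R) : ℂ) := by
    funext x; rw [ballCutoff, regNorm_zero]
  rw [h5, h4, regNorm_zero, shellWeight]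
  simp
  ring

/-- A radial cutoff turns the flux into an average of the usual surface integrals over spheres of
radius between R and 2R. -/
theorem flux_ballCutoff {R : ℝ} (hR : 0 < R) (f g : E3 → ℂ) :
    flux (ballCutoff R) f g =
      -∫ x, shellWeight R x • (f x * radDeriv g x - g x * radDeriv f x) := by
  rw [flux, ← integral_neg]
  congr 1
  funext x
  rw [radDeriv, radDeriv, fderiv_apply_eq_sum, fderiv_apply_eq_sum, Finset.mul_sum, Finset.mul_sum,
    ← Finset.sum_sub_distrib, Finset.smul_sum, ← Finset.sum_neg_distrib]
  refine Finset.sum_congr rfl fun i _ => ?_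
  rw [pderiv_ballCutoff hR, Complex.real_smul]
  ring

/-! ### Uniqueness of radiating solutions of the Helmholtz equation -/

theorem tsupport_helmholtz_subset (k : ℝ) (ψ : E3 → ℂ) :
    tsupport (fun x => lap ψ x + (k : ℂ) ^ 2 * ψ x) ⊆ tsupport ψ := by
  refine closure_minimal (fun x hx => ?_) (isClosed_tsupport ψ)
  by_contra h
  refine hx ?_
  simp only
  rw [image_eq_zero_of_notMem_tsupport h,
    image_eq_zero_of_notMem_tsupport fun h' => h (tsupport_lap_subset ψ h')]
  simp

/-- Solutions of the Helmholtz equation off a point `y`, orthogonal to all test functions of the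
form `Δψ + k²ψ` supported away from `y`. -/
structure IsHelmholtzOff (k : ℝ) (y : E3) (v : E3 → ℂ) : Prop where
  contDiffAt : ∀ x, x ≠ y → ContDiffAt ℝ ∞ v x
  integral_eq_zero : ∀ ψ : E3 → ℂ, ContDiff ℝ ∞ ψ → HasCompactSupport ψ →
    y ∉ tsupport (fun x => lap ψ x + (k : ℂ) ^ 2 * ψ x) →
      ∫ x, v x * (lap ψ x + (k : ℂ) ^ 2 * ψ x) = 0

/-- Testing with functions supported off y and integrating by parts gives the equation almost
everywhere, hence everywhere off y by continuity. -/
theorem IsHelmholtzOff.lap_eq {k : ℝ} {y : E3} {v : E3 → ℂ} (hv : IsHelmholtzOff k y v) {x : E3}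
    (hx : x ≠ y) : lap v x = -(k : ℂ) ^ 2 * v x := by
  set f : E3 → ℂ := fun x => lap v x + (k : ℂ) ^ 2 * v x with hf
  have hopen : IsOpen ({y}ᶜ : Set E3) := isOpen_compl_singleton
  have hcont : ContinuousOn f {y}ᶜ := fun z hz =>
    ((contDiffAt_lap (hv.contDiffAt z hz)).add
      (contDiffAt_const.mul (hv.contDiffAt z hz))).continuousAt.continuousWithinAt
  have hae : ∀ᵐ z : E3, z ∈ ({y}ᶜ : Set E3) → f z = 0 := by
    refine hopen.ae_eq_zero_of_integral_contDiff_smul_eq_zero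
      (hcont.locallyIntegrableOn hopen.measurableSet) fun g hg hgc hgs => ?_
    set ψ : E3 → ℂ := fun x => (g x : ℂ) with hψ
    have hψs : ContDiff ℝ ∞ ψ := Complex.ofRealCLM.contDiff.comp hg
    have hψc : HasCompactSupport ψ := hgc.comp_left (g := fun t : ℝ => (t : ℂ)) Complex.ofReal_zero
    have hsub : Function.support ψ ⊆ Function.support g := fun z hz hz' => hz (by
      simp only [hψ]; rw [hz', Complex.ofReal_zero])
    have hts : tsupport ψ ⊆ {y}ᶜ := (closure_mono hsub).trans hgs
    have hsm : ∀ z ∈ tsupport ψ, ContDiffAt ℝ ∞ v z := fun z hz => hv.contDiffAt z (hts hz)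
    have h1 := hv.integral_eq_zero ψ hψs hψc fun h =>
      hts (tsupport_helmholtz_subset k ψ h) rfl
    have i1 : Integrable fun x => v x * lap ψ x :=
      integrable_mul_of_continuousAt_tsupport (contDiff_lap hψs).continuous
        (hasCompactSupport_lap hψc) fun z hz => (hsm z (tsupport_lap_subset ψ hz)).continuousAt
    have i2 : Integrable fun x => v x * ψ x :=
      integrable_mul_of_continuousAt_tsupport hψs.continuous hψc
        fun z hz => (hsm z hz).continuousAt
    have i3 : Integrable fun x => lap v x * ψ x :=
      integrable_mul_of_continuousAt_tsupport hψs.continuous hψc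
        fun z hz => (contDiffAt_lap (hsm z hz)).continuousAt
    have e1 : ∀ x, v x * (lap ψ x + (k : ℂ) ^ 2 * ψ x) =
        v x * lap ψ x + (k : ℂ) ^ 2 * (v x * ψ x) := fun x => by ring
    simp only [e1] at h1
    rw [integral_add i1 (i2.const_mul _), integral_mul_lap hψs hψc
      (fun z hz => contDiffAt_two_of_infty (hsm z hz)), ← integral_add i3 (i2.const_mul _)] at h1
    rw [← h1]
    congr 1
    funext z
    rw [hf, Complex.real_smul]
    ring
  have hz : Set.EqOn f (fun _ => 0) {y}ᶜ :=
    Measure.eqOn_open_of_ae_eq (μ := volume) ((ae_restrict_iff' hopen.measurableSet).2 hae) hopen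
      hcont continuousOn_const
  have := hz hx
  simp only [hf] at this
  linear_combination this

theorem contDiffAt_helmG_sub (k : ℝ) {z x : E3} (hx : x ≠ z) :
    ContDiffAt ℝ ∞ (fun x => helmG k (x - z)) x :=
  (contDiffAt_helmG k (sub_ne_zero.2 hx)).comp x (contDiffAt_id.sub contDiffAt_const)

theorem lap_sub_arg (f : E3 → ℂ) (y : E3) : lap (fun x => f (x - y)) = fun x => lap f (x - y) := by
  funext x
  simp only [lap, pderiv_sub_arg]

theorem lap_helmG_sub (k : ℝ) {z x : E3} (hx : x ≠ z) :
    lap (fun x => helmG k (x - z)) x = -(k : ℂ) ^ 2 * helmG k (x - z) := by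
  rw [lap_sub_arg]
  exact lap_helmG k (sub_ne_zero.2 hx)

theorem integral_helmG_sub_mul (k : ℝ) (z : E3) {ψ : E3 → ℂ} (hψ : ContDiff ℝ ∞ ψ)
    (hc : HasCompactSupport ψ) :
    ∫ x, helmG k (x - z) * (lap ψ x + (k : ℂ) ^ 2 * ψ x) = -ψ z := by
  have hs : ContDiff ℝ ∞ (fun x => ψ (x + z)) := hψ.comp (contDiff_id.add contDiff_const)
  have hcs : HasCompactSupport (fun x => ψ (x + z)) := hc.comp_homeomorph (Homeomorph.addRight z)
  have h := integral_helmG_mul k hs hcs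
  rw [zero_add] at h
  rw [← h, ← integral_add_right_eq_self _ z]
  congr 1
  funext x
  rw [lap_add_arg, add_sub_cancel_right]

/-- The representation formula for solutions of the Helmholtz equation. -/
theorem IsHelmholtzOff.eq_flux {k : ℝ} {y : E3} {v : E3 → ℂ} (hv : IsHelmholtzOff k y v) {z : E3}
    (hz : z ≠ y) {R : ℝ} (hR : 0 < R) (hyR : ‖y‖ < R) (hzR : ‖z‖ < R) :
    v z = flux (ballCutoff R) v (fun x => helmG k (x - z)) := by
  set G : E3 → ℂ := fun x => helmG k (x - z) with hG
  have hGs : ∀ x, x ≠ z → ContDiffAt ℝ ∞ G x := fun x hx => contDiffAt_helmG_sub k hx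
  have hGH : ∀ x, x ≠ z → lap G x = -(k : ℂ) ^ 2 * G x := fun x hx => lap_helmG_sub k hx
  set χ := ballCutoff R with hχ
  have hχs : ContDiff ℝ ∞ χ := contDiff_ballCutoff hR
  have hχc : HasCompactSupport χ := hasCompactSupport_ballCutoff hR
  have hχy : ∀ᶠ x in 𝓝 y, χ x = 1 := ballCutoff_eventually_eq_one hR hyR
  have hχz : ∀ᶠ x in 𝓝 z, χ x = 1 := ballCutoff_eventually_eq_one hR hzR
  -- a cutoff near `z`
  have hd : 0 < dist y z := dist_pos.2 hz.symm
  let b : ContDiffBump z := ⟨dist y z / 4, dist y z / 2, by positivity, by linarith⟩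
  set β : E3 → ℂ := fun x => (b x : ℂ) with hβ
  have hβs : ContDiff ℝ ∞ β := Complex.ofRealCLM.contDiff.comp b.contDiff
  have hβc : HasCompactSupport β :=
    b.hasCompactSupport.comp_left (g := fun t : ℝ => (t : ℂ)) Complex.ofReal_zero
  have hβz : ∀ᶠ x in 𝓝 z, β x = 1 := by
    filter_upwards [b.eventuallyEq_one] with x hx
    rw [hβ]; simp [hx]
  have hβy : ∀ᶠ x in 𝓝 y, β x = 0 := by
    have h1 : y ∉ tsupport b := by
      rw [b.tsupport_eq, Metric.mem_closedBall]
      show ¬ dist y z ≤ dist y z / 2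
      linarith
    filter_upwards [notMem_tsupport_iff_eventuallyEq.1 h1] with x hx
    rw [hβ]; simp [hx]
  -- The cutoff η vanishes near the pole z of G and is 1 near y. There ηG = G solves the Helmholtz
  -- equation, so ηG is an admissible test function although it need not vanish at y. The outcome is
  -- that the fluxes of v against G through ∇χ and ∇β agree.
  set η : E3 → ℂ := fun x => χ x - β x with hη
  have hηs : ContDiff ℝ ∞ η := hχs.sub hβs
  have hηc : HasCompactSupport η := HasCompactSupport.sub hχc hβc
  have hηz : ∀ᶠ x in 𝓝 z, η x = 0 := by
    filter_upwards [hχz, hβz] with x h1 h2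
    rw [hη]; simp only; rw [h1, h2, sub_self]
  have hηy : ∀ᶠ x in 𝓝 y, η x = 1 := by
    filter_upwards [hχy, hβy] with x h1 h2
    rw [hη]; simp only; rw [h1, h2, sub_zero]
  obtain ⟨hψs, hψe⟩ := helmholtz_cutoff hηs hηz hGs hGH
  have hψc : HasCompactSupport fun x => η x * G x := hηc.mul_right
  have hsupp : y ∉ tsupport fun x => lap (fun x => η x * G x) x + (k : ℂ) ^ 2 * (η x * G x) := by
    rw [notMem_tsupport_iff_eventuallyEq]
    have h1 : η =ᶠ[𝓝 y] fun _ => 1 := hηy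
    filter_upwards [h1.eventuallyEq_nhds] with x hx
    have p0 : ∀ i, pderiv i (fun _ : E3 => (1 : ℂ)) = fun _ => 0 := fun i => by
      funext x; simp [pderiv]
    have p1 : ∀ i, pderiv i (fun _ : E3 => (0 : ℂ)) = fun _ => 0 := fun i => by
      funext x; simp [pderiv]
    rw [hψe, lap_congr hx]
    have : ∀ i, pderiv i η x = 0 := fun i => by rw [pderiv_congr i hx, p0]
    simp [this, lap, p0, p1]
  have hzero := hv.integral_eq_zero _ hψs hψc hsupp
  simp only [hψe] at hzero
  rw [integral_mul_lap_cutoff hηs hηc (contDiffAt_on_tsupport_pderiv hηy hv.contDiffAt)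
    (contDiffAt_on_tsupport_pderiv hηz hGs), flux_sub hχs hχc hβs hβc
    (contDiffAt_on_tsupport_pderiv hχy hv.contDiffAt) (contDiffAt_on_tsupport_pderiv hχz hGs)
    (contDiffAt_on_tsupport_pderiv hβy hv.contDiffAt)
    (contDiffAt_on_tsupport_pderiv hβz hGs)] at hzero
  -- Conversely βv is smooth, since β vanishes near y; pairing it with the fundamental solution G
  -- evaluates the flux through ∇β as v z.
  obtain ⟨hws, hwe⟩ := helmholtz_cutoff hβs hβy hv.contDiffAt fun x hx => hv.lap_eq hx
  have hwc : HasCompactSupport fun x => β x * v x := hβc.mul_right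
  have hrep := integral_helmG_sub_mul k z hws hwc
  simp only [hwe] at hrep
  rw [integral_mul_lap_cutoff hβs hβc (f := G) (contDiffAt_on_tsupport_pderiv hβz hGs)
    (contDiffAt_on_tsupport_pderiv hβy hv.contDiffAt), flux_swap, hβz.self_of_nhds, one_mul,
    neg_inj] at hrep
  rw [← hrep]
  exact (sub_eq_zero.1 hzero).symm

theorem contDiffAt_conj {f : E3 → ℂ} {x : E3} (hf : ContDiffAt ℝ ∞ f x) :
    ContDiffAt ℝ ∞ (fun x => conj (f x)) x :=
  (Complex.conjCLE : ℂ →L[ℝ] ℂ).contDiff.contDiffAt.comp x hf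

theorem lap_conj {f : E3 → ℂ} {x : E3} (hf : ContDiffAt ℝ ∞ f x) :
    lap (fun x => conj (f x)) x = conj (lap f x) := by
  simp only [lap, map_sum]
  refine Finset.sum_congr rfl fun i _ => ?_
  have h : pderiv i (fun x => conj (f x)) =ᶠ[𝓝 x] fun x => conj (pderiv i f x) := by
    filter_upwards [(hf.of_le (m := 1) (WithTop.coe_le_coe.2 le_top)).eventually (by simp)]
      with z hz using pderiv_conj i (hz.differentiableAt (by simp))
  rw [pderiv_congr i h,
    pderiv_conj i (differentiableAt_of_contDiffAt_infty (contDiffAt_infty_pderiv i hf))]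

/-- The flux of `v ∇v̄ - v̄ ∇v` does not depend on the radius. -/
theorem IsHelmholtzOff.flux_conj_eq {k : ℝ} {y : E3} {v : E3 → ℂ} (hv : IsHelmholtzOff k y v)
    {R S : ℝ} (hR : 0 < R) (hyR : ‖y‖ < R) (hS : 0 < S) (hyS : ‖y‖ < S) :
    flux (ballCutoff R) v (fun x => conj (v x)) = flux (ballCutoff S) v (fun x => conj (v x)) := by
  have hcs : ∀ x, x ≠ y → ContDiffAt ℝ ∞ (fun x => conj (v x)) x := fun x hx =>
    contDiffAt_conj (hv.contDiffAt x hx)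
  have hcH : ∀ x, x ≠ y → lap (fun x => conj (v x)) x = -(k : ℂ) ^ 2 * conj (v x) := by
    intro x hx
    rw [lap_conj (hv.contDiffAt x hx), hv.lap_eq hx]
    simp
  have h1 := ballCutoff_eventually_eq_one hR hyR
  have h2 := ballCutoff_eventually_eq_one hS hyS
  -- Both cutoffs are 1 near y, so the product of η with the conjugate of v is a test function
  -- supported away from y.
  set η : E3 → ℂ := fun x => ballCutoff R x - ballCutoff S x with hη
  have hηs : ContDiff ℝ ∞ η := (contDiff_ballCutoff hR).sub (contDiff_ballCutoff hS)
  have hηc : HasCompactSupport η :=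
    HasCompactSupport.sub (hasCompactSupport_ballCutoff hR) (hasCompactSupport_ballCutoff hS)
  have hηy : ∀ᶠ x in 𝓝 y, η x = 0 := by
    filter_upwards [h1, h2] with x h1 h2
    rw [hη]; simp only; rw [h1, h2, sub_self]
  obtain ⟨hψs, hψe⟩ := helmholtz_cutoff hηs hηy hcs hcH
  have hψc : HasCompactSupport fun x => η x * conj (v x) := hηc.mul_right
  have hy0 : y ∉ tsupport fun x => η x * conj (v x) := by
    rw [notMem_tsupport_iff_eventuallyEq]
    filter_upwards [hηy] with x hx
    rw [hx, zero_mul]; rfl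
  have hzero := hv.integral_eq_zero _ hψs hψc fun h => hy0 (tsupport_helmholtz_subset k _ h)
  simp only [hψe] at hzero
  rw [integral_mul_lap_cutoff hηs hηc (contDiffAt_on_tsupport_pderiv hηy hv.contDiffAt)
    (contDiffAt_on_tsupport_pderiv hηy hcs), flux_sub (contDiff_ballCutoff hR)
    (hasCompactSupport_ballCutoff hR) (contDiff_ballCutoff hS) (hasCompactSupport_ballCutoff hS)
    (contDiffAt_on_tsupport_pderiv h1 hv.contDiffAt) (contDiffAt_on_tsupport_pderiv h1 hcs)
    (contDiffAt_on_tsupport_pderiv h2 hv.contDiffAt)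
    (contDiffAt_on_tsupport_pderiv h2 hcs)] at hzero
  exact sub_eq_zero.1 hzero

theorem radDeriv_conj {f : E3 → ℂ} {x : E3} (hf : DifferentiableAt ℝ f x) :
    radDeriv (fun x => conj (f x)) x = conj (radDeriv f x) := by
  rw [radDeriv, radDeriv, fderiv_apply_eq_sum, fderiv_apply_eq_sum, map_sum]
  refine Finset.sum_congr rfl fun i _ => ?_
  rw [pderiv_conj i hf, map_mul, Complex.conj_ofReal]

theorem SommerfeldScalar.eventually_le {k : ℝ} {v : E3 → ℂ} (hS : SommerfeldScalar k v) {δ : ℝ}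
    (hδ : 0 < δ) : ∃ R : ℝ, 0 < R ∧ ∀ x : E3, R ≤ ‖x‖ →
      ‖radDeriv v x - Complex.I * k * v x‖ ≤ δ * ‖x‖⁻¹ := by
  have h := (Metric.tendsto_nhds.1 hS) δ hδ
  rw [← Metric.cobounded_eq_cocompact, ← comap_norm_atTop] at h
  obtain ⟨R, hR⟩ := (eventually_comap.1 h).exists_forall_of_atTop
  refine ⟨max R 1, by positivity, fun x hx => ?_⟩
  have h1 := hR ‖x‖ ((le_max_left _ _).trans hx) x rfl
  have hx0 : 0 < ‖x‖ := lt_of_lt_of_le one_pos ((le_max_right _ _).trans hx)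
  rw [dist_zero_right, norm_mul, Complex.norm_real, norm_norm] at h1
  rw [← div_eq_mul_inv, le_div_iff₀ hx0, mul_comm]
  exact h1.le

theorem continuousAt_radDeriv {f : E3 → ℂ} {x : E3} (hx : x ≠ 0) (hf : ContDiffAt ℝ ∞ f x) :
    ContinuousAt (radDeriv f) x := by
  have h : radDeriv f = fun x => ∑ i, ((‖x‖⁻¹ • x : E3) i : ℂ) * pderiv i f x :=
    funext fun x => fderiv_apply_eq_sum f x _
  rw [h]
  refine tendsto_finsetSum _ fun i _ => ?_
  have h1 : ContinuousAt (fun x : E3 => ‖x‖⁻¹ • x) x :=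
    (continuous_norm.continuousAt.inv₀ (norm_ne_zero_iff.2 hx)).smul continuousAt_id
  have h2 : ContinuousAt (fun x : E3 => (coordL i) (‖x‖⁻¹ • x)) x :=
    (coordL i).continuous.continuousAt.comp h1
  simp only [coordL_apply] at h2
  exact h2.mul (contDiffAt_infty_pderiv i hf).continuousAt

/-- The square mean of a radiating solution over large shells is bounded. -/
theorem IsHelmholtzOff.exists_shell_bound {k : ℝ} (hk : 0 < k) {y : E3} {v : E3 → ℂ}
    (hv : IsHelmholtzOff k y v) (hS : SommerfeldScalar k v) :
    ∃ B R₀ : ℝ, 0 < R₀ ∧ ‖y‖ < R₀ ∧ ∀ R, R₀ ≤ R → ∫ x, shellWeight R x • ‖v x‖ ^ 2 ≤ B := by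
  obtain ⟨R₁, hR₁, hE⟩ := hS.eventually_le one_pos
  set R₀ := max R₁ (‖y‖ + 1) with hR₀
  have hR₀pos : 0 < R₀ := lt_of_lt_of_le hR₁ (le_max_left _ _)
  have hyR₀ : ‖y‖ < R₀ := lt_of_lt_of_le (by linarith) (le_max_right _ _)
  set c := flux (ballCutoff R₀) v (fun x => conj (v x)) with hc
  set K := ∫ x : E3, shellWeight 1 x • (‖x‖ ^ 2)⁻¹ with hK
  refine ⟨(‖c‖ + K / k) / k, R₀, hR₀pos, hyR₀, fun R hR => ?_⟩
  have hRpos := hR₀pos.trans_le hR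
  have hfar : ∀ x : E3, R ≤ ‖x‖ → x ≠ y ∧ x ≠ 0 := fun x hx => by
    constructor
    · rintro rfl; linarith
    · rintro rfl; rw [norm_zero] at hx; linarith
  have hcR : flux (ballCutoff R) v (fun x => conj (v x)) = c :=
    hv.flux_conj_eq hRpos (hyR₀.trans_le hR) hR₀pos hyR₀
  rw [flux_ballCutoff hRpos] at hcR
  set q : E3 → ℂ := fun x => v x * radDeriv (fun x => conj (v x)) x -
    conj (v x) * radDeriv v x with hq
  have hvc : ∀ x, R ≤ ‖x‖ → ContinuousAt v x := fun x hx =>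
    (hv.contDiffAt x (hfar x hx).1).continuousAt
  have hqc : ∀ x, R ≤ ‖x‖ → ContinuousAt q x := fun x hx => by
    have h1 := hv.contDiffAt x (hfar x hx).1
    exact ((hvc x hx).mul (continuousAt_radDeriv (hfar x hx).2 (contDiffAt_conj h1))).sub
      ((contDiffAt_conj h1).continuousAt.mul (continuousAt_radDeriv (hfar x hx).2 h1))
  have iq := integrable_shellWeight_smul hRpos hqc
  have iv : Integrable fun x => shellWeight R x • ‖v x‖ ^ 2 :=
    integrable_shellWeight_smul hRpos fun x hx => ((hvc x hx).norm.pow 2)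
  have ir : Integrable fun x : E3 => shellWeight R x • (‖x‖ ^ 2)⁻¹ :=
    integrable_shellWeight_smul hRpos fun x hx => (continuous_norm.continuousAt.pow 2).inv₀
      (pow_ne_zero 2 (norm_ne_zero_iff.2 (hfar x hx).2))
  have iq2 : Integrable fun x => (Complex.I * (shellWeight R x • q x)).re := (iq.const_mul _).re
  have hre : ∫ x, (Complex.I * (shellWeight R x • q x)).re ≤ ‖c‖ := by
    have h1 : ∫ x, (Complex.I * (shellWeight R x • q x)).re =
        (∫ x, Complex.I * (shellWeight R x • q x)).re :=
      integral_re (iq.const_mul _)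
    rw [h1, integral_const_mul]
    refine (Complex.re_le_norm _).trans ?_
    rw [norm_mul, Complex.norm_I, one_mul, ← hcR, norm_neg]
  have hpt : ∀ x, k * (shellWeight R x • ‖v x‖ ^ 2) ≤
      (Complex.I * (shellWeight R x • q x)).re + 1 / k * (shellWeight R x • (‖x‖ ^ 2)⁻¹) := by
    intro x
    rcases lt_or_ge ‖x‖ R with hx | hx
    · rw [shellWeight_eq_zero_of_lt hRpos hx]; simp
    have hw := shellWeight_nonneg hRpos x
    have hE' := hE x ((le_max_left _ _).trans (hR.trans hx))
    have hd := differentiableAt_of_contDiffAt_infty (hv.contDiffAt x (hfar x hx).1)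
    set E := radDeriv v x - Complex.I * k * v x with hEdef
    have hrad : radDeriv v x = Complex.I * k * v x + E := by rw [hEdef]; ring
    -- With ∂_r v = ikv + E, the conserved flux density is 2k|v|² up to a cross term in v and E.
    have e1 : Complex.I * q x = ((2 * k * ‖v x‖ ^ 2 : ℝ) : ℂ) +
        Complex.I * (v x * conj E - conj (v x) * E) := by
      have h2 : v x * conj (v x) = ((‖v x‖ ^ 2 : ℝ) : ℂ) := by
        rw [Complex.mul_conj, Complex.normSq_eq_norm_sq]
      rw [hq]
      simp only
      rw [radDeriv_conj hd, hrad]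
      simp only [map_add, map_mul, Complex.conj_I, Complex.conj_ofReal]
      push_cast at h2 ⊢
      linear_combination (2 * k : ℂ) * h2 - 2 * (k : ℂ) * (v x * conj (v x)) *
        (Complex.I_sq)
    have e2 : 2 * k * ‖v x‖ ^ 2 - 2 * (‖v x‖ * ‖E‖) ≤ (Complex.I * q x).re := by
      rw [e1, Complex.add_re, Complex.ofReal_re]
      have h3 : ‖Complex.I * (v x * conj E - conj (v x) * E)‖ ≤ 2 * (‖v x‖ * ‖E‖) := by
        rw [norm_mul, Complex.norm_I, one_mul]
        refine (norm_sub_le _ _).trans (le_of_eq ?_)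
        rw [norm_mul, norm_mul, RCLike.norm_conj, RCLike.norm_conj]
        ring
      have h4 := (abs_le.1 ((Complex.abs_re_le_norm _).trans h3)).1
      linarith
    -- Young's inequality gives away half of 2k|v|²; the rest of the error is at most |x|^{-2}/k by
    -- the radiation condition.
    have e3 : 2 * (‖v x‖ * ‖E‖) ≤ k * ‖v x‖ ^ 2 + 1 / k * ‖E‖ ^ 2 := by
      have h5 : 0 ≤ 1 / k * (k * ‖v x‖ - ‖E‖) ^ 2 := by positivity
      have h6 : 1 / k * (k * ‖v x‖ - ‖E‖) ^ 2 =
          k * ‖v x‖ ^ 2 + 1 / k * ‖E‖ ^ 2 - 2 * (‖v x‖ * ‖E‖) := by field_simp; ring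
      linarith
    have e4 : ‖E‖ ^ 2 ≤ (‖x‖ ^ 2)⁻¹ := by
      rw [← inv_pow]
      rw [one_mul] at hE'
      exact pow_le_pow_left₀ (norm_nonneg _) hE' 2
    have e5 : 1 / k * ‖E‖ ^ 2 ≤ 1 / k * (‖x‖ ^ 2)⁻¹ := by gcongr
    have e6 : (Complex.I * (shellWeight R x • q x)).re =
        shellWeight R x * (Complex.I * q x).re := by
      rw [mul_smul_comm, Complex.smul_re, smul_eq_mul]
    rw [e6, smul_eq_mul, smul_eq_mul]
    have e7 : k * ‖v x‖ ^ 2 ≤ (Complex.I * q x).re + 1 / k * (‖x‖ ^ 2)⁻¹ := by linarith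
    have := mul_le_mul_of_nonneg_left e7 hw
    linarith
  have hint := integral_mono (iv.const_mul k) (iq2.add (ir.const_mul (1 / k))) hpt
  simp only [Pi.add_apply] at hint
  rw [integral_const_mul, integral_add iq2 (ir.const_mul (1 / k)), integral_const_mul,
    integral_shellWeight_mul_inv_sq hRpos] at hint
  rw [le_div_iff₀' hk]
  refine hint.trans ?_
  rw [one_div_mul_eq_div]
  linarith

/-- **Uniqueness**: a radiating solution of the Helmholtz equation vanishes. -/
theorem IsHelmholtzOff.eq_zero {k : ℝ} (hk : 0 < k) {y : E3} {v : E3 → ℂ}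
    (hv : IsHelmholtzOff k y v) (hS : SommerfeldScalar k v) {z : E3} (hz : z ≠ y) : v z = 0 := by
  obtain ⟨B, R₀, hR₀, hyR₀, hB⟩ := hv.exists_shell_bound hk hS
  obtain ⟨C, hC, hCb⟩ := helmG_sub_bound hk z
  rw [← Metric.cobounded_eq_cocompact, ← comap_norm_atTop] at hCb
  obtain ⟨R₁, hR₁⟩ := (eventually_comap.1 hCb).exists_forall_of_atTop
  set G : E3 → ℂ := fun x => helmG k (x - z) with hG
  have hGS : SommerfeldScalar k G := sommerfeldScalar_helmG hk z
  set K := ∫ x : E3, shellWeight 1 x • (‖x‖ ^ 2)⁻¹ with hK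
  -- In the representation formula the products ikvG cancel. What is left are v and G, each
  -- multiplied by a radiation error of at most α/|x|, and the shell bound controls the mean square
  -- of v.
  have key : ∀ α : ℝ, 0 < α → α ≤ 1 → ‖v z‖ ≤ α * (B + (1 + C) * K) := by
    intro α hα hα1
    obtain ⟨R₂, hR₂, hEv⟩ := hS.eventually_le hα
    obtain ⟨R₃, hR₃, hEG⟩ := hGS.eventually_le hα
    obtain ⟨R, h0, h1, h2, h3, h4⟩ : ∃ R, R₀ ≤ R ∧ R₁ ≤ R ∧ R₂ ≤ R ∧ R₃ ≤ R ∧ ‖z‖ < R := by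
      refine ⟨|R₀| + |R₁| + |R₂| + |R₃| + ‖z‖ + 1, ?_, ?_, ?_, ?_, ?_⟩ <;>
      linarith [abs_nonneg R₀, abs_nonneg R₁, abs_nonneg R₂, abs_nonneg R₃, norm_nonneg z,
        le_abs_self R₀, le_abs_self R₁, le_abs_self R₂, le_abs_self R₃]
    have hRpos := hR₀.trans_le h0
    have hfar : ∀ x : E3, R ≤ ‖x‖ → x ≠ y ∧ x ≠ 0 := fun x hx => by
      constructor
      · rintro rfl; linarith
      · rintro rfl; rw [norm_zero] at hx; linarith
    have iv : Integrable fun x => shellWeight R x • ‖v x‖ ^ 2 :=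
      integrable_shellWeight_smul hRpos fun x hx =>
        ((hv.contDiffAt x (hfar x hx).1).continuousAt.norm.pow 2)
    have ir : Integrable fun x : E3 => shellWeight R x • (‖x‖ ^ 2)⁻¹ :=
      integrable_shellWeight_smul hRpos fun x hx => (continuous_norm.continuousAt.pow 2).inv₀
        (pow_ne_zero 2 (norm_ne_zero_iff.2 (hfar x hx).2))
    rw [hv.eq_flux hz hRpos (hyR₀.trans_le h0) h4, flux_ballCutoff hRpos, norm_neg]
    have hbound : ∀ x, ‖shellWeight R x • (v x * radDeriv G x - G x * radDeriv v x)‖ ≤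
        α * (shellWeight R x • ‖v x‖ ^ 2) +
          (α * (1 + C)) * (shellWeight R x • (‖x‖ ^ 2)⁻¹) := by
      intro x
      rcases lt_or_ge ‖x‖ R with hx | hx
      · rw [shellWeight_eq_zero_of_lt hRpos hx]; simp
      have hx0 := norm_pos_iff.2 (hfar x hx).2
      have hw := shellWeight_nonneg hRpos x
      have e1 : v x * radDeriv G x - G x * radDeriv v x =
          v x * (radDeriv G x - Complex.I * k * G x) - G x * (radDeriv v x - Complex.I * k * v x) := by
        ring
      have b1 := hEG x (h3.trans hx)
      have b2 := hEv x (h2.trans hx)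
      have b3 : ‖G x‖ ≤ C / ‖x‖ := hR₁ ‖x‖ (h1.trans hx) x rfl
      have b4 : ‖v x‖ * (α * ‖x‖⁻¹) ≤ α * ‖v x‖ ^ 2 + α * (‖x‖ ^ 2)⁻¹ := by
        have : 0 ≤ α * ((‖v x‖ - ‖x‖⁻¹) ^ 2 + ‖v x‖ ^ 2 + ‖x‖⁻¹ ^ 2) := by positivity
        rw [← inv_pow]
        nlinarith
      rw [norm_smul, Real.norm_of_nonneg hw, e1, smul_eq_mul, smul_eq_mul]
      have b5 : ‖v x * (radDeriv G x - Complex.I * k * G x) -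
          G x * (radDeriv v x - Complex.I * k * v x)‖ ≤
          α * ‖v x‖ ^ 2 + α * (1 + C) * (‖x‖ ^ 2)⁻¹ := by
        refine (norm_sub_le _ _).trans ?_
        rw [norm_mul, norm_mul]
        have b6 : ‖G x‖ * ‖radDeriv v x - Complex.I * k * v x‖ ≤ C / ‖x‖ * (α * ‖x‖⁻¹) := by
          gcongr
        have b7 : C / ‖x‖ * (α * ‖x‖⁻¹) = α * C * (‖x‖ ^ 2)⁻¹ := by field_simp
        have b8 : ‖v x‖ * ‖radDeriv G x - Complex.I * k * G x‖ ≤ ‖v x‖ * (α * ‖x‖⁻¹) := by gcongr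
        linarith
      have := mul_le_mul_of_nonneg_left b5 hw
      linarith
    refine (norm_integral_le_of_norm_le ((iv.const_mul α).add (ir.const_mul (α * (1 + C))))
      (Eventually.of_forall hbound)).trans ?_
    simp only [Pi.add_apply]
    rw [integral_add (iv.const_mul α) (ir.const_mul _), integral_const_mul, integral_const_mul,
      integral_shellWeight_mul_inv_sq hRpos]
    have := mul_le_mul_of_nonneg_left (hB R h0) hα.le
    rw [← hK]
    linarith
  have hlim : Tendsto (fun α : ℝ => α * (B + (1 + C) * K)) (𝓝[>] 0) (𝓝 0) := by
    have h : Continuous fun α : ℝ => α * (B + (1 + C) * K) := by fun_prop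
    have := h.tendsto 0
    rw [zero_mul] at this
    exact this.mono_left nhdsWithin_le_nhds
  have hle : ‖v z‖ ≤ 0 := ge_of_tendsto hlim (by
    filter_upwards [Ioc_mem_nhdsGT (zero_lt_one' ℝ)] with α hα using key α hα.1 hα.2)
  exact norm_le_zero_iff.1 hle

/-! ### Uniqueness of the fundamental solution -/

/-- Weak solutions of the homogeneous equation `Δ* w + ω² w = 0` which are smooth off `y`. -/
structure IsHomogeneousSolution (lam mu omega : ℝ) (y : E3) (w : E3 → Fin 3 → ℂ) : Prop where
  locallyIntegrable : ∀ i, LocallyIntegrable (fun x => w x i)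
  contDiffAt : ∀ i x, x ≠ y → ContDiffAt ℝ ∞ (fun x => w x i) x
  integral_eq_zero : ∀ φ : E3 → Fin 3 → ℂ, ContDiff ℝ ∞ φ → HasCompactSupport φ →
    ∫ x, ∑ i, w x i * lameField lam mu omega φ x i = 0

section

variable {lam mu omega : ℝ} {y : E3} {w : E3 → Fin 3 → ℂ}

theorem IsHomogeneousSolution.contDiffAt_divergence
    (hw : IsHomogeneousSolution lam mu omega y w) {x : E3} (hx : x ≠ y) :
    ContDiffAt ℝ ∞ (divergence w) x :=
  ContDiffAt.sum fun i _ => contDiffAt_infty_pderiv i (hw.contDiffAt i x hx)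

theorem IsHomogeneousSolution.integrable_mul (hw : IsHomogeneousSolution lam mu omega y w)
    (i : Fin 3) {θ : E3 → ℂ} (hθ : ContDiff ℝ ∞ θ) (hc : HasCompactSupport θ) :
    Integrable fun x => w x i * θ x :=
  integrable_mul_of_locallyIntegrable (hw.locallyIntegrable i) hθ.continuous hc

/-- On the support of θ the field w is smooth, so the derivatives can be shifted. The right side
involves only w, which is locally integrable, whereas its derivatives are not controlled near y. -/
theorem IsHomogeneousSolution.integral_pderiv_divergence_mul
    (hw : IsHomogeneousSolution lam mu omega y w) (m : Fin 3) {θ : E3 → ℂ} (hθ : ContDiff ℝ ∞ θ)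
    (hc : HasCompactSupport θ) (hy : y ∉ tsupport θ) :
    ∫ x, pderiv m (divergence w) x * θ x = ∫ x, ∑ i, w x i * pderiv i (pderiv m θ) x := by
  have hne : ∀ x ∈ tsupport θ, x ≠ y := fun x hx h => hy (h ▸ hx)
  have hne' : ∀ x ∈ tsupport (pderiv m θ), x ≠ y := fun x hx =>
    hne x (tsupport_pderiv_subset m θ hx)
  have hθ1 := contDiff_pderiv m hθ
  have hc1 := hasCompactSupport_pderiv m hc
  have h1 := integral_mul_pderiv (f := divergence w) m hθ hc fun x hx =>
    (hw.contDiffAt_divergence (hne x hx)).of_le (WithTop.coe_le_coe.2 le_top)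
  have h2 : ∀ i, ∫ x, w x i * pderiv i (pderiv m θ) x =
      -∫ x, pderiv i (fun x => w x i) x * pderiv m θ x := fun i =>
    integral_mul_pderiv (f := fun x => w x i) i hθ1 hc1 fun x hx =>
      (hw.contDiffAt i x (hne' x hx)).of_le (WithTop.coe_le_coe.2 le_top)
  have i1 : ∀ i, Integrable fun x => pderiv i (fun x => w x i) x * pderiv m θ x := fun i =>
    integrable_mul_of_continuousAt_tsupport hθ1.continuous hc1 fun x hx =>
      (contDiffAt_infty_pderiv i (hw.contDiffAt i x (hne' x hx))).continuousAt
  have h3 : ∫ x, divergence w x * pderiv m θ x =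
      ∑ i, ∫ x, pderiv i (fun x => w x i) x * pderiv m θ x := by
    rw [← integral_finsetSum _ fun i _ => i1 i]
    simp only [divergence, Finset.sum_mul]
  rw [integral_finsetSum _ fun i _ => hw.integrable_mul i (contDiff_pderiv i hθ1)
    (hasCompactSupport_pderiv i hc1)]
  simp only [h2, Finset.sum_neg_distrib]
  rw [← h3, h1, neg_neg]

/-- The field `x ↦ c ψ e_m + ∇∂_mψ`. -/
def hessField (c : ℂ) (m : Fin 3) (ψ : E3 → ℂ) (x : E3) (i : Fin 3) : ℂ :=
  (if i = m then c else 0) * ψ x + pderiv i (pderiv m ψ) x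

theorem contDiff_hessField (c : ℂ) (m : Fin 3) {ψ : E3 → ℂ} (hψ : ContDiff ℝ ∞ ψ) :
    ContDiff ℝ ∞ (hessField c m ψ) :=
  contDiff_pi.2 fun i => (contDiff_const.mul hψ).add (contDiff_pderiv i (contDiff_pderiv m hψ))

theorem hasCompactSupport_hessField (c : ℂ) (m : Fin 3) {ψ : E3 → ℂ} (hc : HasCompactSupport ψ) :
    HasCompactSupport (hessField c m ψ) := by
  refine hc.of_isClosed_subset (isClosed_tsupport _)
    (closure_minimal (fun x hx => ?_) (isClosed_tsupport ψ))
  by_contra h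
  refine hx (funext fun i => ?_)
  rw [hessField, image_eq_zero_of_notMem_tsupport h, image_eq_zero_of_notMem_tsupport fun h' =>
    h (tsupport_pderiv_subset m ψ (tsupport_pderiv_subset i _ h'))]
  simp

theorem divergence_hessField (c : ℂ) (m : Fin 3) {ψ : E3 → ℂ} (hψ : ContDiff ℝ ∞ ψ) :
    divergence (hessField c m ψ) = fun x => c * pderiv m ψ x + lap (pderiv m ψ) x := by
  funext x
  have h1 := contDiff_pderiv m hψ
  have h : ∀ i, pderiv i (fun x => hessField c m ψ x i) = fun x =>
      (if i = m then c else 0) * pderiv i ψ x + pderiv i (pderiv i (pderiv m ψ)) x := by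
    intro i
    unfold hessField
    rw [pderiv_smooth_add (contDiff_const.mul hψ) (contDiff_pderiv i h1), pderiv_const_mul]
  rw [divergence]
  simp only [h, Finset.sum_add_distrib, ite_mul, zero_mul, Finset.sum_ite_eq', Finset.mem_univ,
    if_true]
  rfl

/-- Two values of c decouple the system. For c = 0 the result is (2μ + λ)∇∂_m(Δ + k_p²)ψ; for c =
k_s² it is ω²(Δ + k_s²)ψ e_m + (2μ + λ)∇∂_m(Δ + k_s²)ψ. -/
theorem lameField_hessField (c : ℂ) (m : Fin 3) {ψ : E3 → ℂ} (hψ : ContDiff ℝ ∞ ψ) (x : E3)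
    (i : Fin 3) :
    lameField lam mu omega (hessField c m ψ) x i =
      (if i = m then c else 0) * (mu * lap ψ x + (omega : ℂ) ^ 2 * ψ x) +
      ((2 * mu + lam : ℝ) : ℂ) * pderiv i (pderiv m (lap ψ)) x +
      (((lam + mu : ℝ) : ℂ) * c + (omega : ℂ) ^ 2) * pderiv i (pderiv m ψ) x := by
  have h1 := contDiff_pderiv m hψ
  have h2 := contDiff_pderiv i h1
  rw [lameField, divergence_hessField c m hψ]
  have e1 : lap (fun x => hessField c m ψ x i) x =
      (if i = m then c else 0) * lap ψ x + pderiv i (pderiv m (lap ψ)) x := by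
    unfold hessField
    rw [lap_smooth_add (contDiff_const.mul hψ) h2]
    simp only
    rw [lap_const_mul, pderiv_smooth_lap hψ,
      pderiv_smooth_lap h1]
  rw [e1, pderiv_smooth_add (contDiff_const.mul h1) (contDiff_lap h1), pderiv_const_mul,
    ← pderiv_smooth_lap hψ, hessField]
  push_cast
  ring

theorem pderiv_pderiv_helmholtz (c : ℂ) (i m : Fin 3) {ψ : E3 → ℂ} (hψ : ContDiff ℝ ∞ ψ) (x : E3) :
    pderiv i (pderiv m (fun x => lap ψ x + c * ψ x)) x =
      pderiv i (pderiv m (lap ψ)) x + c * pderiv i (pderiv m ψ) x := by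
  have h := contDiff_lap hψ
  rw [pderiv_smooth_add h (contDiff_const.mul hψ), pderiv_const_mul,
    pderiv_smooth_add (contDiff_pderiv m h) (contDiff_const.mul (contDiff_pderiv m hψ)),
    pderiv_const_mul]

/-- The equation of w is tested with ∇∂_mψ. The field need not vanish at y; only (Δ + k_p²)ψ must
vanish near y for the derivatives to be moved back to w. -/
theorem IsHomogeneousSolution.isHelmholtzOff_longitudinal
    (hw : IsHomogeneousSolution lam mu omega y w) (h_lam : 0 < 2 * mu + lam) (m : Fin 3) :
    IsHelmholtzOff (kP lam mu omega) y (pderiv m (divergence w)) where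
  contDiffAt x hx := contDiffAt_infty_pderiv m (hw.contDiffAt_divergence hx)
  integral_eq_zero ψ hψ hc hy := by
    set θ : E3 → ℂ := fun x => lap ψ x + (kP lam mu omega : ℂ) ^ 2 * ψ x with hθ
    have hθs : ContDiff ℝ ∞ θ := contDiff_helmholtz _ hψ
    have hθc : HasCompactSupport θ := hasCompactSupport_helmholtz _ hc
    have h := hw.integral_eq_zero _ (contDiff_hessField 0 m hψ) (hasCompactSupport_hessField 0 m hc)
    have hl : ((2 * mu + lam : ℝ) : ℂ) ≠ 0 := by exact_mod_cast h_lam.ne'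
    have hk : ((2 * mu + lam : ℝ) : ℂ) * (kP lam mu omega : ℂ) ^ 2 = (omega : ℂ) ^ 2 := by
      exact_mod_cast kP_sq h_lam
    have e : ∀ x, ∑ i, w x i * lameField lam mu omega (hessField 0 m ψ) x i =
        ((2 * mu + lam : ℝ) : ℂ) * ∑ i, w x i * pderiv i (pderiv m θ) x := by
      intro x
      rw [Finset.mul_sum]
      refine Finset.sum_congr rfl fun i _ => ?_
      rw [lameField_hessField 0 m hψ, hθ, pderiv_pderiv_helmholtz _ i m hψ, ← hk]
      simp
      ring
    simp only [e] at h
    rw [integral_const_mul] at h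
    have h2 := (mul_eq_zero.1 h).resolve_left hl
    rw [← h2]
    exact hw.integral_pderiv_divergence_mul m hθs hθc hy

/-- The test field is k_s²ψe_m + ∇∂_mψ. Since 2μ + λ = ω²/k_p², moving the second derivatives back
to w produces the correction by k_p^{-2}∂_m div w. -/
theorem IsHomogeneousSolution.isHelmholtzOff_transversal
    (hw : IsHomogeneousSolution lam mu omega y w) (h_omega : 0 < omega) (h_mu : 0 < mu)
    (h_lam : 0 < 2 * mu + lam) (m : Fin 3) :
    IsHelmholtzOff (kS mu omega) y (fun x => w x m +
      ((kP lam mu omega : ℂ) ^ 2)⁻¹ * pderiv m (divergence w) x) where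
  contDiffAt x hx := (hw.contDiffAt m x hx).add
    (contDiffAt_const.mul (contDiffAt_infty_pderiv m (hw.contDiffAt_divergence hx)))
  integral_eq_zero ψ hψ hc hy := by
    set ks := kS mu omega with hks
    set kp := kP lam mu omega with hkp
    set θ : E3 → ℂ := fun x => lap ψ x + (ks : ℂ) ^ 2 * ψ x with hθ
    have hθs : ContDiff ℝ ∞ θ := contDiff_helmholtz _ hψ
    have hθc : HasCompactSupport θ := hasCompactSupport_helmholtz _ hc
    have h := hw.integral_eq_zero _ (contDiff_hessField (ks ^ 2) m hψ)
      (hasCompactSupport_hessField (ks ^ 2) m hc)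
    have homega : (omega : ℂ) ≠ 0 := by exact_mod_cast h_omega.ne'
    have hk0 : (kp : ℂ) ≠ 0 := by exact_mod_cast (kP_pos h_omega h_lam).ne'
    have hk : ((2 * mu + lam : ℝ) : ℂ) * (kp : ℂ) ^ 2 = (omega : ℂ) ^ 2 := by
      exact_mod_cast kP_sq h_lam
    have hs : (mu : ℂ) * (ks : ℂ) ^ 2 = (omega : ℂ) ^ 2 := by exact_mod_cast kS_sq h_mu
    have hl : ((2 * mu + lam : ℝ) : ℂ) = (omega : ℂ) ^ 2 * ((kp : ℂ) ^ 2)⁻¹ := by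
      rw [← hk, mul_assoc, mul_inv_cancel₀ (pow_ne_zero 2 hk0), mul_one]
    have e : ∀ x, ∑ i, w x i * lameField lam mu omega (hessField (ks ^ 2) m ψ) x i =
        (omega : ℂ) ^ 2 * (w x m * θ x +
          ((kp : ℂ) ^ 2)⁻¹ * ∑ i, w x i * pderiv i (pderiv m θ) x) := by
      intro x
      have e1 : w x m * θ x = ∑ i, w x i * ((if i = m then 1 else 0) * θ x) := by simp
      rw [e1, Finset.mul_sum, ← Finset.sum_add_distrib, Finset.mul_sum]
      refine Finset.sum_congr rfl fun i _ => ?_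
      rw [lameField_hessField _ m hψ, hθ, pderiv_pderiv_helmholtz _ i m hψ]
      have e2 : ((lam + mu : ℝ) : ℂ) * (ks : ℂ) ^ 2 + (omega : ℂ) ^ 2 =
          (omega : ℂ) ^ 2 * ((kp : ℂ) ^ 2)⁻¹ * (ks : ℂ) ^ 2 := by
        rw [← hl, ← hs]; push_cast; ring
      rw [e2, hl]
      by_cases him : i = m
      · simp only [him, if_true]
        linear_combination w x m * (lap ψ x) * hs
      · simp only [him, if_false]
        ring
    simp only [e] at h
    rw [integral_const_mul] at h
    have h2 := (mul_eq_zero.1 h).resolve_left (pow_ne_zero 2 homega)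
    have hne : ∀ x ∈ tsupport θ, x ≠ y := fun x hx h => hy (h ▸ hx)
    have i1 := hw.integrable_mul m hθs hθc
    have i2 : Integrable fun x => ∑ i, w x i * pderiv i (pderiv m θ) x :=
      integrable_finsetSum _ fun i _ => hw.integrable_mul i
        (contDiff_pderiv i (contDiff_pderiv m hθs))
        (hasCompactSupport_pderiv i (hasCompactSupport_pderiv m hθc))
    have i3 : Integrable fun x => pderiv m (divergence w) x * θ x :=
      integrable_mul_of_continuousAt_tsupport hθs.continuous hθc fun x hx =>
        (contDiffAt_infty_pderiv m (hw.contDiffAt_divergence (hne x hx))).continuousAt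
    rw [integral_add i1 (i2.const_mul _), integral_const_mul,
      ← hw.integral_pderiv_divergence_mul m hθs hθc hy] at h2
    have e3 : ∀ x, (w x m + ((kp : ℂ) ^ 2)⁻¹ * pderiv m (divergence w) x) * θ x =
        w x m * θ x + ((kp : ℂ) ^ 2)⁻¹ * (pderiv m (divergence w) x * θ x) := fun x => by ring
    show ∫ x, (w x m + ((kp : ℂ) ^ 2)⁻¹ * pderiv m (divergence w) x) * θ x = 0
    simp only [e3]
    rw [integral_add i1 (i3.const_mul _), integral_const_mul, h2]

/-- Both parts of w fall under scalar uniqueness; once ∂_m div w vanishes, the transversal part is w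
itself. -/
theorem IsHomogeneousSolution.eq_zero (hw : IsHomogeneousSolution lam mu omega y w)
    (h_omega : 0 < omega) (h_mu : 0 < mu) (h_lam : 0 < 2 * mu + lam)
    (hp : ∀ m, SommerfeldScalar (kP lam mu omega) (fun x => longitudinalPart lam mu omega w x m))
    (hs : ∀ m, SommerfeldScalar (kS mu omega) (fun x => transversalPart lam mu omega w x m))
    {x : E3} (hx : x ≠ y) (m : Fin 3) : w x m = 0 := by
  have hkp := kP_pos h_omega h_lam
  have hk0 : (kP lam mu omega : ℂ) ≠ 0 := by exact_mod_cast hkp.ne'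
  have h1 : SommerfeldScalar (kP lam mu omega) (pderiv m (divergence w)) := by
    refine ((hp m).const_mul (-(kP lam mu omega : ℂ) ^ 2)).congr (y := y) fun z _ => ?_
    rw [longitudinalPart]
    push_cast
    field_simp
  have h2 : SommerfeldScalar (kS mu omega) (fun x => w x m +
      ((kP lam mu omega : ℂ) ^ 2)⁻¹ * pderiv m (divergence w) x) := by
    refine (hs m).congr (y := y) fun z _ => ?_
    rw [transversalPart, Pi.sub_apply, longitudinalPart]
    push_cast
    ring
  have e1 := (hw.isHelmholtzOff_longitudinal h_lam m).eq_zero hkp h1 hx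
  have e2 := (hw.isHelmholtzOff_transversal h_omega h_mu h_lam m).eq_zero
    (kS_pos h_omega h_mu) h2 hx
  simp only [e1, mul_zero, add_zero] at e2
  exact e2

end

theorem divergence_sub {u v : E3 → Fin 3 → ℂ} {x : E3}
    (hu : ∀ i, DifferentiableAt ℝ (fun x => u x i) x)
    (hv : ∀ i, DifferentiableAt ℝ (fun x => v x i) x) :
    divergence (fun x i => u x i - v x i) x = divergence u x - divergence v x := by
  simp only [divergence, ← Finset.sum_sub_distrib]
  exact Finset.sum_congr rfl fun i _ => pderiv_sub i (hu i) (hv i)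

theorem longitudinalPart_sub (lam mu omega : ℝ) {u v : E3 → Fin 3 → ℂ} {y x : E3}
    (hu : ∀ i x, x ≠ y → ContDiffAt ℝ ∞ (fun x => u x i) x)
    (hv : ∀ i x, x ≠ y → ContDiffAt ℝ ∞ (fun x => v x i) x) (hx : x ≠ y) (i : Fin 3) :
    longitudinalPart lam mu omega (fun x i => u x i - v x i) x i =
      longitudinalPart lam mu omega u x i - longitudinalPart lam mu omega v x i := by
  have d := @differentiableAt_of_contDiffAt_infty
  have hdiv : ∀ {u : E3 → Fin 3 → ℂ}, (∀ i x, x ≠ y → ContDiffAt ℝ ∞ (fun x => u x i) x) →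
      ContDiffAt ℝ ∞ (divergence u) x := fun hu =>
    ContDiffAt.sum fun i _ => contDiffAt_infty_pderiv i (hu i x hx)
  have h : divergence (fun x i => u x i - v x i) =ᶠ[𝓝 x]
      fun x => divergence u x - divergence v x := by
    filter_upwards [isOpen_ne.mem_nhds hx] with z hz
    exact divergence_sub (fun i => d (hu i z hz)) fun i => d (hv i z hz)
  simp only [longitudinalPart]
  rw [pderiv_congr i h, pderiv_sub i (d (hdiv hu)) (d (hdiv hv))]
  ring

theorem differentiableAt_longitudinalPart (lam mu omega : ℝ) {u : E3 → Fin 3 → ℂ} {y x : E3}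
    (hu : ∀ i x, x ≠ y → ContDiffAt ℝ ∞ (fun x => u x i) x) (hx : x ≠ y) (i : Fin 3) :
    DifferentiableAt ℝ (fun x => longitudinalPart lam mu omega u x i) x := by
  have hdiv : ContDiffAt ℝ ∞ (divergence u) x :=
    ContDiffAt.sum fun i _ => contDiffAt_infty_pderiv i (hu i x hx)
  exact (differentiableAt_of_contDiffAt_infty (contDiffAt_infty_pderiv i hdiv)).const_mul _

theorem differentiableAt_transversalPart (lam mu omega : ℝ) {u : E3 → Fin 3 → ℂ} {y x : E3}
    (hu : ∀ i x, x ≠ y → ContDiffAt ℝ ∞ (fun x => u x i) x) (hx : x ≠ y) (i : Fin 3) :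
    DifferentiableAt ℝ (fun x => transversalPart lam mu omega u x i) x :=
  (differentiableAt_of_contDiffAt_infty (hu i x hx)).sub
    (differentiableAt_longitudinalPart lam mu omega hu hx i)

theorem IsKupradzeFundamentalSolution.contDiffAt {lam mu omega : ℝ}
    {Φ : E3 → E3 → Matrix (Fin 3) (Fin 3) ℂ} (hΦ : IsKupradzeFundamentalSolution lam mu omega Φ)
    (y : E3) (j i : Fin 3) (x : E3) (hx : x ≠ y) : ContDiffAt ℝ ∞ (fun x => Φ x y i j) x :=
  (hΦ.contDiffOn y i j).contDiffAt (isOpen_compl_singleton.mem_nhds hx)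

theorem IsKupradzeFundamentalSolution.integral_lameField {lam mu omega : ℝ}
    {Φ : E3 → E3 → Matrix (Fin 3) (Fin 3) ℂ} (hΦ : IsKupradzeFundamentalSolution lam mu omega Φ)
    (y : E3) (j : Fin 3) {φ : E3 → Fin 3 → ℂ} (hφ : ContDiff ℝ ∞ φ) (hc : HasCompactSupport φ) :
    ∫ x, ∑ i, Φ x y i j * lameField lam mu omega φ x i = -φ y j := by
  rw [← hΦ.equation y j φ hφ hc]
  congr 1
  funext x
  refine Finset.sum_congr rfl fun i _ => ?_
  rw [lameOp_eq lam mu (contDiffAt_two_of_infty (contDiff_comp hφ i).contDiffAt), lameField]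

/-- Two fundamental solutions satisfying the Kupradze radiation conditions agree off the
diagonal. -/
theorem IsKupradzeFundamentalSolution.unique {lam mu omega : ℝ} (h_omega : 0 < omega)
    (h_mu : 0 < mu) (h_lam : 0 < 2 * mu + lam) {Φ Ψ : E3 → E3 → Matrix (Fin 3) (Fin 3) ℂ}
    (hΦ : IsKupradzeFundamentalSolution lam mu omega Φ)
    (hΨ : IsKupradzeFundamentalSolution lam mu omega Ψ) {x y : E3} (hx : x ≠ y) :
    Φ x y = Ψ x y := by
  ext m j
  have hu := hΦ.contDiffAt y j
  have hv := hΨ.contDiffAt y j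
  have hw : IsHomogeneousSolution lam mu omega y (fun x i => Φ x y i j - Ψ x y i j) := by
    refine ⟨fun i => (hΦ.locallyIntegrable y i j).sub (hΨ.locallyIntegrable y i j),
      fun i x hx => (hu i x hx).sub (hv i x hx), fun φ hφ hc => ?_⟩
    have hi : ∀ {Φ : E3 → E3 → Matrix (Fin 3) (Fin 3) ℂ},
        IsKupradzeFundamentalSolution lam mu omega Φ →
        Integrable fun x => ∑ i, Φ x y i j * lameField lam mu omega φ x i := fun hΦ =>
      integrable_finsetSum _ fun i _ => integrable_mul_of_locallyIntegrable
        (hΦ.locallyIntegrable y i j) (contDiff_lameField lam mu omega (contDiff_comp hφ) i).continuous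
        (hasCompactSupport_lameField lam mu omega hc i)
    have h := integral_sub (hi hΦ) (hi hΨ)
    rw [hΦ.integral_lameField y j hφ hc, hΨ.integral_lameField y j hφ hc, sub_self] at h
    rw [← h]
    congr 1
    funext x
    rw [← Finset.sum_sub_distrib]
    exact Finset.sum_congr rfl fun i _ => by ring
  obtain ⟨hΦp, hΦs⟩ := hΦ.radiating y j
  obtain ⟨hΨp, hΨs⟩ := hΨ.radiating y j
  rw [sommerfeldRadiating_iff (y := y) fun x hx i =>
    differentiableAt_longitudinalPart lam mu omega hu hx i] at hΦp
  rw [sommerfeldRadiating_iff (y := y) fun x hx i =>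
    differentiableAt_longitudinalPart lam mu omega hv hx i] at hΨp
  rw [sommerfeldRadiating_iff (y := y) fun x hx i =>
    differentiableAt_transversalPart lam mu omega hu hx i] at hΦs
  rw [sommerfeldRadiating_iff (y := y) fun x hx i =>
    differentiableAt_transversalPart lam mu omega hv hx i] at hΨs
  refine sub_eq_zero.1 (hw.eq_zero h_omega h_mu h_lam (fun i => ?_) (fun i => ?_) hx m)
  · exact ((hΦp i).sub (hΨp i)
      (fun x hx => differentiableAt_longitudinalPart lam mu omega hu hx i)
      fun x hx => differentiableAt_longitudinalPart lam mu omega hv hx i).congr (y := y)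
        fun x hx => (longitudinalPart_sub lam mu omega hu hv hx i).symm
  · refine ((hΦs i).sub (hΨs i)
      (fun x hx => differentiableAt_transversalPart lam mu omega hu hx i)
      fun x hx => differentiableAt_transversalPart lam mu omega hv hx i).congr (y := y)
        fun x hx => ?_
    simp only [transversalPart, Pi.sub_apply, longitudinalPart_sub lam mu omega hu hv hx i]
    ring

end

end NavierLame

/-! ### The main theorem -/

open NavierLame in
theorem theorem2p1 (lam mu omega : ℝ) (h_omega : 0 < omega) (h_mu : 0 < mu)
    (h_lam : 0 < 2 * mu + lam) :
    (∃ Φ : E3 → E3 → Matrix (Fin 3) (Fin 3) ℂ, IsKupradzeFundamentalSolution lam mu omega Φ) ∧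
    (∀ Φ : E3 → E3 → Matrix (Fin 3) (Fin 3) ℂ, IsKupradzeFundamentalSolution lam mu omega Φ →
      ∀ p q : SphCoord, p.Admissible → q.Admissible → ‖q.toPoint‖ < ‖p.toPoint‖ →
        Φ p.toPoint q.toPoint =
          doubleSum (psiTerm lam mu omega) p q + doubleSum (minusTerm lam mu omega) p q
            + doubleSum (zeroTerm lam mu omega) p q + doubleSum (plusTerm lam mu omega) p q) ∧
    (∃ M : ℝ, ∀ (n : ℕ) (m : ℤ), |m| ≤ (n : ℤ) →
      |coefA n m| ≤ M ∧ |coefB n m| ≤ M ∧ |coefC n m| ≤ M ∧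
      |coefD n m| ≤ M ∧ |coefE n m| ≤ M ∧ |coefF n m| ≤ M) ∧
    ConvergesWithRadialDerivatives (psiTerm lam mu omega) ∧
    ConvergesWithRadialDerivatives (minusTerm lam mu omega) ∧
    ConvergesWithRadialDerivatives (zeroTerm lam mu omega) ∧
    ConvergesWithRadialDerivatives (plusTerm lam mu omega) := by 
  refine ⟨⟨_, isKupradzeFundamentalSolution_kupMat h_omega h_mu h_lam⟩, ?_, ⟨1, ?_⟩,
    converges_psiTerm h_omega h_mu h_lam, converges_minusTerm h_omega h_mu h_lam,
    converges_zeroTerm h_omega h_mu h_lam, converges_plusTerm h_omega h_mu h_lam⟩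
  · intro Φ hΦ p q hp hq h
    have hne : p.toPoint ≠ q.toPoint := fun e => by rw [e] at h; exact lt_irrefl _ h
    -- Since |y| < |x| excludes the diagonal, every solution may be replaced by the explicit one.
    rw [hΦ.unique h_omega h_mu h_lam (isKupradzeFundamentalSolution_kupMat h_omega h_mu h_lam) hne]
    exact kupMat_eq_series h_omega h_mu h_lam hp hq h
  · exact fun n m h => abs_coef_le_one h
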